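/- **Setting.** Let $\mathbb F$ be a field and let $A=(A_{\alpha\beta}x_{\alpha\beta})_{\alpha\in[\mu],\beta\in[\nu]}$, where the $A_{\alpha\beta}$ are $2\times2$ matrices over $\mathbb F$ and the $x_{\alpha\beta}$ are distinct variables. Put $U_\alpha=V_\beta=\mathbb F^2$ and view $A_{\alpha\beta}$ as the bilinear form $(u,v)\mapsto u^\top A_{\alpha\beta}v$ on $U_\alpha\times V_\beta$; $X^{\perp_{\alpha\beta}}$ denotes the orthogonal space with respect to it. Let $E=\{\alpha\beta: A_{\alpha\beta}\ne O\}$; an edge is rank-$k$ if $\operatorname{rank}A_{\alpha\beta}=k$. For $I\subseteq E$ let $A_I$ be $A$ with the blocks outside $I$ replaced by zero. $I$ is a *matching* if $\operatorname{rank}A_I>\operatorname{rank}A_{I\setminus\{\alpha\beta\}}$ (over $\mathbb F(x)$) for all $\alpha\beta\in I$. An edge of $I$ is *isolated* if both its ends have degree 1 in $I$; $r(I)$ is $|I|$ plus the number of isolated rank-2 edges of $I$. A component of $I$ is *rank-1* if it contains a rank-1 edge. Let $\ker_I(\alpha)$ be $U_\alpha$ if $\deg_I(\alpha)=0$, the left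 kernel of $A_{\alpha\beta}$ if $\alpha$ is incident in $I$ only to one rank-1 edge $\alpha\beta$, and $\{0\}$ otherwise; $\ker_I(\beta)\subseteq V_\beta$ is defined likewise with right kernels. *Optimality witness of $I$*: subspaces $X_\alpha\subseteq U_\alpha$, $Y_\beta\subseteq V_\beta$ with $A_{\alpha\beta}(X_\alpha,Y_\beta)=\{0\}$ for all $\alpha,\beta$ and $r(I)=2\mu+2\nu-\sum_\alpha\dim X_\alpha-\sum_\beta\dim Y_\beta$. *Signs and valid labeling*: signs $\pm$ on the edges of $I$ such that any two incident edges have different signs, and two distinct lines $U_\alpha^\pm\subseteq U_\alpha$, $V_\beta^\pm\subseteq V_\beta$ for each node such that for each $\alpha\beta\in I$: $A_{\alpha\beta}(U_\alpha^+,V_\beta^-)=A_{\alpha\beta}(U_\alpha^-,V_\beta^+)=\{0\}$, and the left and right kernels of $A_{\alpha\beta}$ are $U_\alpha^{s},V_\beta^{s}$ if $\alpha\beta$ is rank-1 of sign $s$. *Outer space-walk*: $(Y_1,\beta_1\alpha_1,X_1,\alpha_1\beta_2,\dots,\beta_k\alpha_k,X_k)$, $k\ge1$, with $\beta_i\alpha_i\in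 E\setminus I$, each $\alpha_i\beta_{i+1}$ an isolated rank-2 edge of $I$, $Y_i\not\subseteq$ the right kernel of $A_{\alpha_i\beta_i}$, $X_i=Y_i^{\perp_{\alpha_i\beta_i}}$, $Y_{i+1}=X_i^{\perp_{\alpha_i\beta_{i+1}}}$. *Inner space-walk*: $(X_1,\alpha_1\beta_1,Y_1,\beta_1\alpha_2,\dots,\alpha_k\beta_k,Y_k)$, $k\ge1$, whose edges form a walk in a rank-1 component of $I$ without immediate reversals, each $\beta_i\alpha_{i+1}$ being rank-2, and $(X_i,Y_i)=(U_{\alpha_i}^{s},V_{\beta_i}^{-s})$ where $s$ is the sign of $\alpha_i\beta_i$. *Augmenting space-walk for $I$*: for some signs and valid labeling, an alternating concatenation $\mathcal T=\mathcal P_0\circ\mathcal Q_1\circ\mathcal P_1\circ\cdots\circ\mathcal Q_m\circ\mathcal P_m$ ($m\ge 0$) of outer space-walks $\mathcal P_i$ and inner space-walks $\mathcal Q_i$ such that: the last node and space of $\mathcal Q_i$ are the first node and space of $\mathcal P_i$; the last node $\alpha$ of $\mathcal P_i$ is the first node of $\mathcal Q_{i+1}$, and if the first space of $\mathcal Q_{i+1}$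 is $U_\alpha^{s}$ then the last space of $\mathcal P_i$ is not $U_\alpha^{-s}$; the first space of $\mathcal P_0$ equals $\ker_I(\beta)\neq\{0\}$ for its first node $\beta$; the last space of $\mathcal P_m$ differs from $\ker_I(\alpha)\ne\{0\}$ for its last node $\alpha$; and $\mathcal T$ is irredundant: every node is visited at most twice, and if a row node $\alpha$ (column node $\beta$) is visited first with space $Z$ and later with space $Z'$ (the spaces directly after entering the node, or the initial space at the start), then $Z\not\subseteq Z'$ ($Z\not\supseteq Z'$). **Theorem.** There is an algorithm which, given the list of the nonzero blocks $A_{\alpha\beta}$ (in any order) with the edges of a matching $I$ marked, finds in $O(|E|)$ time either an optimality witness of $I$ or an augmenting space-walk for $I$. Here an algorithm is a single program, independent of $\mathbb F,\mu,\nu,A,I$, for a unit-cost random access machine (zero-initialized memory) with addition, subtraction and comparison of natural numbers, and field operations and equality tests in $\mathbb F$; $O(|E|)$ means at most $C(|E|+1)$ steps with one absolute constant $C$. Subspaces of $\mathbb F^2$ are output as their codimension together with a spanning vector if it is 1. -/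

import Mathlib

/-! ### Generic partitioned matrices with `2 × 2` blocks -/

section Matching

variable {F : Type*} [Field F] {μ ν : ℕ}

/-- The blocks `A_{αβ}` of a `(2 × 2)`-type generic partitioned matrix. -/
abbrev Blocks (F : Type*) (μ ν : ℕ) : Type _ := Fin μ → Fin ν → Matrix (Fin 2) (Fin 2) F

/-- The subspaces of `F²`. -/
abbrev Space (F : Type*) [Field F] : Type _ := Submodule F (Fin 2 → F)

open Classical in
/-- The edge set `E` of the bipartite graph `G`: the index pairs of the nonzero blocks. -/
noncomputable def edges (A : Blocks F μ ν) : Finset (Fin μ × Fin ν) :=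
  Finset.univ.filter fun e => A e.1 e.2 ≠ 0

/-- The field `F(x)` of rational functions in the variables `x_{αβ}`. -/
abbrev RatFun (F : Type*) [Field F] (μ ν : ℕ) : Type _ :=
  FractionRing (MvPolynomial (Fin μ × Fin ν) F)

/-- The matrix `A_I` over `F(x)`: its `(α,β)` block is `A_{αβ} x_{αβ}` if `αβ ∈ I`, else zero. -/
noncomputable def symbolic (A : Blocks F μ ν) (I : Finset (Fin μ × Fin ν)) :
    Matrix (Fin μ × Fin 2) (Fin ν × Fin 2) (RatFun F μ ν) :=
  fun r c =>
    if (r.1, c.1) ∈ I then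
      algebraMap (MvPolynomial (Fin μ × Fin ν) F) (RatFun F μ ν)
        (MvPolynomial.C (A r.1 c.1 r.2 c.2) * MvPolynomial.X (r.1, c.1))
    else 0

/-- `I ⊆ E` is a matching: removing any edge of `I` decreases the rank of `A_I`. -/
def IsMatching (A : Blocks F μ ν) (I : Finset (Fin μ × Fin ν)) : Prop :=
  I ⊆ edges A ∧ ∀ e ∈ I, (symbolic A (I.erase e)).rank < (symbolic A I).rank

/-- The degree of the node `α` in `I`. -/
def degRow (I : Finset (Fin μ × Fin ν)) (α : Fin μ) : ℕ := (I.filter fun e => e.1 = α).card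

/-- The degree of the node `β` in `I`. -/
def degCol (I : Finset (Fin μ × Fin ν)) (β : Fin ν) : ℕ := (I.filter fun e => e.2 = β).card

/-- `αβ` is an isolated rank-2 edge of `I`. -/
def IsIsolatedRankTwo (A : Blocks F μ ν) (I : Finset (Fin μ × Fin ν)) (e : Fin μ × Fin ν) : Prop :=
  e ∈ I ∧ degRow I e.1 = 1 ∧ degCol I e.2 = 1 ∧ (A e.1 e.2).rank = 2

open Classical in
/-- `r(I) = |I| +` the number of isolated rank-2 edges in `I`. -/
noncomputable def rankFormula (A : Blocks F μ ν) (I : Finset (Fin μ × Fin ν)) : ℕ :=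
  I.card + (I.filter fun e => IsIsolatedRankTwo A I e).card

/-- The subgraph `([μ], [ν]; I)`. -/
def subgraphOf (I : Finset (Fin μ × Fin ν)) : SimpleGraph (Fin μ ⊕ Fin ν) where
  Adj
    | .inl α, .inr β => (α, β) ∈ I
    | .inr β, .inl α => (α, β) ∈ I
    | _, _ => False
  symm := ⟨by rintro (a | a) (b | b) h <;> exact h⟩
  loopless := ⟨by rintro (a | a) h <;> exact h⟩

/-- The node `α` lies in a connected component of `I` that contains a rank-1 edge. -/
def InRankOneComponent (A : Blocks F μ ν) (I : Finset (Fin μ × Fin ν)) (α : Fin μ) : Prop :=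
  ∃ e ∈ I, (A e.1 e.2).rank = 1 ∧ (subgraphOf I).Reachable (.inl α) (.inl e.1)

/-! ### Kernels and orthogonal spaces of a block, seen as the bilinear form `(u, v) ↦ uᵀ B v` -/

/-- The left kernel of `B`. -/
def kerL (B : Matrix (Fin 2) (Fin 2) F) : Space F := LinearMap.ker B.vecMulLinear

/-- The right kernel of `B`. -/
def kerR (B : Matrix (Fin 2) (Fin 2) F) : Space F := LinearMap.ker B.mulVecLin

/-- The orthogonal space, on the column side, of a space `X` on the row side. -/
def perpRow (B : Matrix (Fin 2) (Fin 2) F) (X : Space F) : Space F where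
  carrier := {y | ∀ x ∈ X, x ⬝ᵥ (B.mulVec y) = 0}
  add_mem' := by
    intro a b ha hb x hx
    rw [Matrix.mulVec_add, dotProduct_add, ha x hx, hb x hx, add_zero]
  zero_mem' := by
    intro x _
    rw [Matrix.mulVec_zero, dotProduct_zero]
  smul_mem' := by
    intro c y hy x hx
    rw [Matrix.mulVec_smul, dotProduct_smul, hy x hx, smul_zero]

/-- The orthogonal space, on the row side, of a space `Y` on the column side. -/
def perpCol (B : Matrix (Fin 2) (Fin 2) F) (Y : Space F) : Space F where
  carrier := {x | ∀ y ∈ Y, x ⬝ᵥ (B.mulVec y) = 0}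
  add_mem' := by
    intro a b ha hb y hy
    rw [add_dotProduct, ha y hy, hb y hy, add_zero]
  zero_mem' := by
    intro y _
    rw [zero_dotProduct]
  smul_mem' := by
    intro c x hx y hy
    rw [smul_dotProduct, hx y hy, smul_zero]

/-- `B(X, Y) = {0}`. -/
def Vanishes (B : Matrix (Fin 2) (Fin 2) F) (X Y : Space F) : Prop :=
  ∀ x ∈ X, ∀ y ∈ Y, x ⬝ᵥ (B.mulVec y) = 0

/-- `ker_I(α)`: all of `F²` if `α` has degree 0 (empty infimum), the left kernel of the block if `α`
has degree 1 (which is zero for a rank-2 block), and zero otherwise. -/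
def kerRow (A : Blocks F μ ν) (I : Finset (Fin μ × Fin ν)) (α : Fin μ) : Space F :=
  if degRow I α ≤ 1 then ⨅ β : {β : Fin ν // (α, β) ∈ I}, kerL (A α β) else ⊥

/-- `ker_I(β)`, symmetrically with right kernels. -/
def kerCol (A : Blocks F μ ν) (I : Finset (Fin μ × Fin ν)) (β : Fin ν) : Space F :=
  if degCol I β ≤ 1 then ⨅ α : {α : Fin μ // (α, β) ∈ I}, kerR (A α β) else ⊥

/-- The spaces `X_α`, `Y_β` form an optimality witness of `I`. -/
def IsOptimalityWitness (A : Blocks F μ ν) (I : Finset (Fin μ × Fin ν))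
    (X : Fin μ → Space F) (Y : Fin ν → Space F) : Prop :=
  (∀ α β, Vanishes (A α β) (X α) (Y β)) ∧
  (rankFormula A I : ℤ) = 2 * μ + 2 * ν
    - ∑ α, (Module.finrank F (X α) : ℤ) - ∑ β, (Module.finrank F (Y β) : ℤ)

/-! ### Signs and valid labelings -/

/-- Signs of edges (`true` is `+`, `false` is `-`) and two spaces for each node:
`U α true` is `U_α⁺`, `U α false` is `U_α⁻`, and likewise for `V`. -/
structure Labeling (F : Type*) [Field F] (μ ν : ℕ) where
  sign : Fin μ × Fin ν → Bool
  U : Fin μ → Bool → Space F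
  V : Fin ν → Bool → Space F

/-- The signs are a proper 2-edge-colouring of `I`, and the spaces are a valid labeling for `I`. -/
structure Labeling.IsValid (L : Labeling F μ ν) (A : Blocks F μ ν)
    (I : Finset (Fin μ × Fin ν)) : Prop where
  proper : ∀ e ∈ I, ∀ f ∈ I, e ≠ f → (e.1 = f.1 ∨ e.2 = f.2) → L.sign e ≠ L.sign f
  dimU : ∀ α s, Module.finrank F (L.U α s) = 1
  dimV : ∀ β s, Module.finrank F (L.V β s) = 1
  distinctU : ∀ α, L.U α true ≠ L.U α false
  distinctV : ∀ β, L.V β true ≠ L.V β false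
  vanish : ∀ e ∈ I, ∀ s, Vanishes (A e.1 e.2) (L.U e.1 s) (L.V e.2 (!s))
  kernel : ∀ e ∈ I, (A e.1 e.2).rank = 1 →
    kerL (A e.1 e.2) = L.U e.1 (L.sign e) ∧ kerR (A e.1 e.2) = L.V e.2 (L.sign e)

/-! ### Space-walks -/

/-- One step of a space-walk. In an outer space-walk it stands for `(Y, βα, X)`, in an inner
space-walk for `(X, αβ, Y)`. The edge that links two successive steps is determined by them. -/
structure WalkStep (F : Type*) [Field F] (μ ν : ℕ) where
  α : Fin μ
  β : Fin ν
  X : Space F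
  Y : Space F

/-- `(Y₁, β₁α₁, X₁, α₁β₂, …, β_kα_k, X_k)`, `k ≥ 1`, is an outer space-walk for `I`. -/
def IsOuterSpaceWalk (A : Blocks F μ ν) (I : Finset (Fin μ × Fin ν))
    (P : List (WalkStep F μ ν)) : Prop :=
  P ≠ [] ∧
  (∀ s ∈ P, (s.α, s.β) ∈ edges A ∧ (s.α, s.β) ∉ I ∧
    ¬ s.Y ≤ kerR (A s.α s.β) ∧ s.X = perpCol (A s.α s.β) s.Y) ∧
  P.IsChain fun s t => IsIsolatedRankTwo A I (s.α, t.β) ∧ t.Y = perpRow (A s.α t.β) s.X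

/-- `(X₁, α₁β₁, Y₁, β₁α₂, …, α_kβ_k, Y_k)`, `k ≥ 1`, is an inner space-walk for `I`: it runs along
a rank-1 component of `I`, without turning back on an edge, and each `β_iα_{i+1}` is rank-2. -/
def IsInnerSpaceWalk (A : Blocks F μ ν) (I : Finset (Fin μ × Fin ν)) (L : Labeling F μ ν)
    (Q : List (WalkStep F μ ν)) : Prop :=
  Q ≠ [] ∧
  (∀ s ∈ Q, (s.α, s.β) ∈ I ∧ InRankOneComponent A I s.α ∧
    s.X = L.U s.α (L.sign (s.α, s.β)) ∧ s.Y = L.V s.β (!L.sign (s.α, s.β))) ∧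
  Q.IsChain fun s t =>
    (t.α, s.β) ∈ I ∧ (A t.α s.β).rank = 2 ∧ s.α ≠ t.α ∧ s.β ≠ t.β

/-- The pieces `P₀, Q₁, P₁, …, Q_m, P_m` of an alternating concatenation; `Q i` is `Q_{i+1}`. -/
structure SpaceWalk (F : Type*) [Field F] (μ ν : ℕ) where
  m : ℕ
  P : Fin (m + 1) → List (WalkStep F μ ν)
  Q : Fin m → List (WalkStep F μ ν)

/-- The steps of the concatenation `P₀ ∘ Q₁ ∘ P₁ ∘ ⋯ ∘ Q_m ∘ P_m`. -/
def SpaceWalk.steps (T : SpaceWalk F μ ν) : List (WalkStep F μ ν) :=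
  T.P 0 ++ (List.ofFn fun i : Fin T.m => T.Q i ++ T.P i.succ).flatten

/-- The visits of `T` at row nodes in their order, each with the space right after the edge by which
the node is entered. The first node of each `Q_i` is the last one of `P_{i-1}`, not a new visit. -/
def SpaceWalk.rowVisits (T : SpaceWalk F μ ν) : List (WalkStep F μ ν) :=
  T.P 0 ++ (List.ofFn fun i : Fin T.m => (T.Q i).tail ++ T.P i.succ).flatten

/-- The visits of `T` at column nodes in their order, the initial node included. The first node of
each `P_i` with `i ≥ 1` is the last one of `Q_i`, not a new visit. -/
def SpaceWalk.colVisits (T : SpaceWalk F μ ν) : List (WalkStep F μ ν) :=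
  T.P 0 ++ (List.ofFn fun i : Fin T.m => T.Q i ++ (T.P i.succ).tail).flatten

/-- Every node is visited at most twice, and if it is visited first with the space `Z` and then with
the space `Z'`, then `Z ⊄ Z'` at a row node and `Z ⊉ Z'` at a column node. -/
structure SpaceWalk.Irredundant (T : SpaceWalk F μ ν) : Prop where
  row_le_two : ∀ α, (T.rowVisits.filter fun s => s.α = α).length ≤ 2
  col_le_two : ∀ β, (T.colVisits.filter fun s => s.β = β).length ≤ 2
  row_space : T.rowVisits.Pairwise fun s t => s.α = t.α → ¬ s.X ≤ t.X
  col_space : T.colVisits.Pairwise fun s t => s.β = t.β → ¬ t.Y ≤ s.Y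

/-- `T` is a compatible concatenation of outer and inner space-walks for `I`, with respect to `L`,
that satisfies the two end conditions of an augmenting space-walk. -/
structure SpaceWalk.IsAugmentingFor (T : SpaceWalk F μ ν) (A : Blocks F μ ν)
    (I : Finset (Fin μ × Fin ν)) (L : Labeling F μ ν) : Prop where
  outer : ∀ i, IsOuterSpaceWalk A I (T.P i)
  inner : ∀ i, IsInnerSpaceWalk A I L (T.Q i)
  compat_inner_outer : ∀ i, ∀ s ∈ (T.Q i).getLast?, ∀ t ∈ (T.P i.succ).head?,
    s.β = t.β ∧ s.Y = t.Y
  compat_outer_inner : ∀ i, ∀ s ∈ (T.P i.castSucc).getLast?, ∀ t ∈ (T.Q i).head?,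
    s.α = t.α ∧ ∀ σ, t.X = L.U t.α σ → s.X ≠ L.U t.α (!σ)
  initial : ∀ s ∈ (T.P 0).head?, s.Y = kerCol A I s.β ∧ kerCol A I s.β ≠ ⊥
  final : ∀ s ∈ (T.P (Fin.last T.m)).getLast?, s.X ≠ kerRow A I s.α ∧ kerRow A I s.α ≠ ⊥

/-- `T` is an (irredundant) augmenting space-walk for `I`, for some signs and valid labeling. -/
def SpaceWalk.IsAugmenting (T : SpaceWalk F μ ν) (A : Blocks F μ ν)
    (I : Finset (Fin μ × Fin ν)) : Prop :=
  T.Irredundant ∧ ∃ L : Labeling F μ ν, L.IsValid A I ∧ T.IsAugmentingFor A I L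

end Matching

/-! ### Programs for a unit-cost random access machine with natural numbers and field elements -/

namespace Ram

/-- The memory: countably many arrays of natural numbers and of field elements. -/
structure State (F : Type*) where
  nat : ℕ → ℕ → ℕ
  fld : ℕ → ℕ → F

/-- Expressions for natural numbers; `get a i` is the cell `i` of the array `a`. -/
inductive NExpr : Type
  | const (n : ℕ)
  | get (a : ℕ) (i : NExpr)
  | add (x y : NExpr)
  | sub (x y : NExpr)

/-- Expressions for field elements. The only field constants are `0` and `1`. -/
inductive FExpr : Type
  | zero
  | one
  | get (a : ℕ) (i : NExpr)
  | add (x y : FExpr)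
  | sub (x y : FExpr)
  | mul (x y : FExpr)
  | inv (x : FExpr)

/-- Tests: comparison of natural numbers, equality of field elements, negation, conjunction. -/
inductive Test : Type
  | eq (x y : NExpr)
  | lt (x y : NExpr)
  | feq (x y : FExpr)
  | not (b : Test)
  | and (b c : Test)

/-- Programs. The syntax does not mention a field, so that one program runs over all fields. -/
inductive Prog : Type
  | skip
  | setN (a : ℕ) (i e : NExpr)
  | setF (a : ℕ) (i : NExpr) (e : FExpr)
  | seq (p q : Prog)
  | cond (b : Test) (p q : Prog)
  | loop (b : Test) (p : Prog)

/-- The cost of an expression: one unit for each operation in it. -/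
def NExpr.cost : NExpr → ℕ
  | const _ => 1
  | get _ i => i.cost + 1
  | add x y => x.cost + y.cost + 1
  | sub x y => x.cost + y.cost + 1

/-- The cost of an expression: one unit for each operation in it. -/
def FExpr.cost : FExpr → ℕ
  | zero => 1
  | one => 1
  | get _ i => i.cost + 1
  | add x y => x.cost + y.cost + 1
  | sub x y => x.cost + y.cost + 1
  | mul x y => x.cost + y.cost + 1
  | inv x => x.cost + 1

/-- The cost of a test: one unit for each operation in it. -/
def Test.cost : Test → ℕ
  | eq x y => x.cost + y.cost + 1
  | lt x y => x.cost + y.cost + 1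
  | feq x y => x.cost + y.cost + 1
  | not b => b.cost + 1
  | and b c => b.cost + c.cost + 1

variable {F : Type*} [Field F]

/-- The value of an expression in a state. -/
def NExpr.eval (σ : State F) : NExpr → ℕ
  | const n => n
  | get a i => σ.nat a (i.eval σ)
  | add x y => x.eval σ + y.eval σ
  | sub x y => x.eval σ - y.eval σ

/-- The value of an expression in a state. -/
def FExpr.eval (σ : State F) : FExpr → F
  | zero => 0
  | one => 1
  | get a i => σ.fld a (i.eval σ)
  | add x y => x.eval σ + y.eval σ
  | sub x y => x.eval σ - y.eval σ
  | mul x y => x.eval σ * y.eval σ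
  | inv x => (x.eval σ)⁻¹

/-- The test succeeds in the state. -/
def Test.Holds (σ : State F) : Test → Prop
  | eq x y => x.eval σ = y.eval σ
  | lt x y => x.eval σ < y.eval σ
  | feq x y => x.eval σ = y.eval σ
  | not b => ¬ b.Holds σ
  | and b c => b.Holds σ ∧ c.Holds σ

/-- Write `v` to the cell `i` of the array `a` of natural numbers. -/
def State.setN (σ : State F) (a i v : ℕ) : State F :=
  { σ with nat := Function.update σ.nat a (Function.update (σ.nat a) i v) }

/-- Write `v` to the cell `i` of the array `a` of field elements. -/
def State.setF (σ : State F) (a i : ℕ) (v : F) : State F :=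
  { σ with fld := Function.update σ.fld a (Function.update (σ.fld a) i v) }

/-- `Exec p σ t τ`: the program `p`, started in the state `σ`, halts in the state `τ`
after exactly `t` time units. -/
inductive Exec : Prog → State F → ℕ → State F → Prop
  | skip (σ : State F) : Exec .skip σ 1 σ
  | setN (σ : State F) (a : ℕ) (i e : NExpr) :
      Exec (.setN a i e) σ (i.cost + e.cost + 1) (σ.setN a (i.eval σ) (e.eval σ))
  | setF (σ : State F) (a : ℕ) (i : NExpr) (e : FExpr) :
      Exec (.setF a i e) σ (i.cost + e.cost + 1) (σ.setF a (i.eval σ) (e.eval σ))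
  | seq {p q : Prog} {σ ρ τ : State F} {t u : ℕ} (hp : Exec p σ t ρ) (hq : Exec q ρ u τ) :
      Exec (.seq p q) σ (t + u) τ
  | condTrue {b : Test} {p q : Prog} {σ τ : State F} {t : ℕ} (hb : b.Holds σ)
      (hp : Exec p σ t τ) : Exec (.cond b p q) σ (b.cost + t) τ
  | condFalse {b : Test} {p q : Prog} {σ τ : State F} {t : ℕ} (hb : ¬ b.Holds σ)
      (hq : Exec q σ t τ) : Exec (.cond b p q) σ (b.cost + t) τ
  | loopTrue {b : Test} {p : Prog} {σ ρ τ : State F} {t u : ℕ} (hb : b.Holds σ)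
      (hp : Exec p σ t ρ) (hl : Exec (.loop b p) ρ u τ) :
      Exec (.loop b p) σ (b.cost + t + u) τ
  | loopFalse {b : Test} {p : Prog} {σ : State F} (hb : ¬ b.Holds σ) :
      Exec (.loop b p) σ b.cost σ

/-- The machine is deterministic: the running time and the final state are unique. -/
theorem Exec.unique {p : Prog} {σ τ τ' : State F} {t t' : ℕ}
    (h : Exec p σ t τ) (h' : Exec p σ t' τ') : t = t' ∧ τ = τ' := by
  induction h generalizing t' τ' with
  | skip | setN | setF => cases h'; exact ⟨rfl, rfl⟩
  | seq _ _ ih₁ ih₂ =>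
    cases h' with
    | seq a b =>
      obtain ⟨rfl, rfl⟩ := ih₁ a
      obtain ⟨rfl, rfl⟩ := ih₂ b
      exact ⟨rfl, rfl⟩
  | condTrue hb _ ih | condFalse hb _ ih =>
    cases h' with
    | condTrue hb' a | condFalse hb' a =>
      first
        | exact absurd hb hb'
        | exact absurd hb' hb
        | (obtain ⟨rfl, rfl⟩ := ih a; exact ⟨rfl, rfl⟩)
  | loopTrue hb _ _ ih₁ ih₂ =>
    cases h' with
    | loopTrue _ a b =>
      obtain ⟨rfl, rfl⟩ := ih₁ a
      obtain ⟨rfl, rfl⟩ := ih₂ b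
      exact ⟨rfl, rfl⟩
    | loopFalse hb' => exact absurd hb hb'
  | loopFalse hb =>
    cases h' with
    | loopTrue hb' _ _ => exact absurd hb' hb
    | loopFalse _ => exact ⟨rfl, rfl⟩

end Ram

/-! ### Input and output conventions -/

section InputOutput

variable {F : Type*} [Field F] {μ ν : ℕ}

/-- The input: the nonzero blocks of `A` in the order given by `enum`, with the edges of `I` marked.
Natural number arrays: `0` holds `|E|, μ, ν`; `1` and `2` hold the row and the column node of the
`k`-th edge; `3` holds `1` if that edge is in `I` and `0` otherwise. Field arrays `0, 1, 2, 3` hold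
the entries `(0,0), (0,1), (1,0), (1,1)` of its block. All other cells are zero. -/
noncomputable def inputState (A : Blocks F μ ν) (I : Finset (Fin μ × Fin ν))
    (enum : Fin (edges A).card ≃ {e // e ∈ edges A}) : Ram.State F where
  nat a k :=
    match a with
    | 0 => match k with
      | 0 => (edges A).card
      | 1 => μ
      | 2 => ν
      | _ => 0
    | 1 => if h : k < (edges A).card then ((enum ⟨k, h⟩).1.1 : ℕ) else 0
    | 2 => if h : k < (edges A).card then ((enum ⟨k, h⟩).1.2 : ℕ) else 0
    | 3 => if h : k < (edges A).card then (if (enum ⟨k, h⟩).1 ∈ I then 1 else 0) else 0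
    | _ => 0
  fld a k :=
    if h : k < (edges A).card then
      match a with
      | 0 => A (enum ⟨k, h⟩).1.1 (enum ⟨k, h⟩).1.2 0 0
      | 1 => A (enum ⟨k, h⟩).1.1 (enum ⟨k, h⟩).1.2 0 1
      | 2 => A (enum ⟨k, h⟩).1.1 (enum ⟨k, h⟩).1.2 1 0
      | 3 => A (enum ⟨k, h⟩).1.1 (enum ⟨k, h⟩).1.2 1 1
      | _ => 0
    else 0

/-- A subspace of `F²` is output as its codimension, with a spanning vector if that is one. -/
def decodeSpace (codim : ℕ) (p q : F) : Space F :=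
  match codim with
  | 0 => ⊤
  | 1 => Submodule.span F {![p, q]}
  | _ => ⊥

/-- Output of an optimality witness. The cell 0 of the natural number array `4` is `0`. The array
`5` and the field arrays `4, 5` hold the spaces `X_α`; the array `6` and the field arrays `6, 7`
hold the spaces `Y_β`. -/
def OutputsWitness (σ : Ram.State F) (X : Fin μ → Space F) (Y : Fin ν → Space F) : Prop :=
  σ.nat 4 0 = 0 ∧
  (∀ α : Fin μ, decodeSpace (σ.nat 5 α) (σ.fld 4 α) (σ.fld 5 α) = X α) ∧
  (∀ β : Fin ν, decodeSpace (σ.nat 6 β) (σ.fld 6 β) (σ.fld 7 β) = Y β)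

/-- Output of a space-walk. The cells 0 and 1 of the natural number array `4` are `1` and the number
of steps. For the `k`-th step, the arrays `7` and `8` hold its row and column node, the array `9`
and the field arrays `8, 9` its row space, the array `10` and the field arrays `10, 11` its column
space. -/
def OutputsWalk (σ : Ram.State F) (T : SpaceWalk F μ ν) : Prop :=
  σ.nat 4 0 = 1 ∧ σ.nat 4 1 = T.steps.length ∧
  ∀ k (h : k < T.steps.length),
    σ.nat 7 k = (T.steps[k].α : ℕ) ∧ σ.nat 8 k = (T.steps[k].β : ℕ) ∧
    decodeSpace (σ.nat 9 k) (σ.fld 8 k) (σ.fld 9 k) = T.steps[k].X ∧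
    decodeSpace (σ.nat 10 k) (σ.fld 10 k) (σ.fld 11 k) = T.steps[k].Y

end InputOutput

/-!
The algorithm is a graph search over column nodes, each reached with a subspace of the plane. A failed
search is itself an optimality witness; a successful one is a space-walk that can be traced back.

*What a matching provides.* A nonzero minor of maximal size of `A_I` contains every variable of a
matching `I` (`IsMatching.exists_transversal`). Hence every node has degree at most two, `I` is
a union of paths and even cycles, and signs exist. Removing any edge enlarges both kernels of `A_I`
(`IsMatching.isCritical`). A rank-1 edge forces a line at each of its ends, namely its kernel, and
orthogonality carries this line along the adjacent rank-2 edges (`DartLabel`). By comparing kernels,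
the two lines forced at a node of degree two are distinct (`IsCritical.cross_ne_zero`), every edge
that is not an isolated rank-2 edge receives a line at both ends, and that line is unique
(`IsCritical.exists_dartLabel_row`, `DartLabel.unique`). These lines are the valid labeling
(`IsWellLabelled.exists_labeling`), and they are found by propagation from the rank-1 edges. For
isolated rank-2 edges the labeling is arbitrary, and the search does not depend on it.

*The search.* An item of the search forest (`Item`, `IsForest`) is a column node `β` reached with
a space `Y`. The roots are the columns with a nonzero kernel. From an item, an edge outside `I` leads to
a row node `α` with the space `X`, the orthogonal space of `Y`, and an edge of `I` leads from `α` to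
a new item. The forest keeps the intersection of the spaces with which items enter from `α`, and the
sum of the spaces with which `β` is reached. An item is added only if it makes the intersection
smaller. The intersection can shrink only twice, and the sum then grows as well
(`IsForest.not_le_wCol`), so every node is reached by at most two items (`IsForest.length_col_le`),
and the search treats every edge a bounded number of times (`IsForest.work_le`).

*The two outcomes.* If the search reaches a row node whose nonzero kernel differs from the space `X`,
the path in the forest is an augmenting space-walk (`IsForest.exists_augmenting`). It is irredundant
because the spaces are monotone along the forest. If the search is completed without such a node, the
intersections at the row nodes and the sums at the column nodes (the whole plane at the columns
without an edge of `I`) annihilate all blocks. Each edge of `I` contributes one, or two if it is an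
isolated rank-2 edge, to the total codimension, which is therefore `r(I)`
(`IsForest.isOptimalityWitness`).

*The machine.* Loop-free programs are treated by weakest preconditions (`Prog.wp`), and the loops by
invariants with a step counter (`Triple.loop`). The memory is used as follows.
* The arrays `0`–`3` of numbers and of field elements hold the input, and `4`–`10` of numbers and
  `4`–`11` of field elements the output. The spaces of the optimality witness are kept up to date
  during the search.
* The arrays `11`–`15` of numbers hold, for each column node, the list of the edges outside `I` at
  it, and for each node a constant amount of data from which its edges in `I` can be read off.
* The array `17` of numbers marks the ends of edges that have a label; the field arrays `12`, `13`
  hold the labels. The row end of the `k`-th edge has the number `k`, its column end `|E| + k`.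
* The array `20` of numbers holds the registers, and the field arrays `20`–`27` temporary vectors.
* The arrays `21`–`29` of numbers and the field arrays `14`–`19` hold the items.
-/


/-! ### Weakest preconditions and loops for the random access machine -/

namespace Ram

variable {F : Type*}

section Memory

@[simp] theorem State.nat_setN (σ : State F) (a i v b : ℕ) :
    (σ.setN a i v).nat b = if b = a then Function.update (σ.nat b) i v else σ.nat b := by
  by_cases hb : b = a
  · subst hb
    simp [State.setN]
  · simp [State.setN, hb]

@[simp] theorem State.fld_setN (σ : State F) (a i v : ℕ) : (σ.setN a i v).fld = σ.fld := rfl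

@[simp] theorem State.nat_setF (σ : State F) (a i : ℕ) (v : F) : (σ.setF a i v).nat = σ.nat := rfl

@[simp] theorem State.fld_setF (σ : State F) (a i : ℕ) (v : F) (b : ℕ) :
    (σ.setF a i v).fld b = if b = a then Function.update (σ.fld b) i v else σ.fld b := by
  by_cases hb : b = a
  · subst hb
    simp [State.setF]
  · simp [State.setF, hb]

end Memory

variable [Field F]

/-- The weakest precondition of a loop-free program; a program that contains a loop has none. -/
def Prog.wp : Prog → (State F → Prop) → State F → Prop
  | skip, Q, σ => Q σ
  | setN a i e, Q, σ => Q (σ.setN a (i.eval σ) (e.eval σ))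
  | setF a i e, Q, σ => Q (σ.setF a (i.eval σ) (e.eval σ))
  | seq p q, Q, σ => p.wp (q.wp Q) σ
  | cond b p q, Q, σ => (b.Holds σ → p.wp Q σ) ∧ (¬ b.Holds σ → q.wp Q σ)
  | loop _ _, _, _ => False

/-- A bound on the running time of a loop-free program. -/
def Prog.bound : Prog → ℕ
  | skip => 1
  | setN _ i e => i.cost + e.cost + 1
  | setF _ i e => i.cost + e.cost + 1
  | seq p q => p.bound + q.bound
  | cond b p q => b.cost + (p.bound + q.bound)
  | loop b _ => b.cost

/-- The programs of the list, one after the other. -/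
def Prog.block : List Prog → Prog
  | [] => .skip
  | p :: l => .seq p (block l)

attribute [simp] NExpr.eval FExpr.eval Test.Holds Prog.wp Prog.block

theorem Prog.wp_mono {p : Prog} {Q Q' : State F → Prop} {σ : State F} (h : p.wp Q σ)
    (hQ : ∀ τ, Q τ → Q' τ) : p.wp Q' σ := by
  induction p generalizing σ Q Q' with
  | skip => exact hQ _ h
  | setN => exact hQ _ h
  | setF => exact hQ _ h
  | seq p q ihp ihq => exact ihp h fun τ hτ => ihq hτ hQ
  | cond b p q ihp ihq => exact ⟨fun hb => ihp (h.1 hb) hQ, fun hb => ihq (h.2 hb) hQ⟩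
  | loop => exact h

/-- From every state that satisfies `P`, the program halts within `c` steps in a state that
satisfies `Q`. -/
def Triple (P : State F → Prop) (p : Prog) (c : ℕ) (Q : State F → Prop) : Prop :=
  ∀ σ, P σ → ∃ t τ, Exec p σ t τ ∧ t ≤ c ∧ Q τ

theorem Prog.exec_of_wp {p : Prog} {Q : State F → Prop} {σ : State F} (h : p.wp Q σ) :
    ∃ t τ, Exec p σ t τ ∧ t ≤ p.bound ∧ Q τ := by
  induction p generalizing σ Q with
  | skip => exact ⟨_, _, Exec.skip _, le_rfl, h⟩
  | setN => exact ⟨_, _, Exec.setN _ _ _ _, le_rfl, h⟩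
  | setF => exact ⟨_, _, Exec.setF _ _ _ _, le_rfl, h⟩
  | seq p q ihp ihq =>
    obtain ⟨t, ρ, h₁, ht, hρ⟩ := ihp h
    obtain ⟨u, τ, h₂, hu, hτ⟩ := ihq hρ
    exact ⟨_, _, Exec.seq h₁ h₂, Nat.add_le_add ht hu, hτ⟩
  | cond b p q ihp ihq =>
    by_cases hb : b.Holds σ
    · obtain ⟨t, τ, h₁, ht, hτ⟩ := ihp (h.1 hb)
      exact ⟨_, _, Exec.condTrue hb h₁, by simp only [Prog.bound]; omega, hτ⟩
    · obtain ⟨t, τ, h₁, ht, hτ⟩ := ihq (h.2 hb)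
      exact ⟨_, _, Exec.condFalse hb h₁, by simp only [Prog.bound]; omega, hτ⟩
  | loop => exact h.elim

theorem Triple.of_wp {P Q : State F → Prop} {p : Prog} (h : ∀ σ, P σ → p.wp Q σ) :
    Triple P p p.bound Q := fun σ hσ => Prog.exec_of_wp (h σ hσ)

theorem Triple.seq {P Q R : State F → Prop} {p q : Prog} {c d : ℕ} (hp : Triple P p c Q)
    (hq : Triple Q q d R) : Triple P (.seq p q) (c + d) R := by
  intro σ hσ
  obtain ⟨t, ρ, h₁, ht, hρ⟩ := hp σ hσ
  obtain ⟨u, τ, h₂, hu, hτ⟩ := hq ρ hρ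
  exact ⟨_, _, Exec.seq h₁ h₂, Nat.add_le_add ht hu, hτ⟩

theorem Triple.cond {P Q : State F → Prop} {b : Test} {p q : Prog} {c d : ℕ}
    (hp : Triple (fun σ => P σ ∧ b.Holds σ) p c Q)
    (hq : Triple (fun σ => P σ ∧ ¬ b.Holds σ) q d Q) :
    Triple P (.cond b p q) (b.cost + (c + d)) Q := by
  intro σ hσ
  by_cases hb : b.Holds σ
  · obtain ⟨t, τ, h₁, ht, hτ⟩ := hp σ ⟨hσ, hb⟩
    exact ⟨_, _, Exec.condTrue hb h₁, by omega, hτ⟩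
  · obtain ⟨t, τ, h₁, ht, hτ⟩ := hq σ ⟨hσ, hb⟩
    exact ⟨_, _, Exec.condFalse hb h₁, by omega, hτ⟩

/-- The loop rule: the loop-free body keeps the invariant `J` and raises its counter by one, and the
counter is at most `N`. -/
theorem Triple.loop {b : Test} {p : Prog} {N : ℕ} {J : ℕ → State F → Prop}
    (hN : ∀ i σ, J i σ → i ≤ N)
    (h : ∀ i σ, J i σ → b.Holds σ → p.wp (J (i + 1)) σ) :
    Triple (fun σ => ∃ i, J i σ) (.loop b p) ((b.cost + p.bound) * N + b.cost)
      (fun τ => (∃ i, J i τ) ∧ ¬ b.Holds τ) := by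
  have key : ∀ m i σ, N - i = m → J i σ → ∃ t τ, Exec (.loop b p) σ t τ ∧
      t ≤ (b.cost + p.bound) * m + b.cost ∧ ((∃ i, J i τ) ∧ ¬ b.Holds τ) := by
    intro m
    induction m with
    | zero =>
      intro i σ hm hJ
      by_cases hb : b.Holds σ
      · obtain ⟨t, τ, -, -, hτ⟩ := Prog.exec_of_wp (h i σ hJ hb)
        have := hN _ _ hτ
        omega
      · exact ⟨_, _, Exec.loopFalse hb, by omega, ⟨i, hJ⟩, hb⟩
    | succ m ih =>
      intro i σ hm hJ
      by_cases hb : b.Holds σ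
      · obtain ⟨t, ρ, h₁, ht, hρ⟩ := Prog.exec_of_wp (h i σ hJ hb)
        obtain ⟨u, τ, h₂, hu, hτ⟩ := ih (i + 1) ρ (by omega) hρ
        refine ⟨_, _, Exec.loopTrue hb h₁ h₂, ?_, hτ⟩
        rw [Nat.mul_succ]
        omega
      · exact ⟨_, _, Exec.loopFalse hb, Nat.le_add_left _ _, ⟨i, hJ⟩, hb⟩
  rintro σ ⟨i, hJ⟩
  obtain ⟨t, τ, h₁, ht, hτ⟩ := key _ i σ rfl hJ
  refine ⟨t, τ, h₁, ht.trans ?_, hτ⟩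
  gcongr
  omega

end Ram

/-! ### Lines in the plane and orthogonality with respect to a `2 × 2` block -/

section Plane

variable {F : Type*} [Field F]

/-- The determinant of two vectors of the plane; it vanishes if they span the same line. -/
def cross (x y : Fin 2 → F) : F := x 0 * y 1 - x 1 * y 0

/-- A vector that spans the space orthogonal to the row vector `x`, unless `xᵀ B = 0`. -/
def rowPerp (B : Matrix (Fin 2) (Fin 2) F) (x : Fin 2 → F) : Fin 2 → F :=
  ![x 0 * B 0 1 + x 1 * B 1 1, -(x 0 * B 0 0 + x 1 * B 1 0)]

/-- A vector that spans the space orthogonal to the column vector `y`, unless `B y = 0`. -/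
def colPerp (B : Matrix (Fin 2) (Fin 2) F) (y : Fin 2 → F) : Fin 2 → F :=
  rowPerp B.transpose y

open Classical in
/-- A vector that spans the left kernel of a block of rank one. -/
noncomputable def leftKerVec (B : Matrix (Fin 2) (Fin 2) F) : Fin 2 → F :=
  if B 0 0 = 0 ∧ B 1 0 = 0 then ![B 1 1, -B 0 1] else ![B 1 0, -B 0 0]

/-- A vector that spans the right kernel of a block of rank one. -/
noncomputable def rightKerVec (B : Matrix (Fin 2) (Fin 2) F) : Fin 2 → F :=
  leftKerVec B.transpose

open Classical in
/-- A vector outside the line spanned by a given nonzero vector. -/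
noncomputable def complVec (x : Fin 2 → F) : Fin 2 → F := if x 1 = 0 then ![0, 1] else ![1, 0]

theorem vec_ne_zero_iff {x : Fin 2 → F} : x ≠ 0 ↔ x 0 ≠ 0 ∨ x 1 ≠ 0 := by
  rw [Ne, funext_iff, Fin.forall_fin_two]
  simp only [Pi.zero_apply]
  tauto

theorem bilin_apply (B : Matrix (Fin 2) (Fin 2) F) (x y : Fin 2 → F) :
    x ⬝ᵥ B.mulVec y = x 0 * (B 0 0 * y 0 + B 0 1 * y 1) + x 1 * (B 1 0 * y 0 + B 1 1 * y 1) := by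
  simp [dotProduct, Matrix.mulVec, Fin.sum_univ_two]

theorem bilin_transpose (B : Matrix (Fin 2) (Fin 2) F) (x y : Fin 2 → F) :
    y ⬝ᵥ B.transpose.mulVec x = x ⬝ᵥ B.mulVec y := by
  simp only [bilin_apply, Matrix.transpose_apply]
  ring

theorem det_eq (B : Matrix (Fin 2) (Fin 2) F) : B.det = B 0 0 * B 1 1 - B 0 1 * B 1 0 :=
  Matrix.det_fin_two B

theorem block_ne_zero_iff {B : Matrix (Fin 2) (Fin 2) F} :
    B ≠ 0 ↔ ¬ (B 0 0 = 0 ∧ B 0 1 = 0 ∧ B 1 0 = 0 ∧ B 1 1 = 0) := by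
  rw [not_iff_not, ← Matrix.ext_iff]
  simp only [Fin.forall_fin_two, Matrix.zero_apply]
  tauto

theorem cross_complVec {x : Fin 2 → F} (hx : x ≠ 0) : cross x (complVec x) ≠ 0 := by
  rw [vec_ne_zero_iff] at hx
  unfold cross complVec
  split_ifs with h <;> simp_all

theorem complVec_ne_zero (x : Fin 2 → F) : complVec x ≠ 0 := by
  rw [vec_ne_zero_iff]
  unfold complVec
  split_ifs <;> simp

theorem mem_span_vec_iff {x y : Fin 2 → F} (hx : x ≠ 0) :
    y ∈ Submodule.span F {x} ↔ cross x y = 0 := by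
  rw [Submodule.mem_span_singleton]
  constructor
  · rintro ⟨c, rfl⟩
    simp [cross]
    ring
  · intro h
    unfold cross at h
    rcases vec_ne_zero_iff.1 hx with h0 | h0
    · refine ⟨y 0 / x 0, funext fun i => ?_⟩
      fin_cases i <;> simp
      · field_simp
      · field_simp
        linear_combination -h
    · refine ⟨y 1 / x 1, funext fun i => ?_⟩
      fin_cases i <;> simp
      · field_simp
        linear_combination h
      · field_simp

theorem finrank_span_vec {x : Fin 2 → F} (hx : x ≠ 0) :
    Module.finrank F (Submodule.span F {x}) = 1 := finrank_span_singleton hx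

theorem span_le_span_vec_iff {x y : Fin 2 → F} (hx : x ≠ 0) :
    Submodule.span F {y} ≤ Submodule.span F {x} ↔ cross x y = 0 := by
  rw [Submodule.span_singleton_le_iff_mem, mem_span_vec_iff hx]

theorem span_eq_span_vec_iff {x y : Fin 2 → F} (hx : x ≠ 0) (hy : y ≠ 0) :
    Submodule.span F {y} = Submodule.span F {x} ↔ cross x y = 0 := by
  rw [← span_le_span_vec_iff hx]
  refine ⟨fun h => h.le, fun h => Submodule.eq_of_le_of_finrank_eq h ?_⟩
  rw [finrank_span_vec hx, finrank_span_vec hy]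

/-- Two lines that are comparable are equal. -/
theorem eq_of_le_of_finrank_one {S T : Space F} (hS : Module.finrank F S = 1)
    (hT : Module.finrank F T = 1) (h : S ≤ T) : S = T :=
  Submodule.eq_of_le_of_finrank_eq h (hS.trans hT.symm)

theorem finrank_top_space : Module.finrank F (⊤ : Space F) = 2 := by
  rw [finrank_top, Module.finrank_fin_fun]

theorem finrank_space_le (S : Space F) : Module.finrank F S ≤ 2 := by
  simpa using Submodule.finrank_le S

theorem finrank_eq_zero_space {S : Space F} : Module.finrank F S = 0 ↔ S = ⊥ :=
  Submodule.finrank_eq_zero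

theorem finrank_eq_two_space {S : Space F} : Module.finrank F S = 2 ↔ S = ⊤ := by
  refine ⟨fun h => Submodule.eq_top_of_finrank_eq (h.trans (Module.finrank_fin_fun F).symm), ?_⟩
  rintro rfl
  exact finrank_top_space

theorem exists_vec_of_finrank_one {S : Space F} (hS : Module.finrank F S = 1) :
    ∃ x : Fin 2 → F, x ≠ 0 ∧ S = Submodule.span F {x} := by
  have hb : S ≠ ⊥ := fun h => by
    rw [h, finrank_bot] at hS
    exact zero_ne_one hS
  obtain ⟨x, hx, hx0⟩ := Submodule.exists_mem_ne_zero_of_ne_bot hb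
  refine ⟨x, hx0, (eq_of_le_of_finrank_one (finrank_span_vec hx0) hS ?_).symm⟩
  rwa [Submodule.span_singleton_le_iff_mem]

/-- Two distinct lines meet in zero and together span the plane. -/
theorem isCompl_of_lines {S T : Space F} (hS : Module.finrank F S = 1)
    (hT : Module.finrank F T = 1) (h : S ≠ T) : S ⊓ T = ⊥ ∧ S ⊔ T = ⊤ := by
  have h1 : Module.finrank F (S ⊓ T : Submodule F _) = 0 := by
    have hle : Module.finrank F (S ⊓ T : Submodule F _) ≤ 1 :=
      hS ▸ Submodule.finrank_mono inf_le_left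
    by_contra h0
    have h2 : Module.finrank F (S ⊓ T : Submodule F _) = 1 := by omega
    exact h ((eq_of_le_of_finrank_one h2 hS inf_le_left).symm.trans
      (eq_of_le_of_finrank_one h2 hT inf_le_right))
  have h3 := Submodule.finrank_sup_add_finrank_inf_eq S T
  exact ⟨finrank_eq_zero_space.1 h1, finrank_eq_two_space.1 (by omega)⟩

theorem perpCol_eq (B : Matrix (Fin 2) (Fin 2) F) (Y : Space F) :
    perpCol B Y = perpRow B.transpose Y := by
  ext x
  change (∀ y ∈ Y, x ⬝ᵥ B.mulVec y = 0) ↔ ∀ y ∈ Y, y ⬝ᵥ B.transpose.mulVec x = 0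
  simp only [bilin_transpose]

theorem mem_perpRow {B : Matrix (Fin 2) (Fin 2) F} {X : Space F} {y : Fin 2 → F} :
    y ∈ perpRow B X ↔ ∀ x ∈ X, x ⬝ᵥ B.mulVec y = 0 := Iff.rfl

theorem mem_kerL {B : Matrix (Fin 2) (Fin 2) F} {x : Fin 2 → F} :
    x ∈ kerL B ↔ x 0 * B 0 0 + x 1 * B 1 0 = 0 ∧ x 0 * B 0 1 + x 1 * B 1 1 = 0 := by
  simp [kerL, funext_iff, Matrix.vecMul, dotProduct, Fin.sum_univ_two, Fin.forall_fin_two]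

theorem mem_kerR {B : Matrix (Fin 2) (Fin 2) F} {y : Fin 2 → F} :
    y ∈ kerR B ↔ B 0 0 * y 0 + B 0 1 * y 1 = 0 ∧ B 1 0 * y 0 + B 1 1 * y 1 = 0 := by
  simp [kerR, funext_iff, Fin.forall_fin_two]

theorem kerR_eq (B : Matrix (Fin 2) (Fin 2) F) : kerR B = kerL B.transpose := by
  ext y
  simp only [mem_kerL, mem_kerR, Matrix.transpose_apply, mul_comm (y _)]

theorem vanishes_iff_le_perpCol {B : Matrix (Fin 2) (Fin 2) F} {X Y : Space F} :
    Vanishes B X Y ↔ X ≤ perpCol B Y := Iff.rfl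

theorem vanishes_iff_le_perpRow {B : Matrix (Fin 2) (Fin 2) F} {X Y : Space F} :
    Vanishes B X Y ↔ Y ≤ perpRow B X :=
  ⟨fun h _ hy x hx => h x hx _ hy, fun h x hx _ hy => h hy x hx⟩

theorem perpRow_top (B : Matrix (Fin 2) (Fin 2) F) : perpRow B ⊤ = kerR B := by
  ext y
  simp only [mem_perpRow, mem_kerR, bilin_apply, Submodule.mem_top, true_implies]
  refine ⟨fun h => ⟨?_, ?_⟩, fun h x => by rw [h.1, h.2]; ring⟩
  · simpa using h ![1, 0]
  · simpa using h ![0, 1]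

theorem perpCol_top (B : Matrix (Fin 2) (Fin 2) F) : perpCol B ⊤ = kerL B := by
  rw [perpCol_eq, perpRow_top, kerR_eq, Matrix.transpose_transpose]

theorem perpRow_bot (B : Matrix (Fin 2) (Fin 2) F) : perpRow B ⊥ = ⊤ := by
  ext y
  simp [mem_perpRow]

theorem perpRow_anti {B : Matrix (Fin 2) (Fin 2) F} {X X' : Space F} (h : X ≤ X') :
    perpRow B X' ≤ perpRow B X := fun _ hy x hx => hy x (h hx)

theorem mem_perpRow_span {B : Matrix (Fin 2) (Fin 2) F} {x y : Fin 2 → F} :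
    y ∈ perpRow B (Submodule.span F {x}) ↔ x ⬝ᵥ B.mulVec y = 0 := by
  simp only [mem_perpRow, Submodule.mem_span_singleton, forall_exists_index,
    forall_apply_eq_imp_iff, smul_dotProduct, smul_eq_mul]
  exact ⟨fun h => by simpa using h 1, fun h c => by rw [h, mul_zero]⟩

theorem cross_rowPerp (B : Matrix (Fin 2) (Fin 2) F) (x y : Fin 2 → F) :
    cross (rowPerp B x) y = x ⬝ᵥ B.mulVec y := by
  rw [bilin_apply]
  simp [cross, rowPerp]
  ring

theorem cross_colPerp (B : Matrix (Fin 2) (Fin 2) F) (x y : Fin 2 → F) :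
    cross x (colPerp B y) = -(x ⬝ᵥ B.mulVec y) := by
  rw [bilin_apply]
  simp [cross, colPerp, rowPerp]
  ring

theorem cross_comm (x y : Fin 2 → F) : cross x y = -cross y x := by
  unfold cross; ring

theorem rowPerp_ne_zero_iff {B : Matrix (Fin 2) (Fin 2) F} {x : Fin 2 → F} :
    rowPerp B x ≠ 0 ↔ x ∉ kerL B := by
  rw [vec_ne_zero_iff, mem_kerL]
  simp only [rowPerp, Matrix.cons_val_zero, Matrix.cons_val_one, ne_eq, neg_eq_zero]
  tauto

theorem colPerp_ne_zero_iff {B : Matrix (Fin 2) (Fin 2) F} {y : Fin 2 → F} :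
    colPerp B y ≠ 0 ↔ y ∉ kerR B := by
  rw [kerR_eq]
  exact rowPerp_ne_zero_iff

theorem perpRow_span {B : Matrix (Fin 2) (Fin 2) F} {x : Fin 2 → F} (h : x ∉ kerL B) :
    perpRow B (Submodule.span F {x}) = Submodule.span F {rowPerp B x} := by
  ext y
  rw [mem_perpRow_span, mem_span_vec_iff (rowPerp_ne_zero_iff.2 h), cross_rowPerp]

theorem perpCol_span {B : Matrix (Fin 2) (Fin 2) F} {y : Fin 2 → F} (h : y ∉ kerR B) :
    perpCol B (Submodule.span F {y}) = Submodule.span F {colPerp B y} := by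
  rw [perpCol_eq, perpRow_span (by rwa [← kerR_eq])]
  rfl

theorem kerL_eq_bot {B : Matrix (Fin 2) (Fin 2) F} (h : B.det ≠ 0) : kerL B = ⊥ := by
  rw [det_eq] at h
  rw [eq_bot_iff]
  intro x hx
  rw [mem_kerL] at hx
  rw [Submodule.mem_bot]
  by_contra hx0
  rcases vec_ne_zero_iff.1 hx0 with h0 | h0
  · exact mul_ne_zero h h0 (by linear_combination B 1 1 * hx.1 - B 1 0 * hx.2)
  · exact mul_ne_zero h h0 (by linear_combination B 0 0 * hx.2 - B 0 1 * hx.1)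

theorem kerR_eq_bot {B : Matrix (Fin 2) (Fin 2) F} (h : B.det ≠ 0) : kerR B = ⊥ := by
  rw [kerR_eq]
  exact kerL_eq_bot (by rwa [Matrix.det_transpose])

theorem rowPerp_ne_zero {B : Matrix (Fin 2) (Fin 2) F} (h : B.det ≠ 0) {x : Fin 2 → F}
    (hx : x ≠ 0) : rowPerp B x ≠ 0 := by
  rw [rowPerp_ne_zero_iff, kerL_eq_bot h]
  simpa using hx

theorem colPerp_ne_zero {B : Matrix (Fin 2) (Fin 2) F} (h : B.det ≠ 0) {x : Fin 2 → F}
    (hx : x ≠ 0) : colPerp B x ≠ 0 :=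
  rowPerp_ne_zero (by rwa [Matrix.det_transpose]) hx

theorem leftKerVec_ne_zero {B : Matrix (Fin 2) (Fin 2) F} (h : B ≠ 0) : leftKerVec B ≠ 0 := by
  rw [block_ne_zero_iff] at h
  rw [vec_ne_zero_iff]
  unfold leftKerVec
  split_ifs with h0 <;> simp <;> tauto

theorem rightKerVec_ne_zero {B : Matrix (Fin 2) (Fin 2) F} (h : B ≠ 0) : rightKerVec B ≠ 0 :=
  leftKerVec_ne_zero (by simpa using h)

theorem kerL_eq_span {B : Matrix (Fin 2) (Fin 2) F} (h : B ≠ 0) (hd : B.det = 0) :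
    kerL B = Submodule.span F {leftKerVec B} := by
  ext x
  rw [mem_span_vec_iff (leftKerVec_ne_zero h), mem_kerL]
  rw [block_ne_zero_iff] at h
  rw [det_eq] at hd
  unfold leftKerVec cross
  split_ifs with h0
  · obtain ⟨ha, hb⟩ := h0
    simp only [ha, hb, Matrix.cons_val_zero, Matrix.cons_val_one]
    constructor
    · rintro ⟨-, h2⟩
      linear_combination h2
    · intro h2
      exact ⟨by ring, by linear_combination h2⟩
  · simp only [Matrix.cons_val_zero, Matrix.cons_val_one]
    constructor
    · rintro ⟨h1, -⟩
      linear_combination h1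
    · intro h1
      refine ⟨by linear_combination h1, ?_⟩
      by_cases ha : B 0 0 = 0
      · have hb : B 1 0 ≠ 0 := fun hb => h0 ⟨ha, hb⟩
        apply mul_left_cancel₀ hb
        linear_combination B 1 1 * h1 - x 0 * hd
      · apply mul_left_cancel₀ ha
        linear_combination B 0 1 * h1 + x 1 * hd

theorem kerR_eq_span {B : Matrix (Fin 2) (Fin 2) F} (h : B ≠ 0) (hd : B.det = 0) :
    kerR B = Submodule.span F {rightKerVec B} := by
  rw [kerR_eq]
  exact kerL_eq_span (by simpa using h) (by rwa [Matrix.det_transpose])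

theorem block_rank_eq_two_iff {B : Matrix (Fin 2) (Fin 2) F} : B.rank = 2 ↔ B.det ≠ 0 := by
  rw [← isUnit_iff_ne_zero, ← Matrix.isUnit_iff_isUnit_det]
  constructor
  · intro h
    rw [← Matrix.mulVec_surjective_iff_isUnit]
    have : LinearMap.range B.mulVecLin = ⊤ :=
      Submodule.eq_top_of_finrank_eq (by simpa [Matrix.rank] using h)
    exact LinearMap.range_eq_top.1 this
  · intro h
    simpa using Matrix.rank_of_isUnit B h

theorem block_rank_eq_one_iff {B : Matrix (Fin 2) (Fin 2) F} : B.rank = 1 ↔ B ≠ 0 ∧ B.det = 0 := by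
  have h2 := @block_rank_eq_two_iff F _ B
  have hle : B.rank ≤ 2 := by simpa using B.rank_le_card_width
  have h0 : B.rank = 0 ↔ B = 0 := by
    rw [Matrix.rank, Submodule.finrank_eq_zero, LinearMap.range_eq_bot]
    refine ⟨fun h => ?_, fun h => by simp [h]⟩
    ext i j
    have := congrFun (LinearMap.congr_fun h (Pi.single j 1)) i
    simpa using this
  constructor
  · intro h
    refine ⟨fun hB => ?_, ?_⟩
    · have := h0.2 hB
      omega
    · by_contra hd
      have := h2.2 hd
      omega
  · rintro ⟨hB, hd⟩
    have h1 : B.rank ≠ 2 := fun h => h2.1 h hd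
    have h3 : B.rank ≠ 0 := fun h => hB (h0.1 h)
    omega

/-- Orthogonality with respect to a block of rank two reflects inclusions. -/
theorem le_of_perpRow_le {B : Matrix (Fin 2) (Fin 2) F} (hB : B.det ≠ 0) {X X' : Space F}
    (h : perpRow B X' ≤ perpRow B X) : X ≤ X' := by
  have h2 := finrank_space_le X'
  rcases (show Module.finrank F X' = 0 ∨ Module.finrank F X' = 1 ∨ Module.finrank F X' = 2 by
    omega) with h0 | h1 | h2
  · rw [finrank_eq_zero_space] at h0
    subst h0
    rw [perpRow_bot, top_le_iff] at h
    intro x hx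
    have := kerL_eq_bot hB
    rw [← this, mem_kerL]
    have hy : ∀ y : Fin 2 → F, x ⬝ᵥ B.mulVec y = 0 := fun y =>
      (h ▸ Submodule.mem_top : y ∈ perpRow B X) x hx
    have hy0 := hy ![1, 0]
    have hy1 := hy ![0, 1]
    simp only [bilin_apply, Matrix.cons_val_zero, Matrix.cons_val_one] at hy0 hy1
    exact ⟨by linear_combination hy0, by linear_combination hy1⟩
  · obtain ⟨x', hx', rfl⟩ := exists_vec_of_finrank_one h1
    intro x hx
    rw [mem_span_vec_iff hx']
    have hm : x' ∉ kerL B := by rw [kerL_eq_bot hB]; simpa using hx'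
    rw [perpRow_span hm, Submodule.span_singleton_le_iff_mem] at h
    have := h x hx
    rw [det_eq] at hB
    rw [bilin_apply] at this
    simp only [rowPerp, Matrix.cons_val_zero, Matrix.cons_val_one] at this
    refine (mul_eq_zero.1 (?_ : (B 0 0 * B 1 1 - B 0 1 * B 1 0) * _ = 0)).resolve_left hB
    unfold cross
    linear_combination -this
  · rw [finrank_eq_two_space] at h2
    rw [h2]
    exact le_top

theorem finrank_perpRow {B : Matrix (Fin 2) (Fin 2) F} (hB : B.det ≠ 0) (X : Space F) :
    Module.finrank F (perpRow B X) = 2 - Module.finrank F X := by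
  have h2 := finrank_space_le X
  rcases (show Module.finrank F X = 0 ∨ Module.finrank F X = 1 ∨ Module.finrank F X = 2 by
    omega) with h0 | h1 | h2
  · rw [finrank_eq_zero_space] at h0
    subst h0
    rw [perpRow_bot, finrank_top_space, finrank_bot]
  · obtain ⟨x, hx, rfl⟩ := exists_vec_of_finrank_one h1
    rw [perpRow_span (by rw [kerL_eq_bot hB]; simpa using hx), h1,
      finrank_span_vec (rowPerp_ne_zero hB hx)]
  · rw [h2]
    rw [finrank_eq_two_space] at h2
    subst h2
    rw [perpRow_top, kerR_eq_bot hB]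
    simp

end Plane

/-! ### Degrees in a matching -/

section Degree

theorem Matrix.exists_linearIndependent_rows {K m n : Type*} [Field K] [Fintype m] [Fintype n]
    (M : Matrix m n K) {r : ℕ} (hr : M.rank = r) :
    ∃ R : Fin r → m, LinearIndependent K (M.submatrix R id).row := by
  rw [Matrix.rank_eq_finrank_span_row] at hr
  subst hr
  obtain ⟨f, hf, -, hli⟩ := Submodule.exists_fun_fin_finrank_span_eq K (Set.range M.row)
  choose R hR using hf
  refine ⟨R, ?_⟩
  have h : (M.submatrix R id).row = f := funext hR
  rwa [h]

theorem Matrix.exists_minor {K m n : Type*} [Field K] [Fintype m] [Fintype n] (M : Matrix m n K)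
    {r : ℕ} (hr : M.rank = r) :
    ∃ (R : Fin r → m) (C : Fin r → n), R.Injective ∧ C.Injective ∧
      (M.submatrix R C).det ≠ 0 := by
  obtain ⟨R, hR⟩ := M.exists_linearIndependent_rows hr
  have hr1 : (M.submatrix R id).transpose.rank = r := by
    rw [Matrix.rank_transpose, hR.rank_matrix, Fintype.card_fin]
  obtain ⟨C, hC⟩ := Matrix.exists_linearIndependent_rows _ hr1
  have hM : (M.submatrix R id).transpose.submatrix C id = (M.submatrix R C).transpose := rfl
  rw [hM] at hC
  have hdet : (M.submatrix R C).det ≠ 0 := by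
    rw [Matrix.linearIndependent_rows_iff_isUnit, Matrix.isUnit_iff_isUnit_det,
      Matrix.det_transpose] at hC
    exact hC.ne_zero
  refine ⟨R, C, fun i j h => ?_, fun i j h => ?_, hdet⟩
  · by_contra hij
    exact hdet (Matrix.det_zero_of_row_eq hij (by funext k; simp [h]))
  · by_contra hij
    exact hdet (Matrix.det_zero_of_column_eq hij (by intro k; simp [h]))

variable {F : Type*} [Field F] {μ ν : ℕ}

/-- The entries of `A_I` as polynomials. -/
noncomputable def polyMatrix (A : Blocks F μ ν) (I : Finset (Fin μ × Fin ν)) :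
    Matrix (Fin μ × Fin 2) (Fin ν × Fin 2) (MvPolynomial (Fin μ × Fin ν) F) :=
  fun r c => MvPolynomial.monomial (Finsupp.single (r.1, c.1) 1)
    (if (r.1, c.1) ∈ I then A r.1 c.1 r.2 c.2 else 0)

theorem symbolic_eq_map (A : Blocks F μ ν) (I : Finset (Fin μ × Fin ν)) :
    symbolic A I = (polyMatrix A I).map (algebraMap _ (RatFun F μ ν)) := by
  ext r c
  simp only [symbolic, polyMatrix, Matrix.map_apply]
  split_ifs with h
  · rw [MvPolynomial.X, MvPolynomial.C_mul_monomial, mul_one]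
  · simp

theorem coeff_det_polyMatrix (A : Blocks F μ ν) (I : Finset (Fin μ × Fin ν)) {r : ℕ}
    (R : Fin r → Fin μ × Fin 2) (C : Fin r → Fin ν × Fin 2) (m : Fin μ × Fin ν →₀ ℕ) :
    ((polyMatrix A I).submatrix R C).det.coeff m =
      ∑ σ : Equiv.Perm (Fin r), (Equiv.Perm.sign σ : F) *
        if ∑ i, Finsupp.single ((R (σ i)).1, (C i).1) 1 = m then
          ∏ i, (if ((R (σ i)).1, (C i).1) ∈ I then A (R (σ i)).1 (C i).1 (R (σ i)).2 (C i).2 else 0)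
        else 0 := by
  classical
  rw [Matrix.det_apply', MvPolynomial.coeff_sum]
  refine Finset.sum_congr rfl fun σ _ => ?_
  have h1 : ((Equiv.Perm.sign σ : ℤ) : MvPolynomial (Fin μ × Fin ν) F) =
      MvPolynomial.C ((Equiv.Perm.sign σ : ℤ) : F) := by simp
  rw [h1, MvPolynomial.coeff_C_mul]
  congr 1
  simp only [Matrix.submatrix_apply, polyMatrix]
  rw [← MvPolynomial.coeff_monomial, MvPolynomial.monomial_sum_prod]

/-- A nonzero minor of maximal size contains a monomial in which every variable of a matching
occurs; it comes from an expansion term whose positions run through all edges of the matching. -/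
theorem IsMatching.exists_transversal {A : Blocks F μ ν} {I : Finset (Fin μ × Fin ν)}
    (h : IsMatching A I) : ∃ (r : ℕ) (R : Fin r → Fin μ × Fin 2) (C : Fin r → Fin ν × Fin 2),
      R.Injective ∧ C.Injective ∧ ∀ e ∈ I, ∃ i, ((R i).1, (C i).1) = e := by
  classical
  obtain ⟨r, hr⟩ : ∃ r, (symbolic A I).rank = r := ⟨_, rfl⟩
  obtain ⟨R, C, hR, hC, hdet⟩ := (symbolic A I).exists_minor hr
  have hmap : ∀ J, ((symbolic A J).submatrix R C).det =
      algebraMap _ (RatFun F μ ν) ((polyMatrix A J).submatrix R C).det := fun J => by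
    rw [symbolic_eq_map, Matrix.submatrix_map, RingHom.map_det, RingHom.mapMatrix_apply]
  have hinj := IsFractionRing.injective (MvPolynomial (Fin μ × Fin ν) F) (RatFun F μ ν)
  have hP : ((polyMatrix A I).submatrix R C).det ≠ 0 := fun h0 => hdet (by rw [hmap, h0, map_zero])
  obtain ⟨m, hm⟩ := MvPolynomial.ne_zero_iff.1 hP
  have hsupp : ∀ e ∈ I, m e ≠ 0 := by
    intro e he hme
    have hlt := h.2 e he
    have h0 : ((polyMatrix A (I.erase e)).submatrix R C).det = 0 := by
      apply hinj
      rw [map_zero, ← hmap]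
      by_contra hne
      have h1 : ((symbolic A (I.erase e)).submatrix R C).rank = r := by
        rw [Matrix.rank_of_isUnit _ ((Matrix.isUnit_iff_isUnit_det _).2 (isUnit_iff_ne_zero.2 hne)),
          Fintype.card_fin]
      have h2 := Matrix.rank_submatrix_le (symbolic A (I.erase e)) R C
      omega
    apply hm
    rw [← MvPolynomial.coeff_zero m, ← h0, coeff_det_polyMatrix, coeff_det_polyMatrix]
    refine Finset.sum_congr rfl fun σ _ => ?_
    congr 1
    split_ifs with hσ
    · refine Finset.prod_congr rfl fun i _ => ?_
      have hne : ((R (σ i)).1, (C i).1) ≠ e := by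
        intro hie
        rw [← hσ, Finsupp.finsetSum_apply, Finset.sum_eq_zero_iff] at hme
        have := hme i (Finset.mem_univ _)
        simp [hie] at this
      simp [hne]
    · rfl
  rw [coeff_det_polyMatrix] at hm
  obtain ⟨σ, -, hσ⟩ := Finset.exists_ne_zero_of_sum_ne_zero hm
  have hσ' := right_ne_zero_of_mul hσ
  split_ifs at hσ' with hs
  · refine ⟨_, R ∘ σ, C, hR.comp σ.injective, hC, fun e he => ?_⟩
    have := hsupp e he
    rw [← hs, Finsupp.finsetSum_apply] at this
    obtain ⟨i, -, hi⟩ := Finset.exists_ne_zero_of_sum_ne_zero this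
    refine ⟨i, ?_⟩
    by_contra hne
    exact hi (Finsupp.single_eq_of_ne' hne)
  · exact (hσ' rfl).elim

theorem IsMatching.degRow_le {A : Blocks F μ ν} {I : Finset (Fin μ × Fin ν)}
    (h : IsMatching A I) (α : Fin μ) : degRow I α ≤ 2 := by
  classical
  obtain ⟨r, R, C, hR, -, hI⟩ := h.exists_transversal
  choose f hf using hI
  have hinj : ((I.filter fun e => e.1 = α).card) ≤ (Finset.univ : Finset (Fin 2)).card := by
    refine Finset.card_le_card_of_injOn (fun e => if he : e ∈ I then (R (f e he)).2 else 0)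
      (fun _ _ => Finset.mem_univ _) ?_
    intro e he e' he' hee
    simp only [Finset.coe_filter, Set.mem_ofPred_eq] at he he'
    simp only [he.1, he'.1, dif_pos] at hee
    have h1 := hf e he.1
    have h2 := hf e' he'.1
    have h3 : R (f e he.1) = R (f e' he'.1) := Prod.ext
      (((congrArg Prod.fst h1).trans (he.2.trans he'.2.symm)).trans (congrArg Prod.fst h2).symm) hee
    rw [← h1, ← h2, hR h3]
  simpa [degRow] using hinj

theorem IsMatching.degCol_le {A : Blocks F μ ν} {I : Finset (Fin μ × Fin ν)}
    (h : IsMatching A I) (β : Fin ν) : degCol I β ≤ 2 := by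
  classical
  obtain ⟨r, R, C, -, hC, hI⟩ := h.exists_transversal
  choose f hf using hI
  have hinj : ((I.filter fun e => e.2 = β).card) ≤ (Finset.univ : Finset (Fin 2)).card := by
    refine Finset.card_le_card_of_injOn (fun e => if he : e ∈ I then (C (f e he)).2 else 0)
      (fun _ _ => Finset.mem_univ _) ?_
    intro e he e' he' hee
    simp only [Finset.coe_filter, Set.mem_ofPred_eq] at he he'
    simp only [he.1, he'.1, dif_pos] at hee
    have h1 := hf e he.1
    have h2 := hf e' he'.1
    have h3 : C (f e he.1) = C (f e' he'.1) := Prod.ext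
      (((congrArg Prod.snd h1).trans (he.2.trans he'.2.symm)).trans (congrArg Prod.snd h2).symm) hee
    rw [← h1, ← h2, hC h3]
  simpa [degCol] using hinj

end Degree

/-! ### Critical edge sets and the lines forced by their rank-1 edges -/

section Critical

variable {K : Type*} [Field K] {μ ν : ℕ}

/-- The transposed partitioned matrix. -/
def transBlocks (A : Blocks K μ ν) : Blocks K ν μ := fun β α => (A α β).transpose

/-- The edges of the transposed partitioned matrix. -/
def transEdges (I : Finset (Fin μ × Fin ν)) : Finset (Fin ν × Fin μ) :=
  I.map (Equiv.prodComm _ _).toEmbedding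

theorem mem_transEdges {I : Finset (Fin μ × Fin ν)} {e : Fin ν × Fin μ} :
    e ∈ transEdges I ↔ e.swap ∈ I := by
  simp only [transEdges, Finset.mem_map_equiv]
  rfl

theorem transEdges_transEdges (I : Finset (Fin μ × Fin ν)) : transEdges (transEdges I) = I := by
  ext e
  simp [mem_transEdges]

theorem transEdges_erase (I : Finset (Fin μ × Fin ν)) (e : Fin ν × Fin μ) :
    (transEdges I).erase e = transEdges (I.erase e.swap) := by
  ext f
  simp [mem_transEdges]

/-- The signs on `I` are a proper 2-edge-colouring. -/
def IsProperSign (I : Finset (Fin μ × Fin ν)) (sgn : Fin μ × Fin ν → Bool) : Prop :=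
  ∀ e ∈ I, ∀ f ∈ I, e ≠ f → (e.1 = f.1 ∨ e.2 = f.2) → sgn e ≠ sgn f

theorem IsProperSign.transpose {I : Finset (Fin μ × Fin ν)} {sgn : Fin μ × Fin ν → Bool}
    (h : IsProperSign I sgn) : IsProperSign (transEdges I) (sgn ∘ Prod.swap) := by
  intro e he f hf hef hs
  rw [mem_transEdges] at he hf
  exact h _ he _ hf (fun h => hef (Prod.swap_injective h)) hs.symm

theorem IsProperSign.eq_or_eq {I : Finset (Fin μ × Fin ν)} {sgn : Fin μ × Fin ν → Bool}
    (h : IsProperSign I sgn) {e f g : Fin μ × Fin ν} (he : e ∈ I) (hf : f ∈ I) (hg : g ∈ I)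
    (hfe : f ≠ e) (h1 : f.1 = e.1) (h2 : g.1 = e.1) : g = e ∨ g = f := by
  by_contra! hc
  have a1 := h e he f hf hfe.symm (Or.inl h1.symm)
  have a2 := h e he g hg hc.1.symm (Or.inl h2.symm)
  have a3 := h f hf g hg hc.2.symm (Or.inl (h1.trans h2.symm))
  revert a1 a2 a3
  cases sgn e <;> cases sgn f <;> cases sgn g <;> simp

theorem IsProperSign.eq_or_eq' {I : Finset (Fin μ × Fin ν)} {sgn : Fin μ × Fin ν → Bool}
    (h : IsProperSign I sgn) {e f g : Fin μ × Fin ν} (he : e ∈ I) (hf : f ∈ I) (hg : g ∈ I)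
    (hfe : f ≠ e) (h1 : f.2 = e.2) (h2 : g.2 = e.2) : g = e ∨ g = f := by
  have := h.transpose.eq_or_eq (e := e.swap) (f := f.swap) (g := g.swap)
    (by simpa [mem_transEdges]) (by simpa [mem_transEdges]) (by simpa [mem_transEdges])
    (fun h => hfe (Prod.swap_injective h)) h1 h2
  simpa only [Prod.swap_inj] using this

/-- The equations of the row node `α` in the linear system `A_J y = 0`, where the variable `x_e` has
the value `w e`. -/
def rowEq (A : Blocks K μ ν) (w : Fin μ × Fin ν → K) (J : Finset (Fin μ × Fin ν))
    (y : Fin ν → Fin 2 → K) (α : Fin μ) : Fin 2 → K :=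
  ∑ e ∈ J with e.1 = α, w e • (A e.1 e.2).mulVec (y e.2)

/-- The right kernel of `A_J`, where the variable `x_e` has the value `w e`. -/
def rightKer (A : Blocks K μ ν) (w : Fin μ × Fin ν → K) (J : Finset (Fin μ × Fin ν)) :
    Submodule K (Fin ν → Fin 2 → K) where
  carrier := {y | ∀ α, rowEq A w J y α = 0}
  add_mem' := by
    intro y z hy hz α
    have h1 := hy α
    have h2 := hz α
    simp only [rowEq, Pi.add_apply, Matrix.mulVec_add, smul_add, Finset.sum_add_distrib] at *
    rw [h1, h2, add_zero]
  zero_mem' := by intro α; simp [rowEq]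
  smul_mem' := by
    intro c y hy α
    have h1 := hy α
    simp only [rowEq, Pi.smul_apply, Matrix.mulVec_smul, smul_comm _ c] at *
    rw [← Finset.smul_sum, h1, smul_zero]

theorem mem_rightKer {A : Blocks K μ ν} {w : Fin μ × Fin ν → K} {J : Finset (Fin μ × Fin ν)}
    {y : Fin ν → Fin 2 → K} : y ∈ rightKer A w J ↔ ∀ α, rowEq A w J y α = 0 := Iff.rfl

/-- Removing any edge of `I` enlarges both kernels of `A_I`, for nonzero values of the variables;
`sgn` is a proper 2-edge-colouring of `I`. -/
structure IsCritical (A : Blocks K μ ν) (w : Fin μ × Fin ν → K) (I : Finset (Fin μ × Fin ν))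
    (sgn : Fin μ × Fin ν → Bool) : Prop where
  block : ∀ e ∈ I, A e.1 e.2 ≠ 0
  weight : ∀ e ∈ I, w e ≠ 0
  proper : IsProperSign I sgn
  right : ∀ e ∈ I, Module.finrank K (rightKer A w I) < Module.finrank K (rightKer A w (I.erase e))
  left : ∀ e ∈ transEdges I,
    Module.finrank K (rightKer (transBlocks A) (w ∘ Prod.swap) (transEdges I)) <
      Module.finrank K (rightKer (transBlocks A) (w ∘ Prod.swap) ((transEdges I).erase e))

variable {A : Blocks K μ ν} {w : Fin μ × Fin ν → K} {I : Finset (Fin μ × Fin ν)}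
  {sgn : Fin μ × Fin ν → Bool}

theorem IsCritical.transpose (h : IsCritical A w I sgn) :
    IsCritical (transBlocks A) (w ∘ Prod.swap) (transEdges I) (sgn ∘ Prod.swap) where
  block e he := by
    rw [mem_transEdges] at he
    simpa [transBlocks] using h.block _ he
  weight e he := by
    rw [mem_transEdges] at he
    exact h.weight _ he
  proper := h.proper.transpose
  right := h.left
  left := by
    rw [transEdges_transEdges]
    exact h.right

theorem rowEq_erase {y : Fin ν → Fin 2 → K} {f : Fin μ × Fin ν}
    (hy : (A f.1 f.2).mulVec (y f.2) = 0) (α : Fin μ) :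
    rowEq A w (I.erase f) y α = rowEq A w I y α := by
  unfold rowEq
  refine Finset.sum_subset (Finset.filter_subset_filter _ (Finset.erase_subset _ _)) ?_
  intro e he he'
  have : e = f := by
    by_contra hne
    simp_all
  rw [this, hy, smul_zero]

theorem IsCritical.exists_mulVec_ne_zero (h : IsCritical A w I sgn) {f : Fin μ × Fin ν}
    (hf : f ∈ I) : ∃ y ∈ rightKer A w (I.erase f), (A f.1 f.2).mulVec (y f.2) ≠ 0 := by
  by_contra! hc
  refine (h.right f hf).not_ge (Submodule.finrank_mono fun y hy α => ?_)
  rw [← rowEq_erase (hc y hy)]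
  exact hy α

theorem rowEq_of_unique {J : Finset (Fin μ × Fin ν)} {e : Fin μ × Fin ν} (he : e ∈ J)
    (hJ : ∀ g ∈ J, g.1 = e.1 → g = e) (y : Fin ν → Fin 2 → K) :
    rowEq A w J y e.1 = w e • (A e.1 e.2).mulVec (y e.2) := by
  have : J.filter (fun g => g.1 = e.1) = {e} := by
    ext g
    simp only [Finset.mem_filter, Finset.mem_singleton]
    exact ⟨fun hg => hJ g hg.1 hg.2, by rintro rfl; exact ⟨he, rfl⟩⟩
  rw [rowEq, this, Finset.sum_singleton]

theorem rowEq_of_pair {J : Finset (Fin μ × Fin ν)} {e f : Fin μ × Fin ν} (he : e ∈ J) (hf : f ∈ J)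
    (hfe : f ≠ e) (h1 : f.1 = e.1) (hJ : ∀ g ∈ J, g.1 = e.1 → g = e ∨ g = f)
    (y : Fin ν → Fin 2 → K) :
    rowEq A w J y e.1 =
      w e • (A e.1 e.2).mulVec (y e.2) + w f • (A f.1 f.2).mulVec (y f.2) := by
  have : J.filter (fun g => g.1 = e.1) = {e, f} := by
    ext g
    simp only [Finset.mem_filter, Finset.mem_singleton, Finset.mem_insert]
    refine ⟨fun hg => hJ g hg.1 hg.2, ?_⟩
    rintro (rfl | rfl)
    exacts [⟨he, rfl⟩, ⟨hf, h1⟩]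
  rw [rowEq, this, Finset.sum_pair hfe.symm]

theorem eq_zero_of_mulVec_eq_zero {B : Matrix (Fin 2) (Fin 2) K} (hB : B.det ≠ 0)
    {y : Fin 2 → K} (h : B.mulVec y = 0) : y = 0 := by
  have : y ∈ kerR B := h
  rwa [kerR_eq_bot hB] at this

/-- A rank-2 edge that is alone at its row node is alone at its column node. -/
theorem IsCritical.unique_col (h : IsCritical A w I sgn) {e : Fin μ × Fin ν} (he : e ∈ I)
    (hd : (A e.1 e.2).det ≠ 0) (hu : ∀ g ∈ I, g.1 = e.1 → g = e) :
    ∀ g ∈ I, g.2 = e.2 → g = e := by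
  intro f hf hfe
  by_contra hne
  obtain ⟨y, hy, hy0⟩ := h.exists_mulVec_ne_zero hf
  apply hy0
  have h1 := hy e.1
  rw [rowEq_of_unique (Finset.mem_erase.2 ⟨fun h => hne h.symm, he⟩)
    (fun g hg => hu g (Finset.mem_of_mem_erase hg)), smul_eq_zero_iff_right (h.weight e he)] at h1
  rw [hfe, eq_zero_of_mulVec_eq_zero hd h1, Matrix.mulVec_zero]

theorem IsCritical.unique_row (h : IsCritical A w I sgn) {e : Fin μ × Fin ν} (he : e ∈ I)
    (hd : (A e.1 e.2).det ≠ 0) (hu : ∀ g ∈ I, g.2 = e.2 → g = e) :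
    ∀ g ∈ I, g.1 = e.1 → g = e := by
  intro g hg hge
  have := h.transpose.unique_col (e := e.swap) (by simpa [mem_transEdges])
    (by simpa [transBlocks] using hd) (fun g' hg' h' => by
      rw [mem_transEdges] at hg'
      rw [← hu _ hg' h', Prod.swap_swap]) g.swap (by simpa [mem_transEdges]) hge
  exact Prod.swap_injective this

/-- The lines at the two ends of the edges of `I` that are forced by rank-1 edges. Side `true` is
the row end. A rank-1 edge carries its kernels; otherwise the line at an end of an edge is
orthogonal to the line at the other end that is carried by the other edge there. The first argument
records whether the originating kernel is a left kernel. -/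
inductive DartLabel (A : Blocks K μ ν) (I : Finset (Fin μ × Fin ν)) :
    Bool → Bool → Fin μ × Fin ν → (Fin 2 → K) → Prop
  | baseRow {e} (he : e ∈ I) (hd : (A e.1 e.2).det = 0) :
      DartLabel A I true true e (leftKerVec (A e.1 e.2))
  | baseCol {e} (he : e ∈ I) (hd : (A e.1 e.2).det = 0) :
      DartLabel A I false false e (rightKerVec (A e.1 e.2))
  | rowStep {b e f x} (h : DartLabel A I b true e x) (hf : f ∈ I) (hfe : f ≠ e) (h1 : f.1 = e.1)
      (hd : (A f.1 f.2).det ≠ 0) : DartLabel A I b false f (rowPerp (A f.1 f.2) x)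
  | colStep {b e f x} (h : DartLabel A I b false e x) (hf : f ∈ I) (hfe : f ≠ e) (h1 : f.2 = e.2)
      (hd : (A f.1 f.2).det ≠ 0) : DartLabel A I b true f (colPerp (A f.1 f.2) x)

theorem DartLabel.mem {b s : Bool} {e : Fin μ × Fin ν} {x : Fin 2 → K}
    (h : DartLabel A I b s e x) : e ∈ I := by
  cases h <;> assumption

theorem DartLabel.ne_zero {b s : Bool} {e : Fin μ × Fin ν} {x : Fin 2 → K}
    (h : DartLabel A I b s e x) (hA : ∀ e ∈ I, A e.1 e.2 ≠ 0) : x ≠ 0 := by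
  induction h with
  | baseRow he _ => exact leftKerVec_ne_zero (hA _ he)
  | baseCol he _ => exact rightKerVec_ne_zero (hA _ he)
  | rowStep _ _ _ _ hd ih => exact rowPerp_ne_zero hd ih
  | colStep _ _ _ _ hd ih => exact colPerp_ne_zero hd ih

theorem DartLabel.transpose {b s : Bool} {e : Fin μ × Fin ν} {x : Fin 2 → K}
    (h : DartLabel A I b s e x) :
    DartLabel (transBlocks A) (transEdges I) (!b) (!s) e.swap x := by
  induction h with
  | @baseRow e he hd =>
    exact DartLabel.baseCol (A := transBlocks A) (e := e.swap) (by simpa [mem_transEdges])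
      (by simpa [transBlocks] using hd)
  | @baseCol e he hd =>
    exact DartLabel.baseRow (A := transBlocks A) (e := e.swap) (by simpa [mem_transEdges])
      (by simpa [transBlocks] using hd)
  | @rowStep b e f x _ hf hfe h1 hd ih =>
    exact DartLabel.colStep (A := transBlocks A) (f := f.swap) ih (by simpa [mem_transEdges])
      (fun h => hfe (Prod.swap_injective h)) h1 (by simpa [transBlocks] using hd)
  | @colStep b e f x _ hf hfe h1 hd ih =>
    exact DartLabel.rowStep (A := transBlocks A) (f := f.swap) ih (by simpa [mem_transEdges])
      (fun h => hfe (Prod.swap_injective h)) h1 (by simpa [transBlocks] using hd)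

theorem leftKerVec_dot {B : Matrix (Fin 2) (Fin 2) K} (hB : B ≠ 0) (hd : B.det = 0)
    (y : Fin 2 → K) : leftKerVec B ⬝ᵥ B.mulVec y = 0 := by
  have : leftKerVec B ∈ kerL B := by
    rw [kerL_eq_span hB hd]
    exact Submodule.mem_span_singleton_self _
  rw [mem_kerL] at this
  rw [bilin_apply]
  linear_combination y 0 * this.1 + y 1 * this.2

/-- Equations that a kernel vector inherits along a chain of forced lines starting at a left kernel:
the component at a column node lies on the forced line, and the term of an edge at a row node is
orthogonal to the forced line. -/
theorem DartLabel.propagate (hA : ∀ e ∈ I, A e.1 e.2 ≠ 0) (hs : IsProperSign I sgn)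
    {y : Fin ν → Fin 2 → K} {c : Bool}
    (hstep : ∀ g₀ ∈ I, ∀ g ∈ I, g ≠ g₀ → g.1 = g₀.1 → (A g.1 g.2).det ≠ 0 → sgn g₀ = c →
      ∀ l : Fin 2 → K, l ⬝ᵥ (A g₀.1 g₀.2).mulVec (y g₀.2) = 0 →
        l ⬝ᵥ (A g.1 g.2).mulVec (y g.2) = 0)
    {b s : Bool} {e : Fin μ × Fin ν} {x : Fin 2 → K} (h : DartLabel A I b s e x) (hb : b = true) :
    (s = true → sgn e = c → x ⬝ᵥ (A e.1 e.2).mulVec (y e.2) = 0) ∧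
      (s = false → sgn e = !c → cross x (y e.2) = 0) := by
  induction h with
  | baseRow he hd => exact ⟨fun _ _ => leftKerVec_dot (hA _ he) hd _, by simp⟩
  | baseCol => simp at hb
  | @rowStep b e f x h hf hfe h1 hd ih =>
    refine ⟨by simp, fun _ hc => ?_⟩
    have hne := hs f hf e h.mem hfe (Or.inl h1)
    have hce : sgn e = c := by
      revert hne hc
      cases sgn e <;> cases sgn f <;> cases c <;> simp
    rw [cross_rowPerp]
    exact hstep e h.mem f hf hfe h1 hd hce x ((ih hb).1 rfl hce)
  | @colStep b e f x h hf hfe h1 hd ih =>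
    refine ⟨fun _ hc => ?_, by simp⟩
    have hne := hs f hf e h.mem hfe (Or.inr h1)
    have hce : sgn e = !c := by
      revert hne hc
      cases sgn e <;> cases sgn f <;> cases c <;> simp
    have := (ih hb).2 rfl hce
    rw [h1, bilin_apply]
    rw [← h1] at this ⊢
    simp only [colPerp, rowPerp, cross, Matrix.transpose_apply, Matrix.cons_val_zero,
      Matrix.cons_val_one] at this ⊢
    linear_combination (A f.1 f.2 0 1 * A f.1 f.2 1 0 - A f.1 f.2 0 0 * A f.1 f.2 1 1) * this

end Critical

/-! ### The two lines at a node are distinct -/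

section Critical

variable {K : Type*} [Field K] {μ ν : ℕ}
variable {A : Blocks K μ ν} {w : Fin μ × Fin ν → K} {I : Finset (Fin μ × Fin ν)}
  {sgn : Fin μ × Fin ν → Bool}

theorem exists_smul_of_cross {x y : Fin 2 → K} (hx : x ≠ 0) (h : cross x y = 0) :
    ∃ c : K, c • x = y :=
  Submodule.mem_span_singleton.1 ((mem_span_vec_iff hx).2 h)

theorem eq_zero_of_dot_eq_zero {l m u : Fin 2 → K} (hlm : cross l m ≠ 0) (hl : l ⬝ᵥ u = 0)
    (hm : m ⬝ᵥ u = 0) : u = 0 := by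
  simp only [dotProduct, Fin.sum_univ_two] at hl hm
  unfold cross at hlm
  funext i
  refine (mul_eq_zero.1 (?_ : (l 0 * m 1 - l 1 * m 0) * u i = 0)).resolve_left hlm
  fin_cases i
  · simp only [Fin.zero_eta]
    linear_combination m 1 * hl - l 1 * hm
  · simp only [Fin.mk_one]
    linear_combination l 0 * hm - m 0 * hl

/-- At a row node, a rank-1 edge and a line that stems from a left kernel: if the line were the left
kernel of the edge, then one equation of this node would be redundant, and the other equation cannot
make both of its edges indispensable. -/
theorem IsCritical.cross_ne_zero_of_left (h : IsCritical A w I sgn) {e f : Fin μ × Fin ν}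
    {x : Fin 2 → K} (he : e ∈ I) (hd : (A e.1 e.2).det = 0) (hfe : f ≠ e) (h1 : f.1 = e.1)
    (hx : DartLabel A I true true f x) : cross (leftKerVec (A e.1 e.2)) x ≠ 0 := by
  intro hc
  have hf := hx.mem
  have hl0 := leftKerVec_ne_zero (h.block e he)
  set l := leftKerVec (A e.1 e.2) with hl
  have hle : ∀ y : Fin 2 → K, l ⬝ᵥ (A e.1 e.2).mulVec y = 0 :=
    leftKerVec_dot (h.block e he) hd
  have hpair : ∀ g₀ ∈ I, ∀ g ∈ I, g ≠ g₀ → g.1 = g₀.1 → ∀ y, rowEq A w I y g₀.1 =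
      w g₀ • (A g₀.1 g₀.2).mulVec (y g₀.2) + w g • (A g.1 g.2).mulVec (y g.2) :=
    fun g₀ h₀ g hg hne hr y => rowEq_of_pair h₀ hg hne hr
      (fun g' hg' h' => h.proper.eq_or_eq h₀ hg hg' hne hr h') y
  have hlf : ∀ y : Fin ν → Fin 2 → K, (∀ α, α ≠ e.1 → rowEq A w I y α = 0) →
      l ⬝ᵥ (A f.1 f.2).mulVec (y f.2) = 0 := by
    intro y hy
    have := (hx.propagate (y := y) (c := sgn f) h.block h.proper ?_ rfl).1 rfl rfl
    · rw [cross_comm, neg_eq_zero] at hc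
      obtain ⟨c, hc⟩ := exists_smul_of_cross (hx.ne_zero h.block) hc
      rw [← hc, smul_dotProduct, this, smul_zero]
    · intro g₀ h₀ g hg hne hr hgd hs l' hl'
      by_cases hα : g₀.1 = e.1
      · exfalso
        rcases h.proper.eq_or_eq he hf h₀ hfe h1 hα with rfl | rfl
        · exact h.proper _ h₀ f hf hfe.symm (Or.inl h1.symm) hs
        · rcases h.proper.eq_or_eq he hf hg hfe h1 (hr.trans hα) with rfl | rfl
          · exact hgd hd
          · exact hne rfl
      · have h2 := hy g₀.1 hα
        rw [hpair g₀ h₀ g hg hne hr] at h2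
        have h3 := congrArg (l' ⬝ᵥ ·) h2
        simp only [dotProduct_add, dotProduct_smul, hl', smul_zero, zero_add, dotProduct_zero] at h3
        exact (smul_eq_zero_iff_right (h.weight g hg)).1 h3
  obtain ⟨y₂, hy₂, hy₂0⟩ := h.exists_mulVec_ne_zero hf
  set m := complVec l with hm
  have hlm : cross l m ≠ 0 := cross_complVec hl0
  have hoff : ∀ g ∈ I, g.1 = e.1 → ∀ y ∈ rightKer A w (I.erase g), ∀ α, α ≠ e.1 →
      rowEq A w I y α = 0 := by
    intro g hg hge y hy α hα
    rw [← hy α]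
    unfold rowEq
    congr 1
    ext g'
    simp only [Finset.mem_filter, Finset.mem_erase]
    refine ⟨fun h' => ⟨⟨?_, h'.1⟩, h'.2⟩, fun h' => ⟨h'.1.2, h'.2⟩⟩
    rintro rfl
    exact hα (h'.2.symm.trans hge)
  have hfy₂ : m ⬝ᵥ (A f.1 f.2).mulVec (y₂ f.2) ≠ 0 := fun h0 =>
    hy₂0 (eq_zero_of_dot_eq_zero hlm (hlf y₂ (hoff f hf h1 y₂ hy₂)) h0)
  have hother : ∀ g ∈ I, ∀ g' ∈ I, g ≠ g' → g.1 = e.1 → g'.1 = e.1 →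
      ∀ y ∈ rightKer A w (I.erase g), (A g'.1 g'.2).mulVec (y g'.2) = 0 := by
    intro g hg g' hg' hne hge hge' y hy
    have h2 := hy g'.1
    rw [rowEq_of_unique (Finset.mem_erase.2 ⟨hne.symm, hg'⟩) (fun k hk hk' => by
      rcases h.proper.eq_or_eq hg' hg (Finset.mem_of_mem_erase hk) hne (hge.trans hge'.symm) hk'
        with h' | h'
      · exact h'
      · exact absurd h' (Finset.ne_of_mem_erase hk))] at h2
    exact (smul_eq_zero_iff_right (h.weight g' hg')).1 h2
  have hey₂ := hother f hf e he hfe h1 rfl y₂ hy₂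
  -- subtracting a multiple of `y₂` maps the kernel without `e` injectively into the full kernel
  let φ : (Fin ν → Fin 2 → K) →ₗ[K] K :=
    { toFun := fun y => w e * (m ⬝ᵥ (A e.1 e.2).mulVec (y e.2)) /
        (w f * (m ⬝ᵥ (A f.1 f.2).mulVec (y₂ f.2)))
      map_add' := by
        intro y z
        simp only [Pi.add_apply, Matrix.mulVec_add, dotProduct_add]
        ring
      map_smul' := by
        intro c y
        simp only [Pi.smul_apply, Matrix.mulVec_smul, dotProduct_smul, smul_eq_mul, RingHom.id_apply]
        ring }
  let T : (Fin ν → Fin 2 → K) →ₗ[K] (Fin ν → Fin 2 → K) := LinearMap.id - φ.smulRight y₂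
  have hT : ∀ y, T y = y - φ y • y₂ := fun y => rfl
  have hmaps : ∀ y ∈ rightKer A w (I.erase e), T y ∈ rightKer A w I := by
    intro y hy α
    by_cases hα : α = e.1
    · subst hα
      have hfy := hother e he f hf hfe.symm rfl h1 y hy
      rw [hpair e he f hf hfe h1, hT]
      simp only [Pi.sub_apply, Pi.smul_apply, Matrix.mulVec_sub, Matrix.mulVec_smul, hey₂, hfy]
      apply eq_zero_of_dot_eq_zero hlm
      · simp only [smul_zero, sub_zero, zero_sub, dotProduct_add, dotProduct_smul, dotProduct_neg,
          smul_neg, hle, hlf y₂ (hoff f hf h1 y₂ hy₂), neg_zero, add_zero]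
      · have hwf := h.weight f hf
        simp only [smul_zero, sub_zero, zero_sub, dotProduct_add, dotProduct_smul, dotProduct_neg,
          smul_eq_mul, smul_neg, φ, LinearMap.coe_mk, AddHom.coe_mk]
        field_simp
        ring
    · have a1 := hoff e he rfl y hy α hα
      have a2 := hoff f hf h1 y₂ hy₂ α hα
      rw [hT]
      simp only [rowEq, Pi.sub_apply, Pi.smul_apply, Matrix.mulVec_sub, Matrix.mulVec_smul,
        smul_sub, Finset.sum_sub_distrib] at a1 a2 ⊢
      rw [a1, zero_sub, neg_eq_zero]
      simp only [smul_comm (w _) (φ y)]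
      rw [← Finset.smul_sum, a2, smul_zero]
  refine (h.right e he).not_ge ?_
  refine LinearMap.finrank_le_finrank_of_injective (f := T.restrict hmaps) ?_
  rw [injective_iff_map_eq_zero]
  rintro ⟨y, hy⟩ h0
  have h0' : y - φ y • y₂ = 0 := congrArg Subtype.val h0
  have hfy := hother e he f hf hfe.symm rfl h1 y hy
  rw [sub_eq_zero] at h0'
  have h3 := congrArg (fun z : Fin ν → Fin 2 → K => m ⬝ᵥ (A f.1 f.2).mulVec (z f.2)) h0'
  simp only [hfy, dotProduct_zero, Pi.smul_apply, Matrix.mulVec_smul, dotProduct_smul,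
    smul_eq_mul] at h3
  have h4 : φ y = 0 := (mul_eq_zero.1 h3.symm).resolve_right hfy₂
  apply Subtype.ext
  change y = 0
  rw [h0', h4, zero_smul]

/-- At a row node, a rank-1 edge and a line that stems from a right kernel: if the line were the
left kernel of the edge, then the edge would not occur in the equations for the left kernel. -/
theorem IsCritical.cross_ne_zero_of_right (h : IsCritical A w I sgn) {e f : Fin μ × Fin ν}
    {x : Fin 2 → K} (he : e ∈ I) (hd : (A e.1 e.2).det = 0) (h1 : f.1 = e.1)
    (hx : DartLabel A I false true f x) : cross (leftKerVec (A e.1 e.2)) x ≠ 0 := by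
  intro hc
  have hT := h.transpose
  have he' : e.swap ∈ transEdges I := by simpa [mem_transEdges]
  obtain ⟨z, hz, hz0⟩ := hT.exists_mulVec_ne_zero he'
  have hzx : cross x (z e.1) = 0 := by
    have := (hx.transpose.propagate (y := z) (c := !sgn f) hT.block hT.proper ?_ rfl).2 rfl
      (by simp)
    · rwa [Prod.snd_swap, h1] at this
    · intro g₀ h₀ g hg hne hr hgd _ l hl
      have hge : g ≠ e.swap := by
        rintro rfl
        exact hgd (by simpa [transBlocks] using hd)
      have h2 := congrArg (l ⬝ᵥ ·) (hz g₀.1)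
      simp only [dotProduct_zero] at h2
      have hge' := Finset.mem_erase.2 ⟨hge, hg⟩
      refine (smul_eq_zero_iff_right (hT.weight g hg)).1 ?_
      by_cases hg₀ : g₀ = e.swap
      · rw [← hr, rowEq_of_unique hge' (fun k hk hk' => by
          rcases hT.proper.eq_or_eq h₀ hg (Finset.mem_of_mem_erase hk) hne hr (hk'.trans hr)
            with h' | h'
          · exact absurd (h'.trans hg₀) (Finset.ne_of_mem_erase hk)
          · exact h')] at h2
        rwa [dotProduct_smul] at h2
      · rw [rowEq_of_pair (Finset.mem_erase.2 ⟨hg₀, h₀⟩) hge' hne hr (fun k hk hk' =>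
          hT.proper.eq_or_eq h₀ hg (Finset.mem_of_mem_erase hk) hne hr hk')] at h2
        simpa only [dotProduct_add, dotProduct_smul, hl, smul_zero, zero_add] using h2
  rw [cross_comm, neg_eq_zero] at hc
  obtain ⟨c, hc⟩ := exists_smul_of_cross (hx.ne_zero h.block) hc
  obtain ⟨d, hd'⟩ := exists_smul_of_cross (hx.ne_zero h.block) hzx
  have hc0 : c ≠ 0 := by
    rintro rfl
    exact leftKerVec_ne_zero (h.block e he) (by rw [← hc, zero_smul])
  apply hz0
  have hker : z e.1 ∈ kerL (A e.1 e.2) := by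
    rw [kerL_eq_span (h.block e he) hd, Submodule.mem_span_singleton]
    exact ⟨d * c⁻¹, by rw [← hd', ← hc, smul_smul, mul_assoc, inv_mul_cancel₀ hc0, mul_one]⟩
  have : z e.1 ∈ kerR (transBlocks A e.2 e.1) := by
    rw [kerR_eq]
    exact hker
  exact this

/-- The two lines at a node of degree two are distinct. -/
theorem IsCritical.cross_ne_zero {b s : Bool} {e : Fin μ × Fin ν} {x : Fin 2 → K}
    (hx : DartLabel A I b s e x) (h : IsCritical A w I sgn) {b' : Bool} {f : Fin μ × Fin ν}
    {y : Fin 2 → K} (hy : DartLabel A I b' s f y) (hfe : f ≠ e)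
    (hnode : if s then f.1 = e.1 else f.2 = e.2) : cross x y ≠ 0 := by
  induction hx generalizing b' f y with
  | baseRow he hd =>
    cases b'
    · exact h.cross_ne_zero_of_right he hd hnode hy
    · exact h.cross_ne_zero_of_left he hd hfe hnode hy
  | @baseCol e he hd =>
    have he' : e.swap ∈ transEdges I := by simpa [mem_transEdges]
    have hd' : (transBlocks A e.swap.1 e.swap.2).det = 0 := by simpa [transBlocks] using hd
    have hfe' : f.swap ≠ e.swap := fun h => hfe (Prod.swap_injective h)
    have hy' := hy.transpose
    cases b'
    · exact h.transpose.cross_ne_zero_of_left he' hd' hfe' hnode hy'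
    · exact h.transpose.cross_ne_zero_of_right (f := f.swap) he' hd' hnode hy'
  | @rowStep b e₀ e x₀ hx₀ he hne h1 hd ih =>
    have := ih (hy.colStep he hfe.symm hnode.symm hd) hne h1
    rw [cross_rowPerp]
    rw [cross_colPerp] at this
    exact neg_ne_zero.1 this
  | @colStep b e₀ e x₀ hx₀ he hne h1 hd ih =>
    have := ih (hy.rowStep he hfe.symm hnode.symm hd) hne h1
    rw [cross_comm, neg_ne_zero, cross_rowPerp] at this
    rw [cross_comm, neg_ne_zero, cross_colPerp, neg_ne_zero]
    exact this

/-- The lines at the ends of the edges are unique. -/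
theorem DartLabel.unique (hs : IsProperSign I sgn) {b s : Bool} {e : Fin μ × Fin ν}
    {x : Fin 2 → K} (hx : DartLabel A I b s e x) {b' : Bool} {y : Fin 2 → K}
    (hy : DartLabel A I b' s e y) : x = y := by
  induction hx generalizing b' y with
  | baseRow he hd =>
    cases hy with
    | baseRow => rfl
    | colStep _ _ _ _ hd' => exact absurd hd hd'
  | baseCol he hd =>
    cases hy with
    | baseCol => rfl
    | rowStep _ _ _ _ hd' => exact absurd hd hd'
  | rowStep h hf hfe h1 hd ih =>
    cases hy with
    | baseCol _ hd' => exact absurd hd' hd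
    | rowStep h' _ hfe' h1' _ =>
      rcases hs.eq_or_eq hf h.mem h'.mem hfe.symm h1.symm h1'.symm with h2 | h2
      · exact absurd h2.symm hfe'
      · subst h2
        rw [ih h']
  | colStep h hf hfe h1 hd ih =>
    cases hy with
    | baseRow _ hd' => exact absurd hd' hd
    | colStep h' _ hfe' h1' _ =>
      rcases hs.eq_or_eq' hf h.mem h'.mem hfe.symm h1.symm h1'.symm with h2 | h2
      · exact absurd h2.symm hfe'
      · subst h2
        rw [ih h']

end Critical

/-! ### Edges that are not isolated have lines at both ends -/

section Critical

variable {K : Type*} [Field K] {μ ν : ℕ}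
variable {A : Blocks K μ ν} {w : Fin μ × Fin ν → K} {I : Finset (Fin μ × Fin ν)}
  {sgn : Fin μ × Fin ν → Bool}

/-- The edge has no neighbour in `I`. -/
def IsAlone (I : Finset (Fin μ × Fin ν)) (e : Fin μ × Fin ν) : Prop :=
  (∀ g ∈ I, g.1 = e.1 → g = e) ∧ (∀ g ∈ I, g.2 = e.2 → g = e)

theorem IsAlone.transpose {e : Fin μ × Fin ν} (h : IsAlone I e) :
    IsAlone (transEdges I) e.swap := by
  refine ⟨fun g hg hge => ?_, fun g hg hge => ?_⟩ <;> rw [mem_transEdges] at hg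
  · rw [← h.2 _ hg hge, Prod.swap_swap]
  · rw [← h.1 _ hg hge, Prod.swap_swap]

/-- An edge whose row line is not forced by any rank-1 edge would lie on a cycle of rank-2 edges;
the equations of that cycle, with one edge removed, still have only the zero solution. -/
theorem IsCritical.exists_dartLabel_row (h : IsCritical A w I sgn) {e₀ : Fin μ × Fin ν}
    (he₀ : e₀ ∈ I) (ha₀ : (A e₀.1 e₀.2).det = 0 ∨ ¬ IsAlone I e₀) :
    ∃ b x, DartLabel A I b true e₀ x := by
  by_contra! hc₀
  have ha₀' : ¬ IsAlone I e₀ := ha₀.resolve_left fun hd => hc₀ _ _ (DartLabel.baseRow he₀ hd)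
  let J := {e : Fin μ × Fin ν // e ∈ I ∧ ¬ IsAlone I e ∧ sgn e = sgn e₀ ∧
    ∀ b x, ¬ DartLabel A I b true e x}
  have hnext : ∀ e : J, ∃ (f : Fin μ × Fin ν) (k : J), f ∈ I ∧ f ≠ e.1 ∧ f.2 = e.1.2 ∧
      k.1 ≠ f ∧ k.1.1 = f.1 ∧ (A k.1.1 k.1.2).det ≠ 0 ∧ sgn f ≠ sgn e₀ := by
    rintro ⟨e, he, ha, hse, hc⟩
    have hd : (A e.1 e.2).det ≠ 0 := fun hd => hc _ _ (DartLabel.baseRow he hd)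
    have hf : ∃ f ∈ I, f.2 = e.2 ∧ f ≠ e := by
      by_contra! hf
      exact ha ⟨h.unique_row he hd hf, hf⟩
    obtain ⟨f, hf, hfe, hne⟩ := hf
    have hcf : ∀ b x, ¬ DartLabel A I b false f x := fun b x hx =>
      hc _ _ (hx.colStep he hne.symm hfe.symm hd)
    have hdf : (A f.1 f.2).det ≠ 0 := fun hd => hcf _ _ (DartLabel.baseCol hf hd)
    have hk : ∃ k ∈ I, k.1 = f.1 ∧ k ≠ f := by
      by_contra! hk
      exact hne.symm (h.unique_col hf hdf hk e he hfe.symm)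
    obtain ⟨k, hk, hkf, hnk⟩ := hk
    have hck : ∀ b x, ¬ DartLabel A I b true k x := fun b x hx =>
      hcf _ _ (hx.rowStep hf hnk.symm hkf.symm hdf)
    have s1 := h.proper f hf e he hne (Or.inr hfe)
    have s2 := h.proper k hk f hf hnk (Or.inl hkf)
    have s3 : sgn k = sgn e₀ := by
      rw [← hse]
      revert s1 s2
      cases sgn e <;> cases sgn f <;> cases sgn k <;> simp
    exact ⟨f, ⟨k, hk, fun hal => hnk (hal.1 f hf hkf.symm).symm, s3, hck⟩, hf, hne, hfe, hnk, hkf,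
      fun hd => hck _ _ (DartLabel.baseRow hk hd), hse ▸ s1⟩
  choose f g hf hfe hfe2 hgf hgf1 hdet hsf using hnext
  have hinj : Function.Injective g := by
    intro e e' hee
    have h1 : f e' = f e := by
      rcases h.proper.eq_or_eq (g e).2.1 (hf e) (hf e') (hgf e).symm (hgf1 e).symm
        (by rw [← hgf1 e', hee]) with h' | h'
      · exact absurd (by rw [h', hee]) (hgf e')
      · exact h'
    rcases h.proper.eq_or_eq' (hf e) e.2.1 e'.2.1 (hfe e).symm (hfe2 e).symm
      (by rw [← hfe2 e', h1]) with h' | h'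
    · exact absurd (h1.trans h'.symm) (hfe e')
    · exact (Subtype.ext h').symm
  let a : J := ⟨e₀, he₀, ha₀', rfl, hc₀⟩
  obtain ⟨y, hy, hy0⟩ := h.exists_mulVec_ne_zero (hf a)
  have hstep : ∀ e : J, f e = f a ∨ y e.1.2 = 0 → y (g e).1.2 = 0 := by
    intro e he
    have hga : (g e).1 ≠ f a := fun h' => hsf a (by rw [← h']; exact (g e).2.2.2.1)
    have hk := Finset.mem_erase.2 ⟨hga, (g e).2.1⟩
    have h1 := hy (g e).1.1
    have hwk := h.weight _ (g e).2.1
    by_cases hfa : f e = f a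
    · rw [rowEq_of_unique hk (fun k hk hk' => by
        rcases h.proper.eq_or_eq (g e).2.1 (hf e) (Finset.mem_of_mem_erase hk) (hgf e).symm
          (hgf1 e).symm hk' with h' | h'
        · exact h'
        · exact absurd (h'.trans hfa) (Finset.ne_of_mem_erase hk)),
        smul_eq_zero_iff_right hwk] at h1
      exact eq_zero_of_mulVec_eq_zero (hdet e) h1
    · rw [rowEq_of_pair hk (Finset.mem_erase.2 ⟨hfa, hf e⟩) (hgf e).symm (hgf1 e).symm
        (fun k hk hk' => h.proper.eq_or_eq (g e).2.1 (hf e) (Finset.mem_of_mem_erase hk)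
          (hgf e).symm (hgf1 e).symm hk'), hfe2 e, he.resolve_left hfa, Matrix.mulVec_zero,
        smul_zero, add_zero, smul_eq_zero_iff_right hwk] at h1
      exact eq_zero_of_mulVec_eq_zero (hdet e) h1
  have hiter : ∀ n, y (g^[n + 1] a).1.2 = 0 := by
    intro n
    induction n with
    | zero => exact hstep a (Or.inl rfl)
    | succ n ih =>
      rw [Function.iterate_succ_apply']
      exact hstep _ (Or.inr ih)
  obtain ⟨n, hn, hper⟩ := hinj.mem_periodicPts a
  obtain ⟨k, rfl⟩ : ∃ k, n = k + 1 := ⟨n - 1, by omega⟩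
  have := hiter k
  rw [hper] at this
  apply hy0
  rw [hfe2 a, this, Matrix.mulVec_zero]

theorem IsCritical.exists_dartLabel_col (h : IsCritical A w I sgn) {e : Fin μ × Fin ν}
    (he : e ∈ I) (ha : (A e.1 e.2).det = 0 ∨ ¬ IsAlone I e) :
    ∃ b x, DartLabel A I b false e x := by
  obtain ⟨b, x, hx⟩ := h.transpose.exists_dartLabel_row (e₀ := e.swap)
    (by simpa [mem_transEdges]) (ha.imp (fun h => by simpa [transBlocks] using h)
      fun h h' => h (by simpa only [transEdges_transEdges, Prod.swap_swap] using h'.transpose))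
  have := hx.transpose
  rw [transEdges_transEdges] at this
  exact ⟨_, _, this⟩

end Critical

/-! ### Forced lines over a larger field -/

section Extension

variable {F K : Type*} [Field F] [Field K] {μ ν : ℕ} {A : Blocks F μ ν}
  {I : Finset (Fin μ × Fin ν)}

/-- The blocks over a larger field. -/
def mapBlocks (φ : F →+* K) (A : Blocks F μ ν) : Blocks K μ ν := fun α β => (A α β).map φ

theorem det_mapBlocks (φ : F →+* K) (α : Fin μ) (β : Fin ν) :
    (mapBlocks φ A α β).det = φ (A α β).det := by
  rw [mapBlocks, RingHom.map_det, RingHom.mapMatrix_apply]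

theorem map_leftKerVec (φ : F →+* K) (B : Matrix (Fin 2) (Fin 2) F) :
    φ ∘ leftKerVec B = leftKerVec (B.map φ) := by
  by_cases h : B 0 0 = 0 ∧ B 1 0 = 0
  · have h' : (B.map φ) 0 0 = 0 ∧ (B.map φ) 1 0 = 0 := by simpa using h
    rw [leftKerVec, leftKerVec, if_pos h, if_pos h']
    funext i
    fin_cases i <;> simp
  · have h' : ¬ ((B.map φ) 0 0 = 0 ∧ (B.map φ) 1 0 = 0) := by simpa using h
    rw [leftKerVec, leftKerVec, if_neg h, if_neg h']
    funext i
    fin_cases i <;> simp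

theorem map_rowPerp (φ : F →+* K) (B : Matrix (Fin 2) (Fin 2) F) (x : Fin 2 → F) :
    φ ∘ rowPerp B x = rowPerp (B.map φ) (φ ∘ x) := by
  funext i
  fin_cases i <;> simp [rowPerp]

theorem DartLabel.map (φ : F →+* K) {b s : Bool} {e : Fin μ × Fin ν} {x : Fin 2 → F}
    (h : DartLabel A I b s e x) : DartLabel (mapBlocks φ A) I b s e (φ ∘ x) := by
  induction h with
  | baseRow he hd =>
    rw [map_leftKerVec]
    exact DartLabel.baseRow (A := mapBlocks φ A) he (by rw [det_mapBlocks, hd, map_zero])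
  | baseCol he hd =>
    rw [rightKerVec, map_leftKerVec]
    exact DartLabel.baseCol (A := mapBlocks φ A) he (by rw [det_mapBlocks, hd, map_zero])
  | rowStep _ hf hfe h1 hd ih =>
    rw [map_rowPerp]
    exact DartLabel.rowStep (A := mapBlocks φ A) ih hf hfe h1
      (by rw [det_mapBlocks]; simpa using hd)
  | colStep _ hf hfe h1 hd ih =>
    rw [colPerp, map_rowPerp]
    exact DartLabel.colStep (A := mapBlocks φ A) ih hf hfe h1
      (by rw [det_mapBlocks]; simpa using hd)

theorem DartLabel.exists_of_map (φ : F →+* K) {b s : Bool} {e : Fin μ × Fin ν} {x : Fin 2 → K}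
    (h : DartLabel (mapBlocks φ A) I b s e x) : ∃ x', DartLabel A I b s e x' := by
  induction h with
  | baseRow he hd => exact ⟨_, DartLabel.baseRow he (by simpa [det_mapBlocks] using hd)⟩
  | baseCol he hd => exact ⟨_, DartLabel.baseCol he (by simpa [det_mapBlocks] using hd)⟩
  | rowStep _ hf hfe h1 hd ih =>
    obtain ⟨x', ih⟩ := ih
    exact ⟨_, ih.rowStep hf hfe h1 (by simpa [det_mapBlocks] using hd)⟩
  | colStep _ hf hfe h1 hd ih =>
    obtain ⟨x', ih⟩ := ih
    exact ⟨_, ih.colStep hf hfe h1 (by simpa [det_mapBlocks] using hd)⟩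

end Extension

/-! ### Proper edge colourings with two colours -/

section Signs

/-- A bipartite multigraph with edge set `S`, whose edge `e` joins `r e` to `c e`, has a proper
2-edge-colouring if no node lies on three edges. Two edges at a common node `c e` are removed and
their other ends are merged. -/
theorem exists_proper_colouring {E R C : Type*} [DecidableEq E] (S : Finset E) (r : E → R)
    (c : E → C) (hr : ∀ e ∈ S, ∀ f ∈ S, ∀ g ∈ S, r e = r f → r e = r g → e = f ∨ e = g ∨ f = g)
    (hc : ∀ e ∈ S, ∀ f ∈ S, ∀ g ∈ S, c e = c f → c e = c g → e = f ∨ e = g ∨ f = g) :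
    ∃ s : E → Bool, ∀ e ∈ S, ∀ f ∈ S, e ≠ f → (r e = r f ∨ c e = c f) → s e ≠ s f := by
  classical
  induction hn : S.card using Nat.strong_induction_on generalizing S r with
  | _ n ih =>
  subst hn
  by_cases h : ∃ e ∈ S, ∃ f ∈ S, e ≠ f ∧ (r e = r f ∨ c e = c f)
  swap
  · exact ⟨fun _ => true, fun e he f hf hne hs => (h ⟨e, he, f, hf, hne, hs⟩).elim⟩
  have h' : (∃ e ∈ S, ∃ f ∈ S, e ≠ f ∧ c e = c f) ∨
      (∃ e ∈ S, ∃ f ∈ S, e ≠ f ∧ r e = r f) ∧ ∀ e ∈ S, ∀ f ∈ S, c e = c f → e = f := by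
    by_cases hcc : ∃ e ∈ S, ∃ f ∈ S, e ≠ f ∧ c e = c f
    · exact Or.inl hcc
    · push Not at hcc
      obtain ⟨e, he, f, hf, hne, hs⟩ := h
      refine Or.inr ⟨⟨e, he, f, hf, hne, hs.resolve_right (hcc e he f hf hne)⟩, ?_⟩
      intro a ha b hb hab
      by_contra hne
      exact hcc a ha b hb hne hab
  have hsub : ∀ e f g, g ∈ (S.erase e).erase f ↔ g ≠ f ∧ g ≠ e ∧ g ∈ S := fun e f g => by
    simp [Finset.mem_erase]
  have hcard : ∀ e ∈ S, ∀ f, ((S.erase e).erase f).card < S.card := fun e he f =>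
    lt_of_le_of_lt (Finset.card_le_card (Finset.erase_subset _ _)) (Finset.card_erase_lt_of_mem he)
  -- extension of a colouring of the other edges by the colours `t` of `e` and `!t` of `f`
  have hext : ∀ e ∈ S, ∀ f ∈ S, e ≠ f → ∀ (s : E → Bool) (t : Bool),
      (∀ a ∈ (S.erase e).erase f, ∀ b ∈ (S.erase e).erase f, a ≠ b → (r a = r b ∨ c a = c b) →
        s a ≠ s b) →
      (∀ g ∈ (S.erase e).erase f, r g = r e → s g ≠ t) →
      (∀ g ∈ (S.erase e).erase f, r g = r f → s g = t) →
      (∀ g ∈ (S.erase e).erase f, c g ≠ c e ∧ c g ≠ c f) →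
      ∃ s : E → Bool, ∀ e ∈ S, ∀ f ∈ S, e ≠ f → (r e = r f ∨ c e = c f) → s e ≠ s f := by
    intro e he f hf hne s t hs h1 h2 h3
    refine ⟨fun g => if g = e then t else if g = f then !t else s g, ?_⟩
    intro a ha b hb hab hs'
    by_cases hae : a = e
    · subst hae
      by_cases hbf : b = f
      · subst hbf
        simp [hne.symm]
      · have hb' := (hsub a f b).2 ⟨hbf, hab.symm, hb⟩
        simp only [if_true, hab.symm, hbf, if_false]
        rcases hs' with hs' | hs'
        · exact (h1 b hb' hs'.symm).symm
        · exact absurd hs'.symm (h3 b hb').1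
    · by_cases hbe : b = e
      · subst hbe
        by_cases haf : a = f
        · subst haf
          simp [hae]
        · have ha' := (hsub b f a).2 ⟨haf, hae, ha⟩
          simp only [if_true, hae, haf, if_false]
          rcases hs' with hs' | hs'
          · exact h1 a ha' hs'
          · exact absurd hs' (h3 a ha').1
      · by_cases haf : a = f
        · subst haf
          have hb' := (hsub e a b).2 ⟨hab.symm, hbe, hb⟩
          simp only [if_true, hae, hbe, hab.symm, if_false]
          rcases hs' with hs' | hs'
          · rw [h2 b hb' hs'.symm]
            simp
          · exact absurd hs'.symm (h3 b hb').2
        · have ha' := (hsub e f a).2 ⟨haf, hae, ha⟩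
          by_cases hbf : b = f
          · subst hbf
            simp only [if_true, hae, hbe, haf, if_false]
            rcases hs' with hs' | hs'
            · rw [h2 a ha' hs']
              simp
            · exact absurd hs' (h3 a ha').2
          · have hb' := (hsub e f b).2 ⟨hbf, hbe, hb⟩
            simp only [hae, haf, hbe, hbf, if_false]
            exact hs a ha' b hb' hab hs'
  rcases h' with ⟨e, he, f, hf, hne, hcef⟩ | ⟨⟨e, he, f, hf, hne, href⟩, hcc⟩
  · have h3 : ∀ g ∈ (S.erase e).erase f, c g ≠ c e ∧ c g ≠ c f := by
      intro g hg
      rw [hsub] at hg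
      have key : c g ≠ c e := fun hge => by
        rcases hc e he f hf g hg.2.2 hcef hge.symm with h | h | h
        exacts [hne h, hg.2.1 h.symm, hg.1 h.symm]
      exact ⟨key, hcef ▸ key⟩
    have hre : ∀ g ∈ (S.erase e).erase f, ∀ g' ∈ (S.erase e).erase f, r g = r e → r g' = r e →
        g = g' := by
      intro g hg g' hg' h1 h2
      rw [hsub] at hg hg'
      rcases hr e he g hg.2.2 g' hg'.2.2 h1.symm h2.symm with h | h | h
      exacts [absurd h.symm hg.2.1, absurd h.symm hg'.2.1, h]
    have hrf : ∀ g ∈ (S.erase e).erase f, ∀ g' ∈ (S.erase e).erase f, r g = r f → r g' = r f →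
        g = g' := by
      intro g hg g' hg' h1 h2
      rw [hsub] at hg hg'
      rcases hr f hf g hg.2.2 g' hg'.2.2 h1.symm h2.symm with h | h | h
      exacts [absurd h.symm hg.1, absurd h.symm hg'.1, h]
    obtain ⟨s, hs⟩ := ih _ (hcard e he f) ((S.erase e).erase f)
      (fun g => if r g = r f then r e else r g) (by
        intro a ha b hb d hd hab had
        have h1 := hre a ha b hb
        have h2 := hre a ha d hd
        have h3 := hre b hb d hd
        have h4 := hrf a ha b hb
        have h5 := hrf a ha d hd
        have h6 := hrf b hb d hd
        have h7 := hr a ((hsub _ _ _).1 ha).2.2 b ((hsub _ _ _).1 hb).2.2 d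
          ((hsub _ _ _).1 hd).2.2
        split_ifs at hab had <;> grind)
      (fun a ha b hb d hd => hc a ((hsub _ _ _).1 ha).2.2 b ((hsub _ _ _).1 hb).2.2 d
        ((hsub _ _ _).1 hd).2.2) rfl
    have hs' : ∀ a ∈ (S.erase e).erase f, ∀ b ∈ (S.erase e).erase f, a ≠ b →
        (r a = r b ∨ c a = c b) → s a ≠ s b := fun a ha b hb hab h =>
      hs a ha b hb hab (h.imp_left fun h => by simp only [h])
    by_cases hg : ∃ g ∈ (S.erase e).erase f, r g = r e
    · obtain ⟨g, hg, hge⟩ := hg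
      refine hext e he f hf hne s (!s g) hs' (fun g' hg' h' => ?_) (fun g' hg' h' => ?_) h3
      · rw [hre g' hg' g hg h' hge]
        cases s g <;> simp
      · have hgg : g' ≠ g := by
          rintro rfl
          rw [hsub] at hg
          rcases hr e he f hf g' hg.2.2 (hge.symm.trans h') hge.symm with h | h | h
          exacts [hne h, hg.2.1 h.symm, hg.1 h.symm]
        have := hs g' hg' g hg hgg (Or.inl (by simp only [h', if_true, hge, ite_self]))
        revert this
        cases s g <;> cases s g' <;> simp
    · push Not at hg
      by_cases hg' : ∃ g ∈ (S.erase e).erase f, r g = r f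
      · obtain ⟨g, hgm, hgf⟩ := hg'
        exact hext e he f hf hne s (s g) hs' (fun g' hg' h' => absurd h' (hg g' hg'))
          (fun g' hg' h' => by rw [hrf g' hg' g hgm h' hgf]) h3
      · push Not at hg'
        exact hext e he f hf hne s true hs' (fun g' h1 h' => absurd h' (hg g' h1))
          (fun g' h1 h' => absurd h' (hg' g' h1)) h3
  · have hro : ∀ g ∈ (S.erase e).erase f, r g ≠ r e := fun g hg hge => by
      rw [hsub] at hg
      rcases hr e he f hf g hg.2.2 href hge.symm with h | h | h
      exacts [hne h, hg.2.1 h.symm, hg.1 h.symm]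
    obtain ⟨s, hs⟩ := ih _ (hcard e he f) ((S.erase e).erase f) r
      (fun a ha b hb d hd => hr a ((hsub _ _ _).1 ha).2.2 b ((hsub _ _ _).1 hb).2.2 d
        ((hsub _ _ _).1 hd).2.2)
      (fun a ha b hb d hd => hc a ((hsub _ _ _).1 ha).2.2 b ((hsub _ _ _).1 hb).2.2 d
        ((hsub _ _ _).1 hd).2.2) rfl
    refine hext e he f hf hne s true hs (fun g hg h => absurd h (hro g hg))
      (fun g hg h => absurd (h.trans href.symm) (hro g hg)) (fun g hg => ?_)
    rw [hsub] at hg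
    exact ⟨fun h => hg.2.1 (hcc g hg.2.2 e he h), fun h => hg.1 (hcc g hg.2.2 f hf h)⟩

end Signs

/-! ### Matchings are critical -/

section MatchingCritical

variable {K : Type*} [Field K] {μ ν : ℕ}

/-- The matrix `A_J`, where the variable `x_e` has the value `w e`. -/
noncomputable def weightedMatrix (A : Blocks K μ ν) (w : Fin μ × Fin ν → K)
    (J : Finset (Fin μ × Fin ν)) : Matrix (Fin μ × Fin 2) (Fin ν × Fin 2) K :=
  fun r c => if (r.1, c.1) ∈ J then w (r.1, c.1) * A r.1 c.1 r.2 c.2 else 0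

theorem weightedMatrix_transpose (A : Blocks K μ ν) (w : Fin μ × Fin ν → K)
    (J : Finset (Fin μ × Fin ν)) :
    weightedMatrix (transBlocks A) (w ∘ Prod.swap) (transEdges J) =
      (weightedMatrix A w J).transpose := by
  ext r c
  simp [weightedMatrix, mem_transEdges, transBlocks]

theorem weightedMatrix_mulVec (A : Blocks K μ ν) (w : Fin μ × Fin ν → K)
    (J : Finset (Fin μ × Fin ν)) (v : Fin ν × Fin 2 → K) (α : Fin μ) (i : Fin 2) :
    (weightedMatrix A w J).mulVec v (α, i) = rowEq A w J (fun β j => v (β, j)) α i := by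
  have h : J.filter (fun e => e.1 = α) =
      (Finset.univ.filter fun β => (α, β) ∈ J).map ⟨Prod.mk α, Prod.mk_right_injective α⟩ := by
    ext ⟨α', β⟩
    simp only [Finset.mem_filter, Finset.mem_map, Finset.mem_univ, true_and,
      Function.Embedding.coeFn_mk, Prod.mk.injEq]
    constructor
    · rintro ⟨h, rfl⟩
      exact ⟨β, h, rfl, rfl⟩
    · rintro ⟨β', h, rfl, rfl⟩
      exact ⟨h, rfl⟩
  rw [rowEq, Finset.sum_apply, h, Finset.sum_map, Finset.sum_filter]
  simp only [Matrix.mulVec, dotProduct, weightedMatrix, Fintype.sum_prod_type, Pi.smul_apply,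
    smul_eq_mul, Function.Embedding.coeFn_mk]
  refine Finset.sum_congr rfl fun β _ => ?_
  split_ifs
  · rw [Finset.mul_sum]
    exact Finset.sum_congr rfl fun j _ => mul_assoc _ _ _
  · simp

theorem rank_add_finrank_rightKer (A : Blocks K μ ν) (w : Fin μ × Fin ν → K)
    (J : Finset (Fin μ × Fin ν)) :
    (weightedMatrix A w J).rank + Module.finrank K (rightKer A w J) = ν * 2 := by
  have h : rightKer A w J = (LinearMap.ker (weightedMatrix A w J).mulVecLin).map
      (LinearEquiv.curry K K (Fin ν) (Fin 2)).toLinearMap := by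
    ext y
    rw [Submodule.mem_map_equiv, LinearMap.mem_ker, mem_rightKer]
    rw [funext_iff]
    simp only [Prod.forall, Matrix.mulVecLin_apply, weightedMatrix_mulVec, funext_iff]
    rfl
  rw [h, LinearEquiv.finrank_map_eq, Matrix.rank, LinearMap.finrank_range_add_finrank_ker]
  simp

theorem finrank_rightKer_lt {A : Blocks K μ ν} {w : Fin μ × Fin ν → K}
    {J J' : Finset (Fin μ × Fin ν)}
    (h : (weightedMatrix A w J').rank < (weightedMatrix A w J).rank) :
    Module.finrank K (rightKer A w J) < Module.finrank K (rightKer A w J') := by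
  have h1 := rank_add_finrank_rightKer A w J
  have h2 := rank_add_finrank_rightKer A w J'
  omega

variable {F : Type*} [Field F] {A : Blocks F μ ν} {I : Finset (Fin μ × Fin ν)}
  {sgn : Fin μ × Fin ν → Bool}

/-- The embedding of the ground field into the field of rational functions. -/
noncomputable def constFun (F : Type*) [Field F] (μ ν : ℕ) : F →+* RatFun F μ ν :=
  (algebraMap (MvPolynomial (Fin μ × Fin ν) F) (RatFun F μ ν)).comp MvPolynomial.C

/-- The variable `x_e` as a rational function. -/
noncomputable def varFun (F : Type*) [Field F] (μ ν : ℕ) (e : Fin μ × Fin ν) : RatFun F μ ν :=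
  algebraMap (MvPolynomial (Fin μ × Fin ν) F) (RatFun F μ ν) (MvPolynomial.X e)

theorem symbolic_eq_weightedMatrix (A : Blocks F μ ν) (J : Finset (Fin μ × Fin ν)) :
    symbolic A J = weightedMatrix (mapBlocks (constFun F μ ν) A) (varFun F μ ν) J := by
  ext r c
  simp only [symbolic, weightedMatrix, mapBlocks, constFun, varFun, Matrix.map_apply, map_mul,
    RingHom.comp_apply, mul_comm]

/-- Over the field of rational functions, with the variables as their own values, a kernel that
stayed the same on the removal of an edge would contradict the drop of the rank. -/
theorem IsMatching.isCritical (h : IsMatching A I) (hs : IsProperSign I sgn) :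
    IsCritical (mapBlocks (constFun F μ ν) A) (varFun F μ ν) I sgn where
  block e he h0 := by
    have := h.1 he
    simp only [edges, Finset.mem_filter, Finset.mem_univ, true_and] at this
    apply this
    ext i j
    have := congrFun (congrFun h0 i) j
    simpa [mapBlocks] using this
  weight e _ := by
    rw [varFun, Ne, map_eq_zero_iff _ (IsFractionRing.injective _ _)]
    exact MvPolynomial.X_ne_zero e
  proper := hs
  right e he := by
    apply finrank_rightKer_lt
    rw [← symbolic_eq_weightedMatrix, ← symbolic_eq_weightedMatrix]
    exact h.2 e he
  left e he := by
    apply finrank_rightKer_lt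
    rw [transEdges_erase, weightedMatrix_transpose, weightedMatrix_transpose,
      Matrix.rank_transpose, Matrix.rank_transpose, ← symbolic_eq_weightedMatrix,
      ← symbolic_eq_weightedMatrix]
    exact h.2 _ (mem_transEdges.1 he)

theorem card_le_two_iff_forall {α : Type*} [DecidableEq α] {S : Finset α} (h : S.card ≤ 2) :
    ∀ a ∈ S, ∀ b ∈ S, ∀ c ∈ S, a = b ∨ a = c ∨ b = c := by
  intro a ha b hb c hc
  by_contra! hne
  have : ({a, b, c} : Finset α).card ≤ S.card := Finset.card_le_card (by
    intro x hx
    simp only [Finset.mem_insert, Finset.mem_singleton] at hx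
    rcases hx with rfl | rfl | rfl <;> assumption)
  rw [Finset.card_eq_three.2 ⟨a, b, c, hne.1, hne.2.1, hne.2.2, rfl⟩] at this
  omega

theorem IsMatching.exists_sign (h : IsMatching A I) : ∃ sgn, IsProperSign I sgn := by
  refine exists_proper_colouring I Prod.fst Prod.snd ?_ ?_
  · intro e he f hf g hg hef heg
    exact card_le_two_iff_forall (h.degRow_le e.1) e (by simp [he]) f (by simp [hf, hef])
      g (by simp [hg, heg])
  · intro e he f hf g hg hef heg
    exact card_le_two_iff_forall (h.degCol_le e.2) e (by simp [he]) f (by simp [hf, hef])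
      g (by simp [hg, heg])

/-- What the algorithm uses of a matching. -/
structure IsWellLabelled (A : Blocks F μ ν) (I : Finset (Fin μ × Fin ν))
    (sgn : Fin μ × Fin ν → Bool) : Prop where
  block : ∀ e ∈ I, A e.1 e.2 ≠ 0
  proper : IsProperSign I sgn
  unique_col : ∀ e ∈ I, (A e.1 e.2).det ≠ 0 → (∀ g ∈ I, g.1 = e.1 → g = e) →
    ∀ g ∈ I, g.2 = e.2 → g = e
  unique_row : ∀ e ∈ I, (A e.1 e.2).det ≠ 0 → (∀ g ∈ I, g.2 = e.2 → g = e) →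
    ∀ g ∈ I, g.1 = e.1 → g = e
  exists_label : ∀ e ∈ I, ((A e.1 e.2).det = 0 ∨ ¬ IsAlone I e) → ∀ s,
    ∃ b x, DartLabel A I b s e x
  cross_ne_zero : ∀ {b s e x}, DartLabel A I b s e x → ∀ {b' f y}, DartLabel A I b' s f y →
    f ≠ e → (if s then f.1 = e.1 else f.2 = e.2) → cross x y ≠ 0

theorem IsMatching.isWellLabelled (h : IsMatching A I) (hs : IsProperSign I sgn) :
    IsWellLabelled A I sgn := by
  have hc := h.isCritical hs
  have hdet : ∀ e : Fin μ × Fin ν, (mapBlocks (constFun F μ ν) A e.1 e.2).det = 0 ↔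
      (A e.1 e.2).det = 0 := fun e => by rw [det_mapBlocks, map_eq_zero]
  refine ⟨fun e he => ?_, hs, fun e he hd => hc.unique_col he (mt (hdet e).1 hd),
    fun e he hd => hc.unique_row he (mt (hdet e).1 hd), fun e he ha s => ?_, ?_⟩
  · have := h.1 he
    simpa [edges] using this
  · rw [← hdet] at ha
    cases s
    · obtain ⟨b, x, hx⟩ := hc.exists_dartLabel_col he ha
      obtain ⟨x', hx'⟩ := hx.exists_of_map
      exact ⟨b, x', hx'⟩
    · obtain ⟨b, x, hx⟩ := hc.exists_dartLabel_row he ha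
      obtain ⟨x', hx'⟩ := hx.exists_of_map
      exact ⟨b, x', hx'⟩
  · intro b s e x hx b' f y hy hfe hn h0
    refine IsCritical.cross_ne_zero (hx.map (constFun F μ ν)) hc (hy.map (constFun F μ ν)) hfe hn ?_
    have := congrArg (constFun F μ ν) h0
    simpa [cross] using this

end MatchingCritical

/-! ### The valid labeling of a matching -/

section MatchingLabeling

variable {F : Type*} [Field F] {μ ν : ℕ} {A : Blocks F μ ν} {I : Finset (Fin μ × Fin ν)}
  {sgn : Fin μ × Fin ν → Bool}

/-- The two unit vectors. -/
def stdVec (F : Type*) [Field F] (s : Bool) : Fin 2 → F := if s then ![1, 0] else ![0, 1]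

theorem cross_stdVec : cross (stdVec F true) (stdVec F false) ≠ 0 := by
  simp [cross, stdVec]

/-- Two independent vectors at a node, one for each sign: the given vectors of the edges at the
node, completed where an edge is missing. -/
theorem exists_node_vectors {E : Type*} (At : E → Prop) (sgn : E → Bool) (v : E → Fin 2 → F)
    (hne : ∀ e, At e → v e ≠ 0) (huniq : ∀ e f, At e → At f → sgn e = sgn f → e = f)
    (hcross : ∀ e f, At e → At f → f ≠ e → cross (v e) (v f) ≠ 0) :
    ∃ p : Bool → Fin 2 → F, cross (p true) (p false) ≠ 0 ∧ (∀ e, At e → p (sgn e) = v e) ∧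
      (∀ e, At e → (∀ f, At f → f = e) → p (!sgn e) = complVec (v e)) ∧
      ((∀ e, ¬ At e) → p = stdVec F) := by
  by_cases h1 : ∃ e, At e ∧ sgn e = true <;> by_cases h2 : ∃ e, At e ∧ sgn e = false
  · obtain ⟨e, he, hse⟩ := h1
    obtain ⟨f, hf, hsf⟩ := h2
    have hfe : f ≠ e := by rintro rfl; simp_all
    refine ⟨fun s => if s then v e else v f, by simpa using hcross e f he hf hfe, ?_, ?_, ?_⟩
    · intro g hg
      cases hs : sgn g
      · simp [huniq g f hg hf (hs.trans hsf.symm)]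
      · simp [huniq g e hg he (hs.trans hse.symm)]
    · intro g hg hu
      exact absurd ((hu f hf).trans (hu e he).symm) hfe
    · intro h
      exact absurd he (h e)
  · obtain ⟨e, he, hse⟩ := h1
    push Not at h2
    have hall : ∀ g, At g → g = e := fun g hg =>
      huniq g e hg he (by rw [hse]; simpa using h2 g hg)
    refine ⟨fun s => if s then v e else complVec (v e), by simpa using cross_complVec (hne e he),
      ?_, ?_, ?_⟩
    · intro g hg
      rw [hall g hg, hse]
      simp
    · intro g hg _
      rw [hall g hg, hse]
      simp
    · intro h
      exact absurd he (h e)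
  · obtain ⟨e, he, hse⟩ := h2
    push Not at h1
    have hall : ∀ g, At g → g = e := fun g hg =>
      huniq g e hg he (by rw [hse]; simpa using h1 g hg)
    refine ⟨fun s => if s then complVec (v e) else v e, ?_, ?_, ?_, ?_⟩
    · have := cross_complVec (hne e he)
      rw [cross_comm, neg_ne_zero] at this
      simpa using this
    · intro g hg
      rw [hall g hg, hse]
      simp
    · intro g hg _
      rw [hall g hg, hse]
      simp
    · intro h
      exact absurd he (h e)
  · push Not at h1 h2
    have hnone : ∀ e, ¬ At e := fun e he => by
      have := h1 e he
      have := h2 e he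
      simp_all
    exact ⟨stdVec F, cross_stdVec, fun e he => absurd he (hnone e),
      fun e he => absurd he (hnone e), fun _ => rfl⟩

theorem DartLabel.not_alone {b s : Bool} {e : Fin μ × Fin ν} {x : Fin 2 → F}
    (h : DartLabel A I b s e x) : (A e.1 e.2).det = 0 ∨ ¬ IsAlone I e := by
  cases h with
  | baseRow _ hd => exact Or.inl hd
  | baseCol _ hd => exact Or.inl hd
  | rowStep h _ hfe h1 _ => exact Or.inr fun ha => hfe (ha.1 _ h.mem h1.symm).symm
  | colStep h _ hfe h1 _ => exact Or.inr fun ha => hfe (ha.2 _ h.mem h1.symm).symm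

theorem DartLabel.inRankOneComponent (hA : ∀ e ∈ I, A e.1 e.2 ≠ 0) {b s : Bool}
    {e : Fin μ × Fin ν} {x : Fin 2 → F} (h : DartLabel A I b s e x) :
    InRankOneComponent A I e.1 := by
  induction h with
  | @baseRow e he hd =>
    exact ⟨e, he, block_rank_eq_one_iff.2 ⟨hA e he, hd⟩, SimpleGraph.Reachable.refl _⟩
  | @baseCol e he hd =>
    exact ⟨e, he, block_rank_eq_one_iff.2 ⟨hA e he, hd⟩, SimpleGraph.Reachable.refl _⟩
  | rowStep _ _ _ h1 _ ih => rwa [h1]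
  | @colStep b e f x h hf _ h1 _ ih =>
    obtain ⟨g, hg, hr, hreach⟩ := ih
    refine ⟨g, hg, hr, SimpleGraph.Reachable.trans ?_ hreach⟩
    have a1 : (subgraphOf I).Adj (.inl f.1) (.inr f.2) := hf
    have a2 : (subgraphOf I).Adj (.inr f.2) (.inl e.1) := by
      rw [h1]
      exact h.mem
    exact a1.reachable.trans a2.reachable

theorem finrank_span_of_cross {x y : Fin 2 → F} (h : cross x y ≠ 0) :
    Module.finrank F (Submodule.span F {x}) = 1 ∧ Module.finrank F (Submodule.span F {y}) = 1 ∧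
      Submodule.span F {x} ≠ Submodule.span F {y} := by
  have hx : x ≠ 0 := by rintro rfl; simp [cross] at h
  have hy : y ≠ 0 := by rintro rfl; simp [cross] at h
  refine ⟨finrank_span_vec hx, finrank_span_vec hy, fun heq => h ?_⟩
  exact (span_eq_span_vec_iff hx hy).1 heq.symm

theorem vanishes_span {B : Matrix (Fin 2) (Fin 2) F} {x y : Fin 2 → F}
    (h : x ⬝ᵥ B.mulVec y = 0) :
    Vanishes B (Submodule.span F {x}) (Submodule.span F {y}) := by
  intro x' hx' y' hy'
  rw [Submodule.mem_span_singleton] at hx' hy'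
  obtain ⟨c, rfl⟩ := hx'
  obtain ⟨d, rfl⟩ := hy'
  rw [Matrix.mulVec_smul, smul_dotProduct, dotProduct_smul, h, smul_zero, smul_zero]

/-- A labeling for `I` with the properties that the search relies on. -/
structure IsSearchLabeling (A : Blocks F μ ν) (I : Finset (Fin μ × Fin ν))
    (L : Labeling F μ ν) : Prop where
  valid : L.IsValid A I
  block : ∀ e ∈ I, A e.1 e.2 ≠ 0
  unique_col : ∀ e ∈ I, (A e.1 e.2).det ≠ 0 → (∀ g ∈ I, g.1 = e.1 → g = e) →
    ∀ g ∈ I, g.2 = e.2 → g = e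
  unique_row : ∀ e ∈ I, (A e.1 e.2).det ≠ 0 → (∀ g ∈ I, g.2 = e.2 → g = e) →
    ∀ g ∈ I, g.1 = e.1 → g = e
  component : ∀ e ∈ I, ((A e.1 e.2).det = 0 ∨ ¬ IsAlone I e) → InRankOneComponent A I e.1

theorem IsWellLabelled.exists_labeling (h : IsWellLabelled A I sgn) :
    ∃ L : Labeling F μ ν, IsSearchLabeling A I L ∧
      (∀ b e x, DartLabel A I b true e x → L.U e.1 (L.sign e) = Submodule.span F {x}) ∧
      (∀ b e x, DartLabel A I b false e x → L.V e.2 (L.sign e) = Submodule.span F {x}) ∧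
      (∀ b e x, DartLabel A I b false e x → (∀ f ∈ I, f.2 = e.2 → f = e) →
        L.V e.2 (!L.sign e) = Submodule.span F {complVec x}) := by
  classical
  have hex : ∀ e s, ∃ x, ∀ b y, DartLabel A I b s e y → y = x := by
    intro e s
    by_cases he : ∃ b x, DartLabel A I b s e x
    · obtain ⟨b, x, hx⟩ := he
      exact ⟨x, fun b' y hy => hy.unique h.proper hx⟩
    · push Not at he
      exact ⟨0, fun b y hy => absurd hy (he b y)⟩
  choose v hv using hex
  let At : Bool → Fin μ × Fin ν → Prop := fun s e => ∃ b x, DartLabel A I b s e x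
  have hAt : ∀ {s e}, At s e → ∃ b, DartLabel A I b s e (v e s) := by
    rintro s e ⟨b, x, hx⟩
    exact ⟨b, hv e s b x hx ▸ hx⟩
  have hrow : ∀ α : Fin μ, ∃ p : Bool → Fin 2 → F, cross (p true) (p false) ≠ 0 ∧
      (∀ e, (At true e ∧ e.1 = α) → p (sgn e) = v e true) ∧
      (∀ e, (At true e ∧ e.1 = α) → (∀ f, (At true f ∧ f.1 = α) → f = e) →
        p (!sgn e) = complVec (v e true)) ∧
      ((∀ e, ¬ (At true e ∧ e.1 = α)) → p = stdVec F) := by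
    intro α
    apply exists_node_vectors
    · rintro e ⟨he, -⟩
      exact (hAt he).choose_spec.ne_zero h.block
    · rintro e f ⟨he, rfl⟩ ⟨hf, hfe⟩ hs
      by_contra hne
      exact h.proper e (hAt he).choose_spec.mem f (hAt hf).choose_spec.mem hne (Or.inl hfe.symm) hs
    · rintro e f ⟨he, rfl⟩ ⟨hf, hfe⟩ hne
      exact h.cross_ne_zero (hAt he).choose_spec (hAt hf).choose_spec hne (by simpa using hfe)
  have hcol : ∀ β : Fin ν, ∃ p : Bool → Fin 2 → F, cross (p true) (p false) ≠ 0 ∧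
      (∀ e, (At false e ∧ e.2 = β) → p (sgn e) = v e false) ∧
      (∀ e, (At false e ∧ e.2 = β) → (∀ f, (At false f ∧ f.2 = β) → f = e) →
        p (!sgn e) = complVec (v e false)) ∧
      ((∀ e, ¬ (At false e ∧ e.2 = β)) → p = stdVec F) := by
    intro β
    apply exists_node_vectors
    · rintro e ⟨he, -⟩
      exact (hAt he).choose_spec.ne_zero h.block
    · rintro e f ⟨he, rfl⟩ ⟨hf, hfe⟩ hs
      by_contra hne
      exact h.proper e (hAt he).choose_spec.mem f (hAt hf).choose_spec.mem hne (Or.inr hfe.symm) hs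
    · rintro e f ⟨he, rfl⟩ ⟨hf, hfe⟩ hne
      exact h.cross_ne_zero (hAt he).choose_spec (hAt hf).choose_spec hne (by simpa using hfe)
  choose p hp1 hp2 hp3 hp4 using hrow
  choose q hq1 hq2 hq3 hq4 using hcol
  -- the column vectors at an isolated rank-2 edge are orthogonal to the unit vectors
  let q' : Fin ν → Bool → Fin 2 → F := fun β s =>
    if hβ : ∃ e ∈ I, e.2 = β ∧ (A e.1 e.2).det ≠ 0 ∧ IsAlone I e then
      rowPerp (A hβ.choose.1 hβ.choose.2) (stdVec F (!s)) else q β s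
  have hiso : ∀ e ∈ I, (A e.1 e.2).det ≠ 0 → IsAlone I e → ∀ s,
      p e.1 s = stdVec F s ∧ q' e.2 s = rowPerp (A e.1 e.2) (stdVec F (!s)) := by
    intro e he hd ha s
    constructor
    · rw [hp4 e.1]
      rintro f ⟨hf, hfe⟩
      obtain ⟨b, hf⟩ := hAt hf
      obtain rfl := ha.1 f hf.mem hfe
      exact hf.not_alone.elim hd fun h => h ha
    · have hβ : ∃ f ∈ I, f.2 = e.2 ∧ (A f.1 f.2).det ≠ 0 ∧ IsAlone I f := ⟨e, he, rfl, hd, ha⟩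
      have : hβ.choose = e := ha.2 _ hβ.choose_spec.1 hβ.choose_spec.2.1
      simp only [q', dif_pos hβ, this]
  have hq' : ∀ e, At false e → ∀ s, q' e.2 s = q e.2 s := by
    intro e he s
    obtain ⟨b, he⟩ := hAt he
    refine dif_neg ?_
    rintro ⟨f, hf, hfe, hd, ha⟩
    obtain rfl := ha.2 e he.mem hfe.symm
    exact he.not_alone.elim hd fun h => h ha
  have hq1' : ∀ β, cross (q' β true) (q' β false) ≠ 0 := by
    intro β
    by_cases hβ : ∃ e ∈ I, e.2 = β ∧ (A e.1 e.2).det ≠ 0 ∧ IsAlone I e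
    · obtain ⟨e, he, rfl, hd, ha⟩ := hβ
      rw [(hiso e he hd ha _).2, (hiso e he hd ha _).2]
      rw [det_eq, ← neg_ne_zero] at hd
      simp only [cross, rowPerp, stdVec, Bool.not_true, Bool.not_false, if_true, Bool.false_eq_true,
        if_false, Matrix.cons_val_zero, Matrix.cons_val_one]
      convert hd using 1
      ring
    · simp only [q', dif_neg hβ]
      exact hq1 β
  have hpU : ∀ b e x, DartLabel A I b true e x → p e.1 (sgn e) = x := fun b e x hx => by
    rw [hp2 e.1 e ⟨⟨b, x, hx⟩, rfl⟩, ← hv e true b x hx]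
  have hqV : ∀ b e x, DartLabel A I b false e x → q' e.2 (sgn e) = x := fun b e x hx => by
    rw [hq' e ⟨b, x, hx⟩, hq2 e.2 e ⟨⟨b, x, hx⟩, rfl⟩, ← hv e false b x hx]
  have hpU' : ∀ b e f x, DartLabel A I b true e x → f ∈ I → e ≠ f → e.1 = f.1 →
      p f.1 (!sgn f) = x := fun b e f x hx hf hne hef => by
    rw [← hef, ← hpU b e x hx]
    congr 1
    have := h.proper e hx.mem f hf hne (Or.inl hef)
    revert this
    cases sgn e <;> cases sgn f <;> simp
  have hqV' : ∀ b e f x, DartLabel A I b false e x → f ∈ I → e ≠ f → e.2 = f.2 →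
      q' f.2 (!sgn f) = x := fun b e f x hx hf hne hef => by
    rw [← hef, ← hqV b e x hx]
    congr 1
    have := h.proper e hx.mem f hf hne (Or.inr hef)
    revert this
    cases sgn e <;> cases sgn f <;> simp
  have hvan : ∀ e ∈ I, ∀ s, p e.1 s ⬝ᵥ (A e.1 e.2).mulVec (q' e.2 (!s)) = 0 := by
    intro e he s
    by_cases hi : (A e.1 e.2).det = 0 ∨ ¬ IsAlone I e
    · by_cases hd : (A e.1 e.2).det = 0
      · by_cases hs : s = sgn e
        · rw [hs, hpU _ _ _ (DartLabel.baseRow he hd)]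
          exact leftKerVec_dot (h.block e he) hd _
        · have hs' : (!s) = sgn e := by
            revert hs
            cases s <;> cases sgn e <;> simp
          rw [hs', hqV _ _ _ (DartLabel.baseCol he hd), ← bilin_transpose]
          exact leftKerVec_dot (by simpa using h.block e he) (by rwa [Matrix.det_transpose]) _
      · have hal := hi.resolve_left hd
        by_cases hs : s = sgn e
        · obtain ⟨f, hf, hfe, hne⟩ : ∃ f ∈ I, f.2 = e.2 ∧ f ≠ e := by
            by_contra! hc
            exact hal ⟨h.unique_row e he hd hc, hc⟩
          obtain ⟨b, x, hx⟩ := h.exists_label f hf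
            (Or.inr fun ha => hne (ha.2 e he hfe.symm).symm) false
          rw [hs, hpU _ _ _ (hx.colStep he hne.symm hfe.symm hd), hqV' _ _ _ _ hx he hne hfe]
          rw [← neg_eq_zero, ← cross_colPerp]
          simp [cross, mul_comm]
        · have hs' : (!s) = sgn e := by
            revert hs
            cases s <;> cases sgn e <;> simp
          have hs'' : s = !sgn e := by rw [← hs', Bool.not_not]
          obtain ⟨f, hf, hfe, hne⟩ : ∃ f ∈ I, f.1 = e.1 ∧ f ≠ e := by
            by_contra! hc
            exact hal ⟨hc, h.unique_col e he hd hc⟩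
          obtain ⟨b, x, hx⟩ := h.exists_label f hf
            (Or.inr fun ha => hne (ha.1 e he hfe.symm).symm) true
          rw [hs', hs'', hqV _ _ _ (hx.rowStep he hne.symm hfe.symm hd), hpU' _ _ _ _ hx he hne hfe,
            ← cross_rowPerp]
          simp [cross, mul_comm]
    · push Not at hi
      rw [(hiso e he hi.1 hi.2 s).1, (hiso e he hi.1 hi.2 _).2, Bool.not_not, ← cross_rowPerp]
      simp [cross, mul_comm]
  refine ⟨⟨sgn, fun α s => Submodule.span F {p α s}, fun β s => Submodule.span F {q' β s}⟩,
    ⟨⟨h.proper, ?_, ?_, ?_, ?_, ?_, ?_⟩, h.block, h.unique_col, h.unique_row, ?_⟩, ?_, ?_, ?_⟩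
  · rintro α (_ | _)
    exacts [(finrank_span_of_cross (hp1 α)).2.1, (finrank_span_of_cross (hp1 α)).1]
  · rintro β (_ | _)
    exacts [(finrank_span_of_cross (hq1' β)).2.1, (finrank_span_of_cross (hq1' β)).1]
  · exact fun α => (finrank_span_of_cross (hp1 α)).2.2
  · exact fun β => (finrank_span_of_cross (hq1' β)).2.2
  · exact fun e he s => vanishes_span (hvan e he s)
  · intro e he hr
    obtain ⟨hB, hd⟩ := block_rank_eq_one_iff.1 hr
    dsimp only
    rw [hpU _ _ _ (DartLabel.baseRow he hd), hqV _ _ _ (DartLabel.baseCol he hd)]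
    exact ⟨kerL_eq_span hB hd, kerR_eq_span hB hd⟩
  · intro e he ha
    obtain ⟨b, x, hx⟩ := h.exists_label e he ha true
    exact hx.inRankOneComponent h.block
  · intro b e x hx
    dsimp only
    rw [hpU b e x hx]
  · intro b e x hx
    dsimp only
    rw [hqV b e x hx]
  · intro b e x hx hu
    have hx' : At false e := ⟨b, x, hx⟩
    have := hq3 e.2 e ⟨hx', rfl⟩ (fun f hf => by
      obtain ⟨⟨b', y, hy⟩, hf⟩ := hf
      exact hu f hy.mem hf)
    dsimp only
    rw [hq' e hx', this, ← hv e false b x hx]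

end MatchingLabeling

/-! ### Search forests -/

section SearchForest

variable {F : Type*} [Field F] {μ ν : ℕ}

/-- `e` is an isolated rank-2 edge, provided that it belongs to `I`. -/
def IsIso (A : Blocks F μ ν) (I : Finset (Fin μ × Fin ν)) (e : Fin μ × Fin ν) : Prop :=
  (A e.1 e.2).det ≠ 0 ∧ IsAlone I e

/-- A node of the search forest: a column node `β` reached with the space `Y`. Unless it is a root
(`kind = 0`), it is entered along the edge `αβ` of `I`, where the row node `α` is visited with the
space `X`. The edge is isolated of rank two and `X` is the last space of an outer step (`kind = 1`),
or the edge is the first one of an inner space-walk that is entered after an outer step with last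
space `X` (`kind = 2`), or it continues an inner space-walk (`kind = 3`). The space `R` is that of
`α` in the step along `αβ`, `par` is the position of the parent in the list of all items, and `len`
is the number of steps up to this item. -/
structure Item (F : Type*) [Field F] (μ ν : ℕ) where
  kind : ℕ
  par : ℕ
  α : Fin μ
  β : Fin ν
  X : Space F
  R : Space F
  Y : Space F
  len : ℕ

/-- The intersection of the spaces with which the items enter from `α`. -/
def wRow (T : List (Item F μ ν)) (α : Fin μ) : Space F :=
  ⨅ q ∈ T, ⨅ (_ : q.kind ≠ 0 ∧ q.α = α), q.R

/-- The sum of the spaces with which the items reach `β`. -/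
def wCol (T : List (Item F μ ν)) (β : Fin ν) : Space F :=
  ⨆ q ∈ T, ⨆ (_ : q.β = β), q.Y

theorem le_wRow {T : List (Item F μ ν)} {α : Fin μ} {S : Space F} :
    S ≤ wRow T α ↔ ∀ q ∈ T, q.kind ≠ 0 → q.α = α → S ≤ q.R := by
  simp only [wRow, le_iInf_iff, and_imp]

theorem wCol_le {T : List (Item F μ ν)} {β : Fin ν} {S : Space F} :
    wCol T β ≤ S ↔ ∀ q ∈ T, q.β = β → q.Y ≤ S := by
  simp only [wCol, iSup_le_iff]

theorem wRow_le {T : List (Item F μ ν)} {q : Item F μ ν} (hq : q ∈ T) (hk : q.kind ≠ 0) :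
    wRow T q.α ≤ q.R := le_wRow.1 le_rfl q hq hk rfl

theorem le_wCol {T : List (Item F μ ν)} {q : Item F μ ν} (hq : q ∈ T) :
    q.Y ≤ wCol T q.β := wCol_le.1 le_rfl q hq rfl

theorem wRow_append (T : List (Item F μ ν)) (q : Item F μ ν) (α : Fin μ)
    [Decidable (q.kind ≠ 0 ∧ q.α = α)] :
    wRow (T ++ [q]) α = if q.kind ≠ 0 ∧ q.α = α then wRow T α ⊓ q.R else wRow T α := by
  apply eq_of_forall_le_iff
  intro S
  split_ifs with h
  · rw [le_inf_iff, le_wRow, le_wRow]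
    simp only [List.mem_append, List.mem_singleton]
    constructor
    · exact fun h' => ⟨fun r hr => h' r (Or.inl hr), h' q (Or.inr rfl) h.1 h.2⟩
    · rintro ⟨h1, h2⟩ r (hr | rfl) hk hα
      exacts [h1 r hr hk hα, h2]
  · rw [le_wRow, le_wRow]
    simp only [List.mem_append, List.mem_singleton]
    constructor
    · exact fun h' => fun r hr => h' r (Or.inl hr)
    · rintro h1 r (hr | rfl) hk hα
      exacts [h1 r hr hk hα, absurd ⟨hk, hα⟩ h]

theorem wCol_append (T : List (Item F μ ν)) (q : Item F μ ν) (β : Fin ν) :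
    wCol (T ++ [q]) β = if q.β = β then wCol T β ⊔ q.Y else wCol T β := by
  apply eq_of_forall_ge_iff
  intro S
  split_ifs with h
  · rw [sup_le_iff, wCol_le, wCol_le]
    simp only [List.mem_append, List.mem_singleton]
    constructor
    · exact fun h' => ⟨fun r hr => h' r (Or.inl hr), h' q (Or.inr rfl) h⟩
    · rintro ⟨h1, h2⟩ r (hr | rfl) hβ
      exacts [h1 r hr hβ, h2]
  · rw [wCol_le, wCol_le]
    simp only [List.mem_append, List.mem_singleton]
    constructor
    · exact fun h' => fun r hr => h' r (Or.inl hr)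
    · rintro h1 r (hr | rfl) hβ
      exacts [h1 r hr hβ, absurd hβ h]

theorem wRow_append_le (T U : List (Item F μ ν)) (α : Fin μ) : wRow (T ++ U) α ≤ wRow T α :=
  le_wRow.2 fun q hq hk hα => by
    subst hα
    exact wRow_le (List.mem_append_left _ hq) hk

/-- An outer step leads from the item `p` to the row node `α` with the space `X`. -/
def OuterTo (A : Blocks F μ ν) (I : Finset (Fin μ × Fin ν)) (p : Item F μ ν) (α : Fin μ)
    (X : Space F) : Prop :=
  (α, p.β) ∈ edges A ∧ (α, p.β) ∉ I ∧ ¬ p.Y ≤ kerR (A α p.β) ∧ X = perpCol (A α p.β) p.Y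

/-- The item `q` can be reached from the item `p`. -/
inductive IsStep (A : Blocks F μ ν) (I : Finset (Fin μ × Fin ν)) (L : Labeling F μ ν)
    (p q : Item F μ ν) : Prop
  | iso (hk : q.kind = 1) (hI : (q.α, q.β) ∈ I) (hiso : IsIso A I (q.α, q.β))
      (ho : OuterTo A I p q.α q.X) (hR : q.R = q.X) (hY : q.Y = perpRow (A q.α q.β) q.X)
      (hl : q.len = p.len + 1)
  | enter (hk : q.kind = 2) (hI : (q.α, q.β) ∈ I) (hiso : ¬ IsIso A I (q.α, q.β))
      (ho : OuterTo A I p q.α q.X) (hX : q.X ≠ L.U q.α (!L.sign (q.α, q.β)))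
      (h1 : (∀ f ∈ I, f.1 = q.α → f = (q.α, q.β)) → q.X = L.U q.α (L.sign (q.α, q.β)))
      (hR : q.R = L.U q.α (L.sign (q.α, q.β))) (hY : q.Y = L.V q.β (!L.sign (q.α, q.β)))
      (hl : q.len = p.len + 2)
  | extend (hk : q.kind = 3) (hI : (q.α, q.β) ∈ I) (hp : 2 ≤ p.kind) (hJ : (q.α, p.β) ∈ I)
      (hd : (A q.α p.β).det ≠ 0) (hα : q.α ≠ p.α) (hβ : q.β ≠ p.β) (hX : q.X = q.R)
      (hR : q.R = L.U q.α (L.sign (q.α, q.β))) (hY : q.Y = L.V q.β (!L.sign (q.α, q.β)))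
      (hl : q.len = p.len + 1)

/-- The forests that the search builds. A new item has a new space on its row side, and an earlier
visit of its row node with a smaller space belongs to a sibling. -/
inductive IsForest (A : Blocks F μ ν) (I : Finset (Fin μ × Fin ν)) (L : Labeling F μ ν) :
    List (Item F μ ν) → Prop
  | nil : IsForest A I L []
  | root {T q} (hT : IsForest A I L T) (hk : q.kind = 0) (hY : q.Y = kerCol A I q.β)
      (h0 : kerCol A I q.β ≠ ⊥) (hl : q.len = 0) (hβ : ∀ r ∈ T, r.β ≠ q.β) :
      IsForest A I L (T ++ [q])
  | step {T p q} (hT : IsForest A I L T) (hp : T[q.par]? = some p) (h : IsStep A I L p q)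
      (hnew : ¬ wRow T q.α ≤ q.R)
      (hsep : ∀ r ∈ T, r.kind ≠ 0 → r.α = q.α → r.X ≤ q.X → r.par = q.par) :
      IsForest A I L (T ++ [q])

variable {A : Blocks F μ ν} {I : Finset (Fin μ × Fin ν)} {L : Labeling F μ ν}
  {T : List (Item F μ ν)}

theorem IsStep.kind_ne {p q : Item F μ ν} (h : IsStep A I L p q) : q.kind ≠ 0 := by
  cases h <;> omega

theorem IsStep.mem {p q : Item F μ ν} (h : IsStep A I L p q) : (q.α, q.β) ∈ I := by
  cases h <;> assumption

theorem perpCol_ne_top {B : Matrix (Fin 2) (Fin 2) F} {Y : Space F} (h : ¬ Y ≤ kerR B) :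
    perpCol B Y ≠ ⊤ := by
  intro h'
  rw [eq_top_iff] at h'
  apply h
  rw [← perpRow_top]
  exact vanishes_iff_le_perpRow.1 (vanishes_iff_le_perpCol.2 h')

theorem Labeling.IsValid.ne_not (h : L.IsValid A I) (α : Fin μ) (s : Bool) :
    L.U α s ≠ L.U α (!s) := by
  cases s
  · exact (h.distinctU α).symm
  · exact h.distinctU α

theorem Labeling.IsValid.ne_not' (h : L.IsValid A I) (β : Fin ν) (s : Bool) :
    L.V β s ≠ L.V β (!s) := by
  cases s
  · exact (h.distinctV β).symm
  · exact h.distinctV β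

theorem Labeling.IsValid.U_le_iff (h : L.IsValid A I) {α : Fin μ} {s t : Bool} :
    L.U α s ≤ L.U α t ↔ s = t := by
  refine ⟨fun hle => ?_, by rintro rfl; exact le_rfl⟩
  have := eq_of_le_of_finrank_one (h.dimU α s) (h.dimU α t) hle
  by_contra hne
  obtain rfl : t = !s := by cases s <;> cases t <;> simp_all
  exact h.ne_not α s this

theorem Labeling.IsValid.V_le_iff (h : L.IsValid A I) {β : Fin ν} {s t : Bool} :
    L.V β s ≤ L.V β t ↔ s = t := by
  refine ⟨fun hle => ?_, by rintro rfl; exact le_rfl⟩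
  have := eq_of_le_of_finrank_one (h.dimV β s) (h.dimV β t) hle
  by_contra hne
  obtain rfl : t = !s := by cases s <;> cases t <;> simp_all
  exact h.ne_not' β s this

theorem line_ne_top {S : Space F} (h : Module.finrank F S = 1) : S ≠ ⊤ := by
  rintro rfl
  rw [finrank_top_space] at h
  omega

theorem line_ne_bot {S : Space F} (h : Module.finrank F S = 1) : S ≠ ⊥ := by
  rintro rfl
  rw [finrank_bot] at h
  omega

theorem IsStep.X_ne_top (hL : L.IsValid A I) {p q : Item F μ ν} (h : IsStep A I L p q) :
    q.X ≠ ⊤ := by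
  cases h with
  | iso _ _ _ ho => rw [ho.2.2.2]; exact perpCol_ne_top ho.2.2.1
  | enter _ _ _ ho => rw [ho.2.2.2]; exact perpCol_ne_top ho.2.2.1
  | extend _ _ _ _ _ _ _ hX hR => rw [hX, hR]; exact line_ne_top (hL.dimU _ _)

theorem IsStep.R_ne_top (hL : L.IsValid A I) {p q : Item F μ ν} (h : IsStep A I L p q) :
    q.R ≠ ⊤ := by
  cases h with
  | iso _ _ _ ho hR => rw [hR, ho.2.2.2]; exact perpCol_ne_top ho.2.2.1
  | enter _ _ _ ho _ _ hR => rw [hR]; exact line_ne_top (hL.dimU _ _)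
  | extend _ _ _ _ _ _ _ hX hR => rw [hR]; exact line_ne_top (hL.dimU _ _)

end SearchForest

/-! ### Kernels of the nodes with respect to `I` -/

section Kernels

variable {F : Type*} [Field F] {μ ν : ℕ} {A : Blocks F μ ν} {I : Finset (Fin μ × Fin ν)}

theorem kerCol_of_forall_ne {β : Fin ν} (h : ∀ f ∈ I, f.2 ≠ β) : kerCol A I β = ⊤ := by
  have h0 : degCol I β = 0 := by
    rw [degCol, Finset.card_eq_zero, Finset.filter_eq_empty_iff]
    exact h
  rw [kerCol, if_pos (by omega), iInf_eq_top]
  exact fun α => absurd rfl (h _ α.2)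

theorem kerRow_of_forall_ne {α : Fin μ} (h : ∀ f ∈ I, f.1 ≠ α) : kerRow A I α = ⊤ := by
  have h0 : degRow I α = 0 := by
    rw [degRow, Finset.card_eq_zero, Finset.filter_eq_empty_iff]
    exact h
  rw [kerRow, if_pos (by omega), iInf_eq_top]
  exact fun β => absurd rfl (h _ β.2)

theorem kerCol_of_alone {e : Fin μ × Fin ν} (he : e ∈ I) (h : ∀ f ∈ I, f.2 = e.2 → f = e) :
    kerCol A I e.2 = kerR (A e.1 e.2) := by
  have h0 : degCol I e.2 ≤ 1 := by
    rw [degCol, Finset.card_le_one]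
    simp only [Finset.mem_filter]
    rintro a ⟨ha, ha'⟩ b ⟨hb, hb'⟩
    rw [h a ha ha', h b hb hb']
  rw [kerCol, if_pos h0]
  refine le_antisymm (iInf_le_of_le ⟨e.1, he⟩ le_rfl) (le_iInf fun α => ?_)
  have := congrArg Prod.fst (h _ α.2 rfl)
  dsimp only at this
  rw [this]

theorem kerRow_of_alone {e : Fin μ × Fin ν} (he : e ∈ I) (h : ∀ f ∈ I, f.1 = e.1 → f = e) :
    kerRow A I e.1 = kerL (A e.1 e.2) := by
  have h0 : degRow I e.1 ≤ 1 := by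
    rw [degRow, Finset.card_le_one]
    simp only [Finset.mem_filter]
    rintro a ⟨ha, ha'⟩ b ⟨hb, hb'⟩
    rw [h a ha ha', h b hb hb']
  rw [kerRow, if_pos h0]
  refine le_antisymm (iInf_le_of_le ⟨e.2, he⟩ le_rfl) (le_iInf fun β => ?_)
  have := congrArg Prod.snd (h _ β.2 rfl)
  dsimp only at this
  rw [this]

theorem kerCol_of_ne {e f : Fin μ × Fin ν} (he : e ∈ I) (hf : f ∈ I) (hne : f ≠ e)
    (h2 : f.2 = e.2) : kerCol A I e.2 = ⊥ := by
  rw [kerCol, if_neg]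
  rw [not_le, degCol, Finset.one_lt_card]
  exact ⟨f, by simp [hf, h2], e, by simp [he], hne⟩

/-- A column node with an edge of `I` and a nonzero kernel has degree one, and its edge is
rank-1. -/
theorem alone_of_kerCol_ne_bot {e : Fin μ × Fin ν} (he : e ∈ I) (h : kerCol A I e.2 ≠ ⊥) :
    (∀ f ∈ I, f.2 = e.2 → f = e) ∧ (A e.1 e.2).det = 0 := by
  have h1 : ∀ f ∈ I, f.2 = e.2 → f = e := by
    intro f hf h2
    by_contra hne
    exact h (kerCol_of_ne he hf hne h2)
  refine ⟨h1, ?_⟩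
  by_contra hd
  exact h (by rw [kerCol_of_alone he h1, kerR_eq_bot hd])

end Kernels

/-! ### Facts about search forests -/

section ForestFacts

variable {F : Type*} [Field F] {μ ν : ℕ} {A : Blocks F μ ν} {I : Finset (Fin μ × Fin ν)}
  {L : Labeling F μ ν} {T : List (Item F μ ν)}

theorem perpRow_inf {B : Matrix (Fin 2) (Fin 2) F} (hB : B.det ≠ 0) (X X' : Space F) :
    perpRow B (X ⊓ X') = perpRow B X ⊔ perpRow B X' := by
  symm
  apply Submodule.eq_of_le_of_finrank_le
  · exact sup_le (perpRow_anti inf_le_left) (perpRow_anti inf_le_right)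
  · have h1 := Submodule.finrank_sup_add_finrank_inf_eq (perpRow B X) (perpRow B X')
    have h2 : perpRow B X ⊓ perpRow B X' = perpRow B (X ⊔ X') := by
      apply le_antisymm
      · rw [← vanishes_iff_le_perpRow, vanishes_iff_le_perpCol]
        exact sup_le (vanishes_iff_le_perpCol.1 (vanishes_iff_le_perpRow.2 inf_le_left))
          (vanishes_iff_le_perpCol.1 (vanishes_iff_le_perpRow.2 inf_le_right))
      · exact le_inf (perpRow_anti le_sup_left) (perpRow_anti le_sup_right)
    have h3 := Submodule.finrank_sup_add_finrank_inf_eq X X'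
    rw [h2] at h1
    simp only [finrank_perpRow hB] at h1 ⊢
    have := finrank_space_le X
    have := finrank_space_le X'
    have := finrank_space_le (X ⊔ X')
    omega

theorem finrank_lt_of_not_le {S R : Space F} (h : ¬ S ≤ R) :
    Module.finrank F (S ⊓ R : Submodule F _) < Module.finrank F S := by
  apply Submodule.finrank_lt_finrank_of_lt
  exact lt_of_le_of_ne inf_le_left fun h' => h (inf_eq_left.1 h')

theorem finrank_lt_of_not_ge {S R : Space F} (h : ¬ R ≤ S) :
    Module.finrank F S < Module.finrank F (S ⊔ R : Submodule F _) := by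
  apply Submodule.finrank_lt_finrank_of_lt
  exact lt_of_le_of_ne le_sup_left fun h' => h (sup_eq_left.1 h'.symm)

/-- An item of a search forest is a root or arises from its parent, an earlier item. -/
theorem IsForest.item (h : IsForest A I L T) {i : ℕ} {q : Item F μ ν} (hq : T[i]? = some q) :
    (q.kind = 0 ∧ q.Y = kerCol A I q.β ∧ kerCol A I q.β ≠ ⊥ ∧ q.len = 0) ∨
      ∃ p, T[q.par]? = some p ∧ q.par < i ∧ IsStep A I L p q := by
  have hold : ∀ {T : List (Item F μ ν)} {r p : Item F μ ν} {j : ℕ}, T[j]? = some p →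
      (T ++ [r])[j]? = some p := by
    intro T r p j hj
    rw [List.getElem?_append_left (List.getElem?_eq_some_iff.1 hj).1, hj]
  induction h with
  | nil => simp at hq
  | @root T r hT hk hY h0 hl hβ ih =>
    rw [List.getElem?_append] at hq
    split_ifs at hq with hi
    · rcases ih hq with h | ⟨p, h1, h2, h3⟩
      exacts [Or.inl h, Or.inr ⟨p, hold h1, h2, h3⟩]
    · obtain ⟨-, rfl⟩ : i - T.length = 0 ∧ r = q := by simpa [List.getElem?_singleton] using hq
      exact Or.inl ⟨hk, hY, h0, hl⟩
  | @step T p r hT hp h hnew hsep ih =>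
    rw [List.getElem?_append] at hq
    split_ifs at hq with hi
    · rcases ih hq with h | ⟨p, h1, h2, h3⟩
      exacts [Or.inl h, Or.inr ⟨p, hold h1, h2, h3⟩]
    · obtain ⟨-, rfl⟩ : i - T.length = 0 ∧ r = q := by simpa [List.getElem?_singleton] using hq
      have := (List.getElem?_eq_some_iff.1 hp).1
      exact Or.inr ⟨p, hold hp, by omega, h⟩

theorem IsForest.item_mem (h : IsForest A I L T) {q : Item F μ ν} (hq : q ∈ T) :
    (q.kind = 0 ∧ q.Y = kerCol A I q.β ∧ kerCol A I q.β ≠ ⊥ ∧ q.len = 0) ∨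
      ∃ p ∈ T, T[q.par]? = some p ∧ IsStep A I L p q := by
  obtain ⟨i, hi⟩ := List.mem_iff_getElem?.1 hq
  rcases h.item hi with h | ⟨p, h1, _, h3⟩
  exacts [Or.inl h, Or.inr ⟨p, List.mem_of_getElem? h1, h1, h3⟩]

theorem IsForest.exists_step (h : IsForest A I L T) {q : Item F μ ν} (hq : q ∈ T)
    (hk : q.kind ≠ 0) : ∃ p ∈ T, T[q.par]? = some p ∧ IsStep A I L p q := by
  rcases h.item_mem hq with h | h
  exacts [absurd h.1 hk, h]

theorem IsStep.of_iso {p q : Item F μ ν} (h : IsStep A I L p q) (hi : IsIso A I (q.α, q.β)) :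
    q.kind = 1 ∧ OuterTo A I p q.α q.X ∧ q.R = q.X ∧ q.Y = perpRow (A q.α q.β) q.X := by
  cases h with
  | iso hk hI hiso ho hR hY hl => exact ⟨hk, ho, hR, hY⟩
  | enter _ _ hiso => exact absurd hi hiso
  | extend hk hI hp hJ hd hα hβ =>
    exact absurd (congrArg Prod.snd (hi.2.1 _ hJ rfl)).symm hβ

theorem IsStep.of_not_iso (hL : L.IsValid A I) {p q : Item F μ ν} (h : IsStep A I L p q)
    (hi : ¬ IsIso A I (q.α, q.β)) :
    2 ≤ q.kind ∧ q.R = L.U q.α (L.sign (q.α, q.β)) ∧ q.Y = L.V q.β (!L.sign (q.α, q.β)) ∧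
      q.X ≠ L.U q.α (!L.sign (q.α, q.β)) ∧
      ((∀ f ∈ I, f.1 = q.α → f = (q.α, q.β)) → q.X = L.U q.α (L.sign (q.α, q.β))) := by
  cases h with
  | iso _ _ hiso => exact absurd hiso hi
  | enter hk _ _ ho hX h1 hR hY hl => exact ⟨hk.ge, hR, hY, hX, h1⟩
  | extend hk hI hp hJ hd hα hβ hX hR hY hl =>
    refine ⟨by omega, hR, hY, ?_, fun h => ?_⟩
    · rw [hX, hR]
      exact hL.ne_not _ _
    · rw [hX, hR]

/-- The column space at the end of an isolated rank-2 edge is orthogonal to the row space at its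
other end. -/
theorem IsForest.wCol_of_iso (h : IsForest A I L T) {e : Fin μ × Fin ν} (he : e ∈ I)
    (hi : IsIso A I e) : wCol T e.2 = perpRow (A e.1 e.2) (wRow T e.1) := by
  classical
  induction h with
  | nil =>
    rw [show wRow ([] : List (Item F μ ν)) e.1 = ⊤ by simp [wRow], perpRow_top, kerR_eq_bot hi.1]
    simp [wCol]
  | @root T q hT hk hY h0 hl hβ ih =>
    rw [wRow_append, if_neg (by simp [hk]), wCol_append, if_neg, ih]
    intro hq
    rw [hq] at h0
    exact hi.1 (alone_of_kerCol_ne_bot he h0).2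
  | @step T p q hT hp hs hnew hsep ih =>
    have hq := hs.mem
    have hiff : q.β = e.2 ↔ q.α = e.1 :=
      ⟨fun hb => congrArg Prod.fst (hi.2.2 _ hq hb), fun ha => congrArg Prod.snd (hi.2.1 _ hq ha)⟩
    rw [wRow_append, wCol_append]
    by_cases hb : q.β = e.2
    · have ha := hiff.1 hb
      rw [if_pos hb, if_pos ⟨hs.kind_ne, ha⟩, perpRow_inf hi.1, ih]
      obtain rfl : (q.α, q.β) = e := Prod.ext ha hb
      rw [(hs.of_iso hi).2.2.1, (hs.of_iso hi).2.2.2]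
    · rw [if_neg hb, if_neg fun h => hb (hiff.2 h.2), ih]

/-- The items at the column end of an edge of `I` that is not isolated of rank two: those that enter
through the edge carry one line of the labeling, all others the other line. -/
theorem IsForest.Y_eq (hL : L.IsValid A I) (hb : ∀ e ∈ I, A e.1 e.2 ≠ 0) (h : IsForest A I L T)
    {e : Fin μ × Fin ν} (he : e ∈ I) (hi : ¬ IsIso A I e) {q : Item F μ ν} (hq : q ∈ T)
    (hβ : q.β = e.2) :
    (q.kind ≠ 0 ∧ q.α = e.1 ∧ q.Y = L.V e.2 (!L.sign e)) ∨
      ((q.kind = 0 ∨ q.α ≠ e.1) ∧ q.Y = L.V e.2 (L.sign e)) := by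
  rcases h.item_mem hq with ⟨hk, hY, h0, -⟩ | ⟨p, -, -, hs⟩
  · right
    rw [hβ] at hY h0
    obtain ⟨h1, hd⟩ := alone_of_kerCol_ne_bot he h0
    refine ⟨Or.inl hk, ?_⟩
    rw [hY, kerCol_of_alone he h1]
    exact (hL.kernel e he (block_rank_eq_one_iff.2 ⟨hb e he, hd⟩)).2
  · by_cases hα : q.α = e.1
    · left
      obtain rfl : (q.α, q.β) = e := Prod.ext hα hβ
      exact ⟨hs.kind_ne, rfl, (hs.of_not_iso hL hi).2.2.1⟩
    · right
      have hne : (q.α, q.β) ≠ e := fun h' => hα (congrArg Prod.fst h')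
      have hni : ¬ IsIso A I (q.α, q.β) := fun h' => hne.symm (h'.2.2 e he hβ.symm)
      refine ⟨Or.inr hα, ?_⟩
      have hs' := hL.proper _ hs.mem e he hne (Or.inr hβ)
      rw [(hs.of_not_iso hL hni).2.2.1, ← hβ]
      congr 1
      revert hs'
      cases L.sign (q.α, q.β) <;> cases L.sign e <;> simp

/-- An item that is new on its row side is new on its column side. -/
theorem IsForest.not_le_wCol (hL : L.IsValid A I) (hb : ∀ e ∈ I, A e.1 e.2 ≠ 0)
    (h : IsForest A I L T) {p q : Item F μ ν} (hs : IsStep A I L p q)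
    (hnew : ¬ wRow T q.α ≤ q.R) : ¬ q.Y ≤ wCol T q.β := by
  by_cases hi : IsIso A I (q.α, q.β)
  · obtain ⟨-, -, hR, hY⟩ := hs.of_iso hi
    have := h.wCol_of_iso hs.mem hi
    dsimp only at this
    rw [this, hY, ← hR]
    exact fun h' => hnew (le_of_perpRow_le hi.1 h')
  · obtain ⟨hk, hR, hY, -, -⟩ := hs.of_not_iso hL hi
    intro hle
    have : wCol T q.β ≤ L.V q.β (L.sign (q.α, q.β)) := by
      refine wCol_le.2 fun r hr hrβ => ?_
      rcases h.Y_eq hL hb hs.mem hi hr hrβ with ⟨hrk, hrα, -⟩ | ⟨-, hY'⟩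
      · exfalso
        obtain ⟨p', -, -, hs'⟩ := h.exists_step hr hrk
        dsimp only at hrα
        have hR' := (hs'.of_not_iso hL (by rwa [hrα, hrβ])).2.1
        rw [hrα, hrβ, ← hR] at hR'
        apply hnew
        rw [← hR', ← hrα]
        exact wRow_le hr hrk
      · exact hY'.le
    have h' := hle.trans this
    rw [hY, hL.V_le_iff] at h'
    cases hs : L.sign (q.α, q.β) <;> simp [hs] at h'

theorem IsForest.pairwise_Y (hL : L.IsValid A I) (hb : ∀ e ∈ I, A e.1 e.2 ≠ 0)
    (h : IsForest A I L T) : T.Pairwise fun s t => s.β = t.β → ¬ t.Y ≤ s.Y := by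
  induction h with
  | nil => exact List.Pairwise.nil
  | @root T q hT hk hY h0 hl hβ ih =>
    rw [List.pairwise_append]
    refine ⟨ih, List.pairwise_singleton _ _, fun a ha b hb hab => ?_⟩
    rw [List.mem_singleton] at hb
    subst hb
    exact absurd hab (hβ a ha)
  | @step T p q hT hp hs hnew hsep ih =>
    rw [List.pairwise_append]
    refine ⟨ih, List.pairwise_singleton _ _, fun a ha b hb' hab hle => ?_⟩
    rw [List.mem_singleton] at hb'
    subst hb'
    exact hT.not_le_wCol hL hb hs hnew (hle.trans (by rw [← hab]; exact le_wCol ha))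

/-- Two visits of a row node are made with incomparable spaces in the order of the visits, unless
they have the same parent. -/
theorem IsForest.pairwise_X (h : IsForest A I L T) :
    T.Pairwise fun s t => s.kind ≠ 0 → t.kind ≠ 0 → s.α = t.α → s.X ≤ t.X → s.par = t.par := by
  induction h with
  | nil => exact List.Pairwise.nil
  | @root T q hT hk hY h0 hl hβ ih =>
    rw [List.pairwise_append]
    refine ⟨ih, List.pairwise_singleton _ _, fun a ha b hb _ hk' => ?_⟩
    rw [List.mem_singleton] at hb
    subst hb
    exact absurd hk hk'
  | @step T p q hT hp hs hnew hsep ih =>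
    rw [List.pairwise_append]
    refine ⟨ih, List.pairwise_singleton _ _, fun a ha b hb' hk _ hab hle => ?_⟩
    rw [List.mem_singleton] at hb'
    subst hb'
    exact hsep a ha hk hab hle

theorem IsForest.length_col_le_finrank (hL : L.IsValid A I) (hb : ∀ e ∈ I, A e.1 e.2 ≠ 0)
    (h : IsForest A I L T) (β : Fin ν) :
    (T.filter fun q => q.β = β).length ≤ Module.finrank F (wCol T β) := by
  induction h with
  | nil => simp
  | @root T q hT hk hY h0 hl hβ ih =>
    rw [List.filter_append, List.length_append, wCol_append]
    by_cases hq : q.β = β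
    · rw [if_pos hq]
      subst hq
      have : wCol T q.β = ⊥ := by
        rw [eq_bot_iff]
        exact wCol_le.2 fun r hr hrβ => absurd hrβ (hβ r hr)
      have hlt := finrank_lt_of_not_ge (S := wCol T q.β) (R := q.Y)
        (by rw [this, hY, le_bot_iff]; exact h0)
      simpa using by omega
    · rw [if_neg hq]
      simpa [hq] using ih
  | @step T p q hT hp hs hnew hsep ih =>
    rw [List.filter_append, List.length_append, wCol_append]
    by_cases hq : q.β = β
    · rw [if_pos hq]
      subst hq
      have hlt := finrank_lt_of_not_ge (hT.not_le_wCol hL hb hs hnew)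
      simpa using by omega
    · rw [if_neg hq]
      simpa [hq] using ih

theorem IsForest.length_col_le (hL : L.IsValid A I) (hb : ∀ e ∈ I, A e.1 e.2 ≠ 0)
    (h : IsForest A I L T) (β : Fin ν) : (T.filter fun q => q.β = β).length ≤ 2 :=
  (h.length_col_le_finrank hL hb β).trans (finrank_space_le _)

theorem IsForest.length_row_le (h : IsForest A I L T) (α : Fin μ) :
    (T.filter fun q => q.kind ≠ 0 ∧ q.α = α).length + Module.finrank F (wRow T α) ≤ 2 := by
  classical
  induction h with
  | nil => simpa using finrank_space_le _
  | @root T q hT hk hY h0 hl hβ ih =>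
    rw [List.filter_append, List.length_append, wRow_append, if_neg (by simp [hk])]
    simpa [hk] using ih
  | @step T p q hT hp hs hnew hsep ih =>
    rw [List.filter_append, List.length_append, wRow_append]
    have hk := hs.kind_ne
    by_cases hq : q.α = α
    · rw [if_pos ⟨hk, hq⟩]
      subst hq
      have hlt := finrank_lt_of_not_le hnew
      have h1 : ([q].filter fun r => decide (r.kind ≠ 0 ∧ r.α = q.α)).length = 1 := by simp [hk]
      omega
    · rw [if_neg fun h => hq h.2]
      simpa [hq] using ih

end ForestFacts

/-! ### Completed searches yield optimality witnesses -/

section Witness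

variable {F : Type*} [Field F] {μ ν : ℕ} {A : Blocks F μ ν} {I : Finset (Fin μ × Fin ν)}
  {L : Labeling F μ ν} {T : List (Item F μ ν)}

/-- Reaching the row node `α` with the space `X` does not lead to anything new. -/
def Handled (A : Blocks F μ ν) (I : Finset (Fin μ × Fin ν)) (L : Labeling F μ ν)
    (T : List (Item F μ ν)) (α : Fin μ) (X : Space F) : Prop :=
  (∃ e ∈ I, e.1 = α) ∧ ∀ e ∈ I, e.1 = α →
    (IsIso A I e → wRow T α ≤ X) ∧
    (¬ IsIso A I e → (X ≠ L.U α (!L.sign e) → wRow T α ≤ L.U α (L.sign e)) ∧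
      ((∀ f ∈ I, f.1 = α → f = e) → X = L.U α (L.sign e)))

theorem Handled.append {α : Fin μ} {X : Space F} (h : Handled A I L T α X)
    (N : List (Item F μ ν)) : Handled A I L (T ++ N) α X :=
  ⟨h.1, fun e he hα => ⟨fun hi => (wRow_append_le _ _ _).trans ((h.2 e he hα).1 hi), fun hi =>
    ⟨fun hX => (wRow_append_le _ _ _).trans (((h.2 e he hα).2 hi).1 hX),
      ((h.2 e he hα).2 hi).2⟩⟩⟩

/-- All continuations of the item `p` have been treated. -/
structure IsExpanded (A : Blocks F μ ν) (I : Finset (Fin μ × Fin ν)) (L : Labeling F μ ν)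
    (T : List (Item F μ ν)) (p : Item F μ ν) : Prop where
  outer : ∀ α X, OuterTo A I p α X → Handled A I L T α X
  inner : 2 ≤ p.kind → ∀ f ∈ I, f.2 = p.β → f.1 ≠ p.α → (A f.1 f.2).det ≠ 0 →
    ∀ g ∈ I, g.1 = f.1 → g ≠ f → wRow T g.1 ≤ L.U g.1 (L.sign g)

/-- The columns at which space-walks can start. -/
def IsStart (A : Blocks F μ ν) (I : Finset (Fin μ × Fin ν)) (β : Fin ν) : Prop :=
  (∃ e ∈ I, e.2 = β ∧ (∀ f ∈ I, f.2 = β → f = e) ∧ (A e.1 e.2).det = 0) ∨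
    ((∀ f ∈ I, f.2 ≠ β) ∧ ∃ e ∈ edges A, e.2 = β)

/-- The search is completed: all start columns are roots, and all items are expanded. -/
structure IsCompleted (A : Blocks F μ ν) (I : Finset (Fin μ × Fin ν)) (L : Labeling F μ ν)
    (T : List (Item F μ ν)) : Prop where
  expanded : ∀ p ∈ T, IsExpanded A I L T p
  roots : ∀ β, IsStart A I β → ∃ q ∈ T, q.kind = 0 ∧ q.β = β

/-- Some item enters through the edge `e`. -/
def Covered (T : List (Item F μ ν)) (e : Fin μ × Fin ν) : Prop :=
  ∃ q ∈ T, q.kind ≠ 0 ∧ (q.α, q.β) = e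

theorem perpCol_eq_top {B : Matrix (Fin 2) (Fin 2) F} {Y : Space F} (h : Y ≤ kerR B) :
    perpCol B Y = ⊤ := by
  rw [eq_top_iff, ← vanishes_iff_le_perpCol, vanishes_iff_le_perpRow, perpRow_top]
  exact h

theorem not_eq_of_ne_bool {a b : Bool} (h : a ≠ b) : a = !b := by
  revert h; cases a <;> cases b <;> simp

theorem IsForest.wRow_le_of_covered (hL : L.IsValid A I) (h : IsForest A I L T)
    {e : Fin μ × Fin ν} (hi : ¬ IsIso A I e) (hc : Covered T e) :
    wRow T e.1 ≤ L.U e.1 (L.sign e) := by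
  obtain ⟨q, hq, hk, rfl⟩ := hc
  obtain ⟨p, -, -, hs⟩ := h.exists_step hq hk
  rw [← (hs.of_not_iso hL hi).2.1]
  exact wRow_le hq hk

theorem IsForest.wRow_eq_top (h : IsForest A I L T) {α : Fin μ}
    (hc : ∀ e ∈ I, e.1 = α → ¬ Covered T e) : wRow T α = ⊤ := by
  rw [eq_top_iff]
  refine le_wRow.2 fun q hq hk hα => ?_
  obtain ⟨p, -, -, hs⟩ := h.exists_step hq hk
  exact absurd ⟨q, hq, hk, rfl⟩ (hc _ hs.mem hα)

/-- If no other edge at the row end of `e` is used, the row space contains the line of `e`. -/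
theorem IsForest.le_wRow_of_not_covered (hL : L.IsValid A I) (h : IsForest A I L T)
    {e : Fin μ × Fin ν} (hi : ¬ IsIso A I e)
    (hc : ∀ f ∈ I, f.1 = e.1 → f ≠ e → ¬ Covered T f) : L.U e.1 (L.sign e) ≤ wRow T e.1 := by
  refine le_wRow.2 fun q hq hk hα => ?_
  obtain ⟨p, -, -, hs⟩ := h.exists_step hq hk
  by_cases he : (q.α, q.β) = e
  · subst he
    rw [(hs.of_not_iso hL hi).2.1]
  · exact absurd ⟨q, hq, hk, rfl⟩ (hc _ hs.mem hα he)

theorem IsForest.wCol_le_of_not_covered (hL : L.IsValid A I) (hb : ∀ e ∈ I, A e.1 e.2 ≠ 0)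
    (h : IsForest A I L T) {e : Fin μ × Fin ν} (he : e ∈ I) (hi : ¬ IsIso A I e)
    (hc : ¬ Covered T e) : wCol T e.2 ≤ L.V e.2 (L.sign e) := by
  refine wCol_le.2 fun q hq hβ => ?_
  rcases h.Y_eq hL hb he hi hq hβ with ⟨hk, hα, -⟩ | ⟨-, hY⟩
  · exact absurd ⟨q, hq, hk, Prod.ext hα hβ⟩ hc
  · exact hY.le

theorem IsForest.le_wCol_of_covered (hL : L.IsValid A I) (h : IsForest A I L T)
    {e : Fin μ × Fin ν} (hi : ¬ IsIso A I e) (hc : Covered T e) :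
    L.V e.2 (!L.sign e) ≤ wCol T e.2 := by
  obtain ⟨q, hq, hk, rfl⟩ := hc
  obtain ⟨p, -, -, hs⟩ := h.exists_step hq hk
  rw [← (hs.of_not_iso hL hi).2.2.1]
  exact le_wCol hq

open Classical in
/-- The part of `r(I)` that the edge `e` contributes to the codimension of its row space. -/
noncomputable def rowShare (A : Blocks F μ ν) (I : Finset (Fin μ × Fin ν))
    (T : List (Item F μ ν)) (e : Fin μ × Fin ν) : ℕ :=
  if IsIso A I e then 2 - Module.finrank F (wRow T e.1) else if Covered T e then 1 else 0

open Classical in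
/-- The part of `r(I)` that the edge `e` contributes to the codimension of its column space. -/
noncomputable def colShare (A : Blocks F μ ν) (I : Finset (Fin μ × Fin ν))
    (T : List (Item F μ ν)) (e : Fin μ × Fin ν) : ℕ :=
  if IsIso A I e then Module.finrank F (wRow T e.1) else if Covered T e then 0 else 1

theorem not_isIso_of_ne {e f : Fin μ × Fin ν} (hf : f ∈ I) (hne : f ≠ e)
    (h : f.1 = e.1 ∨ f.2 = e.2) : ¬ IsIso A I e := fun h' =>
  hne (h.elim (h'.2.1 f hf) (h'.2.2 f hf))

theorem inf_eq_bot_of_le_lines (hL : L.IsValid A I) {α : Fin μ} {S : Space F} {s t : Bool}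
    (hst : s ≠ t) (hs : S ≤ L.U α s) (ht : S ≤ L.U α t) : S = ⊥ := by
  rw [eq_bot_iff, ← (isCompl_of_lines (hL.dimU α s) (hL.dimU α t) ?_).1]
  · exact le_inf hs ht
  · exact fun h => hst (hL.U_le_iff.1 h.le)

theorem sup_eq_top_of_lines_le (hL : L.IsValid A I) {β : Fin ν} {S : Space F} {s t : Bool}
    (hst : s ≠ t) (hs : L.V β s ≤ S) (ht : L.V β t ≤ S) : S = ⊤ := by
  rw [eq_top_iff, ← (isCompl_of_lines (hL.dimV β s) (hL.dimV β t) ?_).2]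
  · exact sup_le hs ht
  · exact fun h => hst (hL.V_le_iff.1 h.le)

theorem IsForest.finrank_wRow (hL : L.IsValid A I) (h : IsForest A I L T) (α : Fin μ) :
    Module.finrank F (wRow T α) + ∑ e ∈ I with e.1 = α, rowShare A I T e = 2 := by
  by_cases h0 : ∃ e ∈ I, e.1 = α
  swap
  · have : I.filter (fun e => e.1 = α) = ∅ := by
      rw [Finset.filter_eq_empty_iff]
      exact fun e he hα => h0 ⟨e, he, hα⟩
    rw [this, Finset.sum_empty, h.wRow_eq_top fun e he hα => absurd ⟨e, he, hα⟩ h0,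
      finrank_top_space]
    rfl
  obtain ⟨e, he, rfl⟩ := h0
  by_cases h1 : ∃ f ∈ I, f.1 = e.1 ∧ f ≠ e
  · obtain ⟨f, hf, hfe, hne⟩ := h1
    have : I.filter (fun g => g.1 = e.1) = {e, f} := by
      ext g
      simp only [Finset.mem_filter, Finset.mem_insert, Finset.mem_singleton]
      constructor
      · exact fun hg => IsProperSign.eq_or_eq hL.proper he hf hg.1 hne hfe hg.2
      · rintro (rfl | rfl)
        exacts [⟨he, rfl⟩, ⟨hf, hfe⟩]
    have hie := not_isIso_of_ne (A := A) hf hne (Or.inl hfe)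
    have hif := not_isIso_of_ne (A := A) he hne.symm (Or.inl hfe.symm)
    have hs := hL.proper e he f hf hne.symm (Or.inl hfe.symm)
    rw [this, Finset.sum_pair hne.symm]
    simp only [rowShare, hie, hif, if_false]
    by_cases ce : Covered T e <;> by_cases cf : Covered T f
    · have h1 := h.wRow_le_of_covered hL hie ce
      have h2 := h.wRow_le_of_covered hL hif cf
      rw [hfe] at h2
      rw [inf_eq_bot_of_le_lines hL hs h1 h2, finrank_bot, if_pos ce, if_pos cf]
      rfl
    · have h1 := h.wRow_le_of_covered hL hie ce
      have h2 := h.le_wRow_of_not_covered hL hie fun g hg hge hne' => by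
        rcases IsProperSign.eq_or_eq hL.proper he hf hg hne hfe hge with rfl | rfl
        exacts [absurd rfl hne', cf]
      rw [le_antisymm h1 h2, hL.dimU, if_pos ce, if_neg cf]
      rfl
    · have h1 := h.wRow_le_of_covered hL hif cf
      have h2 := h.le_wRow_of_not_covered hL hif fun g hg hge hne' => by
        rcases IsProperSign.eq_or_eq hL.proper he hf hg hne hfe (hge.trans hfe) with rfl | rfl
        exacts [ce, absurd rfl hne']
      rw [hfe] at h1 h2
      rw [le_antisymm h1 h2, hL.dimU, if_pos cf, if_neg ce]
      rfl
    · have h1 : wRow T e.1 = ⊤ := h.wRow_eq_top fun g hg hge => by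
        rcases IsProperSign.eq_or_eq hL.proper he hf hg hne hfe hge with rfl | rfl
        exacts [ce, cf]
      rw [h1, finrank_top_space, if_neg ce, if_neg cf]
      rfl
  · have h1' : ∀ f ∈ I, f.1 = e.1 → f = e := fun f hf hfe => by_contra fun hne =>
      h1 ⟨f, hf, hfe, hne⟩
    have : I.filter (fun g => g.1 = e.1) = {e} := by
      ext g
      simp only [Finset.mem_filter, Finset.mem_singleton]
      constructor
      · exact fun hg => h1' g hg.1 hg.2
      · rintro rfl
        exact ⟨he, rfl⟩
    rw [this, Finset.sum_singleton, rowShare]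
    by_cases hi : IsIso A I e
    · rw [if_pos hi]
      have := finrank_space_le (wRow T e.1)
      omega
    rw [if_neg hi]
    by_cases ce : Covered T e
    · have h2 := h.le_wRow_of_not_covered hL hi fun f hf hfe hne => absurd (h1' f hf hfe) hne
      rw [le_antisymm (h.wRow_le_of_covered hL hi ce) h2, hL.dimU, if_pos ce]
    · have h1 : wRow T e.1 = ⊤ := h.wRow_eq_top fun f hf hfe => by rwa [h1' f hf hfe]
      rw [h1, finrank_top_space, if_neg ce]

open Classical in
/-- The column spaces of the optimality witness. -/
noncomputable def witnessCol (I : Finset (Fin μ × Fin ν)) (T : List (Item F μ ν)) (β : Fin ν) :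
    Space F := if ∀ f ∈ I, f.2 ≠ β then ⊤ else wCol T β

theorem IsForest.finrank_witnessCol (hS : IsSearchLabeling A I L) (h : IsForest A I L T)
    (hc : ∀ β, IsStart A I β → ∃ q ∈ T, q.kind = 0 ∧ q.β = β) (β : Fin ν) :
    Module.finrank F (witnessCol I T β) + ∑ e ∈ I with e.2 = β, colShare A I T e = 2 := by
  have hL := hS.valid
  have hb := hS.block
  by_cases h0 : ∃ e ∈ I, e.2 = β
  swap
  · have : I.filter (fun e => e.2 = β) = ∅ := by
      rw [Finset.filter_eq_empty_iff]
      exact fun e he hα => h0 ⟨e, he, hα⟩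
    rw [this, Finset.sum_empty, witnessCol, if_pos fun e he hα => absurd ⟨e, he, hα⟩ h0,
      finrank_top_space]
    rfl
  obtain ⟨e, he, rfl⟩ := h0
  rw [witnessCol, if_neg fun h => h e he rfl]
  by_cases h1 : ∃ f ∈ I, f.2 = e.2 ∧ f ≠ e
  · obtain ⟨f, hf, hfe, hne⟩ := h1
    have : I.filter (fun g => g.2 = e.2) = {e, f} := by
      ext g
      simp only [Finset.mem_filter, Finset.mem_insert, Finset.mem_singleton]
      constructor
      · exact fun hg => IsProperSign.eq_or_eq' hL.proper he hf hg.1 hne hfe hg.2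
      · rintro (rfl | rfl)
        exacts [⟨he, rfl⟩, ⟨hf, hfe⟩]
    have hie := not_isIso_of_ne (A := A) hf hne (Or.inr hfe)
    have hif := not_isIso_of_ne (A := A) he hne.symm (Or.inr hfe.symm)
    have hs := hL.proper e he f hf hne.symm (Or.inr hfe.symm)
    rw [this, Finset.sum_pair hne.symm]
    simp only [colShare, hie, hif, if_false]
    have hse := not_eq_of_ne_bool hs
    by_cases ce : Covered T e <;> by_cases cf : Covered T f
    · have h1 := h.le_wCol_of_covered hL hie ce
      have h2 := h.le_wCol_of_covered hL hif cf
      rw [hfe] at h2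
      rw [sup_eq_top_of_lines_le hL (by simpa using hs) h1 h2, finrank_top_space, if_pos ce,
        if_pos cf]
      rfl
    · have h1 := h.le_wCol_of_covered hL hie ce
      have h2 := h.wCol_le_of_not_covered hL hb hf hif cf
      rw [hfe] at h2
      rw [hse, Bool.not_not] at h1
      rw [le_antisymm h2 h1, hL.dimV, if_pos ce, if_neg cf]
      rfl
    · have h1 := h.le_wCol_of_covered hL hif cf
      have h2 := h.wCol_le_of_not_covered hL hb he hie ce
      rw [hfe] at h1
      rw [hse] at h2
      rw [le_antisymm h2 h1, hL.dimV, if_pos cf, if_neg ce]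
      rfl
    · have h1 := h.wCol_le_of_not_covered hL hb hf hif cf
      have h2 := h.wCol_le_of_not_covered hL hb he hie ce
      rw [hfe] at h1
      have : wCol T e.2 = ⊥ := by
        rw [eq_bot_iff, ← (isCompl_of_lines (hL.dimV e.2 (L.sign e)) (hL.dimV e.2 (L.sign f)) ?_).1]
        · exact le_inf h2 h1
        · exact fun h => hs (hL.V_le_iff.1 h.le)
      rw [this, finrank_bot, if_neg cf, if_neg ce]
      rfl
  · have h1' : ∀ f ∈ I, f.2 = e.2 → f = e := fun f hf hfe => by_contra fun hne =>
      h1 ⟨f, hf, hfe, hne⟩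
    have : I.filter (fun g => g.2 = e.2) = {e} := by
      ext g
      simp only [Finset.mem_filter, Finset.mem_singleton]
      constructor
      · exact fun hg => h1' g hg.1 hg.2
      · rintro rfl
        exact ⟨he, rfl⟩
    rw [this, Finset.sum_singleton, colShare]
    by_cases hi : IsIso A I e
    · rw [if_pos hi, h.wCol_of_iso he hi, finrank_perpRow hi.1]
      have := finrank_space_le (wRow T e.1)
      omega
    rw [if_neg hi]
    have hd : (A e.1 e.2).det = 0 := by
      by_contra hd
      exact hi ⟨hd, hS.unique_row e he hd h1', h1'⟩
    have hV : L.V e.2 (L.sign e) ≤ wCol T e.2 := by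
      obtain ⟨q, hq, hk, hβ⟩ := hc e.2 (Or.inl ⟨e, he, rfl, h1', hd⟩)
      rcases h.Y_eq hL hb he hi hq hβ with ⟨h', -⟩ | ⟨-, hY⟩
      · exact absurd hk h'
      · rw [← hY, ← hβ]
        exact le_wCol hq
    by_cases ce : Covered T e
    · rw [sup_eq_top_of_lines_le hL (by simp) hV (h.le_wCol_of_covered hL hi ce),
        finrank_top_space, if_pos ce]
    · rw [le_antisymm (h.wCol_le_of_not_covered hL hb he hi ce) hV, hL.dimV, if_neg ce]

theorem isIsolatedRankTwo_iff {e : Fin μ × Fin ν} :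
    IsIsolatedRankTwo A I e ↔ e ∈ I ∧ IsIso A I e := by
  unfold IsIsolatedRankTwo IsIso IsAlone
  rw [block_rank_eq_two_iff]
  have key : ∀ p : Fin μ × Fin ν → Prop, ∀ _ : DecidablePred p, p e → e ∈ I →
      ((I.filter p).card = 1 ↔ ∀ g ∈ I, p g → g = e) := by
    intro p _ hp he
    rw [Finset.card_eq_one]
    constructor
    · rintro ⟨a, ha⟩ g hg hpg
      have h1 : g ∈ I.filter p := by simp [hg, hpg]
      have h2 : e ∈ I.filter p := by simp [he, hp]
      rw [ha, Finset.mem_singleton] at h1 h2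
      rw [h1, h2]
    · intro h
      refine ⟨e, ?_⟩
      ext g
      simp only [Finset.mem_filter, Finset.mem_singleton]
      exact ⟨fun hg => h g hg.1 hg.2, by rintro rfl; exact ⟨he, hp⟩⟩
  constructor
  · rintro ⟨he, h1, h2, h3⟩
    exact ⟨he, h3, (key (·.1 = e.1) _ rfl he).1 h1, (key (·.2 = e.2) _ rfl he).1 h2⟩
  · rintro ⟨he, h3, h1, h2⟩
    exact ⟨he, (key (·.1 = e.1) _ rfl he).2 h1, (key (·.2 = e.2) _ rfl he).2 h2, h3⟩

/-- The codimensions at the rows and at the columns add up to `r(I)`, edge by edge. -/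
theorem IsForest.sum_finrank (hS : IsSearchLabeling A I L) (h : IsForest A I L T)
    (hc : ∀ β, IsStart A I β → ∃ q ∈ T, q.kind = 0 ∧ q.β = β) :
    rankFormula A I + ∑ α, Module.finrank F (wRow T α) +
      ∑ β, Module.finrank F (witnessCol I T β) = 2 * μ + 2 * ν := by
  classical
  have h1 : ∑ α, (Module.finrank F (wRow T α) + ∑ e ∈ I with e.1 = α, rowShare A I T e) =
      2 * μ := by
    rw [Finset.sum_congr rfl fun α _ => h.finrank_wRow hS.valid α]
    simp [mul_comm]
  have h2 : ∑ β, (Module.finrank F (witnessCol I T β) +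
      ∑ e ∈ I with e.2 = β, colShare A I T e) = 2 * ν := by
    rw [Finset.sum_congr rfl fun β _ => h.finrank_witnessCol hS hc β]
    simp [mul_comm]
  rw [Finset.sum_add_distrib, Finset.sum_fiberwise] at h1 h2
  have h3 : ∑ e ∈ I, rowShare A I T e + ∑ e ∈ I, colShare A I T e = rankFormula A I := by
    rw [← Finset.sum_add_distrib, rankFormula, Finset.card_eq_sum_ones, Finset.card_filter,
      ← Finset.sum_add_distrib]
    refine Finset.sum_congr rfl fun e he => ?_
    rw [rowShare, colShare]
    by_cases hi : IsIso A I e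
    · rw [if_pos hi, if_pos hi, if_pos (isIsolatedRankTwo_iff.2 ⟨he, hi⟩)]
      have := finrank_space_le (wRow T e.1)
      omega
    · rw [if_neg hi, if_neg hi, if_neg fun h' => hi (isIsolatedRankTwo_iff.1 h').2]
      by_cases ce : Covered T e <;> simp [ce]
  omega

theorem Handled.wRow_le (hS : IsSearchLabeling A I L) {α : Fin μ} {X : Space F}
    (h : Handled A I L T α X) : wRow T α ≤ X := by
  have hL := hS.valid
  obtain ⟨⟨e, he, rfl⟩, h⟩ := h
  by_cases hi : IsIso A I e
  · exact (h e he rfl).1 hi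
  obtain ⟨h1, h2⟩ := (h e he rfl).2 hi
  by_cases hf : ∃ f ∈ I, f.1 = e.1 ∧ f ≠ e
  · obtain ⟨f, hf, hfe, hne⟩ := hf
    have hs := hL.proper e he f hf hne.symm (Or.inl hfe.symm)
    obtain ⟨h3, -⟩ := (h f hf hfe).2 (not_isIso_of_ne he hne.symm (Or.inl hfe.symm))
    rw [not_eq_of_ne_bool hs.symm] at h3
    rw [Bool.not_not] at h3
    by_cases c1 : X = L.U e.1 (L.sign e)
    · rw [c1]
      exact h1 (by rw [c1]; exact hL.ne_not _ _)
    by_cases c2 : X = L.U e.1 (!L.sign e)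
    · rw [c2]
      exact h3 c1
    · rw [inf_eq_bot_of_le_lines hL (by simp) (h1 c2) (h3 c1)]
      exact bot_le
  · have hX := h2 fun f hf' hfe => by_contra fun hne => hf ⟨f, hf', hfe, hne⟩
    rw [hX]
    exact h1 (by rw [hX]; exact hL.ne_not _ _)

theorem IsForest.le_perpCol (hS : IsSearchLabeling A I L) (h : IsForest A I L T)
    (hc : IsCompleted A I L T) {α : Fin μ} {q : Item F μ ν} (hq : q ∈ T) :
    wRow T α ≤ perpCol (A α q.β) q.Y := by
  have hL := hS.valid
  by_cases hE : (α, q.β) ∈ edges A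
  swap
  · have hA : A α q.β = 0 := by simpa [edges] using hE
    rw [hA, perpCol_eq_top]
    · exact le_top
    · intro y _
      simp [mem_kerR]
  by_cases hk : q.Y ≤ kerR (A α q.β)
  · rw [perpCol_eq_top hk]
    exact le_top
  by_cases hI : (α, q.β) ∈ I
  swap
  · exact ((hc.expanded q hq).outer α _ ⟨hE, hI, hk, rfl⟩).wRow_le hS
  rw [← vanishes_iff_le_perpCol, vanishes_iff_le_perpRow]
  by_cases hi : IsIso A I (α, q.β)
  · have := h.wCol_of_iso hI hi
    dsimp only at this
    rw [← this]
    exact le_wCol hq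
  rcases h.Y_eq hL hS.block hI hi hq rfl with ⟨hk', hα, hY⟩ | ⟨hne, hY⟩
  · have := h.wRow_le_of_covered hL hi ⟨q, hq, hk', Prod.ext hα rfl⟩
    rw [hY]
    dsimp only at this ⊢
    exact (vanishes_iff_le_perpRow.1 (hL.vanish _ hI _)).trans (perpRow_anti this)
  · have hd : (A α q.β).det ≠ 0 := fun hd => hk (by
      rw [hY, (hL.kernel _ hI (block_rank_eq_one_iff.2 ⟨hS.block _ hI, hd⟩)).2])
    rcases h.item_mem hq with ⟨hk', hYk, h0, -⟩ | ⟨p, -, -, hs⟩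
    · exact absurd (alone_of_kerCol_ne_bot hI h0).2 hd
    have hne' : q.α ≠ α := hne.resolve_left hs.kind_ne
    have hni : ¬ IsIso A I (q.α, q.β) := not_isIso_of_ne hI
      (fun h' => hne' (congrArg Prod.fst h').symm) (Or.inr rfl)
    obtain ⟨g, hg, hg1, hgne⟩ : ∃ g ∈ I, g.1 = α ∧ g ≠ (α, q.β) := by
      by_contra! hcon
      have := hS.unique_col (α, q.β) hI hd (fun g hg h1 => hcon g hg h1) _ hs.mem rfl
      exact hne' (congrArg Prod.fst this)
    have hw := (hc.expanded q hq).inner (hs.of_not_iso hL hni).1 (α, q.β) hI rfl hne'.symm hd g hg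
      hg1 hgne
    have hsg := hL.proper g hg _ hI hgne (Or.inl hg1)
    rw [not_eq_of_ne_bool hsg] at hw
    subst hg1
    rw [hY]
    have hv := hL.vanish _ hI (!L.sign (g.1, q.β))
    rw [Bool.not_not] at hv
    exact (vanishes_iff_le_perpRow.1 hv).trans (perpRow_anti hw)

/-- A completed search yields an optimality witness. -/
theorem IsForest.isOptimalityWitness (hS : IsSearchLabeling A I L) (h : IsForest A I L T)
    (hc : IsCompleted A I L T) : IsOptimalityWitness A I (wRow T) (witnessCol I T) := by
  constructor
  · intro α β
    have key : Vanishes (A α β) (wRow T α) (wCol T β) := by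
      rw [vanishes_iff_le_perpRow]
      refine wCol_le.2 fun q hq hβ => ?_
      subst hβ
      rw [← vanishes_iff_le_perpRow, vanishes_iff_le_perpCol]
      exact h.le_perpCol hS hc hq
    unfold witnessCol
    split_ifs with hβ
    swap
    · exact key
    by_cases hA : A α β = 0
    · rw [hA]
      intro x _ y _
      simp
    obtain ⟨q, hq, hk, rfl⟩ := hc.roots β (Or.inr ⟨hβ, (α, β), by simpa [edges] using hA, rfl⟩)
    rcases h.item_mem hq with ⟨-, hY, -⟩ | ⟨p, -, -, hs⟩
    · rw [← kerCol_of_forall_ne (A := A) hβ, ← hY]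
      exact h.le_perpCol hS hc hq
    · exact absurd hk hs.kind_ne
  · have := h.sum_finrank hS hc.roots
    zify at this
    linarith

end Witness

/-! ### Space-walks from their pieces -/

section Pieces

variable {F : Type*} [Field F] {μ ν : ℕ}

/-- The last space of the inner space-walk `Q` is the first space of the outer space-walk `P`. -/
def InnerOuterLink (Q P : List (WalkStep F μ ν)) : Prop :=
  ∀ s ∈ Q.getLast?, ∀ t ∈ P.head?, s.β = t.β ∧ s.Y = t.Y

/-- The inner space-walk `Q` may follow the outer space-walk `P`. -/
def OuterInnerLink (L : Labeling F μ ν) (P Q : List (WalkStep F μ ν)) : Prop :=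
  ∀ s ∈ P.getLast?, ∀ t ∈ Q.head?,
    s.α = t.α ∧ ∀ σ, t.X = L.U t.α σ → s.X ≠ L.U t.α (!σ)

/-- The first outer space-walk of a concatenation. -/
def firstPiece (d : List (List (WalkStep F μ ν) × List (WalkStep F μ ν)))
    (P : List (WalkStep F μ ν)) : List (WalkStep F μ ν) :=
  match d with
  | [] => P
  | a :: _ => a.1

/-- The concatenation of the pairs of an outer and an inner space-walk in `d` and of the outer
space-walk `P`. -/
def SpaceWalk.ofPieces (d : List (List (WalkStep F μ ν) × List (WalkStep F μ ν)))
    (P : List (WalkStep F μ ν)) : SpaceWalk F μ ν where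
  m := d.length
  P i := if h : i.1 < d.length then d[i.1].1 else P
  Q i := d[i].2

theorem SpaceWalk.ofPieces_flatten (φ ψ : List (WalkStep F μ ν) → List (WalkStep F μ ν))
    (d : List (List (WalkStep F μ ν) × List (WalkStep F μ ν))) (P : List (WalkStep F μ ν)) :
    ψ ((ofPieces d P).P 0) ++ (List.ofFn fun i : Fin d.length =>
      φ ((ofPieces d P).Q i) ++ ψ ((ofPieces d P).P i.succ)).flatten =
      d.flatMap (fun a => ψ a.1 ++ φ a.2) ++ ψ P := by
  induction d with
  | nil => simp [ofPieces]
  | cons a d ih =>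
    have hd : (d.flatMap fun a => ψ a.1 ++ φ a.2) ++ ψ P = _ := ih.symm
    rw [List.flatMap_cons, List.append_assoc, hd]
    simp only [List.length_cons, List.ofFn_succ, List.flatten_cons, List.append_assoc]
    simp [ofPieces]
    rfl

theorem SpaceWalk.ofPieces_P_zero (d : List (List (WalkStep F μ ν) × List (WalkStep F μ ν)))
    (P : List (WalkStep F μ ν)) : (ofPieces d P).P 0 = firstPiece d P := by
  cases d <;> simp [ofPieces, firstPiece]

theorem SpaceWalk.steps_ofPieces (d : List (List (WalkStep F μ ν) × List (WalkStep F μ ν)))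
    (P : List (WalkStep F μ ν)) :
    (ofPieces d P).steps = d.flatMap (fun a => a.1 ++ a.2) ++ P :=
  ofPieces_flatten id id d P

theorem SpaceWalk.rowVisits_ofPieces (d : List (List (WalkStep F μ ν) × List (WalkStep F μ ν)))
    (P : List (WalkStep F μ ν)) :
    (ofPieces d P).rowVisits = d.flatMap (fun a => a.1 ++ a.2.tail) ++ P :=
  ofPieces_flatten List.tail id d P

theorem SpaceWalk.colVisits_ofPieces (d : List (List (WalkStep F μ ν) × List (WalkStep F μ ν)))
    (P : List (WalkStep F μ ν)) :
    (ofPieces d P).colVisits =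
      (firstPiece d P).take 1 ++ (d.flatMap (fun a => a.1.tail ++ a.2) ++ P.tail) := by
  have h := ofPieces_flatten id List.tail d P
  simp only [id] at h
  rw [← h, ← List.append_assoc, ← ofPieces_P_zero, ← List.drop_one,
    List.take_append_drop]
  rfl

variable {A : Blocks F μ ν} {I : Finset (Fin μ × Fin ν)} {L : Labeling F μ ν}

/-- The pieces `d`, `P` form the beginning of a space-walk that ends with the item `q`; the last
outer space-walk `P` may still be empty. -/
structure PartialWalk (A : Blocks F μ ν) (I : Finset (Fin μ × Fin ν)) (L : Labeling F μ ν)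
    (q : Item F μ ν) (d : List (List (WalkStep F μ ν) × List (WalkStep F μ ν)))
    (P : List (WalkStep F μ ν)) : Prop where
  pieces : ∀ a ∈ d, IsOuterSpaceWalk A I a.1 ∧ IsInnerSpaceWalk A I L a.2 ∧
    OuterInnerLink L a.1 a.2
  chain : d.IsChain fun a b => InnerOuterLink a.2 b.1
  outer : P ≠ [] → IsOuterSpaceWalk A I P
  link : ∀ a ∈ d.getLast?, InnerOuterLink a.2 P
  init : ∀ t ∈ (firstPiece d P).head?, t.Y = kerCol A I t.β ∧ kerCol A I t.β ≠ ⊥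
  tip_outer : ∀ s ∈ P.getLast?,
    IsIsolatedRankTwo A I (s.α, q.β) ∧ q.Y = perpRow (A s.α q.β) s.X
  tip_inner : P = [] → ∀ a ∈ d.getLast?, ∀ s ∈ a.2.getLast?, s.β = q.β ∧ s.Y = q.Y ∧ s.α = q.α
  tip_root : P = [] → d = [] → q.Y = kerCol A I q.β ∧ kerCol A I q.β ≠ ⊥
  tip_kind : 2 ≤ q.kind → P = [] ∧ d ≠ []

theorem PartialWalk.append_outer {p : Item F μ ν}
    {d : List (List (WalkStep F μ ν) × List (WalkStep F μ ν))} {P : List (WalkStep F μ ν)}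
    (h : PartialWalk A I L p d P) {α : Fin μ} {X : Space F} (ho : OuterTo A I p α X) :
    IsOuterSpaceWalk A I (P ++ [⟨α, p.β, X, p.Y⟩]) ∧
      (∀ a ∈ d.getLast?, InnerOuterLink a.2 (P ++ [⟨α, p.β, X, p.Y⟩])) ∧
      (∀ t ∈ (firstPiece d (P ++ [⟨α, p.β, X, p.Y⟩])).head?,
        t.Y = kerCol A I t.β ∧ kerCol A I t.β ≠ ⊥) := by
  refine ⟨⟨by simp, ?_, ?_⟩, ?_, ?_⟩
  · intro s hs
    rw [List.mem_append, List.mem_singleton] at hs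
    rcases hs with hs | rfl
    · exact (h.outer (List.ne_nil_of_mem hs)).2.1 s hs
    · exact ⟨ho.1, ho.2.1, ho.2.2.1, ho.2.2.2⟩
  · rw [List.isChain_append]
    refine ⟨?_, List.IsChain.singleton _, ?_⟩
    · by_cases hP : P = []
      · rw [hP]; exact List.IsChain.nil
      · exact (h.outer hP).2.2
    · intro s hs t ht
      simp only [List.head?_cons, Option.mem_def, Option.some.injEq] at ht
      subst ht
      exact h.tip_outer s hs
  · intro a ha s hs t ht
    cases hP : P with
    | nil =>
      rw [hP] at ht
      simp only [List.nil_append, List.head?_cons, Option.mem_def, Option.some.injEq] at ht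
      subst ht
      have := h.tip_inner hP a ha s hs
      exact ⟨this.1, this.2.1⟩
    | cons x P' =>
      refine h.link a ha s hs t ?_
      rw [hP] at ht ⊢
      exact ht
  · cases hd : d with
    | cons a d' =>
      intro t ht
      refine h.init t ?_
      rw [hd]
      exact ht
    | nil =>
      cases hP : P with
      | nil =>
        intro t ht
        simp only [firstPiece, List.nil_append, List.head?_cons, Option.mem_def,
          Option.some.injEq] at ht
        subst ht
        exact h.tip_root hP hd
      | cons x P' =>
        intro t ht
        refine h.init t ?_
        rw [hd, hP]
        exact ht

theorem firstPiece_append (d : List (List (WalkStep F μ ν) × List (WalkStep F μ ν)))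
    (a : List (WalkStep F μ ν) × List (WalkStep F μ ν)) (P : List (WalkStep F μ ν)) :
    firstPiece (d ++ [a]) P = firstPiece d a.1 := by
  cases d <;> rfl

theorem PartialWalk.iso {p q : Item F μ ν}
    {d : List (List (WalkStep F μ ν) × List (WalkStep F μ ν))} {P : List (WalkStep F μ ν)}
    (h : PartialWalk A I L p d P) (hk : q.kind = 1) (hI : (q.α, q.β) ∈ I)
    (hi : IsIso A I (q.α, q.β)) (ho : OuterTo A I p q.α q.X) (hY : q.Y = perpRow (A q.α q.β) q.X) :
    PartialWalk A I L q d (P ++ [⟨q.α, p.β, q.X, p.Y⟩]) := by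
  obtain ⟨h1, h2, h3⟩ := h.append_outer ho
  refine ⟨h.pieces, h.chain, fun _ => h1, h2, h3, ?_, by simp, by simp, by omega⟩
  intro s hs
  simp only [List.getLast?_append, List.getLast?_singleton, Option.some_or, Option.mem_def,
    Option.some.injEq] at hs
  subst hs
  exact ⟨isIsolatedRankTwo_iff.2 ⟨hI, hi⟩, hY⟩

theorem PartialWalk.enter (hS : IsSearchLabeling A I L) {p q : Item F μ ν}
    {d : List (List (WalkStep F μ ν) × List (WalkStep F μ ν))} {P : List (WalkStep F μ ν)}
    (h : PartialWalk A I L p d P) (hI : (q.α, q.β) ∈ I)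
    (hi : ¬ IsIso A I (q.α, q.β)) (ho : OuterTo A I p q.α q.X)
    (hX : q.X ≠ L.U q.α (!L.sign (q.α, q.β)))
    (hR : q.R = L.U q.α (L.sign (q.α, q.β))) (hY : q.Y = L.V q.β (!L.sign (q.α, q.β))) :
    PartialWalk A I L q
      (d ++ [(P ++ [⟨q.α, p.β, q.X, p.Y⟩], [⟨q.α, q.β, q.R, q.Y⟩])]) [] := by
  obtain ⟨h1, h2, h3⟩ := h.append_outer ho
  refine ⟨?_, ?_, by simp, ?_, ?_, by simp, ?_, by simp, by simp⟩
  · intro a ha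
    rw [List.mem_append, List.mem_singleton] at ha
    rcases ha with ha | rfl
    · exact h.pieces a ha
    refine ⟨h1, ⟨by simp, ?_, List.IsChain.singleton _⟩, ?_⟩
    · intro s hs
      rw [List.mem_singleton] at hs
      subst hs
      refine ⟨hI, hS.component _ hI ?_, hR, hY⟩
      by_contra hcon
      push Not at hcon
      exact hi hcon
    · intro s hs t ht
      simp only [List.getLast?_append, List.getLast?_singleton, Option.some_or, Option.mem_def,
        Option.some.injEq, List.head?_cons] at hs ht
      subst hs ht
      refine ⟨rfl, fun σ hσ => ?_⟩
      dsimp only at hσ ⊢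
      rw [hR] at hσ
      rw [← hS.valid.U_le_iff.1 hσ.le]
      exact hX
  · rw [List.isChain_append]
    refine ⟨h.chain, List.IsChain.singleton _, fun a ha b hb => ?_⟩
    simp only [List.head?_cons, Option.mem_def, Option.some.injEq] at hb
    subst hb
    exact h2 a ha
  · intro a _ s _ t ht
    simp at ht
  · rw [firstPiece_append]
    exact h3
  · intro _ a ha s hs
    simp only [List.getLast?_append, List.getLast?_singleton, Option.some_or, Option.mem_def,
      Option.some.injEq] at ha
    subst ha
    simp only [List.getLast?_singleton, Option.mem_def, Option.some.injEq] at hs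
    subst hs
    exact ⟨rfl, rfl, rfl⟩

theorem PartialWalk.extend (hS : IsSearchLabeling A I L) {p q : Item F μ ν}
    {d : List (List (WalkStep F μ ν) × List (WalkStep F μ ν))} {P Q : List (WalkStep F μ ν)}
    (h : PartialWalk A I L p (d ++ [(P, Q)]) []) (hI : (q.α, q.β) ∈ I) (hJ : (q.α, p.β) ∈ I)
    (hd : (A q.α p.β).det ≠ 0) (hα : q.α ≠ p.α) (hβ : q.β ≠ p.β)
    (hR : q.R = L.U q.α (L.sign (q.α, q.β))) (hY : q.Y = L.V q.β (!L.sign (q.α, q.β))) :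
    PartialWalk A I L q (d ++ [(P, Q ++ [⟨q.α, q.β, q.R, q.Y⟩])]) [] := by
  obtain ⟨h1, h2, h3⟩ := h.pieces (P, Q) (by simp)
  refine ⟨?_, ?_, by simp, ?_, ?_, by simp, ?_, by simp, by simp⟩
  · intro a ha
    rw [List.mem_append, List.mem_singleton] at ha
    rcases ha with ha | rfl
    · exact h.pieces a (List.mem_append_left _ ha)
    refine ⟨h1, ⟨by simp, ?_, ?_⟩, ?_⟩
    · intro s hs
      rw [List.mem_append, List.mem_singleton] at hs
      rcases hs with hs | rfl
      · exact h2.2.1 s hs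
      refine ⟨hI, hS.component _ hI (Or.inr fun hcon => ?_), hR, hY⟩
      exact hβ (congrArg Prod.snd (hcon.1 _ hJ rfl)).symm
    · rw [List.isChain_append]
      refine ⟨h2.2.2, List.IsChain.singleton _, fun s hs t ht => ?_⟩
      simp only [List.head?_cons, Option.mem_def, Option.some.injEq] at ht
      subst ht
      obtain ⟨e1, -, e2⟩ := h.tip_inner rfl (P, Q) (by simp) s hs
      dsimp only
      rw [e1, e2]
      exact ⟨hJ, block_rank_eq_two_iff.2 hd, hα.symm, hβ.symm⟩
    · intro s hs t ht
      refine h3 s hs t ?_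
      obtain ⟨x, Q', rfl⟩ := List.exists_cons_of_ne_nil h2.1
      exact ht
  · have hc := h.chain
    rw [List.isChain_append] at hc ⊢
    refine ⟨hc.1, List.IsChain.singleton _, fun a ha b hb => ?_⟩
    simp only [List.head?_cons, Option.mem_def, Option.some.injEq] at hb
    subst hb
    exact hc.2.2 a ha (P, Q) (by simp)
  · intro a _ s _ t ht
    simp at ht
  · have := h.init
    rw [firstPiece_append] at this ⊢
    exact this
  · intro _ a ha s hs
    simp only [List.getLast?_append, List.getLast?_singleton, Option.some_or, Option.mem_def,
      Option.some.injEq] at ha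
    subst ha
    simp only [List.getLast?_append, List.getLast?_singleton, Option.some_or, Option.mem_def,
      Option.some.injEq] at hs
    subst hs
    exact ⟨rfl, rfl, rfl⟩

end Pieces

/-! ### Augmenting space-walks from search forests -/

section PathWalk

variable {F : Type*} [Field F] {μ ν : ℕ}

/-- The row nodes visited by a beginning of a space-walk. -/
def rowsOf (d : List (List (WalkStep F μ ν) × List (WalkStep F μ ν)))
    (P : List (WalkStep F μ ν)) : List (WalkStep F μ ν) :=
  d.flatMap (fun a => a.1 ++ a.2.tail) ++ P

/-- The column nodes visited by a beginning of a space-walk, without its end if that is not the end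
of an inner space-walk. -/
def colsOf (d : List (List (WalkStep F μ ν) × List (WalkStep F μ ν)))
    (P : List (WalkStep F μ ν)) : List (WalkStep F μ ν) :=
  (firstPiece d P).take 1 ++ (d.flatMap (fun a => a.1.tail ++ a.2) ++ P.tail)

theorem colsOf_append (d : List (List (WalkStep F μ ν) × List (WalkStep F μ ν)))
    (P : List (WalkStep F μ ν)) (s : WalkStep F μ ν) (h : P ≠ [] ∨ d = []) :
    colsOf d (P ++ [s]) = colsOf d P ++ [s] := by
  cases P with
  | nil =>
    obtain rfl : d = [] := h.resolve_left (by simp)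
    simp [colsOf, firstPiece]
  | cons x P => cases d <;> simp [colsOf, firstPiece]

theorem colsOf_singleton (d : List (List (WalkStep F μ ν) × List (WalkStep F μ ν)))
    (s : WalkStep F μ ν) (h : d ≠ []) : colsOf d [s] = colsOf d [] := by
  obtain ⟨a, d', rfl⟩ := List.exists_cons_of_ne_nil h
  simp [colsOf, firstPiece]

theorem colsOf_append_pair (d : List (List (WalkStep F μ ν) × List (WalkStep F μ ν)))
    (P Q : List (WalkStep F μ ν)) : colsOf (d ++ [(P, Q)]) [] = colsOf d P ++ Q := by
  simp [colsOf, firstPiece_append]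

/-- `S` is the list of the steps on the path of the search forest `T` from a root to the item at
position `i`. -/
inductive PathSteps (T : List (Item F μ ν)) : ℕ → List (WalkStep F μ ν) → Prop
  | root {i q} (hq : T[i]? = some q) (hk : q.kind = 0) : PathSteps T i []
  | iso {i q p S} (hq : T[i]? = some q) (hp : T[q.par]? = some p) (hk : q.kind = 1)
      (h : PathSteps T q.par S) : PathSteps T i (S ++ [⟨q.α, p.β, q.X, p.Y⟩])
  | enter {i q p S} (hq : T[i]? = some q) (hp : T[q.par]? = some p) (hk : q.kind = 2)
      (h : PathSteps T q.par S) :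
      PathSteps T i (S ++ [⟨q.α, p.β, q.X, p.Y⟩, ⟨q.α, q.β, q.R, q.Y⟩])
  | extend {i q p S} (hq : T[i]? = some q) (hp : T[q.par]? = some p) (hk : q.kind = 3)
      (h : PathSteps T q.par S) : PathSteps T i (S ++ [⟨q.α, q.β, q.R, q.Y⟩])

variable {A : Blocks F μ ν} {I : Finset (Fin μ × Fin ν)} {L : Labeling F μ ν}
  {T : List (Item F μ ν)}

/-- The pieces `d`, `P` are those of the path `l` of the search forest `T` from a root to the item
`q` at position `i`. -/
structure IsPathTo (A : Blocks F μ ν) (I : Finset (Fin μ × Fin ν)) (L : Labeling F μ ν)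
    (T : List (Item F μ ν)) (i : ℕ) (q : Item F μ ν)
    (d : List (List (WalkStep F μ ν) × List (WalkStep F μ ν))) (P : List (WalkStep F μ ν))
    (l : List (Item F μ ν)) : Prop where
  walk : PartialWalk A I L q d P
  kind : P = [] → d ≠ [] → 2 ≤ q.kind
  steps : PathSteps T i (d.flatMap (fun a => a.1 ++ a.2) ++ P)
  length : (d.flatMap (fun a => a.1 ++ a.2) ++ P).length = q.len
  rows : (rowsOf d P).map (fun s => (s.α, s.X)) = l.tail.map fun r => (r.α, r.X)
  cols : (colsOf d P).map (fun s => (s.β, s.Y)) =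
    (if 2 ≤ q.kind then l else l.dropLast).map fun r => (r.β, r.Y)
  last : ∃ l', l = l' ++ [q]
  sub : l.Sublist (T.take (i + 1))
  nonroot : ∀ r ∈ l.tail, r.kind ≠ 0
  pars : l.tail.Pairwise fun s t => s.par < t.par
  par_lt : ∀ r ∈ l.tail, r.par < i

/-- The column visits after a further outer step from the last item of the path. -/
theorem IsPathTo.cols_append {i : ℕ} {p : Item F μ ν}
    {d : List (List (WalkStep F μ ν) × List (WalkStep F μ ν))} {P : List (WalkStep F μ ν)}
    {l : List (Item F μ ν)} (h : IsPathTo A I L T i p d P l) (α : Fin μ) (X : Space F) :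
    (colsOf d (P ++ [⟨α, p.β, X, p.Y⟩])).map (fun s => (s.β, s.Y)) =
      l.map fun r => (r.β, r.Y) := by
  have hc := h.cols
  by_cases hk : 2 ≤ p.kind
  · obtain ⟨rfl, hd⟩ := h.walk.tip_kind hk
    rw [List.nil_append, colsOf_singleton _ _ hd, hc, if_pos hk]
  · have hP : P ≠ [] ∨ d = [] := by
      by_contra! hcon
      exact hk (h.kind hcon.1 hcon.2)
    rw [colsOf_append _ _ _ hP, List.map_append, hc, if_neg hk]
    obtain ⟨l', rfl⟩ := h.last
    simp

/-- By recursion over the parents, every item is the end of a path of the search forest. -/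
theorem IsForest.exists_path (hS : IsSearchLabeling A I L) (h : IsForest A I L T) (i : ℕ)
    (q : Item F μ ν) (hq : T[i]? = some q) : ∃ d P l, IsPathTo A I L T i q d P l := by
  induction i using Nat.strong_induction_on generalizing q with
  | _ i ih =>
    rcases h.item hq with ⟨hk, hY, h0, hl⟩ | ⟨p, hp, hlt, hs⟩
    · refine ⟨[], [], [q], ⟨by simp, List.IsChain.nil, by simp, by simp, by simp [firstPiece],
        by simp, by simp, fun _ _ => ⟨hY, h0⟩, by omega⟩, by simp, ?_, by simp [hl],
        by simp [rowsOf], ?_, ⟨[], rfl⟩, ?_, by simp, by simp, by simp⟩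
      · exact PathSteps.root hq hk
      · rw [if_neg (by omega)]
        simp [colsOf, firstPiece]
      · rw [List.singleton_sublist]
        obtain ⟨hi, rfl⟩ := List.getElem?_eq_some_iff.1 hq
        exact List.mem_take_iff_getElem.2 ⟨i, by omega, rfl⟩
    obtain ⟨d, P, l, hpath⟩ := ih _ hlt p hp
    have hcols := hpath.cols_append q.α q.X
    obtain ⟨hwalk, hkind, hsteps, hlen, hrows, hcols', ⟨l', hl'⟩, hsub, hnon, hpars, hplt⟩ := hpath
    have htail : (l ++ [q]).tail = l.tail ++ [q] := by
      rw [hl']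
      cases l' <;> simp
    have hsub' : (l ++ [q]).Sublist (T.take (i + 1)) := by
      obtain ⟨hi, rfl⟩ := List.getElem?_eq_some_iff.1 hq
      rw [List.take_succ_eq_append_getElem hi]
      exact (hsub.trans (List.take_sublist_take_left (by omega))).append_right _
    have hnon' : ∀ r ∈ (l ++ [q]).tail, r.kind ≠ 0 := by
      rw [htail]
      intro r hr
      rw [List.mem_append, List.mem_singleton] at hr
      rcases hr with hr | rfl
      exacts [hnon r hr, hs.kind_ne]
    have hpars' : (l ++ [q]).tail.Pairwise fun s t => s.par < t.par := by
      rw [htail, List.pairwise_append]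
      refine ⟨hpars, List.pairwise_singleton _ _, fun a ha b hb => ?_⟩
      rw [List.mem_singleton] at hb
      subst hb
      exact hplt a ha
    have hplt' : ∀ r ∈ (l ++ [q]).tail, r.par < i := by
      rw [htail]
      intro r hr
      rw [List.mem_append, List.mem_singleton] at hr
      rcases hr with hr | rfl
      exacts [(hplt r hr).trans hlt, hlt]
    cases hs with
    | iso hk hI hiso ho hR hY hl =>
      refine ⟨d, P ++ [⟨q.α, p.β, q.X, p.Y⟩], l ++ [q], hwalk.iso hk hI hiso ho hY, by simp, ?_, ?_,
        ?_, ?_, ⟨l, rfl⟩, hsub', hnon', hpars', hplt'⟩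
      · rw [← List.append_assoc]
        exact PathSteps.iso hq hp hk hsteps
      · rw [← List.append_assoc, List.length_append, hlen, hl]
        rfl
      · rw [htail, List.map_append, ← hrows]
        simp [rowsOf]
      · rw [hcols, if_neg (by omega), List.dropLast_concat]
    | enter hk hI hiso ho hX h1 hR hY hl =>
      refine ⟨_, _, l ++ [q], hwalk.enter hS hI hiso ho hX hR hY, fun _ _ => hk.ge, ?_, ?_,
        ?_, ?_, ⟨l, rfl⟩, hsub', hnon', hpars', hplt'⟩
      · have := PathSteps.enter hq hp hk hsteps
        simpa [List.append_assoc] using this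
      · rw [hl, ← hlen]
        simp
        omega
      · rw [htail, List.map_append, ← hrows]
        simp [rowsOf]
      · rw [colsOf_append_pair, List.map_append, hcols, if_pos hk.ge]
        simp
    | extend hk hI hp2 hJ hd hα hβ hX hR hY hl =>
      obtain ⟨rfl, hne⟩ := hwalk.tip_kind hp2
      obtain ⟨d', ⟨P', Q'⟩, rfl⟩ : ∃ d' a, d = d' ++ [a] :=
        ⟨d.dropLast, d.getLast hne, (List.dropLast_append_getLast hne).symm⟩
      have hQ : Q' ≠ [] := (hwalk.pieces (P', Q') (by simp)).2.1.1
      refine ⟨_, _, l ++ [q], hwalk.extend hS hI hJ hd hα hβ hR hY, fun _ _ => by omega, ?_, ?_,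
        ?_, ?_, ⟨l, rfl⟩, hsub', hnon', hpars', hplt'⟩
      · have := PathSteps.extend hq hp hk hsteps
        simpa [List.append_assoc] using this
      · rw [hl, ← hlen]
        simp
        omega
      · rw [htail, List.map_append, ← hrows]
        obtain ⟨x, Q'', rfl⟩ := List.exists_cons_of_ne_nil hQ
        simp [rowsOf, hX]
      · rw [colsOf_append_pair] at hcols' ⊢
        rw [← List.append_assoc, List.map_append, hcols', if_pos hp2, if_pos (by omega)]
        simp

/-- A path of the search forest and an outer step to a row node with a nonzero kernel that differs
from the last space form an augmenting space-walk. -/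
theorem IsForest.exists_augmenting (hS : IsSearchLabeling A I L) (h : IsForest A I L T) {i : ℕ}
    {p : Item F μ ν} (hp : T[i]? = some p) {α : Fin μ} {X : Space F} (ho : OuterTo A I p α X)
    (hX : X ≠ kerRow A I α) (hk : kerRow A I α ≠ ⊥) :
    ∃ (W : SpaceWalk F μ ν) (S : List (WalkStep F μ ν)), PathSteps T i S ∧ S.length = p.len ∧
      W.steps = S ++ [⟨α, p.β, X, p.Y⟩] ∧ W.IsAugmenting A I := by
  have hL := hS.valid
  obtain ⟨d, P, l, hl⟩ := h.exists_path hS i p hp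
  obtain ⟨h1, h2, h3⟩ := hl.walk.append_outer ho
  have hsub : l.Sublist T := hl.sub.trans (List.take_sublist _ _)
  have hXtop : X ≠ ⊤ := by
    rw [ho.2.2.2]
    exact perpCol_ne_top ho.2.2.1
  -- at most one item enters from the last row node, and its space is the kernel of that node
  have hend : (T.filter fun q => q.kind ≠ 0 ∧ q.α = α).length ≤ 1 ∧
      ∀ q ∈ T, q.kind ≠ 0 → q.α = α → ¬ q.X ≤ X := by
    by_cases h0 : ∃ e ∈ I, e.1 = α
    · obtain ⟨e, he, rfl⟩ := h0
      have hal : ∀ f ∈ I, f.1 = e.1 → f = e := by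
        intro f hf hfe
        by_contra hne
        apply hk
        rw [kerRow, if_neg]
        rw [not_le, degRow, Finset.one_lt_card]
        exact ⟨f, by simp [hf, hfe], e, by simp [he], hne⟩
      have hd : (A e.1 e.2).det = 0 := by
        by_contra hd
        exact hk (by rw [kerRow_of_alone he hal, kerL_eq_bot hd])
      have hni : ¬ IsIso A I e := fun h' => h'.1 hd
      have hker : kerRow A I e.1 = L.U e.1 (L.sign e) := by
        rw [kerRow_of_alone he hal]
        exact (hL.kernel e he (block_rank_eq_one_iff.2 ⟨hS.block e he, hd⟩)).1
      constructor
      · have h4 := h.length_row_le e.1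
        have h5 := Submodule.finrank_mono (h.le_wRow_of_not_covered hL hni fun f hf hfe hne =>
          absurd (hal f hf hfe) hne)
        rw [hL.dimU] at h5
        omega
      · intro q hq hqk hqα hle
        obtain ⟨r, -, -, hs⟩ := h.exists_step hq hqk
        obtain rfl := hal _ hs.mem hqα
        rw [(hs.of_not_iso hL hni).2.2.2.2 hal] at hle
        apply hX
        rw [hker]
        refine (Submodule.eq_of_le_of_finrank_le hle ?_).symm
        rw [hL.dimU]
        by_contra hlt
        exact hXtop (finrank_eq_two_space.1 (le_antisymm (finrank_space_le X) (by omega)))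
    · have hno : ∀ q ∈ T, q.kind ≠ 0 → q.α ≠ α := by
        intro q hq hqk hqα
        obtain ⟨r, -, -, hs⟩ := h.exists_step hq hqk
        exact h0 ⟨_, hs.mem, hqα⟩
      constructor
      · rw [List.filter_eq_nil_iff.2]
        · simp
        · intro q hq
          simpa using hno q hq
      · exact fun q hq hqk hqα => absurd hqα (hno q hq hqk)
  have hrows : (rowsOf d (P ++ [⟨α, p.β, X, p.Y⟩])).map (fun s => (s.α, s.X)) =
      (l.tail.map fun r => (r.α, r.X)) ++ [(α, X)] := by
    rw [← hl.rows]
    simp [rowsOf]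
  have hcols := hl.cols_append α X
  refine ⟨SpaceWalk.ofPieces d (P ++ [⟨α, p.β, X, p.Y⟩]), _, hl.steps, hl.length, ?_, ⟨?_, ?_, ?_, ?_⟩,
    L, hL, ?_, ?_, ?_, ?_, ?_, ?_⟩
  · rw [SpaceWalk.steps_ofPieces, List.append_assoc]
  · intro α'
    rw [SpaceWalk.rowVisits_ofPieces]
    change ((rowsOf d _).filter _).length ≤ 2
    have e1 : ((rowsOf d (P ++ [⟨α, p.β, X, p.Y⟩])).filter fun s => s.α = α').length =
        (((rowsOf d (P ++ [⟨α, p.β, X, p.Y⟩])).map (fun s => (s.α, s.X))).filter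
          fun s => s.1 = α').length := by
      rw [List.filter_map, List.length_map]
      rfl
    rw [e1, hrows, List.filter_append, List.length_append, List.filter_map, List.length_map]
    have e2 : (l.tail.filter ((fun s : Fin μ × Space F => decide (s.1 = α')) ∘
        fun r => (r.α, r.X))).length ≤ (T.filter fun q => q.kind ≠ 0 ∧ q.α = α').length := by
      have e3 : l.tail.filter ((fun s : Fin μ × Space F => decide (s.1 = α')) ∘
        fun r => (r.α, r.X)) = l.tail.filter fun q => q.kind ≠ 0 ∧ q.α = α' := by
        apply List.filter_congr
        intro r hr
        simp [hl.nonroot r hr]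
      rw [e3]
      exact (((List.tail_sublist l).trans hsub).filter _).length_le
    by_cases hα : α = α'
    · subst hα
      have := hend.1
      simp only [List.filter_singleton, decide_true, cond_true, List.length_singleton]
      omega
    · have := h.length_row_le α'
      simp only [List.filter_singleton, hα, decide_false, cond_false, List.length_nil]
      omega
  · intro β
    rw [SpaceWalk.colVisits_ofPieces]
    change ((colsOf d _).filter _).length ≤ 2
    have e1 : ((colsOf d (P ++ [⟨α, p.β, X, p.Y⟩])).filter fun s => s.β = β).length =
        (((colsOf d (P ++ [⟨α, p.β, X, p.Y⟩])).map (fun s => (s.β, s.Y))).filter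
          fun s => s.1 = β).length := by
      rw [List.filter_map, List.length_map]
      rfl
    rw [e1, hcols, List.filter_map, List.length_map]
    exact ((hsub.filter _).length_le).trans (h.length_col_le hL hS.block β)
  · rw [SpaceWalk.rowVisits_ofPieces]
    change (rowsOf d _).Pairwise _
    have e1 : ((rowsOf d (P ++ [⟨α, p.β, X, p.Y⟩])).map (fun s => (s.α, s.X))).Pairwise
        fun s t => s.1 = t.1 → ¬ s.2 ≤ t.2 := by
      rw [hrows, List.pairwise_append]
      refine ⟨?_, List.pairwise_singleton _ _, ?_⟩
      · rw [List.pairwise_map]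
        have := (h.pairwise_X.sublist ((List.tail_sublist l).trans hsub)).and hl.pars
        refine this.imp_of_mem fun {a b} ha hb hab hα hle => ?_
        exact absurd (hab.1 (hl.nonroot a ha) (hl.nonroot b hb) hα hle) hab.2.ne
      · intro a ha b hb hab
        rw [List.mem_singleton] at hb
        subst hb
        obtain ⟨r, hr, rfl⟩ := List.mem_map.1 ha
        exact hend.2 r (hsub.subset (List.mem_of_mem_tail hr)) (hl.nonroot r hr) hab
    rw [List.pairwise_map] at e1
    exact e1
  · rw [SpaceWalk.colVisits_ofPieces]
    change (colsOf d _).Pairwise _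
    have e1 : ((colsOf d (P ++ [⟨α, p.β, X, p.Y⟩])).map (fun s => (s.β, s.Y))).Pairwise
        fun s t => s.1 = t.1 → ¬ t.2 ≤ s.2 := by
      rw [hcols, List.pairwise_map]
      exact (h.pairwise_Y hL hS.block).sublist hsub
    rw [List.pairwise_map] at e1
    exact e1
  · intro j
    dsimp only [SpaceWalk.ofPieces]
    split_ifs with hj
    · exact (hl.walk.pieces _ (List.getElem_mem hj)).1
    · exact h1
  · intro j
    exact (hl.walk.pieces _ (List.getElem_mem j.2)).2.1
  · intro j
    have hj : (j : ℕ) < d.length := j.2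
    by_cases hj' : (j : ℕ) + 1 < d.length
    · have e1 : (SpaceWalk.ofPieces d (P ++ [⟨α, p.β, X, p.Y⟩])).P j.succ = d[(j : ℕ) + 1].1 :=
        dif_pos hj'
      rw [e1]
      exact List.isChain_iff_getElem.1 hl.walk.chain j hj'
    · have e1 : (SpaceWalk.ofPieces d (P ++ [⟨α, p.β, X, p.Y⟩])).P j.succ =
          P ++ [⟨α, p.β, X, p.Y⟩] := dif_neg hj'
      rw [e1]
      refine h2 d[(j : ℕ)] ?_
      rw [List.getLast?_eq_getElem?, show d.length - 1 = j by omega]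
      exact List.getElem?_eq_getElem hj
  · intro j
    have hj : (j : ℕ) < d.length := j.2
    have e1 : (SpaceWalk.ofPieces d (P ++ [⟨α, p.β, X, p.Y⟩])).P j.castSucc = d[(j : ℕ)].1 :=
      dif_pos hj
    rw [e1]
    exact (hl.walk.pieces _ (List.getElem_mem hj)).2.2
  · rw [SpaceWalk.ofPieces_P_zero]
    exact h3
  · intro s hs
    simp only [SpaceWalk.ofPieces, Fin.val_last, lt_irrefl, dite_false, List.getLast?_append,
      List.getLast?_singleton, Option.some_or, Option.mem_def, Option.some.injEq] at hs
    subst hs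
    exact ⟨hX, hk⟩

end PathWalk

/-! ### Scanning the list of edges -/

namespace Ram

/-- The `i`-th register: the cell `i` of the array `20`. -/
@[simp] def reg (i : ℕ) : NExpr := .get 20 (.const i)

/-- The successor of a number. -/
@[simp] def NExpr.succ (x : NExpr) : NExpr := .add x (.const 1)

/-- Enter the edge in register 0 into the data of its end nodes. For the edges of `I` at a node, the
arrays `13` (rows) and `15` (columns) hold the sum of their positions, counted from one, and the
array `14` the last position at a row. A column with an edge of `I` gets the zero space. The edges
outside `I` at a column form a linked list with its head in the array `11` and the links in the
array `12`, from the last one to the first one, where `0` stands for the end. -/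
def scanBody : Prog := .block
  [.cond (.eq (.get 3 (reg 0)) (.const 1))
    (.block
      [.setN 13 (.get 1 (reg 0)) (.add (.get 13 (.get 1 (reg 0))) (reg 0).succ),
       .setN 14 (.get 1 (reg 0)) (reg 0).succ,
       .setN 15 (.get 2 (reg 0)) (.add (.get 15 (.get 2 (reg 0))) (reg 0).succ),
       .setN 6 (.get 2 (reg 0)) (.const 2)])
    (.block
      [.setN 12 (reg 0) (.get 11 (.get 2 (reg 0))),
       .setN 11 (.get 2 (reg 0)) (reg 0).succ]),
   .setN 20 (.const 0) (reg 0).succ]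

/-- Enter all edges into the data of their end nodes. -/
def scan : Prog := .loop (.lt (reg 0) (.get 0 (.const 0))) scanBody

/-- The sum of `k + 1` over the positions `k < m` of marked edges at the node `a`. -/
def nodeSum (M R : ℕ → ℕ) (a m : ℕ) : ℕ :=
  ∑ k ∈ Finset.range m, if M k = 1 ∧ R k = a then k + 1 else 0

open Classical in
/-- The last number below `m` with the property `p`, plus one, and zero if there is none. -/
noncomputable def lastBelow (p : ℕ → Prop) : ℕ → ℕ
  | 0 => 0
  | m + 1 => if p m then m + 1 else lastBelow p m

theorem lastBelow_spec (p : ℕ → Prop) (m : ℕ) :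
    (lastBelow p m = 0 ∨ ∃ k < m, p k ∧ lastBelow p m = k + 1) ∧
      ∀ k < m, lastBelow p m ≤ k → ¬ p k := by
  induction m with
  | zero => simp [lastBelow]
  | succ m ih =>
    rw [lastBelow]
    split_ifs with h
    · exact ⟨Or.inr ⟨m, by omega, h, rfl⟩, fun k hk hk' => by omega⟩
    · refine ⟨ih.1.imp_right fun ⟨k, hk, h'⟩ => ⟨k, by omega, h'⟩, fun k hk hk' => ?_⟩
      rcases (show k < m ∨ k = m by omega) with hk | rfl
      · exact ih.2 k hk hk'
      · exact h

variable {F : Type*} [Field F]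

/-- The result of scanning the first `m` edges. -/
structure Scanned (σ₀ : State F) (m : ℕ) (σ : State F) : Prop where
  fld : σ.fld = σ₀.fld
  nat : ∀ a, a ≠ 6 → a ≠ 20 → (a < 11 ∨ 15 < a) → σ.nat a = σ₀.nat a
  counter : σ.nat 20 0 = m
  regs : ∀ i, i ≠ 0 → σ.nat 20 i = σ₀.nat 20 i
  rowSum : ∀ a, σ.nat 13 a = nodeSum (σ₀.nat 3) (σ₀.nat 1) a m
  rowLast : ∀ a, σ.nat 14 a = lastBelow (fun k => σ₀.nat 3 k = 1 ∧ σ₀.nat 1 k = a) m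
  colSum : ∀ a, σ.nat 15 a = nodeSum (σ₀.nat 3) (σ₀.nat 2) a m
  head : ∀ a, σ.nat 11 a = lastBelow (fun k => σ₀.nat 3 k ≠ 1 ∧ σ₀.nat 2 k = a) m
  next : ∀ k < m, σ₀.nat 3 k ≠ 1 →
    σ.nat 12 k = lastBelow (fun j => σ₀.nat 3 j ≠ 1 ∧ σ₀.nat 2 j = σ₀.nat 2 k) k
  col : ∀ a, σ.nat 6 a = if ∃ k < m, σ₀.nat 3 k = 1 ∧ σ₀.nat 2 k = a then 2 else 0

theorem Scanned.step {σ₀ σ : State F} {m : ℕ} (h : Scanned σ₀ m σ) :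
    scanBody.wp (Scanned σ₀ (m + 1)) σ := by
  have e1 : σ.nat 1 = σ₀.nat 1 := h.nat 1 (by omega) (by omega) (by omega)
  have e2 : σ.nat 2 = σ₀.nat 2 := h.nat 2 (by omega) (by omega) (by omega)
  have e3 : σ.nat 3 = σ₀.nat 3 := h.nat 3 (by omega) (by omega) (by omega)
  have hex : ∀ a, (∃ k < m + 1, σ₀.nat 3 k = 1 ∧ σ₀.nat 2 k = a) ↔
      (σ₀.nat 3 m = 1 ∧ σ₀.nat 2 m = a) ∨ ∃ k < m, σ₀.nat 3 k = 1 ∧ σ₀.nat 2 k = a := by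
    intro a
    constructor
    · rintro ⟨k, hk, h'⟩
      rcases (show k < m ∨ k = m by omega) with hk | rfl
      exacts [Or.inr ⟨k, hk, h'⟩, Or.inl h']
    · rintro (h' | ⟨k, hk, h'⟩)
      exacts [⟨m, by omega, h'⟩, ⟨k, by omega, h'⟩]
  have hr : ∀ a, nodeSum (σ₀.nat 3) (σ₀.nat 1) a (m + 1) =
      σ.nat 13 a + if σ₀.nat 3 m = 1 ∧ σ₀.nat 1 m = a then m + 1 else 0 := fun a => by
    rw [h.rowSum, nodeSum, Finset.sum_range_succ]
    rfl
  have hc : ∀ a, nodeSum (σ₀.nat 3) (σ₀.nat 2) a (m + 1) =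
      σ.nat 15 a + if σ₀.nat 3 m = 1 ∧ σ₀.nat 2 m = a then m + 1 else 0 := fun a => by
    rw [h.colSum, nodeSum, Finset.sum_range_succ]
    rfl
  have hnat : ∀ a, a ≠ 6 → a ≠ 20 → (a < 11 ∨ 15 < a) →
      σ.nat a = σ₀.nat a ∧ a ≠ 11 ∧ a ≠ 12 ∧ a ≠ 13 ∧ a ≠ 14 ∧ a ≠ 15 := fun a h6 h20 ha =>
    ⟨h.nat a h6 h20 ha, by omega, by omega, by omega, by omega, by omega⟩
  simp only [scanBody, Prog.block, Prog.wp, Test.Holds, NExpr.eval, reg, NExpr.succ]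
  refine ⟨fun hm => ?_, fun hm => ?_⟩ <;> rw [h.counter, e3] at hm <;> constructor <;>
    simp only [State.nat_setN, State.fld_setN, h.counter, e1, e2, Function.update_apply, h.fld,
      if_true, if_false, Nat.reduceEqDiff, hr, hc, hex, lastBelow]
  · intro a h6 h20 ha
    obtain ⟨h0, h1, h2, h3, h4, h5⟩ := hnat a h6 h20 ha
    simp only [h0, h20, h6, h3, h4, h5, if_false]
  · exact fun i hi => (if_neg hi).trans (h.regs i hi)
  · grind
  · intro a
    rw [← h.rowLast]
    grind
  · grind
  · intro a
    rw [← h.head]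
    grind
  · intro k hk hk'
    exact h.next k (by grind) hk'
  · intro a
    rw [h.col]
    grind
  · intro a h6 h20 ha
    obtain ⟨h0, h1, h2, h3, h4, h5⟩ := hnat a h6 h20 ha
    simp only [h0, h20, h1, h2, if_false]
  · exact fun i hi => (if_neg hi).trans (h.regs i hi)
  · grind
  · intro a
    rw [← h.rowLast]
    grind
  · grind
  · intro a
    rw [← h.head]
    grind
  · intro k hk hk'
    by_cases hkm : k = m
    · rw [if_pos hkm, hkm, h.head]
    · rw [if_neg hkm, h.next k (by omega) hk']
  · intro a
    rw [h.col]
    grind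

theorem triple_scan (σ₀ : State F) (h0 : σ₀.nat 20 0 = 0) (h6 : ∀ i, σ₀.nat 6 i = 0)
    (h1 : ∀ a i, 10 < a → a < 16 → σ₀.nat a i = 0) :
    Triple (fun σ => σ = σ₀) scan ((5 + scanBody.bound) * σ₀.nat 0 0 + 5)
      (Scanned σ₀ (σ₀.nat 0 0)) := by
  have hl := Triple.loop (b := .lt (reg 0) (.get 0 (.const 0))) (p := scanBody)
    (N := σ₀.nat 0 0) (J := fun i σ => Scanned σ₀ i σ ∧ i ≤ σ₀.nat 0 0) (fun i σ h => h.2)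
    (fun i σ h hb => by
      simp only [Test.Holds, reg, NExpr.eval, h.1.counter] at hb
      rw [h.1.nat 0 (by omega) (by omega) (by omega)] at hb
      exact Prog.wp_mono h.1.step fun τ hτ => ⟨hτ, hb⟩)
  intro σ hσ
  subst hσ
  obtain ⟨t, τ, hex, ht, ⟨i, hi, hle⟩, hb⟩ := hl σ ⟨0, ⟨rfl, fun _ _ _ _ => rfl, h0,
    fun _ _ => rfl, fun a => h1 _ a (by omega) (by omega), fun a => h1 _ a (by omega) (by omega),
    fun a => h1 _ a (by omega) (by omega), fun a => h1 _ a (by omega) (by omega), by simp,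
    fun a => by simp [h6]⟩, Nat.zero_le _⟩
  refine ⟨t, τ, hex, ht, ?_⟩
  simp only [Test.Holds, reg, NExpr.eval, hi.counter] at hb
  rw [hi.nat 0 (by omega) (by omega) (by omega)] at hb
  obtain rfl : i = σ.nat 0 0 := by omega
  exact hi

end Ram

/-! ### The edges and their positions in the list -/

namespace Ram

variable {F : Type*} [Field F] {μ ν : ℕ} {A : Blocks F μ ν} {I : Finset (Fin μ × Fin ν)}
  {enum : Fin (edges A).card ≃ {e // e ∈ edges A}}

/-- The edge `e` is at position `k` of the list of edges. -/
def EdgeAt (enum : Fin (edges A).card ≃ {e // e ∈ edges A}) (k : ℕ) (e : Fin μ × Fin ν) : Prop :=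
  ∃ h : k < (edges A).card, (enum ⟨k, h⟩).1 = e

theorem EdgeAt.lt {k : ℕ} {e : Fin μ × Fin ν} (h : EdgeAt enum k e) : k < (edges A).card := h.1

theorem EdgeAt.mem {k : ℕ} {e : Fin μ × Fin ν} (h : EdgeAt enum k e) : e ∈ edges A := by
  obtain ⟨h, rfl⟩ := h
  exact (enum _).2

theorem EdgeAt.eq {k : ℕ} {e f : Fin μ × Fin ν} (h : EdgeAt enum k e) (h' : EdgeAt enum k f) :
    e = f := by
  obtain ⟨_, rfl⟩ := h
  obtain ⟨_, rfl⟩ := h'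
  rfl

theorem EdgeAt.inj {j k : ℕ} {e : Fin μ × Fin ν} (h : EdgeAt enum j e) (h' : EdgeAt enum k e) :
    j = k := by
  obtain ⟨_, h1⟩ := h
  obtain ⟨_, h2⟩ := h'
  have := enum.injective (Subtype.ext (h1.trans h2.symm))
  exact congrArg Fin.val this

theorem exists_edgeAt (enum : Fin (edges A).card ≃ {e // e ∈ edges A}) {k : ℕ}
    (h : k < (edges A).card) : ∃ e, EdgeAt enum k e := ⟨_, h, rfl⟩

theorem exists_pos (enum : Fin (edges A).card ≃ {e // e ∈ edges A}) {e : Fin μ × Fin ν}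
    (h : e ∈ edges A) : ∃ k, EdgeAt enum k e :=
  ⟨enum.symm ⟨e, h⟩, (enum.symm ⟨e, h⟩).2, by simp⟩

/-- The edge at position `k` is an edge outside `I` at the column node `β`. -/
def OffEdge (enum : Fin (edges A).card ≃ {e // e ∈ edges A}) (I : Finset (Fin μ × Fin ν))
    (β : Fin ν) (k : ℕ) : Prop := ∃ e, EdgeAt enum k e ∧ e ∉ I ∧ e.2 = β

/-- The input and the data of the nodes are in the memory. -/
structure Indexed (I : Finset (Fin μ × Fin ν)) (enum : Fin (edges A).card ≃ {e // e ∈ edges A})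
    (σ : State F) : Prop where
  num : σ.nat 0 0 = (edges A).card
  row : ∀ {k e}, EdgeAt enum k e → σ.nat 1 k = e.1
  col : ∀ {k e}, EdgeAt enum k e → σ.nat 2 k = e.2
  mark : ∀ {k e}, EdgeAt enum k e → (σ.nat 3 k = 1 ↔ e ∈ I)
  blk : ∀ {k e}, EdgeAt enum k e → σ.fld 0 k = A e.1 e.2 0 0 ∧ σ.fld 1 k = A e.1 e.2 0 1 ∧
    σ.fld 2 k = A e.1 e.2 1 0 ∧ σ.fld 3 k = A e.1 e.2 1 1
  rowOther : ∀ {k e}, EdgeAt enum k e → e ∈ I →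
    (σ.nat 13 e.1 = k + 1 ∧ ∀ f ∈ I, f.1 = e.1 → f = e) ∨
      ∃ j f, EdgeAt enum j f ∧ f ∈ I ∧ f ≠ e ∧ f.1 = e.1 ∧ σ.nat 13 e.1 = (k + 1) + (j + 1)
  colOther : ∀ {k e}, EdgeAt enum k e → e ∈ I →
    (σ.nat 15 e.2 = k + 1 ∧ ∀ f ∈ I, f.2 = e.2 → f = e) ∨
      ∃ j f, EdgeAt enum j f ∧ f ∈ I ∧ f ≠ e ∧ f.2 = e.2 ∧ σ.nat 15 e.2 = (k + 1) + (j + 1)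
  colNone : ∀ β : Fin ν, σ.nat 15 β = 0 ↔ ∀ f ∈ I, f.2 ≠ β
  rowLast : ∀ α : Fin μ, (σ.nat 14 α = 0 ∧ ∀ f ∈ I, f.1 ≠ α) ∨
    ∃ k e, EdgeAt enum k e ∧ e ∈ I ∧ e.1 = α ∧ σ.nat 14 α = k + 1
  head : ∀ β : Fin ν, σ.nat 11 β = lastBelow (OffEdge enum I β) (edges A).card
  next : ∀ {k e}, EdgeAt enum k e → e ∉ I → σ.nat 12 k = lastBelow (OffEdge enum I e.2) k

/-- The states agree on the input and on the data of the nodes. -/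
structure SameData (σ τ : State F) : Prop where
  n0 : τ.nat 0 = σ.nat 0
  n1 : τ.nat 1 = σ.nat 1
  n2 : τ.nat 2 = σ.nat 2
  n3 : τ.nat 3 = σ.nat 3
  n11 : τ.nat 11 = σ.nat 11
  n12 : τ.nat 12 = σ.nat 12
  n13 : τ.nat 13 = σ.nat 13
  n14 : τ.nat 14 = σ.nat 14
  n15 : τ.nat 15 = σ.nat 15
  f0 : τ.fld 0 = σ.fld 0
  f1 : τ.fld 1 = σ.fld 1
  f2 : τ.fld 2 = σ.fld 2
  f3 : τ.fld 3 = σ.fld 3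

theorem Indexed.congr {σ τ : State F} (h : Indexed I enum σ) (hs : SameData σ τ) :
    Indexed I enum τ := by
  obtain ⟨n0, n1, n2, n3, n11, n12, n13, n14, n15, f0, f1, f2, f3⟩ := hs
  constructor
  · rw [n0]; exact h.num
  · rw [n1]; exact h.row
  · rw [n2]; exact h.col
  · rw [n3]; exact h.mark
  · rw [f0, f1, f2, f3]; exact h.blk
  · rw [n13]; exact h.rowOther
  · rw [n15]; exact h.colOther
  · rw [n15]; exact h.colNone
  · rw [n14]; exact h.rowLast
  · rw [n11]; exact h.head
  · rw [n12]; exact h.next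

theorem lastBelow_congr {p q : ℕ → Prop} {m : ℕ} (h : ∀ k < m, p k ↔ q k) :
    lastBelow p m = lastBelow q m := by
  induction m with
  | zero => rfl
  | succ m ih =>
    rw [lastBelow, lastBelow, ih fun k hk => h k (by omega)]
    by_cases hp : p m
    · rw [if_pos hp, if_pos ((h m (by omega)).1 hp)]
    · rw [if_neg hp, if_neg fun hq => hp ((h m (by omega)).2 hq)]

/-- If at most two marked positions belong to a node, one of them determines the other one from the
sum. -/
theorem nodeSum_cases {M R : ℕ → ℕ} {a m k : ℕ} (hk : k < m) (hM : M k = 1 ∧ R k = a)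
    (h2 : ∀ i j, i < m → j < m → M i = 1 ∧ R i = a → M j = 1 ∧ R j = a → i ≠ k → j ≠ k → i = j) :
    (nodeSum M R a m = k + 1 ∧ ∀ j < m, M j = 1 ∧ R j = a → j = k) ∨
      ∃ j < m, (M j = 1 ∧ R j = a) ∧ j ≠ k ∧ nodeSum M R a m = (k + 1) + (j + 1) := by
  rw [nodeSum, ← Finset.sum_filter]
  by_cases h : ∃ j < m, (M j = 1 ∧ R j = a) ∧ j ≠ k
  · obtain ⟨j, hj, hj1, hjk⟩ := h
    refine Or.inr ⟨j, hj, hj1, hjk, ?_⟩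
    have : (Finset.range m).filter (fun k => M k = 1 ∧ R k = a) = {k, j} := by
      ext i
      simp only [Finset.mem_filter, Finset.mem_range, Finset.mem_insert, Finset.mem_singleton]
      constructor
      · rintro ⟨hi, hi1⟩
        by_cases hik : i = k
        · exact Or.inl hik
        · exact Or.inr (h2 i j hi hj hi1 hj1 hik hjk)
      · rintro (rfl | rfl)
        exacts [⟨hk, hM⟩, ⟨hj, hj1⟩]
    rw [this, Finset.sum_pair hjk.symm]
  · push Not at h
    refine Or.inl ⟨?_, h⟩
    have : (Finset.range m).filter (fun k => M k = 1 ∧ R k = a) = {k} := by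
      ext i
      simp only [Finset.mem_filter, Finset.mem_range, Finset.mem_singleton]
      constructor
      · exact fun hi => h i hi.1 hi.2
      · rintro rfl
        exact ⟨hk, hM⟩
    rw [this, Finset.sum_singleton]

theorem nodeSum_eq_zero {M R : ℕ → ℕ} {a m : ℕ} :
    nodeSum M R a m = 0 ↔ ∀ k < m, ¬ (M k = 1 ∧ R k = a) := by
  rw [nodeSum, Finset.sum_eq_zero_iff]
  simp

theorem Scanned.indexed {sgn : Fin μ × Fin ν → Bool} (hp : IsProperSign I sgn) (hI : I ⊆ edges A)
    {σ : State F} (h : Scanned (inputState A I enum) (edges A).card σ) : Indexed I enum σ := by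
  have e0 : σ.nat 0 = (inputState A I enum).nat 0 := h.nat 0 (by omega) (by omega) (by omega)
  have e1 : σ.nat 1 = (inputState A I enum).nat 1 := h.nat 1 (by omega) (by omega) (by omega)
  have e2 : σ.nat 2 = (inputState A I enum).nat 2 := h.nat 2 (by omega) (by omega) (by omega)
  have e3 : σ.nat 3 = (inputState A I enum).nat 3 := h.nat 3 (by omega) (by omega) (by omega)
  have hrow : ∀ {k e}, EdgeAt enum k e → (inputState A I enum).nat 1 k = e.1 := by
    rintro k e ⟨hk, rfl⟩
    simp [inputState, hk]
  have hcol : ∀ {k e}, EdgeAt enum k e → (inputState A I enum).nat 2 k = e.2 := by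
    rintro k e ⟨hk, rfl⟩
    simp [inputState, hk]
  have hmark : ∀ {k e}, EdgeAt enum k e → ((inputState A I enum).nat 3 k = 1 ↔ e ∈ I) := by
    rintro k e ⟨hk, rfl⟩
    simp [inputState, hk]
  have hmr : ∀ {k e}, EdgeAt enum k e → ∀ α : Fin μ, ((inputState A I enum).nat 3 k = 1 ∧
      (inputState A I enum).nat 1 k = α ↔ e ∈ I ∧ e.1 = α) := fun hk α => by
    rw [hmark hk, hrow hk, Fin.val_inj]
  have hmc : ∀ {k e}, EdgeAt enum k e → ∀ β : Fin ν, ((inputState A I enum).nat 3 k = 1 ∧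
      (inputState A I enum).nat 2 k = β ↔ e ∈ I ∧ e.2 = β) := fun hk β => by
    rw [hmark hk, hcol hk, Fin.val_inj]
  have hoff : ∀ β : Fin ν, ∀ k < (edges A).card, ((inputState A I enum).nat 3 k ≠ 1 ∧
      (inputState A I enum).nat 2 k = β ↔ OffEdge enum I β k) := by
    intro β k hk
    obtain ⟨e, he⟩ := exists_edgeAt enum hk
    rw [Ne, hmark he, hcol he, Fin.val_inj]
    exact ⟨fun h' => ⟨e, he, h'⟩, fun ⟨f, hf, h'⟩ => by rwa [he.eq hf]⟩
  constructor
  · rw [e0]; rfl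
  · rw [e1]; exact hrow
  · rw [e2]; exact hcol
  · rw [e3]; exact hmark
  · rw [h.fld]
    rintro k e ⟨hk, rfl⟩
    simp [inputState, hk]
  · intro k e he heI
    rw [h.rowSum]
    rcases nodeSum_cases he.lt ((hmr he e.1).2 ⟨heI, rfl⟩) (fun i j hi hj hi1 hj1 hik hjk => by
      obtain ⟨f, hf⟩ := exists_edgeAt enum hi
      obtain ⟨g, hg⟩ := exists_edgeAt enum hj
      rw [hmr hf] at hi1
      rw [hmr hg] at hj1
      have hfe : f ≠ e := by rintro rfl; exact hik (hf.inj he)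
      have hge : g ≠ e := by rintro rfl; exact hjk (hg.inj he)
      obtain rfl := (hp.eq_or_eq heI hi1.1 hj1.1 hfe hi1.2 hj1.2).resolve_left hge
      exact hf.inj hg) with ⟨h1, h2⟩ | ⟨j, hj, h1, h2, h3⟩
    · refine Or.inl ⟨h1, fun f hf hfe => ?_⟩
      obtain ⟨j, hj⟩ := exists_pos enum (hI hf)
      obtain rfl := h2 j hj.lt ((hmr hj e.1).2 ⟨hf, hfe⟩)
      exact hj.eq he
    · obtain ⟨f, hf⟩ := exists_edgeAt enum hj
      rw [hmr hf] at h1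
      exact Or.inr ⟨j, f, hf, h1.1, fun hfe => h2 ((hfe ▸ hf).inj he), h1.2, h3⟩
  · intro k e he heI
    rw [h.colSum]
    rcases nodeSum_cases he.lt ((hmc he e.2).2 ⟨heI, rfl⟩) (fun i j hi hj hi1 hj1 hik hjk => by
      obtain ⟨f, hf⟩ := exists_edgeAt enum hi
      obtain ⟨g, hg⟩ := exists_edgeAt enum hj
      rw [hmc hf] at hi1
      rw [hmc hg] at hj1
      have hfe : f ≠ e := by rintro rfl; exact hik (hf.inj he)
      have hge : g ≠ e := by rintro rfl; exact hjk (hg.inj he)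
      obtain rfl := (hp.eq_or_eq' heI hi1.1 hj1.1 hfe hi1.2 hj1.2).resolve_left hge
      exact hf.inj hg) with ⟨h1, h2⟩ | ⟨j, hj, h1, h2, h3⟩
    · refine Or.inl ⟨h1, fun f hf hfe => ?_⟩
      obtain ⟨j, hj⟩ := exists_pos enum (hI hf)
      obtain rfl := h2 j hj.lt ((hmc hj e.2).2 ⟨hf, hfe⟩)
      exact hj.eq he
    · obtain ⟨f, hf⟩ := exists_edgeAt enum hj
      rw [hmc hf] at h1
      exact Or.inr ⟨j, f, hf, h1.1, fun hfe => h2 ((hfe ▸ hf).inj he), h1.2, h3⟩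
  · intro β
    rw [h.colSum, nodeSum_eq_zero]
    constructor
    · intro h' f hf hβ
      obtain ⟨j, hj⟩ := exists_pos enum (hI hf)
      exact h' j hj.lt ((hmc hj β).2 ⟨hf, hβ⟩)
    · intro h' k hk hk'
      obtain ⟨f, hf⟩ := exists_edgeAt enum hk
      rw [hmc hf] at hk'
      exact h' f hk'.1 hk'.2
  · intro α
    rw [h.rowLast]
    obtain ⟨h1 | ⟨k, hk, h1, h2⟩, h3⟩ := lastBelow_spec (fun k =>
      (inputState A I enum).nat 3 k = 1 ∧ (inputState A I enum).nat 1 k = α) (edges A).card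
    · refine Or.inl ⟨h1, fun f hf hα => ?_⟩
      obtain ⟨j, hj⟩ := exists_pos enum (hI hf)
      exact h3 j hj.lt (by omega) ((hmr hj α).2 ⟨hf, hα⟩)
    · obtain ⟨f, hf⟩ := exists_edgeAt enum hk
      rw [hmr hf] at h1
      exact Or.inr ⟨k, f, hf, h1.1, h1.2, h2⟩
  · intro β
    rw [h.head]
    exact lastBelow_congr (hoff β)
  · intro k e he heI
    rw [h.next k he.lt (by rwa [Ne, hmark he]), hcol he]
    exact lastBelow_congr fun j hj => hoff e.2 j (hj.trans he.lt)

end Ram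

/-! ### Computing the lines of the labeling -/

namespace Ram

variable {F : Type*} [Field F] {μ ν : ℕ} {A : Blocks F μ ν} {I : Finset (Fin μ × Fin ν)}
  {enum : Fin (edges A).card ≃ {e // e ∈ edges A}}

/-- The number `δ` stands for the row end (`s = true`) or the column end (`s = false`) of `e`. -/
def DartAt (enum : Fin (edges A).card ≃ {e // e ∈ edges A}) (δ : ℕ) (s : Bool)
    (e : Fin μ × Fin ν) : Prop :=
  if s then EdgeAt enum δ e else ∃ k, δ = (edges A).card + k ∧ EdgeAt enum k e

theorem DartAt.lt {δ : ℕ} {s : Bool} {e : Fin μ × Fin ν} (h : DartAt enum δ s e) :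
    δ < 2 * (edges A).card := by
  cases s
  · obtain ⟨k, rfl, hk⟩ := h
    have := hk.lt
    omega
  · have := EdgeAt.lt h
    omega

theorem DartAt.inj {δ : ℕ} {s t : Bool} {e f : Fin μ × Fin ν} (h : DartAt enum δ s e)
    (h' : DartAt enum δ t f) : s = t ∧ e = f := by
  cases s <;> cases t
  · obtain ⟨k, rfl, hk⟩ := h
    obtain ⟨j, hj, hj'⟩ := h'
    obtain rfl : k = j := by omega
    exact ⟨rfl, hk.eq hj'⟩
  · obtain ⟨k, rfl, hk⟩ := h
    have := EdgeAt.lt h'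
    omega
  · obtain ⟨k, rfl, hk⟩ := h'
    have := EdgeAt.lt h
    omega
  · exact ⟨rfl, EdgeAt.eq h h'⟩

theorem DartAt.eq {δ δ' : ℕ} {s : Bool} {e : Fin μ × Fin ν} (h : DartAt enum δ s e)
    (h' : DartAt enum δ' s e) : δ = δ' := by
  cases s
  · obtain ⟨k, rfl, hk⟩ := h
    obtain ⟨j, rfl, hj⟩ := h'
    rw [hk.inj hj]
  · exact EdgeAt.inj h h'

/-- The label of the end `s` of the edge `e` determines a label of the edge `f`. -/
def DartNext (A : Blocks F μ ν) (I : Finset (Fin μ × Fin ν)) (s : Bool) (e f : Fin μ × Fin ν) :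
    Prop :=
  f ∈ I ∧ f ≠ e ∧ (if s then f.1 = e.1 else f.2 = e.2) ∧ (A f.1 f.2).det ≠ 0

/-- The state of the computation of the labels: `flag` marks the known ones, whose values are
`vec`; all ends of rank-1 edges below `d` and all successors of known labels, except for the label
`c - 1`, are known. -/
structure Chase (I : Finset (Fin μ × Fin ν)) (enum : Fin (edges A).card ≃ {e // e ∈ edges A})
    (flag : ℕ → ℕ) (vec : ℕ → Fin 2 → F) (d c : ℕ) : Prop where
  sound : ∀ δ s e, DartAt enum δ s e → flag δ ≠ 0 → ∃ b, DartLabel A I b s e (vec δ)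
  base : ∀ δ s e, DartAt enum δ s e → e ∈ I → (A e.1 e.2).det = 0 → δ < d → flag δ ≠ 0
  closed : ∀ δ s e δ' f, DartAt enum δ s e → DartAt enum δ' (!s) f → DartNext A I s e f →
    flag δ ≠ 0 → c ≠ δ + 1 → flag δ' ≠ 0
  cur : c ≠ 0 → flag (c - 1) ≠ 0 ∧ c ≤ 2 * (edges A).card
  le : d ≤ 2 * (edges A).card

/-- A bound on the remaining number of steps of the computation of the labels. -/
def chasePotential (n : ℕ) (flag : ℕ → ℕ) (d c : ℕ) : ℕ :=
  2 * (2 * n - d) + (2 * n - ((Finset.range (2 * n)).filter fun δ => flag δ ≠ 0).card) +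
    if c = 0 then 0 else 1

theorem card_flag_le {n : ℕ} {flag : ℕ → ℕ} {δ : ℕ} :
    ((Finset.range n).filter fun j => flag j ≠ 0).card ≤
      ((Finset.range n).filter fun j => Function.update flag δ 1 j ≠ 0).card := by
  apply Finset.card_le_card
  intro j hj
  simp only [Finset.mem_filter, Function.update_apply] at hj ⊢
  refine ⟨hj.1, ?_⟩
  split_ifs
  exacts [one_ne_zero, hj.2]

theorem card_flag_lt {n : ℕ} {flag : ℕ → ℕ} {δ : ℕ} (hδ : δ < n) (h : flag δ = 0) :
    ((Finset.range n).filter fun j => flag j ≠ 0).card <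
      ((Finset.range n).filter fun j => Function.update flag δ 1 j ≠ 0).card := by
  apply Finset.card_lt_card
  rw [Finset.ssubset_iff_of_subset]
  · exact ⟨δ, by simp [hδ], by simp [h]⟩
  · intro j hj
    simp only [Finset.mem_filter, Function.update_apply] at hj ⊢
    refine ⟨hj.1, ?_⟩
    split_ifs
    exacts [one_ne_zero, hj.2]

theorem card_flag_le_card {n : ℕ} {flag : ℕ → ℕ} :
    ((Finset.range n).filter fun j => flag j ≠ 0).card ≤ n :=
  (Finset.card_filter_le _ _).trans (Finset.card_range n).le

variable {flag : ℕ → ℕ} {vec : ℕ → Fin 2 → F} {d c δ δ' : ℕ} {s b : Bool} {e f : Fin μ × Fin ν}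
  {v : Fin 2 → F}

theorem Chase.skip (h : Chase I enum flag vec d 0) (hd : DartAt enum d s e)
    (he : ¬ (e ∈ I ∧ (A e.1 e.2).det = 0)) : Chase I enum flag vec (d + 1) 0 := by
  refine ⟨h.sound, ?_, h.closed, by simp, hd.lt⟩
  intro δ t f hδ hf hdf hlt
  rcases (show δ < d ∨ δ = d by omega) with hlt | rfl
  · exact h.base δ t f hδ hf hdf hlt
  · obtain ⟨-, rfl⟩ := hd.inj hδ
    exact absurd ⟨hf, hdf⟩ he

theorem Chase.mark {b' : ℕ} (h : Chase I enum flag vec d c)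
    (hc : ∀ δ s e δ' f, DartAt enum δ s e → DartAt enum δ' (!s) f → DartNext A I s e f →
      c = δ + 1 → c ≠ 0 → δ' = b') {d' : ℕ} (hd : d' = d ∨ (d' = d + 1 ∧ b' = d))
    (hδ : DartAt enum b' s e) (hv : DartLabel A I b s e v) :
    Chase I enum (Function.update flag b' 1) (Function.update vec b' v) d' (b' + 1) := by
  have hlt := hδ.lt
  refine ⟨?_, ?_, ?_, fun _ => ⟨by simp, hlt⟩, ?_⟩
  · intro j t f hj hne
    by_cases hjb : j = b'
    · subst hjb
      obtain ⟨rfl, rfl⟩ := hδ.inj hj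
      rw [Function.update_self]
      exact ⟨b, hv⟩
    · rw [Function.update_of_ne hjb] at hne ⊢
      exact h.sound j t f hj hne
  · intro j t f hj hf hdf hjd
    by_cases hjb : j = b'
    · subst hjb
      simp
    · rw [Function.update_of_ne hjb]
      exact h.base j t f hj hf hdf (by omega)
  · intro j t f j' g hj hj' hn hne hjc
    have hjb : j ≠ b' := by omega
    rw [Function.update_of_ne hjb] at hne
    by_cases hjb' : j' = b'
    · subst hjb'
      simp
    · rw [Function.update_of_ne hjb']
      refine h.closed j t f j' g hj hj' hn hne fun hcj => hjb' ?_
      exact hc j t f j' g hj hj' hn hcj (by omega)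
  · have := h.le
    omega

theorem Chase.base_mark (h : Chase I enum flag vec d 0) (hd : DartAt enum d s e)
    (hv : DartLabel A I b s e v) :
    Chase I enum (Function.update flag d 1) (Function.update vec d v) (d + 1) (d + 1) :=
  h.mark (fun _ _ _ _ _ _ _ _ _ h0 => absurd rfl h0) (Or.inr ⟨rfl, rfl⟩) hd hv

theorem Chase.next_mark (h : Chase I enum flag vec d (δ + 1)) (hδ : DartAt enum δ s e)
    (hδ' : DartAt enum δ' (!s) f) (hu : ∀ g, DartNext A I s e g → g = f)
    (hv : DartLabel A I b (!s) f v) :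
    Chase I enum (Function.update flag δ' 1) (Function.update vec δ' v) d (δ' + 1) := by
  refine h.mark (fun j t g j' g' hj hj' hn hc _ => ?_) (Or.inl rfl) hδ' hv
  obtain rfl : δ = j := by omega
  obtain ⟨rfl, rfl⟩ := hδ.inj hj
  obtain rfl := hu _ hn
  exact hj'.eq hδ'

theorem Chase.halt (h : Chase I enum flag vec d (δ + 1)) (hδ : DartAt enum δ s e)
    (hu : ∀ g j, DartNext A I s e g → DartAt enum j (!s) g → flag j ≠ 0) :
    Chase I enum flag vec d 0 := by
  refine ⟨h.sound, h.base, ?_, by simp, h.le⟩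
  intro j t g j' g' hj hj' hn hf _
  by_cases hjδ : j = δ
  · subst hjδ
    obtain ⟨rfl, rfl⟩ := hδ.inj hj
    exact hu _ _ hn hj'
  · exact h.closed j t g j' g' hj hj' hn hf (by omega)

/-- At the end of the computation all labels are known. -/
theorem Chase.complete (h : Chase I enum flag vec (2 * (edges A).card) 0) (hI : I ⊆ edges A)
    (hl : DartLabel A I b s e v) : ∀ δ, DartAt enum δ s e → flag δ ≠ 0 := by
  have hex : ∀ {e : Fin μ × Fin ν} (s : Bool), e ∈ I → ∃ δ, DartAt enum δ s e := by
    intro e s he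
    obtain ⟨k, hk⟩ := exists_pos enum (hI he)
    cases s
    · exact ⟨_, k, rfl, hk⟩
    · exact ⟨k, hk⟩
  induction hl with
  | baseRow he hd => exact fun δ hδ => h.base δ _ _ hδ he hd hδ.lt
  | baseCol he hd => exact fun δ hδ => h.base δ _ _ hδ he hd hδ.lt
  | rowStep hl hf hfe h1 hd ih =>
    intro δ hδ
    obtain ⟨j, hj⟩ := hex true hl.mem
    exact h.closed j true _ δ _ hj hδ ⟨hf, hfe, h1, hd⟩ (ih j hj) (by omega)
  | colStep hl hf hfe h1 hd ih =>
    intro δ hδ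
    obtain ⟨j, hj⟩ := hex false hl.mem
    exact h.closed j false _ δ _ hj hδ ⟨hf, hfe, h1, hd⟩ (ih j hj) (by omega)

end Ram

/-! ### Vector operations of the machine -/

namespace Ram

section

variable {F : Type*}

/-- The vector in the cells `i` of the arrays `a` and `a + 1`. -/
def State.vec (σ : State F) (a i : ℕ) : Fin 2 → F := ![σ.fld a i, σ.fld (a + 1) i]

/-- Write a vector to the cells `i` of the arrays `a` and `a + 1`. -/
def State.setVec (σ : State F) (a i : ℕ) (v : Fin 2 → F) : State F :=
  (σ.setF a i (v 0)).setF (a + 1) i (v 1)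

@[simp] theorem State.nat_setVec (σ : State F) (a i : ℕ) (v : Fin 2 → F) :
    (σ.setVec a i v).nat = σ.nat := rfl

@[simp] theorem State.vec_setN (σ : State F) (a i v : ℕ) : (σ.setN a i v).vec = σ.vec := rfl

theorem State.fld_setVec (σ : State F) {a b : ℕ} (i : ℕ) (v : Fin 2 → F) (h : b ≠ a)
    (h' : b ≠ a + 1) : (σ.setVec a i v).fld b = σ.fld b := by
  simp [State.setVec, h, h']

@[simp] theorem NExpr.eval_setF (σ : State F) (a i : ℕ) (v : F) (k : NExpr) :
    k.eval (σ.setF a i v) = k.eval σ := by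
  induction k with
  | const => rfl
  | get a j ih => simp [ih]
  | add x y hx hy => simp [hx, hy]
  | sub x y hx hy => simp [hx, hy]

theorem NExpr.eval_congr {σ τ : State F} (h : τ.nat = σ.nat) (k : NExpr) :
    k.eval τ = k.eval σ := by
  induction k with
  | const => rfl
  | get a j ih => simp [ih, h]
  | add x y hx hy => simp [hx, hy]
  | sub x y hx hy => simp [hx, hy]

theorem State.vec_setVec (σ : State F) (a i : ℕ) (v : Fin 2 → F) :
    (σ.setVec a i v).vec a = Function.update (σ.vec a) i v := by
  funext j
  by_cases h : j = i
  · subst h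
    simp only [State.vec, State.setVec, Function.update_self]
    funext t
    fin_cases t <;> simp
  · simp [State.vec, State.setVec, h]

theorem State.vec_setVec_of_ne (σ : State F) {a b : ℕ} (i : ℕ) (v : Fin 2 → F) (h : b ≠ a)
    (h' : b ≠ a + 1) (h'' : a ≠ b + 1) : (σ.setVec a i v).vec b = σ.vec b := by
  funext j
  rw [State.vec, State.vec, σ.fld_setVec i v h h', σ.fld_setVec i v (by omega) (by omega)]

/-- The states differ at most in the vector in the cells `0` of the arrays `26` and `27`. -/
def SameUpToTemp (σ τ : State F) : Prop :=
  τ.nat = σ.nat ∧ ∀ a, a ≠ 26 → a ≠ 27 → τ.fld a = σ.fld a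

theorem SameUpToTemp.vec {σ τ : State F} (h : SameUpToTemp σ τ) {a : ℕ} (ha : a < 25) :
    τ.vec a = σ.vec a := by
  funext j
  rw [State.vec, State.vec, h.2 a (by omega) (by omega), h.2 (a + 1) (by omega) (by omega)]

end

/-- The determinant of the block at position `k`. -/
@[simp] def detAt (k : NExpr) : FExpr :=
  .sub (.mul (.get 0 k) (.get 3 k)) (.mul (.get 1 k) (.get 2 k))

/-- Copy a vector from the cells `j` of the arrays `b`, `b + 1` to the cells `t` of the arrays `a`,
`a + 1`. -/
def copyVec (b : ℕ) (j : NExpr) (a : ℕ) (t : NExpr) : Prog :=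
  .block [.setF a t (.get b j), .setF (a + 1) t (.get (b + 1) j)]

/-- Write a vector to the cells `0` of the arrays `26`, `27`. -/
def setTemp (x y : FExpr) : Prog :=
  .block [.setF 26 (.const 0) x, .setF 27 (.const 0) y]

/-- Compute the vector orthogonal to the one in the cells `j` of the arrays `b`, `b + 1` with
respect to the block at `k`, or to its transpose if the arrays `p`, `q` are exchanged. -/
def perpVec (p q : ℕ) (k : NExpr) (b : ℕ) (j : NExpr) : Prog :=
  setTemp (.add (.mul (.get b j) (.get p k)) (.mul (.get (b + 1) j) (.get 3 k)))
    (.sub .zero (.add (.mul (.get b j) (.get 0 k)) (.mul (.get (b + 1) j) (.get q k))))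

/-- Compute a vector of the left kernel of the rank-1 block at `k`, or of the right kernel if the
arrays `p`, `q` are exchanged. -/
def kerVec (p q : ℕ) (k : NExpr) : Prog :=
  .cond (.and (.feq (.get 0 k) .zero) (.feq (.get q k) .zero))
    (setTemp (.get 3 k) (.sub .zero (.get p k))) (setTemp (.get q k) (.sub .zero (.get 0 k)))

section

variable {F : Type*} [Field F]

theorem copyVec_wp {σ : State F} {b a : ℕ} {j t : NExpr} {Q : State F → Prop} (h : a ≠ b + 1)
    (hQ : Q (σ.setVec a (t.eval σ) (σ.vec b (j.eval σ)))) : (copyVec b j a t).wp Q σ := by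
  simp only [copyVec, Prog.block, Prog.wp, FExpr.eval, NExpr.eval_setF, State.fld_setF]
  rw [if_neg h.symm]
  exact hQ

/-- The entries of the block `B`, or of its transpose if `p`, `q` are `2`, `1`, are at `k`. -/
def BlockAt (σ : State F) (p q k : ℕ) (B : Matrix (Fin 2) (Fin 2) F) : Prop :=
  (p = 1 ∧ q = 2 ∨ p = 2 ∧ q = 1) ∧
    B 0 0 = σ.fld 0 k ∧ B 0 1 = σ.fld p k ∧ B 1 0 = σ.fld q k ∧ B 1 1 = σ.fld 3 k

theorem BlockAt.det {σ : State F} {p q k : ℕ} {B : Matrix (Fin 2) (Fin 2) F}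
    (h : BlockAt σ p q k B) : σ.fld 0 k * σ.fld 3 k - σ.fld 1 k * σ.fld 2 k = B.det := by
  obtain ⟨hpq, b0, b1, b2, b3⟩ := h
  rw [det_eq, b0, b1, b2, b3]
  rcases hpq with ⟨rfl, rfl⟩ | ⟨rfl, rfl⟩
  · rfl
  · ring

theorem setTemp_wp {σ : State F} {x y : FExpr} {Q : State F → Prop} {v : Fin 2 → F}
    (hx : x.eval σ = v 0) (hy : ∀ z, y.eval (σ.setF 26 0 z) = v 1)
    (hQ : ∀ τ, SameUpToTemp σ τ → τ.vec 26 0 = v → Q τ) : (setTemp x y).wp Q σ := by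
  simp only [setTemp, Prog.block, Prog.wp, NExpr.eval, hy]
  refine hQ _ ⟨rfl, fun a h h' => by simp [h, h']⟩ ?_
  funext t
  fin_cases t <;> simp [State.vec, hx]

theorem perpVec_wp {σ : State F} {p q b : ℕ} {j k : NExpr} {Q : State F → Prop}
    {B : Matrix (Fin 2) (Fin 2) F} (hB : BlockAt σ p q (k.eval σ) B) (hb : b < 25)
    (hQ : ∀ τ, SameUpToTemp σ τ → τ.vec 26 0 = rowPerp B (σ.vec b (j.eval σ)) → Q τ) :
    (perpVec p q k b j).wp Q σ := by
  obtain ⟨hpq, b0, b1, b2, b3⟩ := hB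
  have hp : p ≠ 26 := by omega
  have hq : q ≠ 26 := by omega
  refine setTemp_wp ?_ (fun z => ?_) hQ
  · simp [rowPerp, State.vec, b1, b3]
  · simp [rowPerp, State.vec, b0, b2, hq, show b ≠ 26 by omega, show b ≠ 25 by omega]

theorem kerVec_wp {σ : State F} {p q : ℕ} {k : NExpr} {Q : State F → Prop}
    {B : Matrix (Fin 2) (Fin 2) F} (hB : BlockAt σ p q (k.eval σ) B)
    (hQ : ∀ τ, SameUpToTemp σ τ → τ.vec 26 0 = leftKerVec B → Q τ) : (kerVec p q k).wp Q σ := by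
  obtain ⟨hpq, b0, b1, b2, b3⟩ := hB
  have hp : p ≠ 26 := by omega
  have hq : q ≠ 26 := by omega
  constructor
  · intro hz
    simp only [Test.Holds, FExpr.eval, ← b0, ← b2] at hz
    refine setTemp_wp ?_ (fun z => ?_) hQ
    · simp [leftKerVec, hz, b3]
    · simp [leftKerVec, hz, b1, hp]
  · intro hz
    simp only [Test.Holds, FExpr.eval, ← b0, ← b2] at hz
    refine setTemp_wp ?_ (fun z => ?_) hQ
    · rw [leftKerVec, if_neg hz]
      simp [b2]
    · rw [leftKerVec, if_neg hz]
      simp [b0]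

end

end Ram

/-! ### The program for the labels -/

namespace Ram

/-- The number of edges. -/
@[simp] def numE : NExpr := .get 0 (.const 0)

/-- The predecessor of a number. -/
@[simp] def NExpr.pred (x : NExpr) : NExpr := .sub x (.const 1)

/-- Label the end of a rank-1 edge, if the number in register 12 stands for one. -/
def labelBase (p q : ℕ) (k : NExpr) : Prog :=
  .cond (.and (.eq (.get 3 k) (.const 1)) (.feq (detAt k) .zero))
    (.block [kerVec p q k, copyVec 26 (.const 0) 12 (reg 12), .setN 17 (reg 12) (.const 1),
      .setN 20 (.const 13) (reg 12).succ, .setN 20 (.const 12) (reg 12).succ])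
    (.setN 20 (.const 12) (reg 12).succ)

/-- Label the end `δ` of the edge before the number in register 14, from the label before the number
in register 13. -/
def labelNext (p q : ℕ) (δ : NExpr) : Prog :=
  .cond (.and (.not (.eq (reg 14) (.const 0)))
      (.and (.not (.feq (detAt (reg 14).pred) .zero)) (.eq (.get 17 δ) (.const 0))))
    (.block [perpVec p q (reg 14).pred 12 (reg 13).pred, copyVec 26 (.const 0) 12 δ,
      .setN 17 δ (.const 1), .setN 20 (.const 13) δ.succ])
    (.setN 20 (.const 13) (.const 0))

/-- One step of the computation of the labels. Register 12 holds the number of edge ends that have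
been tested for rank-1 edges, and register 13 is zero or the successor of the last label whose
successor is still to be computed. -/
def labelBody : Prog :=
  .cond (.eq (reg 13) (.const 0))
    (.cond (.lt (reg 12) numE) (labelBase 1 2 (reg 12)) (labelBase 2 1 (.sub (reg 12) numE)))
    (.cond (.lt numE (reg 13))
      (.block [.setN 20 (.const 14) (.sub (.get 15 (.get 2 (.sub (reg 13).pred numE)))
          (.sub (reg 13) numE)),
        labelNext 2 1 (reg 14).pred])
      (.block [.setN 20 (.const 14) (.sub (.get 13 (.get 1 (reg 13).pred)) (reg 13)),
        labelNext 1 2 (.add numE (reg 14).pred)]))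

/-- There are labels still to be computed. -/
@[simp] def labelTest : Test :=
  .not (.and (.eq (reg 13) (.const 0)) (.not (.lt (reg 12) (.add numE numE))))

/-- Compute the labels of the ends of the edges of `I`. -/
def labels : Prog := .loop labelTest labelBody

variable {F : Type*}

/-- The computation of the labels does not change the memory otherwise. -/
structure LabelFrame (σ₁ σ : State F) : Prop where
  nat : ∀ a, a ≠ 17 → a ≠ 20 → σ.nat a = σ₁.nat a
  regs : ∀ i, i ≠ 12 → i ≠ 13 → i ≠ 14 → σ.nat 20 i = σ₁.nat 20 i
  fld : ∀ a, a ≠ 12 → a ≠ 13 → a ≠ 26 → a ≠ 27 → σ.fld a = σ₁.fld a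

theorem LabelFrame.sameData {σ₁ σ : State F} (h : LabelFrame σ₁ σ) : SameData σ₁ σ := by
  constructor <;> first
    | exact h.nat _ (by omega) (by omega)
    | exact h.fld _ (by omega) (by omega) (by omega) (by omega)

theorem LabelFrame.trans {σ₁ σ₂ σ₃ : State F} (h : LabelFrame σ₁ σ₂) (h' : LabelFrame σ₂ σ₃) :
    LabelFrame σ₁ σ₃ :=
  ⟨fun a h1 h2 => (h'.nat a h1 h2).trans (h.nat a h1 h2),
    fun a h1 h2 h3 => (h'.regs a h1 h2 h3).trans (h.regs a h1 h2 h3),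
    fun a h1 h2 h3 h4 => (h'.fld a h1 h2 h3 h4).trans (h.fld a h1 h2 h3 h4)⟩

/-- The label `v` is entered at `δ`, and the registers become `d`, `c`. -/
structure Labelled (σ : State F) (δ : ℕ) (v : Fin 2 → F) (d c : ℕ) (τ : State F) : Prop where
  frame : LabelFrame σ τ
  flag : τ.nat 17 = Function.update (σ.nat 17) δ 1
  vec : τ.vec 12 = Function.update (σ.vec 12) δ v
  reg12 : τ.nat 20 12 = d
  reg13 : τ.nat 20 13 = c

variable [Field F]

theorem labelBase_wp {σ : State F} {p q : ℕ} {k : NExpr} {Q : State F → Prop}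
    {B : Matrix (Fin 2) (Fin 2) F} (hB : BlockAt σ p q (k.eval σ) B)
    (h1 : σ.nat 3 (k.eval σ) = 1 → B.det = 0 → ∀ τ,
      Labelled σ (σ.nat 20 12) (leftKerVec B) (σ.nat 20 12 + 1) (σ.nat 20 12 + 1) τ → Q τ)
    (h2 : ¬ (σ.nat 3 (k.eval σ) = 1 ∧ B.det = 0) → Q (σ.setN 20 12 (σ.nat 20 12 + 1))) :
    (labelBase p q k).wp Q σ := by
  constructor
  · rintro ⟨hm, hd⟩
    simp only [NExpr.eval, FExpr.eval, Test.Holds, detAt, hB.det] at hm hd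
    refine kerVec_wp hB fun τ hτ hv => copyVec_wp (by omega) ?_
    simp only [Prog.block, Prog.wp]
    obtain ⟨hn, hf⟩ := id hτ
    refine h1 hm hd _ ⟨⟨?_, ?_, ?_⟩, ?_, ?_, ?_, ?_⟩
    · intro a ha ha'
      simp [ha, ha', hn]
    · intro i h12 h13 _
      simp [h12, h13, hn]
    · intro a ha ha' h26 h27
      simpa [State.fld_setVec, ha, ha'] using hf a h26 h27
    · simp [hn]
    · simp [State.vec_setVec, hv, hn, hτ.vec]
    · simp [hn]
    · simp [hn]
  · intro hc
    apply h2
    simpa only [NExpr.eval, FExpr.eval, Test.Holds, detAt, hB.det] using hc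

theorem labelNext_wp {σ : State F} {p q : ℕ} {δ : NExpr} {Q : State F → Prop}
    {B : Matrix (Fin 2) (Fin 2) F} (hB : σ.nat 20 14 ≠ 0 → BlockAt σ p q (σ.nat 20 14 - 1) B)
    (hδ : ∀ τ : State F, τ.nat 20 = σ.nat 20 → τ.nat 0 = σ.nat 0 → δ.eval τ = δ.eval σ)
    (h1 : σ.nat 20 14 ≠ 0 → B.det ≠ 0 → σ.nat 17 (δ.eval σ) = 0 → ∀ τ,
      Labelled σ (δ.eval σ) (rowPerp B (σ.vec 12 (σ.nat 20 13 - 1))) (σ.nat 20 12) (δ.eval σ + 1) τ →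
        Q τ)
    (h2 : ¬ (σ.nat 20 14 ≠ 0 ∧ B.det ≠ 0 ∧ σ.nat 17 (δ.eval σ) = 0) → Q (σ.setN 20 13 0)) :
    (labelNext p q δ).wp Q σ := by
  constructor
  · rintro ⟨h0, hd, hf⟩
    simp only [NExpr.eval, FExpr.eval, Test.Holds, detAt, reg, NExpr.pred] at h0 hd hf
    rw [(hB h0).det] at hd
    refine perpVec_wp (hB h0) (by omega) fun τ hτ hv => copyVec_wp (by omega) ?_
    simp only [Prog.block, Prog.wp, NExpr.eval, NExpr.succ]
    obtain ⟨hn, hf'⟩ := id hτ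
    have e1 : δ.eval τ = δ.eval σ := NExpr.eval_congr hn δ
    rw [hδ (τ.setVec 12 _ _) (by simp [hn]) (by simp [hn]),
      hδ ((τ.setVec 12 _ _).setN 17 _ _) (by simp [hn]) (by simp [hn]), e1]
    refine h1 h0 hd hf _ ⟨⟨?_, ?_, ?_⟩, ?_, ?_, ?_, ?_⟩
    · intro a ha ha'
      simp [ha, ha', hn]
    · intro i h12 h13 _
      simp [h13, hn]
    · intro a ha ha' h26 h27
      simpa [State.fld_setVec, ha, ha'] using hf' a h26 h27
    · simp [hn]
    · simp [State.vec_setVec, hv, hτ.vec]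
    · simp [hn]
    · simp
  · intro hc
    apply h2
    rintro ⟨h0, hd, hf⟩
    apply hc
    simp only [NExpr.eval, FExpr.eval, Test.Holds, detAt, reg, NExpr.pred]
    rw [(hB h0).det]
    exact ⟨h0, hd, hf⟩

variable {μ ν : ℕ} {A : Blocks F μ ν} {I : Finset (Fin μ × Fin ν)}
  {enum : Fin (edges A).card ≃ {e // e ∈ edges A}}

theorem Indexed.blockAt {σ : State F} (h : Indexed I enum σ) {k : ℕ} {e : Fin μ × Fin ν}
    (he : EdgeAt enum k e) : BlockAt σ 1 2 k (A e.1 e.2) := by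
  obtain ⟨h1, h2, h3, h4⟩ := h.blk he
  exact ⟨by omega, h1.symm, h2.symm, h3.symm, h4.symm⟩

theorem Indexed.blockAt_transpose {σ : State F} (h : Indexed I enum σ) {k : ℕ}
    {e : Fin μ × Fin ν} (he : EdgeAt enum k e) : BlockAt σ 2 1 k (A e.1 e.2).transpose := by
  obtain ⟨h1, h2, h3, h4⟩ := h.blk he
  exact ⟨by omega, h1.symm, h3.symm, h2.symm, h4.symm⟩

/-- The invariant of the computation of the labels. -/
structure Labelling (I : Finset (Fin μ × Fin ν)) (enum : Fin (edges A).card ≃ {e // e ∈ edges A})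
    (σ₁ : State F) (i : ℕ) (σ : State F) : Prop where
  frame : LabelFrame σ₁ σ
  chase : Chase I enum (σ.nat 17) (σ.vec 12) (σ.nat 20 12) (σ.nat 20 13)
  count : i + chasePotential (edges A).card (σ.nat 17) (σ.nat 20 12) (σ.nat 20 13) ≤
    6 * (edges A).card

/-- After a label was entered for the end of a rank-1 edge, the invariant holds. -/
theorem Labelling.base {σ₁ σ τ : State F} {i : ℕ} (h : Labelling I enum σ₁ i σ)
    (hc : σ.nat 20 13 = 0) {s b : Bool} {e : Fin μ × Fin ν} (hd : DartAt enum (σ.nat 20 12) s e)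
    {v : Fin 2 → F} (hv : DartLabel A I b s e v)
    (hτ : Labelled σ (σ.nat 20 12) v (σ.nat 20 12 + 1) (σ.nat 20 12 + 1) τ) :
    Labelling I enum σ₁ (i + 1) τ := by
  refine ⟨h.frame.trans hτ.frame, ?_, ?_⟩
  · rw [hτ.flag, hτ.vec, hτ.reg12, hτ.reg13]
    have := h.chase
    rw [hc] at this
    exact this.base_mark hd hv
  · have h1 := h.count
    rw [hτ.flag, hτ.reg12, hτ.reg13]
    unfold chasePotential at h1 ⊢
    rw [if_pos hc] at h1
    rw [if_neg (by omega)]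
    have h2 := card_flag_le (n := 2 * (edges A).card) (flag := σ.nat 17) (δ := σ.nat 20 12)
    have h3 := hd.lt
    omega

theorem Labelling.skip {σ₁ σ : State F} {i : ℕ} (h : Labelling I enum σ₁ i σ)
    (hc : σ.nat 20 13 = 0) {s : Bool} {e : Fin μ × Fin ν} (hd : DartAt enum (σ.nat 20 12) s e)
    (he : ¬ (e ∈ I ∧ (A e.1 e.2).det = 0)) :
    Labelling I enum σ₁ (i + 1) (σ.setN 20 12 (σ.nat 20 12 + 1)) := by
  refine ⟨h.frame.trans ⟨?_, ?_, ?_⟩, ?_, ?_⟩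
  · intro a _ ha
    simp [ha]
  · intro i hi _ _
    simp [hi]
  · intros
    rfl
  · have := h.chase
    rw [hc] at this
    simpa [hc] using this.skip hd he
  · have h1 := h.count
    unfold chasePotential at h1 ⊢
    have h3 := hd.lt
    simp [hc] at h1 ⊢
    omega

theorem Labelling.next {σ₁ σ τ : State F} {i δ δ' : ℕ} (h : Labelling I enum σ₁ i σ)
    (hc : σ.nat 20 13 = δ + 1) {s b : Bool} {e f : Fin μ × Fin ν} (hd : DartAt enum δ s e)
    (hd' : DartAt enum δ' (!s) f) (hu : ∀ g, DartNext A I s e g → g = f)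
    {v : Fin 2 → F} (hv : DartLabel A I b (!s) f v) (hf : σ.nat 17 δ' = 0)
    (hτ : Labelled σ δ' v (σ.nat 20 12) (δ' + 1) τ) : Labelling I enum σ₁ (i + 1) τ := by
  refine ⟨h.frame.trans hτ.frame, ?_, ?_⟩
  · rw [hτ.flag, hτ.vec, hτ.reg12, hτ.reg13]
    have := h.chase
    rw [hc] at this
    exact this.next_mark hd hd' hu hv
  · have h1 := h.count
    rw [hτ.flag, hτ.reg12, hτ.reg13]
    unfold chasePotential at h1 ⊢
    rw [if_neg (by omega)] at h1
    rw [if_neg (by omega)]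
    have h2 := card_flag_lt hd'.lt hf
    have h3 := card_flag_le_card (n := 2 * (edges A).card)
      (flag := Function.update (σ.nat 17) δ' 1)
    omega

theorem Labelling.halt {σ₁ σ : State F} {i δ : ℕ} (h : Labelling I enum σ₁ i σ)
    (hc : σ.nat 20 13 = δ + 1) {s : Bool} {e : Fin μ × Fin ν} (hd : DartAt enum δ s e)
    (hu : ∀ g j, DartNext A I s e g → DartAt enum j (!s) g → σ.nat 17 j ≠ 0) :
    Labelling I enum σ₁ (i + 1) (σ.setN 20 13 0) := by
  refine ⟨h.frame.trans ⟨?_, ?_, ?_⟩, ?_, ?_⟩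
  · intro a _ ha
    simp [ha]
  · intro i _ hi _
    simp [hi]
  · intros
    rfl
  · have := h.chase
    rw [hc] at this
    simpa using this.halt hd hu
  · have h1 := h.count
    unfold chasePotential at h1 ⊢
    simp [hc] at h1 ⊢
    omega

/-- Register 14 is free. -/
theorem Labelling.setReg {σ₁ σ : State F} {i : ℕ} (h : Labelling I enum σ₁ i σ) (v : ℕ) :
    Labelling I enum σ₁ i (σ.setN 20 14 v) := by
  refine ⟨h.frame.trans ⟨?_, ?_, ?_⟩, ?_, ?_⟩
  · intro a _ ha
    simp [ha]
  · intro i _ _ hi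
    simp [hi]
  · intros
    rfl
  · simpa using h.chase
  · simpa using h.count

end Ram

namespace Ram

variable {F : Type*} [Field F] {μ ν : ℕ} {A : Blocks F μ ν} {I : Finset (Fin μ × Fin ν)}
  {enum : Fin (edges A).card ≃ {e // e ∈ edges A}}

theorem Labelling.step {sgn : Fin μ × Fin ν → Bool} (hp : IsProperSign I sgn)
    {σ₁ σ : State F} {i : ℕ} (h₁ : Indexed I enum σ₁)
    (h : Labelling I enum σ₁ i σ)
    (hb : ¬ (σ.nat 20 13 = 0 ∧ ¬ σ.nat 20 12 < (edges A).card + (edges A).card)) :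
    labelBody.wp (Labelling I enum σ₁ (i + 1)) σ := by
  have hI : Indexed I enum σ := h₁.congr h.frame.sameData
  have hnum := hI.num
  constructor
  · intro hc
    simp only [Test.Holds, NExpr.eval, reg] at hc
    constructor
    · intro hlt
      simp only [Test.Holds, NExpr.eval, reg, numE, hnum] at hlt
      obtain ⟨e, he⟩ := exists_edgeAt enum hlt
      have hd : DartAt enum (σ.nat 20 12) true e := he
      have hm := hI.mark he
      refine labelBase_wp (B := A e.1 e.2) (hI.blockAt he) ?_ ?_
      · intro h3 hdet τ hτ
        exact h.base hc hd (DartLabel.baseRow (hm.1 h3) hdet) hτ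
      · intro hn
        refine h.skip hc hd fun h' => hn ⟨hm.2 h'.1, h'.2⟩
    · intro hlt
      simp only [Test.Holds, NExpr.eval, reg, numE, hnum] at hlt
      obtain ⟨e, he⟩ := exists_edgeAt enum (show σ.nat 20 12 - (edges A).card < (edges A).card by
        by_contra hcon
        exact hb ⟨hc, by omega⟩)
      have hd : DartAt enum (σ.nat 20 12) false e := ⟨_, by omega, he⟩
      have hm := hI.mark he
      refine labelBase_wp (B := (A e.1 e.2).transpose) ?_ ?_ ?_
      · simp only [NExpr.eval, reg, numE, hnum]
        exact hI.blockAt_transpose he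
      · intro h3 hdet τ hτ
        simp only [NExpr.eval, reg, numE, hnum, Matrix.det_transpose] at h3 hdet
        exact h.base hc hd (DartLabel.baseCol (hm.1 h3) hdet) hτ
      · intro hn
        simp only [NExpr.eval, reg, numE, hnum, Matrix.det_transpose] at hn
        refine h.skip hc hd fun h' => hn ⟨hm.2 h'.1, h'.2⟩
  · intro hc
    simp only [Test.Holds, NExpr.eval, reg] at hc
    obtain ⟨hflag, hle⟩ := h.chase.cur hc
    obtain ⟨δ, hδ⟩ : ∃ δ, σ.nat 20 13 = δ + 1 := ⟨σ.nat 20 13 - 1, by omega⟩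
    rw [hδ, Nat.add_sub_cancel] at hflag
    constructor
    · intro hlt
      simp only [Test.Holds, NExpr.eval, reg, numE, hnum] at hlt
      obtain ⟨k, rfl⟩ : ∃ k, δ = (edges A).card + k := ⟨δ - (edges A).card, by omega⟩
      obtain ⟨e, he⟩ := exists_edgeAt enum (show k < (edges A).card by omega)
      have hd : DartAt enum ((edges A).card + k) false e := ⟨k, rfl, he⟩
      obtain ⟨b, hb'⟩ := h.chase.sound _ _ _ hd hflag
      simp only [Prog.block, Prog.wp]
      simp only [NExpr.eval, reg, numE, hnum, hδ, NExpr.pred, Nat.add_sub_cancel,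
        show (edges A).card + k + 1 - (edges A).card = k + 1 by omega,
        show (edges A).card + k - (edges A).card = k by omega, hI.col he]
      have hother := hI.colOther he hb'.mem
      generalize hv : σ.nat 15 e.2 - (k + 1) = v
      have h' := h.setReg v
      have hI' : Indexed I enum (σ.setN 20 14 v) := h₁.congr h'.frame.sameData
      rcases hother with ⟨h15, hal⟩ | ⟨j, f, hj, hf, hfe, h2, h15⟩
      · obtain rfl : v = 0 := by omega
        refine labelNext_wp (B := 0) (by simp) (fun τ h20 _ => by simp [h20]) (by simp) fun _ => ?_
        exact h'.halt (by simpa using hδ) hd fun g _ hg _ => absurd (hal g hg.1 hg.2.2.1) hg.2.1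
      · obtain rfl : v = j + 1 := by omega
        refine labelNext_wp (B := (A f.1 f.2).transpose) (fun _ => ?_) ?_ ?_ ?_
        · simpa using hI'.blockAt_transpose hj
        · intro τ h20 _
          simp [h20]
        · intro _ hdet hfl τ hτ
          rw [Matrix.det_transpose] at hdet
          simp [hδ] at hfl hτ
          exact h'.next (by simpa using hδ) hd (f := f) hj
            (fun g hg => (hp.eq_or_eq' hb'.mem hf hg.1 hfe h2 hg.2.2.1).resolve_left hg.2.1)
            (DartLabel.colStep hb' hf hfe h2 hdet) (by simpa using hfl) hτ
        · intro hn
          refine h'.halt (by simpa using hδ) hd fun g j' hg hj' hfl => hn ?_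
          obtain rfl := (hp.eq_or_eq' hb'.mem hf hg.1 hfe h2 hg.2.2.1).resolve_left hg.2.1
          obtain rfl := EdgeAt.inj hj hj'
          rw [Matrix.det_transpose]
          exact ⟨by simp, hg.2.2.2, by simpa using hfl⟩
    · intro hlt
      simp only [Test.Holds, NExpr.eval, reg, numE, hnum] at hlt
      obtain ⟨e, he⟩ := exists_edgeAt enum (show δ < (edges A).card by omega)
      have hd : DartAt enum δ true e := he
      obtain ⟨b, hb'⟩ := h.chase.sound _ _ _ hd hflag
      simp only [Prog.block, Prog.wp]
      simp only [NExpr.eval, reg, hδ, NExpr.pred, Nat.add_sub_cancel, hI.row he]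
      have hother := hI.rowOther he hb'.mem
      generalize hv : σ.nat 13 e.1 - (δ + 1) = v
      have h' := h.setReg v
      have hI' : Indexed I enum (σ.setN 20 14 v) := h₁.congr h'.frame.sameData
      rcases hother with ⟨h13, hal⟩ | ⟨j, f, hj, hf, hfe, h2, h13⟩
      · obtain rfl : v = 0 := by omega
        refine labelNext_wp (B := 0) (by simp) (fun τ h20 h0 => by simp [h20, h0]) (by simp)
          fun _ => ?_
        exact h'.halt (by simpa using hδ) hd fun g _ hg _ => absurd (hal g hg.1 hg.2.2.1) hg.2.1
      · obtain rfl : v = j + 1 := by omega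
        have hj' : DartAt enum ((edges A).card + j) (!true) f := ⟨j, rfl, hj⟩
        refine labelNext_wp (B := A f.1 f.2) (fun _ => ?_) ?_ ?_ ?_
        · simpa using hI'.blockAt hj
        · intro τ h20 h0
          simp [h20, h0]
        · intro _ hdet hfl τ hτ
          simp [hδ, hnum] at hfl hτ
          exact h'.next (by simpa using hδ) hd (f := f) hj'
            (fun g hg => (hp.eq_or_eq hb'.mem hf hg.1 hfe h2 hg.2.2.1).resolve_left hg.2.1)
            (DartLabel.rowStep hb' hf hfe h2 hdet) (by simpa using hfl) hτ
        · intro hn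
          refine h'.halt (by simpa using hδ) hd fun g j'' hg hj'' hfl => hn ?_
          obtain rfl := (hp.eq_or_eq hb'.mem hf hg.1 hfe h2 hg.2.2.1).resolve_left hg.2.1
          obtain rfl := hj'.eq hj''
          exact ⟨by simp, hg.2.2.2, by simpa [hnum] using hfl⟩

/-- The lines of the labeling are in the memory. -/
structure HasLabels (I : Finset (Fin μ × Fin ν)) (enum : Fin (edges A).card ≃ {e // e ∈ edges A})
    (L : Labeling F μ ν) (σ : State F) : Prop where
  row_ne : ∀ {k e}, EdgeAt enum k e → e ∈ I → ¬ IsIso A I e → σ.vec 12 k ≠ 0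
  row : ∀ {k e}, EdgeAt enum k e → e ∈ I → ¬ IsIso A I e →
    L.U e.1 (L.sign e) = Submodule.span F {σ.vec 12 k}
  col_ne : ∀ {k e}, EdgeAt enum k e → e ∈ I → ¬ IsIso A I e →
    σ.vec 12 ((edges A).card + k) ≠ 0
  col : ∀ {k e}, EdgeAt enum k e → e ∈ I → ¬ IsIso A I e →
    L.V e.2 (L.sign e) = Submodule.span F {σ.vec 12 ((edges A).card + k)}
  opp : ∀ {k e}, EdgeAt enum k e → e ∈ I → ¬ IsIso A I e → (∀ f ∈ I, f.2 = e.2 → f = e) →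
    L.V e.2 (!L.sign e) = Submodule.span F {complVec (σ.vec 12 ((edges A).card + k))}

/-- Each step of the loop labels one end of an edge, or ends a chain of labels, or leaves behind an
end at which no chain has to start, so that a linear number of steps suffices. -/
theorem triple_labels {sgn : Fin μ × Fin ν → Bool} (hw : IsWellLabelled A I sgn)
    (hIE : I ⊆ edges A) {σ₁ : State F} (h₁ : Indexed I enum σ₁) (h17 : ∀ i, σ₁.nat 17 i = 0)
    (h12 : σ₁.nat 20 12 = 0) (h13 : σ₁.nat 20 13 = 0) :
    ∃ L : Labeling F μ ν, IsSearchLabeling A I L ∧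
      Triple (fun σ => σ = σ₁) labels
        ((labelTest.cost + labelBody.bound) * (6 * (edges A).card) + labelTest.cost)
        (fun τ => LabelFrame σ₁ τ ∧ HasLabels I enum L τ) := by
  obtain ⟨L, hL, hU, hV, hV'⟩ := hw.exists_labeling
  have hT := Triple.loop
    (b := labelTest)
    (p := labelBody) (N := 6 * (edges A).card) (J := Labelling I enum σ₁)
    (fun i σ h => by have := h.count; omega)
    (fun i σ h hb => by
      refine h.step hw.proper h₁ ?_
      simpa [(h₁.congr h.frame.sameData).num] using hb)
  refine ⟨L, hL, ?_⟩
  intro σ hσ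
  subst hσ
  have hstart : Labelling I enum σ 0 σ := by
    refine ⟨⟨fun _ _ _ => rfl, fun _ _ _ _ => rfl, fun _ _ _ _ _ => rfl⟩, ?_, ?_⟩
    · rw [h12, h13]
      exact ⟨fun δ s e _ h => absurd (h17 δ) h, fun _ _ _ _ _ _ h => absurd h (by omega),
        fun δ _ _ _ _ _ _ _ h => absurd (h17 δ) h, fun h => absurd rfl h, by omega⟩
    · rw [h12, h13]
      unfold chasePotential
      rw [if_pos rfl]
      omega
  obtain ⟨t, τ, hex, ht, ⟨i, hi⟩, hb⟩ := hT σ ⟨0, hstart⟩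
  refine ⟨t, τ, hex, ht, hi.frame, ?_⟩
  have hn := (h₁.congr hi.frame.sameData).num
  simp only [labelTest, Test.Holds, NExpr.eval, reg, numE, hn, not_not] at hb
  have hch := hi.chase
  rw [hb.1, show τ.nat 20 12 = 2 * (edges A).card by have := hch.le; omega] at hch
  have hlab : ∀ {e : Fin μ × Fin ν} {s δ}, e ∈ I → ¬ IsIso A I e → DartAt enum δ s e →
      ∃ b, DartLabel A I b s e (τ.vec 12 δ) := by
    intro e s δ he hni hδ
    obtain ⟨b, x, hx⟩ := hw.exists_label e he (by unfold IsIso at hni; tauto) s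
    exact hch.sound _ _ _ hδ (hch.complete hIE hx δ hδ)
  constructor
  · intro k e hk he hni
    obtain ⟨b, hb⟩ := hlab (s := true) he hni hk
    exact hb.ne_zero hw.block
  · intro k e hk he hni
    obtain ⟨b, hb⟩ := hlab (s := true) he hni hk
    exact hU _ _ _ hb
  · intro k e hk he hni
    obtain ⟨b, hb⟩ := hlab (s := false) he hni ⟨k, rfl, hk⟩
    exact hb.ne_zero hw.block
  · intro k e hk he hni
    obtain ⟨b, hb⟩ := hlab (s := false) he hni ⟨k, rfl, hk⟩
    exact hV _ _ _ hb
  · intro k e hk he hni hal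
    obtain ⟨b, hb⟩ := hlab (s := false) he hni ⟨k, rfl, hk⟩
    exact hV' _ _ _ hb hal

end Ram

/-! ### The steps of the search -/

section Search

variable {F : Type*} [Field F] {μ ν : ℕ} {A : Blocks F μ ν} {I : Finset (Fin μ × Fin ν)}
  {L : Labeling F μ ν} {T : List (Item F μ ν)}

open Classical in
/-- Add the item to the search forest, unless the space of its row node is already small enough. -/
noncomputable def push (T : List (Item F μ ν)) (q : Item F μ ν) : List (Item F μ ν) :=
  if wRow T q.α ≤ q.R then T else T ++ [q]

/-- The row node of the item `r` has been entered through all edges of `I` that the space of `r`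
allows. -/
def IsEntered (I : Finset (Fin μ × Fin ν)) (L : Labeling F μ ν) (T : List (Item F μ ν))
    (r : Item F μ ν) : Prop :=
  ∀ e ∈ I, e.1 = r.α → r.X ≠ L.U r.α (!L.sign e) → wRow T r.α ≤ L.U r.α (L.sign e)

/-- The row nodes of the items of inner space-walks have been entered through all edges that their
spaces allow, except perhaps for children of the item at position `i`. -/
def EnteredExcept (I : Finset (Fin μ × Fin ν)) (L : Labeling F μ ν) (T : List (Item F μ ν))
    (i : ℕ) : Prop := ∀ r ∈ T, 2 ≤ r.kind → r.par ≠ i → IsEntered I L T r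

/-- The row nodes of the items of inner space-walks have been entered through all edges that their
spaces allow. -/
def Entered (I : Finset (Fin μ × Fin ν)) (L : Labeling F μ ν) (T : List (Item F μ ν)) : Prop :=
  ∀ r ∈ T, 2 ≤ r.kind → IsEntered I L T r

theorem IsEntered.append {r : Item F μ ν} (h : IsEntered I L T r) (N : List (Item F μ ν)) :
    IsEntered I L (T ++ N) r := fun e he hα hX =>
  (wRow_append_le _ _ _).trans (h e he hα hX)

theorem Entered.except (h : Entered I L T) (i : ℕ) : EnteredExcept I L T i :=
  fun r hr hk _ => h r hr hk

theorem push_eq (T : List (Item F μ ν)) (q : Item F μ ν) : ∃ N, push T q = T ++ N := by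
  unfold push
  split_ifs
  exacts [⟨[], by simp⟩, ⟨[q], rfl⟩]

theorem mem_push {q r : Item F μ ν} (h : r ∈ push T q) : r ∈ T ∨ r = q := by
  unfold push at h
  split_ifs at h
  · exact Or.inl h
  · simpa using h

theorem wRow_push_le {q : Item F μ ν} (hk : q.kind ≠ 0) : wRow (push T q) q.α ≤ q.R := by
  unfold push
  split_ifs with h
  · exact h
  · exact wRow_le (by simp) hk

theorem EnteredExcept.push {i : ℕ} (h : EnteredExcept I L T i) {q : Item F μ ν}
    (hq : q.par = i) : EnteredExcept I L (push T q) i := by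
  intro r hr hk hi
  rcases mem_push hr with hr | rfl
  · obtain ⟨N, hN⟩ := push_eq T q
    rw [hN]
    exact (h r hr hk hi).append N
  · exact absurd hq hi

theorem Entered.of_append {N : List (Item F μ ν)} (h : Entered I L T)
    (hN : ∀ r ∈ N, 2 ≤ r.kind → IsEntered I L (T ++ N) r) : Entered I L (T ++ N) := by
  intro r hr hk
  rcases List.mem_append.1 hr with hr | hr
  exacts [(h r hr hk).append N, hN r hr hk]

theorem line_le_iff {S R : Space F} (hS : Module.finrank F S = 1) (hR : R ≠ ⊤) :
    S ≤ R ↔ S = R := by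
  refine ⟨fun h => Submodule.eq_of_le_of_finrank_le h ?_, fun h => h.le⟩
  have h1 := finrank_space_le R
  have h2 : Module.finrank F R ≠ 2 := fun h => hR (finrank_eq_two_space.1 h)
  omega

/-- Adding a reachable item keeps the search forest. An earlier visit of the row node with a smaller
space that is not due to a sibling would have entered along the same edge. -/
theorem IsForest.push (hL : L.IsValid A I) (h : IsForest A I L T) {p q : Item F μ ν}
    (hp : T[q.par]? = some p) (hs : IsStep A I L p q) (he : EnteredExcept I L T q.par) :
    IsForest A I L (push T q) := by
  unfold _root_.push
  split_ifs with hnew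
  · exact h
  refine h.step hp hs hnew fun r hr hk hα hX => ?_
  by_contra hpar
  apply hnew
  obtain ⟨p', -, -, hs'⟩ := h.exists_step hr hk
  have hle := wRow_le hr hk
  rw [hα] at hle
  by_cases hi : IsIso A I (q.α, q.β)
  · have hrq : (r.α, r.β) = (q.α, q.β) := hi.2.1 _ hs'.mem hα
    obtain ⟨-, -, hR, -⟩ := hs.of_iso hi
    obtain ⟨-, -, hR', -⟩ := hs'.of_iso (hrq ▸ hi)
    rw [hR]
    rw [hR'] at hle
    exact hle.trans hX
  · obtain ⟨-, hR, -, hXne, -⟩ := hs.of_not_iso hL hi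
    rw [hR]
    have hi' : ¬ IsIso A I (r.α, r.β) := fun hi' =>
      hi (hi'.2.1 _ hs.mem hα.symm ▸ hi')
    have hk' := (hs'.of_not_iso hL hi').1
    have := he r hr hk' hpar _ hs.mem hα.symm
    rw [hα] at this
    apply this
    intro hrX
    rw [hrX, line_le_iff (hL.dimU _ _) (hs.X_ne_top hL)] at hX
    exact hXne hX.symm

theorem IsStep.isEntered_extend (hL : L.IsValid A I) {p q : Item F μ ν} (hs : IsStep A I L p q)
    (hk : q.kind = 3) {N : List (Item F μ ν)} (hle : wRow N q.α ≤ q.R) : IsEntered I L N q := by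
  cases hs with
  | iso hk' => omega
  | enter hk' => omega
  | extend _ hI hp hJ hd hα hβ hX hR hY hl =>
    intro e he heα hne
    rw [hX, hR] at hne
    rw [hR] at hle
    by_cases hee : (q.α, q.β) = e
    · rwa [← hee]
    · have := hL.proper _ hI e he hee (Or.inl heα.symm)
      rw [not_eq_of_ne_bool this] at hne
      exact absurd rfl hne

theorem handled_of_iso {e : Fin μ × Fin ν} (he : e ∈ I) (hi : IsIso A I e) {X : Space F}
    (h : wRow T e.1 ≤ X) : Handled A I L T e.1 X := by
  refine ⟨⟨e, he, rfl⟩, fun f hf hfe => ?_⟩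
  obtain rfl := hi.2.1 f hf hfe
  exact ⟨fun _ => h, fun hn => absurd hi hn⟩

theorem handled_of_alone {e : Fin μ × Fin ν} (he : e ∈ I) (hal : ∀ f ∈ I, f.1 = e.1 → f = e)
    (hi : ¬ IsIso A I e) (h : wRow T e.1 ≤ L.U e.1 (L.sign e)) :
    Handled A I L T e.1 (L.U e.1 (L.sign e)) := by
  refine ⟨⟨e, he, rfl⟩, fun f hf hfe => ?_⟩
  obtain rfl := hal f hf hfe
  exact ⟨fun hi' => absurd hi' hi, fun _ => ⟨fun _ => h, fun _ => rfl⟩⟩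

theorem handled_of_pair (hL : L.IsValid A I) {e f : Fin μ × Fin ν} (he : e ∈ I) (hf : f ∈ I)
    (hne : f ≠ e) (h1 : f.1 = e.1) {X : Space F}
    (h : X ≠ L.U e.1 (!L.sign e) → wRow T e.1 ≤ L.U e.1 (L.sign e))
    (h' : X ≠ L.U e.1 (!L.sign f) → wRow T e.1 ≤ L.U e.1 (L.sign f)) :
    Handled A I L T e.1 X := by
  refine ⟨⟨e, he, rfl⟩, fun g hg hge => ?_⟩
  rcases IsProperSign.eq_or_eq hL.proper he hf hg hne h1 hge with rfl | rfl
  · exact ⟨fun hi => absurd hi (not_isIso_of_ne hf hne (Or.inl h1)), fun _ => ⟨h, fun hal =>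
      absurd (hal f hf h1) hne⟩⟩
  · exact ⟨fun hi => absurd hi (not_isIso_of_ne he hne.symm (Or.inl h1.symm)), fun _ => ⟨h',
      fun hal => absurd (hal e he rfl) hne.symm⟩⟩

end Search

namespace Ram

section

variable {F : Type*} [Field F] {μ ν : ℕ} {A : Blocks F μ ν} {I : Finset (Fin μ × Fin ν)}
  {enum : Fin (edges A).card ≃ {e // e ∈ edges A}} {L : Labeling F μ ν} {T : List (Item F μ ν)}

/-- The continuations of the item `q` inside `I` have been treated, and those along the edges
outside `I` at the positions from `p` on. -/
structure ExpandedFrom (I : Finset (Fin μ × Fin ν))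
    (enum : Fin (edges A).card ≃ {e // e ∈ edges A}) (L : Labeling F μ ν)
    (T : List (Item F μ ν)) (q : Item F μ ν) (p : ℕ) : Prop where
  outer : ∀ k α X, EdgeAt enum k (α, q.β) → p ≤ k → OuterTo A I q α X → Handled A I L T α X
  inner : 2 ≤ q.kind → ∀ f ∈ I, f.2 = q.β → f.1 ≠ q.α → (A f.1 f.2).det ≠ 0 →
    ∀ g ∈ I, g.1 = f.1 → g ≠ f → wRow T g.1 ≤ L.U g.1 (L.sign g)

theorem ExpandedFrom.append {q : Item F μ ν} {p : ℕ} (h : ExpandedFrom I enum L T q p)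
    (N : List (Item F μ ν)) : ExpandedFrom I enum L (T ++ N) q p :=
  ⟨fun k α X hk hp ho => (h.outer k α X hk hp ho).append N,
    fun hk f hf h2 h1 hd g hg hgf hne =>
      (wRow_append_le _ _ _).trans (h.inner hk f hf h2 h1 hd g hg hgf hne)⟩

theorem ExpandedFrom.isExpanded {q : Item F μ ν} (h : ExpandedFrom I enum L T q 0) :
    IsExpanded A I L T q := by
  refine ⟨fun α X ho => ?_, h.inner⟩
  obtain ⟨k, hk⟩ := exists_pos enum ho.1
  exact h.outer k α X hk (Nat.zero_le _) ho

theorem ExpandedFrom.lastBelow {q : Item F μ ν} {m : ℕ} (h : ExpandedFrom I enum L T q m) :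
    ExpandedFrom I enum L T q (lastBelow (OffEdge enum I q.β) m) := by
  refine ⟨fun k α X hk hle ho => ?_, h.inner⟩
  by_cases hkm : m ≤ k
  · exact h.outer k α X hk hkm ho
  · exact absurd ⟨_, hk, ho.2.1, rfl⟩ ((lastBelow_spec (OffEdge enum I q.β) m).2 k (by omega) hle)

/-- The state of the search: the items before `qh` have been taken up, and of the last one of these
the edges outside `I` before the position `p` still have to be treated. -/
structure SearchState (I : Finset (Fin μ × Fin ν))
    (enum : Fin (edges A).card ≃ {e // e ∈ edges A}) (L : Labeling F μ ν)
    (T : List (Item F μ ν)) (qh p : ℕ) : Prop where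
  forest : IsForest A I L T
  roots : ∀ β, IsStart A I β → ∃ q ∈ T, q.kind = 0 ∧ q.β = β
  entered : Entered I L T
  le : qh ≤ T.length
  expanded : ∀ j q, j < qh → T[j]? = some q →
    ExpandedFrom I enum L T q (if j + 1 = qh then p else 0)
  pos : ∀ k, p = k + 1 → ∃ q, 0 < qh ∧ T[qh - 1]? = some q ∧ OffEdge enum I q.β k

theorem SearchState.isCompleted (h : SearchState I enum L T T.length 0) : IsCompleted A I L T := by
  refine ⟨fun q hq => ?_, h.roots⟩
  obtain ⟨j, hj⟩ := List.mem_iff_getElem?.1 hq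
  have := h.expanded j q (List.getElem?_eq_some_iff.1 hj).1 hj
  rw [ite_self] at this
  exact this.isExpanded

theorem getElem?_append_of_some {α : Type*} {T N : List α} {j : ℕ} {q : α} (h : T[j]? = some q) :
    (T ++ N)[j]? = some q := by
  rw [List.getElem?_append_left (List.getElem?_eq_some_iff.1 h).1, h]

theorem getElem?_of_append {α : Type*} {T N : List α} {j : ℕ} {q : α} (h : (T ++ N)[j]? = some q)
    (hj : j < T.length) : T[j]? = some q := by
  rwa [List.getElem?_append_left hj] at h

theorem lastBelow_pos {P : ℕ → Prop} {m k : ℕ} (h : lastBelow P m = k + 1) : P k := by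
  obtain ⟨h1 | ⟨j, -, hj, h1⟩, -⟩ := lastBelow_spec P m
  · omega
  · obtain rfl : j = k := by omega
    exact hj

/-- The next item is taken up. -/
theorem SearchState.pop {qh : ℕ} (h : SearchState I enum L T qh 0) {q : Item F μ ν}
    (hq : T[qh]? = some q) {N : List (Item F μ ν)} (hF : IsForest A I L (T ++ N))
    (hE : Entered I L (T ++ N))
    (hi : 2 ≤ q.kind → ∀ f ∈ I, f.2 = q.β → f.1 ≠ q.α → (A f.1 f.2).det ≠ 0 →
      ∀ g ∈ I, g.1 = f.1 → g ≠ f → wRow (T ++ N) g.1 ≤ L.U g.1 (L.sign g)) :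
    SearchState I enum L (T ++ N) (qh + 1) (lastBelow (OffEdge enum I q.β) (edges A).card) := by
  have hlt := (List.getElem?_eq_some_iff.1 hq).1
  refine ⟨hF, fun β hβ => ?_, hE, by rw [List.length_append]; omega, fun j r hj hr => ?_,
    fun k hk => ⟨q, by omega, getElem?_append_of_some hq, lastBelow_pos hk⟩⟩
  · obtain ⟨r, hr, h'⟩ := h.roots β hβ
    exact ⟨r, List.mem_append_left _ hr, h'⟩
  · have hr' := getElem?_of_append hr (by omega)
    by_cases hjq : j = qh
    · subst hjq
      obtain rfl : q = r := by rw [hq] at hr'; exact Option.some.inj hr'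
      rw [if_pos rfl]
      exact ExpandedFrom.lastBelow ⟨fun k α X hk hle _ => absurd hk.lt (by omega), hi⟩
    · rw [if_neg (by omega)]
      have := h.expanded j r (by omega) hr'
      rw [ite_self] at this
      exact this.append N

/-- The edge at the position `k` has been treated. -/
theorem SearchState.advance {qh k : ℕ} (h : SearchState I enum L T qh (k + 1)) {q : Item F μ ν}
    (hqh : 0 < qh) (hq : T[qh - 1]? = some q) {α : Fin μ} (hk : EdgeAt enum k (α, q.β))
    {N : List (Item F μ ν)}
    (hF : IsForest A I L (T ++ N)) (hE : Entered I L (T ++ N))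
    (hH : ∀ X, OuterTo A I q α X → Handled A I L (T ++ N) α X) :
    SearchState I enum L (T ++ N) qh (lastBelow (OffEdge enum I q.β) k) := by
  have hle := h.le
  refine ⟨hF, fun β hβ => ?_, hE, by rw [List.length_append]; omega, fun j r hj hr => ?_,
    fun k hk => ⟨q, hqh, getElem?_append_of_some hq, lastBelow_pos hk⟩⟩
  · obtain ⟨r, hr, h'⟩ := h.roots β hβ
    exact ⟨r, List.mem_append_left _ hr, h'⟩
  · have hr' := getElem?_of_append hr (by omega)
    have := (h.expanded j r hj hr').append N
    by_cases hjq : j + 1 = qh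
    · obtain rfl : j = qh - 1 := by omega
      obtain rfl : q = r := by rw [hq] at hr'; exact Option.some.inj hr'
      rw [if_pos hjq] at this ⊢
      refine ExpandedFrom.lastBelow ⟨fun j α' X hj hle ho => ?_, this.inner⟩
      by_cases hjk : j = k
      · subst hjk
        obtain rfl : α = α' := congrArg Prod.fst (hk.eq hj)
        exact hH X ho
      · exact this.outer j α' X hj (by omega) ho
    · rw [if_neg hjq] at this ⊢
      exact this

end

end Ram

/-! ### The search forest in the memory -/

section Code

variable {F : Type*} [Field F]

/-- The number `c` and the vector `v` describe the space `S`. -/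
def IsCode (c : ℕ) (v : Fin 2 → F) (S : Space F) : Prop :=
  c = 0 ∧ S = ⊤ ∨ c = 1 ∧ v ≠ 0 ∧ S = Submodule.span F {v} ∨ c = 2 ∧ S = ⊥

theorem IsCode.decodeSpace {c : ℕ} {v : Fin 2 → F} {S : Space F} (h : IsCode c v S) :
    decodeSpace c (v 0) (v 1) = S := by
  have hv : ![v 0, v 1] = v := by
    funext i
    fin_cases i <;> rfl
  rcases h with ⟨rfl, rfl⟩ | ⟨rfl, -, rfl⟩ | ⟨rfl, rfl⟩
  · rfl
  · simp only [_root_.decodeSpace, hv]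
  · rfl

theorem isCode_line {v : Fin 2 → F} (h : v ≠ 0) : IsCode 1 v (Submodule.span F {v}) :=
  Or.inr (Or.inl ⟨rfl, h, rfl⟩)

theorem IsCode.le_iff {c c' : ℕ} {v v' : Fin 2 → F} {S R : Space F} (h : IsCode c v S)
    (h' : IsCode c' v' R) (hR : R ≠ ⊤) :
    S ≤ R ↔ c = 2 ∨ c = 1 ∧ c' = 1 ∧ cross v v' = 0 := by
  rcases h' with ⟨-, h'⟩ | ⟨rfl, hv', rfl⟩ | ⟨rfl, rfl⟩
  · exact absurd h' hR
  · rcases h with ⟨rfl, rfl⟩ | ⟨rfl, hv, rfl⟩ | ⟨rfl, rfl⟩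
    · simpa [top_le_iff] using hR
    · rw [span_le_span_vec_iff hv', cross_comm, neg_eq_zero]
      simp
    · simp
  · rcases h with ⟨rfl, rfl⟩ | ⟨rfl, hv, rfl⟩ | ⟨rfl, rfl⟩
    · simp
    · simpa using hv
    · simp

theorem IsCode.eq_line_iff {c : ℕ} {v w : Fin 2 → F} {S : Space F} (h : IsCode c v S)
    (hw : w ≠ 0) : S = Submodule.span F {w} ↔ c = 1 ∧ cross v w = 0 := by
  rcases h with ⟨rfl, rfl⟩ | ⟨rfl, hv, rfl⟩ | ⟨rfl, rfl⟩
  · have := line_ne_top (finrank_span_vec hw)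
    simpa using this.symm
  · rw [span_eq_span_vec_iff hw hv, cross_comm, neg_eq_zero]
    simp
  · have := line_ne_bot (finrank_span_vec hw)
    simpa using this.symm

theorem IsCode.inf {c c' : ℕ} {v v' : Fin 2 → F} {S R : Space F} (h : IsCode c v S)
    (h' : IsCode c' v' R) (hSR : ¬ S ≤ R) :
    IsCode (if c = 0 then c' else 2) (if c = 0 then v' else v) (S ⊓ R) := by
  rcases h with ⟨rfl, rfl⟩ | ⟨rfl, hv, rfl⟩ | ⟨rfl, rfl⟩
  · simpa using h'
  · have := finrank_lt_of_not_le hSR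
    rw [finrank_span_vec hv, Nat.lt_one_iff, finrank_eq_zero_space] at this
    exact Or.inr (Or.inr ⟨rfl, this⟩)
  · exact absurd bot_le hSR

theorem IsCode.sup {c c' : ℕ} {v v' : Fin 2 → F} {S R : Space F} (h : IsCode c v S)
    (h' : IsCode c' v' R) (hSR : ¬ R ≤ S) :
    IsCode (if c = 2 then c' else 0) (if c = 2 then v' else v) (S ⊔ R) := by
  rcases h with ⟨rfl, rfl⟩ | ⟨rfl, hv, rfl⟩ | ⟨rfl, rfl⟩
  · exact absurd le_top hSR
  · have h1 := finrank_lt_of_not_ge hSR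
    have h2 := finrank_space_le (Submodule.span F {v} ⊔ R)
    rw [finrank_span_vec hv] at h1
    exact Or.inl ⟨rfl, finrank_eq_two_space.1 (by omega)⟩
  · simpa using h'

end Code

namespace Ram

/-- The row node of the edge in register 7. -/
@[simp] def rowE : NExpr := .get 1 (reg 7)

/-- The column node of the edge in register 7. -/
@[simp] def colE : NExpr := .get 2 (reg 7)

/-- The determinant of the vectors in the cells `i` of the arrays `a`, `a + 1` and `j` of `b`,
`b + 1`. -/
@[simp] def crossE (a : ℕ) (i : NExpr) (b : ℕ) (j : NExpr) : FExpr :=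
  .sub (.mul (.get a i) (.get (b + 1) j)) (.mul (.get (a + 1) i) (.get b j))

/-- Append the item in the registers to the list of items. The registers 6 to 11 hold the kind of
the item, its edge, the codimensions of `X`, `R`, `Y`, and its length, the cells `0` of the arrays
`20` to `25` hold the vectors of `X`, `R`, `Y`, and the parent is the last item that was taken up,
whose position is the predecessor of register 1. -/
def storeItem : Prog := .block
  [.setN 21 (reg 2) (reg 6), .setN 22 (reg 2) (reg 1).pred, .setN 23 (reg 2) rowE,
   .setN 24 (reg 2) colE, .setN 25 (reg 2) (reg 7), .setN 26 (reg 2) (reg 11),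
   .setN 27 (reg 2) (reg 8), .setN 28 (reg 2) (reg 10), .setN 29 (reg 2) (reg 9),
   copyVec 20 (.const 0) 14 (reg 2), copyVec 24 (.const 0) 16 (reg 2),
   copyVec 22 (.const 0) 18 (reg 2), .setN 20 (.const 2) (reg 2).succ]

/-- Intersect the row space of the forest with that of the item in the registers. -/
def updateRow : Prog :=
  .cond (.eq (.get 5 rowE) (.const 0))
    (.block [copyVec 22 (.const 0) 4 rowE, .setN 5 rowE (reg 9)]) (.setN 5 rowE (.const 2))

/-- Add the column space of the item in the registers to that of the forest. -/
def updateCol : Prog :=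
  .cond (.eq (.get 6 colE) (.const 2))
    (.block [copyVec 24 (.const 0) 6 colE, .setN 6 colE (reg 10)]) (.setN 6 colE (.const 0))

/-- Add the item in the registers to the search forest, unless the space of its row node is already
small enough. -/
def pushItem : Prog :=
  .cond (.and (.not (.eq (.get 5 rowE) (.const 2)))
      (.not (.and (.eq (.get 5 rowE) (.const 1)) (.and (.eq (reg 9) (.const 1))
        (.feq (crossE 4 rowE 22 (.const 0)) .zero)))))
    (.block [updateRow, updateCol, storeItem]) .skip

variable {F : Type*} [Field F] {μ ν : ℕ} {A : Blocks F μ ν} {I : Finset (Fin μ × Fin ν)}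
  {enum : Fin (edges A).card ≃ {e // e ∈ edges A}} {L : Labeling F μ ν} {T : List (Item F μ ν)}

/-- The item `q` is in the memory at position `j`. -/
structure ItemAt (enum : Fin (edges A).card ≃ {e // e ∈ edges A}) (σ : State F) (j : ℕ)
    (q : Item F μ ν) : Prop where
  kind : σ.nat 21 j = q.kind
  par : σ.nat 22 j = q.par
  row : σ.nat 23 j = q.α
  col : σ.nat 24 j = q.β
  edge : EdgeAt enum (σ.nat 25 j) (q.α, q.β)
  len : σ.nat 26 j = q.len
  X : IsCode (σ.nat 27 j) (σ.vec 14 j) q.X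
  Y : IsCode (σ.nat 28 j) (σ.vec 16 j) q.Y
  R : IsCode (σ.nat 29 j) (σ.vec 18 j) q.R

/-- The list of items and the spaces of the search forest are in the memory. -/
structure Rep (I : Finset (Fin μ × Fin ν)) (enum : Fin (edges A).card ≃ {e // e ∈ edges A})
    (T : List (Item F μ ν)) (σ : State F) : Prop where
  count : σ.nat 20 2 = T.length
  items : ∀ j q, T[j]? = some q → ItemAt enum σ j q
  row : ∀ α : Fin μ, IsCode (σ.nat 5 α) (σ.vec 4 α) (wRow T α)
  col : ∀ β : Fin ν, IsCode (σ.nat 6 β) (σ.vec 6 β) (witnessCol I T β)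

/-- The item `q` is in the registers. -/
structure RegItem (enum : Fin (edges A).card ≃ {e // e ∈ edges A}) (q : Item F μ ν)
    (σ : State F) : Prop where
  kind : σ.nat 20 6 = q.kind
  par : σ.nat 20 1 - 1 = q.par
  edge : EdgeAt enum (σ.nat 20 7) (q.α, q.β)
  len : σ.nat 20 11 = q.len
  X : IsCode (σ.nat 20 8) (σ.vec 20 0) q.X
  R : IsCode (σ.nat 20 9) (σ.vec 22 0) q.R
  Y : IsCode (σ.nat 20 10) (σ.vec 24 0) q.Y

/-- The state `τ` arises from `σ` by a change of the search forest. -/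
structure ForestFrame (σ τ : State F) : Prop where
  nat : ∀ a, a ≠ 5 → a ≠ 6 → (a < 20 ∨ 29 < a) → τ.nat a = σ.nat a
  regs : ∀ i, i ≠ 2 → τ.nat 20 i = σ.nat 20 i
  fld : ∀ a, (a < 4 ∨ 7 < a) → (a < 14 ∨ 19 < a) → τ.fld a = σ.fld a

theorem ForestFrame.vec {F : Type*} {σ τ : State F} (h : ForestFrame σ τ) {a : ℕ} (h1 : 7 < a)
    (h2 : a < 13 ∨ 19 < a) : τ.vec a = σ.vec a := by
  funext j
  rw [State.vec, State.vec, h.fld a (by omega) (by omega), h.fld (a + 1) (by omega) (by omega)]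

theorem ForestFrame.trans {F : Type*} {σ₁ σ₂ σ₃ : State F} (h : ForestFrame σ₁ σ₂)
    (h' : ForestFrame σ₂ σ₃) : ForestFrame σ₁ σ₃ :=
  ⟨fun a h1 h2 h3 => (h'.nat a h1 h2 h3).trans (h.nat a h1 h2 h3),
    fun i hi => (h'.regs i hi).trans (h.regs i hi),
    fun a h1 h2 => (h'.fld a h1 h2).trans (h.fld a h1 h2)⟩

theorem ForestFrame.sameData {F : Type*} {σ τ : State F} (h : ForestFrame σ τ) : SameData σ τ := by
  constructor <;> first
    | exact h.nat _ (by omega) (by omega) (by omega)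
    | exact h.fld _ (by omega) (by omega)

theorem RegItem.congr {σ τ : State F} {q : Item F μ ν} (h : RegItem enum q σ)
    (hf : ForestFrame σ τ) : RegItem enum q τ := by
  obtain ⟨h1, h2, h3, h4, h5, h6, h7⟩ := h
  constructor
  · rwa [hf.regs _ (by omega)]
  · rwa [hf.regs _ (by omega)]
  · rwa [hf.regs _ (by omega)]
  · rwa [hf.regs _ (by omega)]
  · rwa [hf.regs _ (by omega), hf.vec (by omega) (by omega)]
  · rwa [hf.regs _ (by omega), hf.vec (by omega) (by omega)]
  · rwa [hf.regs _ (by omega), hf.vec (by omega) (by omega)]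

/-- The item `q` is appended to the list of items. -/
structure Stored (enum : Fin (edges A).card ≃ {e // e ∈ edges A}) (q : Item F μ ν)
    (σ τ : State F) : Prop where
  frame : ForestFrame σ τ
  n5 : τ.nat 5 = σ.nat 5
  n6 : τ.nat 6 = σ.nat 6
  v4 : τ.vec 4 = σ.vec 4
  v6 : τ.vec 6 = σ.vec 6
  count : τ.nat 20 2 = σ.nat 20 2 + 1
  old : ∀ j r, j < σ.nat 20 2 → ItemAt enum σ j r → ItemAt enum τ j r
  new : ItemAt enum τ (σ.nat 20 2) q

theorem storeItem_wp {σ : State F} (hI : Indexed I enum σ) {q : Item F μ ν}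
    (hq : RegItem enum q σ) {Q : State F → Prop} (h : ∀ τ, Stored enum q σ τ → Q τ) :
    storeItem.wp Q σ := by
  simp only [storeItem, Prog.block, Prog.wp]
  refine copyVec_wp (by omega) ?_
  refine copyVec_wp (by omega) ?_
  refine copyVec_wp (by omega) ?_
  have hr := hI.row hq.edge
  have hc := hI.col hq.edge
  apply h
  obtain ⟨h1, h2, h3, h4, h5, h6, h7⟩ := hq
  constructor
  · constructor
    · intro a ha5 ha6 ha
      simp [show a ≠ 20 by omega, show a ≠ 21 by omega, show a ≠ 22 by omega,
        show a ≠ 23 by omega, show a ≠ 24 by omega, show a ≠ 25 by omega, show a ≠ 26 by omega,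
        show a ≠ 27 by omega, show a ≠ 28 by omega, show a ≠ 29 by omega]
    · intro i hi
      simp [hi]
    · intro a h1 h2
      rw [State.fld_setN]
      rw [State.fld_setVec, State.fld_setVec, State.fld_setVec] <;> first | rfl | omega
  · simp
  · simp
  · simp [State.vec_setVec_of_ne]
  · simp [State.vec_setVec_of_ne]
  · simp
  · intro j r hj ⟨r1, r2, r3, r4, r5, r6, r7, r8, r9⟩
    have hne : j ≠ σ.nat 20 2 := by omega
    constructor <;> simp [State.vec_setVec_of_ne, State.vec_setVec, hne] <;> assumption
  · constructor <;> simp [State.vec_setVec_of_ne, State.vec_setVec] <;> assumption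

end Ram

namespace Ram

/-- The state `τ` arises from `σ` by a change of the spaces of the search forest. -/
structure SpaceFrame {F : Type*} (σ τ : State F) : Prop where
  nat : ∀ a, a ≠ 5 → a ≠ 6 → τ.nat a = σ.nat a
  fld : ∀ a, (a < 4 ∨ 7 < a) → τ.fld a = σ.fld a

theorem SpaceFrame.forestFrame {F : Type*} {σ τ : State F} (h : SpaceFrame σ τ) :
    ForestFrame σ τ :=
  ⟨fun a h1 h2 _ => h.nat a h1 h2, fun i _ => by rw [h.nat 20 (by omega) (by omega)],
    fun a h1 _ => h.fld a h1⟩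

theorem SpaceFrame.trans {F : Type*} {σ₁ σ₂ σ₃ : State F} (h : SpaceFrame σ₁ σ₂)
    (h' : SpaceFrame σ₂ σ₃) : SpaceFrame σ₁ σ₃ :=
  ⟨fun a h1 h2 => (h'.nat a h1 h2).trans (h.nat a h1 h2),
    fun a h1 => (h'.fld a h1).trans (h.fld a h1)⟩

theorem SpaceFrame.vec {F : Type*} {σ τ : State F} (h : SpaceFrame σ τ) {a : ℕ} (h1 : 7 < a) :
    τ.vec a = σ.vec a := by
  funext j
  rw [State.vec, State.vec, h.fld a (by omega), h.fld (a + 1) (by omega)]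

variable {F : Type*} [Field F] {μ ν : ℕ} {A : Blocks F μ ν} {I : Finset (Fin μ × Fin ν)}
  {enum : Fin (edges A).card ≃ {e // e ∈ edges A}} {L : Labeling F μ ν} {T : List (Item F μ ν)}

theorem SpaceFrame.itemAt {σ τ : State F} (h : SpaceFrame σ τ) {j : ℕ} {q : Item F μ ν}
    (hq : ItemAt enum σ j q) : ItemAt enum τ j q := by
  obtain ⟨h1, h2, h3, h4, h5, h6, h7, h8, h9⟩ := hq
  constructor <;> rw [h.nat _ (by omega) (by omega)] <;>
    first | assumption | (rw [h.vec (by omega)]; assumption)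

theorem updateRow_wp {σ : State F} {a : ℕ} (ha : σ.nat 1 (σ.nat 20 7) = a) {Q : State F → Prop}
    (h : ∀ τ, SpaceFrame σ τ → τ.nat 6 = σ.nat 6 → τ.vec 6 = σ.vec 6 →
      τ.nat 5 = Function.update (σ.nat 5) a (if σ.nat 5 a = 0 then σ.nat 20 9 else 2) →
      τ.vec 4 = Function.update (σ.vec 4) a (if σ.nat 5 a = 0 then σ.vec 22 0 else σ.vec 4 a) →
      Q τ) : updateRow.wp Q σ := by
  constructor
  · intro hc
    simp only [Test.Holds, NExpr.eval, reg, rowE, ha] at hc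
    simp only [Prog.block, Prog.wp]
    refine copyVec_wp (by omega) (h _ ⟨?_, ?_⟩ ?_ ?_ ?_ ?_)
    · intro a h1 h2
      simp [h1]
    · intro a h1
      rw [State.fld_setN, State.fld_setVec] <;> omega
    · simp
    · simp [State.vec_setVec_of_ne]
    · simp [ha, hc]
    · simp [ha, hc, State.vec_setVec]
  · intro hc
    simp only [Test.Holds, NExpr.eval, reg, rowE, ha] at hc
    refine h _ ⟨?_, ?_⟩ ?_ ?_ ?_ ?_
    · intro a h1 h2
      simp [h1]
    · intros
      rfl
    · simp
    · simp
    · simp [ha, hc]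
    · simp [hc]

theorem updateCol_wp {σ : State F} {b : ℕ} (hb : σ.nat 2 (σ.nat 20 7) = b) {Q : State F → Prop}
    (h : ∀ τ, SpaceFrame σ τ → τ.nat 5 = σ.nat 5 → τ.vec 4 = σ.vec 4 →
      τ.nat 6 = Function.update (σ.nat 6) b (if σ.nat 6 b = 2 then σ.nat 20 10 else 0) →
      τ.vec 6 = Function.update (σ.vec 6) b (if σ.nat 6 b = 2 then σ.vec 24 0 else σ.vec 6 b) →
      Q τ) : updateCol.wp Q σ := by
  constructor
  · intro hc
    simp only [Test.Holds, NExpr.eval, reg, colE, hb] at hc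
    simp only [Prog.block, Prog.wp]
    refine copyVec_wp (by omega) (h _ ⟨?_, ?_⟩ ?_ ?_ ?_ ?_)
    · intro a h1 h2
      simp [h2]
    · intro a h1
      rw [State.fld_setN, State.fld_setVec] <;> omega
    · simp
    · simp [State.vec_setVec_of_ne]
    · simp [hb, hc]
    · simp [hb, hc, State.vec_setVec]
  · intro hc
    simp only [Test.Holds, NExpr.eval, reg, colE, hb] at hc
    refine h _ ⟨?_, ?_⟩ ?_ ?_ ?_ ?_
    · intro a h1 h2
      simp [h2]
    · intros
      rfl
    · simp
    · simp
    · simp [hb, hc]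
    · simp [hc]

theorem Stored.items {σ τ : State F} {q : Item F μ ν} (h : Stored enum q σ τ)
    (hc : σ.nat 20 2 = T.length) (hT : ∀ j r, T[j]? = some r → ItemAt enum σ j r) (j : ℕ)
    (r : Item F μ ν) (hr : (T ++ [q])[j]? = some r) : ItemAt enum τ j r := by
  by_cases hj : j < T.length
  · exact h.old j r (by omega) (hT j r (getElem?_of_append hr hj))
  · rw [List.getElem?_append_right (by omega)] at hr
    obtain ⟨hj', hr⟩ := List.getElem?_eq_some_iff.1 hr
    simp only [List.length_singleton] at hj'
    obtain rfl : j = σ.nat 20 2 := by omega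
    simp only [hc, Nat.sub_self, List.getElem_cons_zero] at hr
    rw [← hr]
    exact h.new

theorem witnessCol_of_mem {e : Fin μ × Fin ν} (he : e ∈ I) (T : List (Item F μ ν)) :
    witnessCol I T e.2 = wCol T e.2 := by
  rw [witnessCol, if_neg fun h => h e he rfl]

theorem pushItem_wp (hL : L.IsValid A I) (hb : ∀ e ∈ I, A e.1 e.2 ≠ 0) (hF : IsForest A I L T)
    {σ : State F} (hI : Indexed I enum σ) (hT : Rep I enum T σ) {p q : Item F μ ν}
    (hs : IsStep A I L p q) (hq : RegItem enum q σ) {Q : State F → Prop}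
    (h : ∀ τ, ForestFrame σ τ → Rep I enum (push T q) τ → Q τ) : pushItem.wp Q σ := by
  classical
  have hr := hI.row hq.edge
  have hc := hI.col hq.edge
  dsimp only at hr hc
  have hle := (hT.row q.α).le_iff hq.R (hs.R_ne_top hL)
  constructor
  · intro htest
    simp only [Test.Holds, NExpr.eval, FExpr.eval, reg, rowE, hr, crossE] at htest
    have hnew : ¬ wRow T q.α ≤ q.R := by
      rw [hle]
      rintro (h2 | ⟨h1, h1', h0⟩)
      exacts [htest.1 h2, htest.2 ⟨h1, h1', h0⟩]
    have hnewY := hF.not_le_wCol hL hb hs hnew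
    have hmem : witnessCol I T q.β = wCol T q.β := witnessCol_of_mem hs.mem T
    simp only [Prog.block, Prog.wp]
    refine updateRow_wp hr fun σ₁ f₁ n6 v6 n5 v4 => ?_
    have hc₁ : σ₁.nat 2 (σ₁.nat 20 7) = q.β := by
      rw [f₁.nat 2 (by omega) (by omega), f₁.nat 20 (by omega) (by omega), hc]
    refine updateCol_wp hc₁ fun σ₂ f₂ n5' v4' n6' v6' => ?_
    have f := f₁.trans f₂
    refine storeItem_wp (hI.congr f.forestFrame.sameData) (hq.congr f.forestFrame) fun τ hτ => ?_
    refine h τ (f.forestFrame.trans hτ.frame) ?_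
    rw [push, if_neg hnew]
    have hcount : σ₂.nat 20 2 = T.length := by rw [f.nat 20 (by omega) (by omega), hT.count]
    refine ⟨?_, hτ.items hcount fun j r hr => f.itemAt (hT.items j r hr), fun α => ?_, fun β => ?_⟩
    · rw [hτ.count, hcount, List.length_append, List.length_singleton]
    · rw [hτ.n5, hτ.v4, n5', v4', n5, v4]
      by_cases hα : q.α = α
      · subst hα
        have hw : wRow (T ++ [q]) q.α = wRow T q.α ⊓ q.R := by
          rw [wRow_append, if_pos ⟨hs.kind_ne, rfl⟩]
        rw [hw, Function.update_self, Function.update_self]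
        exact (hT.row q.α).inf hq.R hnew
      · have hne : (α : ℕ) ≠ q.α := fun h => hα (Fin.ext h.symm)
        have hw : wRow (T ++ [q]) α = wRow T α := by
          rw [wRow_append, if_neg fun h => hα h.2]
        rw [hw, Function.update_of_ne hne, Function.update_of_ne hne]
        exact hT.row α
    · rw [hτ.n6, hτ.v6, n6', v6', n6, v6, f₁.nat 20 (by omega) (by omega), f₁.vec (by omega)]
      by_cases hβ : q.β = β
      · subst hβ
        have hm : witnessCol I (T ++ [q]) q.β = wCol (T ++ [q]) q.β :=
          witnessCol_of_mem hs.mem _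
        rw [hm, wCol_append, if_pos rfl, Function.update_self, Function.update_self, ← hmem]
        exact (hT.col q.β).sup hq.Y (hmem ▸ hnewY)
      · have hne : (β : ℕ) ≠ q.β := fun h => hβ (Fin.ext h.symm)
        have hm : witnessCol I (T ++ [q]) β = witnessCol I T β := by
          rw [witnessCol, witnessCol, wCol_append, if_neg hβ]
        rw [hm, Function.update_of_ne hne, Function.update_of_ne hne]
        exact hT.col β
  · intro htest
    simp only [Test.Holds, NExpr.eval, FExpr.eval, reg, rowE, hr, crossE] at htest
    refine h σ ⟨fun _ _ _ _ => rfl, fun _ _ => rfl, fun _ _ _ => rfl⟩ ?_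
    rw [push, if_pos]
    · exact hT
    · rw [hle]
      by_contra hcon
      push Not at hcon
      exact htest ⟨hcon.1, fun hh => hcon.2 hh.1 hh.2.1 hh.2.2⟩

end Ram

/-! ### The roots of the search forest -/

namespace Ram

/-- The edge in register 4. -/
@[simp] def edgeR : NExpr := reg 4

/-- The column node of the edge in register 4. -/
@[simp] def colR : NExpr := .get 2 edgeR

/-- Write the item of a root at the column node of the edge in register 4 to the registers, except
for the vector of its column space, whose codimension is `c`. -/
def rootRegs (c : ℕ) : Prog := .block
  [.setN 20 (.const 6) (.const 0), .setN 20 (.const 7) edgeR, .setN 20 (.const 8) (.const 0),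
   .setN 20 (.const 9) (.const 0), .setN 20 (.const 10) (.const c),
   .setN 20 (.const 11) (.const 0)]

/-- Add a root at the column node of the edge in register 4, if the edge is a rank-1 edge of `I`
with no other edge of `I` at that node, or if it is the last edge at a node without edges of `I`. -/
def rootBody : Prog := .block
  [.cond (.eq (.get 3 edgeR) (.const 1))
    (.cond (.and (.eq (.get 15 colR) edgeR.succ) (.feq (detAt edgeR) .zero))
      (.block [rootRegs 1, copyVec 12 (.add numE edgeR) 24 (.const 0), updateCol, storeItem]) .skip)
    (.cond (.and (.eq (.get 15 colR) (.const 0)) (.eq (.get 11 colR) edgeR.succ))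
      (.block [rootRegs 0, storeItem]) .skip),
   .setN 20 (.const 4) edgeR.succ]

/-- There are edges that have not been tested for roots. -/
@[simp] def rootTest : Test := .lt edgeR numE

/-- Compute the roots of the search forest. -/
def roots : Prog := .loop rootTest rootBody

section

variable {F : Type*}

/-- The state `τ` arises from `σ` by a change of the registers that describe an item. -/
structure TempFrame (σ τ : State F) : Prop where
  nat : ∀ a, a ≠ 20 → τ.nat a = σ.nat a
  regs : ∀ i, i < 6 → τ.nat 20 i = σ.nat 20 i
  fld : ∀ a, a < 20 → τ.fld a = σ.fld a

theorem TempFrame.vec {σ τ : State F} (h : TempFrame σ τ) {a : ℕ} (h1 : a < 19) :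
    τ.vec a = σ.vec a := by
  funext j
  rw [State.vec, State.vec, h.fld a (by omega), h.fld (a + 1) (by omega)]

theorem TempFrame.trans {σ₁ σ₂ σ₃ : State F} (h : TempFrame σ₁ σ₂)
    (h' : TempFrame σ₂ σ₃) : TempFrame σ₁ σ₃ :=
  ⟨fun a h1 => (h'.nat a h1).trans (h.nat a h1), fun i hi => (h'.regs i hi).trans (h.regs i hi),
    fun a h1 => (h'.fld a h1).trans (h.fld a h1)⟩

theorem TempFrame.refl (σ : State F) : TempFrame σ σ :=
  ⟨fun _ _ => rfl, fun _ _ => rfl, fun _ _ => rfl⟩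

theorem TempFrame.setN {σ₁ σ₂ : State F} (h : TempFrame σ₁ σ₂) {i : ℕ} (hi : 6 ≤ i) (v : ℕ) :
    TempFrame σ₁ (σ₂.setN 20 i v) :=
  h.trans ⟨fun a ha => by simp [ha], fun j hj => by simp [show j ≠ i by omega], fun _ _ => rfl⟩

theorem TempFrame.setVec {σ₁ σ₂ : State F} (h : TempFrame σ₁ σ₂) {a : ℕ} (ha : 20 ≤ a) (i : ℕ)
    (v : Fin 2 → F) : TempFrame σ₁ (σ₂.setVec a i v) :=
  h.trans ⟨fun _ _ => rfl, fun _ _ => rfl,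
    fun b hb => State.fld_setVec _ _ _ (by omega) (by omega)⟩

theorem SameUpToTemp.tempFrame {σ τ : State F} (h : SameUpToTemp σ τ) : TempFrame σ τ :=
  ⟨fun a _ => by rw [h.1], fun i _ => by rw [h.1], fun a ha => h.2 a (by omega) (by omega)⟩

theorem TempFrame.sameData {σ τ : State F} (h : TempFrame σ τ) : SameData σ τ := by
  constructor <;> first | exact h.nat _ (by omega) | exact h.fld _ (by omega)

end

variable {F : Type*} [Field F] {μ ν : ℕ} {A : Blocks F μ ν} {I : Finset (Fin μ × Fin ν)}
  {enum : Fin (edges A).card ≃ {e // e ∈ edges A}} {L : Labeling F μ ν} {T : List (Item F μ ν)}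

/-- The input, the data of the nodes, and the labels are in the memory. -/
structure Ready (I : Finset (Fin μ × Fin ν)) (enum : Fin (edges A).card ≃ {e // e ∈ edges A})
    (L : Labeling F μ ν) (σ : State F) : Prop where
  indexed : Indexed I enum σ
  labels : HasLabels I enum L σ
  output : σ.nat 4 0 = 0

theorem HasLabels.congr {σ τ : State F} (h : HasLabels I enum L σ) (hv : τ.vec 12 = σ.vec 12) :
    HasLabels I enum L τ := by
  constructor <;> intro k e hk he hi <;> rw [hv]
  exacts [h.row_ne hk he hi, h.row hk he hi, h.col_ne hk he hi, h.col hk he hi, h.opp hk he hi]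

theorem Ready.temp {σ τ : State F} (h : Ready I enum L σ) (hf : TempFrame σ τ) :
    Ready I enum L τ :=
  ⟨h.indexed.congr hf.sameData, h.labels.congr (hf.vec (by omega)),
    by rw [hf.nat 4 (by omega), h.output]⟩

theorem Ready.forest {σ τ : State F} (h : Ready I enum L σ) (hf : ForestFrame σ τ) :
    Ready I enum L τ :=
  ⟨h.indexed.congr hf.sameData, h.labels.congr (hf.vec (by omega) (by omega)),
    by rw [hf.nat 4 (by omega) (by omega) (by omega), h.output]⟩

theorem ItemAt.temp {σ τ : State F} {j : ℕ} {q : Item F μ ν} (hq : ItemAt enum σ j q)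
    (h : TempFrame σ τ) : ItemAt enum τ j q := by
  obtain ⟨h1, h2, h3, h4, h5, h6, h7, h8, h9⟩ := hq
  constructor <;> rw [h.nat _ (by omega)] <;>
    first | assumption | (rw [h.vec (by omega)]; assumption)

theorem Rep.temp {σ τ : State F} (h : Rep I enum T σ) (hf : TempFrame σ τ) : Rep I enum T τ := by
  refine ⟨?_, fun j q hq => (h.items j q hq).temp hf, fun α => ?_, fun β => ?_⟩
  · rw [hf.regs 2 (by omega), h.count]
  · rw [hf.nat 5 (by omega), hf.vec (by omega)]
    exact h.row α
  · rw [hf.nat 6 (by omega), hf.vec (by omega)]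
    exact h.col β

theorem Ready.setReg {σ : State F} (h : Ready I enum L σ) (i v : ℕ) :
    Ready I enum L (σ.setN 20 i v) := by
  refine ⟨h.indexed.congr ?_, h.labels.congr rfl, by simpa using h.output⟩
  constructor <;> simp

theorem Rep.setReg {σ : State F} (h : Rep I enum T σ) {i : ℕ} (hi : i ≠ 2) (v : ℕ) :
    Rep I enum T (σ.setN 20 i v) := by
  refine ⟨by simpa [hi.symm] using h.count, fun j q hq => ?_, by simpa using h.row,
    by simpa using h.col⟩
  obtain ⟨h1, h2, h3, h4, h5, h6, h7, h8, h9⟩ := h.items j q hq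
  constructor <;> simpa

/-- The list position at which the column `β` is found to be the start of a space-walk. -/
def RootAt (I : Finset (Fin μ × Fin ν)) (enum : Fin (edges A).card ≃ {e // e ∈ edges A}) (k : ℕ)
    (β : Fin ν) : Prop :=
  ∃ e, EdgeAt enum k e ∧ e.2 = β ∧
    (e ∈ I ∧ (∀ f ∈ I, f.2 = β → f = e) ∧ (A e.1 e.2).det = 0 ∨
      (∀ f ∈ I, f.2 ≠ β) ∧ lastBelow (OffEdge enum I β) (edges A).card = k + 1)

theorem RootAt.unique {k k' : ℕ} {β : Fin ν} (h : RootAt I enum k β) (h' : RootAt I enum k' β) :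
    k = k' := by
  obtain ⟨e, he, rfl, h⟩ := h
  obtain ⟨e', he', hβ, h'⟩ := h'
  rcases h with ⟨h1, h2, -⟩ | ⟨h1, h2⟩ <;> rcases h' with ⟨h1', h2', -⟩ | ⟨h1', h2'⟩
  · rw [h2 e' h1' hβ] at he'
    exact he.inj he'
  · exact absurd rfl (h1' e h1)
  · exact absurd hβ (h1 e' h1')
  · omega

theorem exists_rootAt (hIE : I ⊆ edges A) {β : Fin ν} (h : IsStart A I β) :
    ∃ k < (edges A).card, RootAt I enum k β := by
  rcases h with ⟨e, he, rfl, hal, hd⟩ | ⟨hn, e, he, rfl⟩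
  · obtain ⟨k, hk⟩ := exists_pos enum (hIE he)
    exact ⟨k, hk.lt, e, hk, rfl, Or.inl ⟨he, hal, hd⟩⟩
  · obtain ⟨k, hk⟩ := exists_pos enum he
    have hoff : OffEdge enum I e.2 k := ⟨e, hk, fun h => hn e h rfl, rfl⟩
    obtain ⟨h1 | ⟨j, hj, ⟨f, hf, hfI, hf2⟩, h1⟩, h2⟩ :=
      lastBelow_spec (OffEdge enum I e.2) (edges A).card
    · exact absurd hoff (h2 k hk.lt (by omega))
    · exact ⟨j, hj, f, hf, hf2, Or.inr ⟨hn, h1⟩⟩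

/-- The invariant of the computation of the roots: the first `i` edges have been tested. -/
structure Rooted (I : Finset (Fin μ × Fin ν)) (enum : Fin (edges A).card ≃ {e // e ∈ edges A})
    (L : Labeling F μ ν) (T : List (Item F μ ν)) (i : ℕ) (σ : State F) : Prop where
  ready : Ready I enum L σ
  rep : Rep I enum T σ
  forest : IsForest A I L T
  reg1 : σ.nat 20 1 = 0
  reg3 : σ.nat 20 3 = 0
  reg4 : σ.nat 20 4 = i
  reg5 : σ.nat 20 5 = 0
  le : i ≤ (edges A).card
  sound : ∀ q ∈ T, q.kind = 0 ∧ ∃ k < i, RootAt I enum k q.β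
  complete : ∀ k < i, ∀ β, RootAt I enum k β → ∃ q ∈ T, q.β = β

theorem Rooted.next {i : ℕ} {σ τ : State F} (h : Rooted I enum L T i σ)
    (hi : i < (edges A).card) {T' : List (Item F μ ν)} (hr : Ready I enum L τ)
    (hR : Rep I enum T' τ) (hF : IsForest A I L T')
    (hreg : ∀ j, j ≠ 2 → j < 6 → τ.nat 20 j = σ.nat 20 j)
    (hs : ∀ q ∈ T', q ∈ T ∨ q.kind = 0 ∧ RootAt I enum i q.β)
    (hc : ∀ q ∈ T, q ∈ T') (hc' : ∀ β, RootAt I enum i β → ∃ q ∈ T', q.β = β) :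
    Rooted I enum L T' (i + 1) (τ.setN 20 4 (τ.nat 20 4 + 1)) := by
  refine ⟨hr.setReg _ _, hR.setReg (by omega) _, hF, ?_, ?_, ?_, ?_, by omega, fun q hq => ?_,
    fun k hk β hβ => ?_⟩
  · simp [hreg 1, h.reg1]
  · simp [hreg 3, h.reg3]
  · simp [hreg 4, h.reg4]
  · simp [hreg 5, h.reg5]
  · rcases hs q hq with hq | ⟨hq, hq'⟩
    · obtain ⟨h1, k, hk, h2⟩ := h.sound q hq
      exact ⟨h1, k, by omega, h2⟩
    · exact ⟨hq, i, by omega, hq'⟩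
  · by_cases hki : k = i
    · exact hc' β (hki ▸ hβ)
    · obtain ⟨q, hq, h'⟩ := h.complete k (by omega) β hβ
      exact ⟨q, hc q hq, h'⟩

theorem rootRegs_wp {σ : State F} {c : ℕ} {Q : State F → Prop}
    (h : ∀ τ, TempFrame σ τ → τ.fld = σ.fld → τ.nat 20 6 = 0 → τ.nat 20 7 = σ.nat 20 4 →
      τ.nat 20 8 = 0 → τ.nat 20 9 = 0 → τ.nat 20 10 = c → τ.nat 20 11 = 0 → Q τ) :
    (rootRegs c).wp Q σ := by
  simp only [rootRegs, Prog.block, Prog.wp, NExpr.eval]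
  apply h <;> try simp
  exact (((((((TempFrame.refl σ).setN (by omega) _).setN (by omega) _).setN (by omega) _).setN
    (by omega) _).setN (by omega) _).setN (by omega) _)

theorem Rooted.step (hS : IsSearchLabeling A I L) {i : ℕ} {σ : State F}
    (h : Rooted I enum L T i σ) (hi : i < (edges A).card) :
    rootBody.wp (fun τ => ∃ T', Rooted I enum L T' (i + 1) τ) σ := by
  obtain ⟨e, he⟩ := exists_edgeAt enum hi
  have hI := h.ready.indexed
  have hcol := hI.col he
  have hrow := hI.row he
  have hmark := hI.mark he
  have hdet := (hI.blockAt he).det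
  have hfresh : RootAt I enum i e.2 → ∀ r ∈ T, r.β ≠ e.2 := by
    intro hroot r hr hre
    obtain ⟨-, k, hk, hk'⟩ := h.sound r hr
    rw [hre] at hk'
    have := hk'.unique hroot
    omega
  have hskip : ¬ RootAt I enum i e.2 →
      ∃ T', Rooted I enum L T' (i + 1) (σ.setN 20 4 (i + 1)) := by
    intro hn
    have := h.next hi h.ready h.rep h.forest (fun _ _ _ => rfl) (fun q hq => Or.inl hq)
      (fun q hq => hq) fun β hβ => ?_
    · rw [h.reg4] at this
      exact ⟨T, this⟩
    obtain ⟨f, hf, rfl, -⟩ := id hβ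
    rw [hf.eq he] at hβ
    exact absurd hβ hn
  -- the new root and the forest that contains it
  have hnew : ∀ q : Item F μ ν, q.kind = 0 → q.β = e.2 → RootAt I enum i e.2 →
      ∀ τ : State F, Ready I enum L τ → Rep I enum (T ++ [q]) τ → IsForest A I L (T ++ [q]) →
      (∀ j, j ≠ 2 → j < 6 → τ.nat 20 j = σ.nat 20 j) →
      ∃ T', Rooted I enum L T' (i + 1) (τ.setN 20 4 (τ.nat 20 4 + 1)) := by
    intro q hk hβ hroot τ h1 h2 h3 h4
    refine ⟨T ++ [q], h.next hi h1 h2 h3 h4 (fun r hr => ?_) (fun r hr => by simp [hr])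
      fun β hβ' => ⟨q, by simp, ?_⟩⟩
    · rcases List.mem_append.1 hr with hr | hr
      · exact Or.inl hr
      · rw [List.mem_singleton] at hr
        subst hr
        exact Or.inr ⟨hk, hβ ▸ hroot⟩
    · obtain ⟨f, hf, rfl, -⟩ := hβ'
      rw [hβ, hf.eq he]
  simp only [rootBody, Prog.block, Prog.wp, Test.Holds, NExpr.eval, FExpr.eval, reg, edgeR, colR,
    NExpr.succ, detAt, h.reg4, hcol, hmark, hdet]
  refine ⟨fun hm => ⟨fun hc => ?_, fun hc => ?_⟩, fun hm => ⟨fun hc => ?_, fun hc => ?_⟩⟩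
  · obtain ⟨h15, hd⟩ := hc
    have hal : ∀ f ∈ I, f.2 = e.2 → f = e := by
      rcases hI.colOther he hm with ⟨-, hal⟩ | ⟨j, f, -, -, -, -, h15'⟩
      · exact hal
      · omega
    have hroot : RootAt I enum i e.2 := ⟨e, he, rfl, Or.inl ⟨hm, hal, hd⟩⟩
    have hker : kerCol A I e.2 = L.V e.2 (L.sign e) := by
      rw [kerCol_of_alone hm hal]
      exact (hS.valid.kernel e hm (block_rank_eq_one_iff.2 ⟨hS.block e hm, hd⟩)).2
    have hni : ¬ IsIso A I e := fun h' => h'.1 hd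
    have hlab := h.ready.labels.col he hm hni
    let q : Item F μ ν := ⟨0, 0, e.1, e.2, ⊤, ⊤, L.V e.2 (L.sign e), 0⟩
    have hF : IsForest A I L (T ++ [q]) := h.forest.root (q := q) rfl hker.symm
      (hker ▸ line_ne_bot (hS.valid.dimV _ _)) rfl (hfresh hroot)
    refine rootRegs_wp fun σ₁ f₁ hfld r6 r7 r8 r9 r10 r11 => ?_
    refine copyVec_wp (by omega) ?_
    generalize hσ₂ : State.setVec _ _ _ _ = σ₂
    have f₂ : TempFrame σ σ₂ := by
      rw [← hσ₂]
      exact f₁.setVec (by omega) _ _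
    have hn₂ : σ₂.nat = σ₁.nat := by rw [← hσ₂]; rfl
    have hv : σ₂.vec 24 0 = σ.vec 12 ((edges A).card + i) := by
      rw [← hσ₂]
      simp [State.vec_setVec, f₁.regs 4, h.reg4, f₁.nat 0, hI.num, f₁.vec (a := 12)]
    have hreg : RegItem enum q σ₂ := by
      constructor <;> rw [hn₂]
      · exact r6
      · rw [f₁.regs 1 (by omega), h.reg1]
      · rw [r7, h.reg4]
        exact he
      · exact r11
      · exact Or.inl ⟨r8, rfl⟩
      · exact Or.inl ⟨r9, rfl⟩
      · rw [r10, hv, show q.Y = _ from hlab]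
        exact isCode_line (h.ready.labels.col_ne he hm hni)
    have hT₂ := h.rep.temp f₂
    have hr₂ := h.ready.temp f₂
    refine updateCol_wp (b := e.2) (hr₂.indexed.col hreg.edge) fun σ₃ f₃ n5 v4 n6 v6 => ?_
    refine storeItem_wp (hr₂.indexed.congr f₃.forestFrame.sameData)
      (hreg.congr f₃.forestFrame) fun τ hτ => ?_
    have fτ := f₃.forestFrame.trans hτ.frame
    refine hnew q rfl rfl hroot τ (hr₂.forest fτ) ⟨?_, hτ.items ?_ fun j r hr =>
      f₃.itemAt (hT₂.items j r hr), fun α => ?_, fun β => ?_⟩ hF fun j hj hj' => ?_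
    · rw [hτ.count, f₃.nat 20 (by omega) (by omega), hT₂.count]
      simp
    · rw [f₃.nat 20 (by omega) (by omega), hT₂.count]
    · classical
      rw [hτ.n5, hτ.v4, n5, v4, wRow_append, if_neg fun h' => h'.1 rfl]
      exact hT₂.row α
    · have hbot : wCol T e.2 = ⊥ := by
        rw [eq_bot_iff]
        exact wCol_le.2 fun r hr hre => absurd hre (hfresh hroot r hr)
      have hcode := hT₂.col e.2
      rw [witnessCol_of_mem hm, hbot] at hcode
      have h2 : σ₂.nat 6 e.2 = 2 := by
        rcases hcode with ⟨-, hc⟩ | ⟨-, hv, hc⟩ | ⟨hc, -⟩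
        · exact absurd hc bot_ne_top
        · exact absurd hc.symm (by simpa using hv)
        · exact hc
      rw [hτ.n6, hτ.v6, n6, v6, if_pos h2, if_pos h2]
      by_cases hβ : e.2 = β
      · subst hβ
        have hw : witnessCol I (T ++ [q]) e.2 = q.Y := by
          rw [witnessCol_of_mem hm, wCol_append, if_pos rfl, hbot, bot_sup_eq]
        rw [hw, Function.update_self, Function.update_self]
        exact hreg.Y
      · have hne : (β : ℕ) ≠ e.2 := fun h => hβ (Fin.ext h.symm)
        have hw : witnessCol I (T ++ [q]) β = witnessCol I T β := by
          rw [witnessCol, witnessCol, wCol_append, if_neg hβ]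
        rw [hw, Function.update_of_ne hne, Function.update_of_ne hne]
        exact hT₂.col β
    · rw [fτ.regs j hj, f₂.regs j hj']
  · refine hskip fun ⟨f, hf, _, hf'⟩ => ?_
    obtain rfl := hf.eq he
    rcases hf' with ⟨-, hal, hd⟩ | ⟨hal, -⟩
    · rcases hI.colOther he hm with ⟨h15, -⟩ | ⟨j, g, -, hg, hge, hg2, -⟩
      · exact hc ⟨h15, hd⟩
      · exact hge (hal g hg hg2)
    · exact hal f hm rfl
  · obtain ⟨h15, h11⟩ := hc
    have hal := (hI.colNone e.2).1 h15
    have hroot : RootAt I enum i e.2 := ⟨e, he, rfl, Or.inr ⟨hal, by rw [← hI.head, h11]⟩⟩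
    have hker : kerCol A I e.2 = ⊤ := kerCol_of_forall_ne hal
    let q : Item F μ ν := ⟨0, 0, e.1, e.2, ⊤, ⊤, ⊤, 0⟩
    have hF : IsForest A I L (T ++ [q]) := h.forest.root (q := q) rfl hker.symm
      (hker ▸ top_ne_bot) rfl (hfresh hroot)
    refine rootRegs_wp fun σ₁ f₁ hfld r6 r7 r8 r9 r10 r11 => ?_
    have hreg : RegItem enum q σ₁ := by
      constructor
      · exact r6
      · rw [f₁.regs 1 (by omega), h.reg1]
      · rw [r7, h.reg4]
        exact he
      · exact r11
      · exact Or.inl ⟨r8, rfl⟩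
      · exact Or.inl ⟨r9, rfl⟩
      · exact Or.inl ⟨r10, rfl⟩
    have hT₁ := h.rep.temp f₁
    have hr₁ := h.ready.temp f₁
    refine storeItem_wp hr₁.indexed hreg fun τ hτ => ?_
    refine hnew q rfl rfl hroot τ (hr₁.forest hτ.frame) ⟨?_, hτ.items hT₁.count hT₁.items,
      fun α => ?_, fun β => ?_⟩ hF fun j hj hj' => ?_
    · rw [hτ.count, hT₁.count]
      simp
    · classical
      rw [hτ.n5, hτ.v4, wRow_append, if_neg fun h' => h'.1 rfl]
      exact hT₁.row α
    · have hw : witnessCol I (T ++ [q]) β = witnessCol I T β := by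
        rw [witnessCol, witnessCol]
        split_ifs with hβ
        · rfl
        · rw [wCol_append, if_neg]
          rintro rfl
          exact hβ hal
      rw [hτ.n6, hτ.v6, hw]
      exact hT₁.col β
    · rw [hτ.frame.regs j hj, f₁.regs j hj']
  · refine hskip fun ⟨f, hf, _, hf'⟩ => ?_
    obtain rfl := hf.eq he
    rcases hf' with ⟨hfI, -⟩ | ⟨hal, hlast⟩
    · exact hm hfI
    · exact hc ⟨(hI.colNone _).2 hal, by rw [hI.head, hlast]⟩

theorem triple_roots (hS : IsSearchLabeling A I L) {σ₀ : State F} (h : Rooted I enum L [] 0 σ₀) :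
    Triple (fun σ => σ = σ₀) roots
      ((rootTest.cost + rootBody.bound) * (edges A).card + rootTest.cost)
      (fun τ => ∃ T, Rooted I enum L T (edges A).card τ) := by
  have hl := Triple.loop (b := rootTest) (p := rootBody) (N := (edges A).card)
    (J := fun i (σ : State F) => ∃ T, Rooted I enum L T i σ) (fun i σ ⟨T, h⟩ => h.le)
    (fun i σ ⟨T, h⟩ hb => h.step hS (by
      simpa [h.reg4, h.ready.indexed.num] using hb))
  rintro σ rfl
  obtain ⟨t, τ, hex, ht, ⟨i, T, hT⟩, hb⟩ := hl σ ⟨0, [], h⟩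
  refine ⟨t, τ, hex, ht, T, ?_⟩
  simp only [rootTest, Test.Holds, edgeR, numE, reg, NExpr.eval, hT.reg4,
    hT.ready.indexed.num] at hb
  obtain rfl : i = (edges A).card := by have := hT.le; omega
  exact hT

theorem Rooted.searchState (hIE : I ⊆ edges A) {σ : State F}
    (h : Rooted I enum L T (edges A).card σ) : SearchState I enum L T 0 0 := by
  refine ⟨h.forest, fun β hβ => ?_, fun r hr hk => ?_, Nat.zero_le _, fun j q hj => ?_,
    fun k hk => ?_⟩
  · obtain ⟨k, hk, hk'⟩ := exists_rootAt (enum := enum) hIE hβ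
    obtain ⟨q, hq, rfl⟩ := h.complete k hk β hk'
    exact ⟨q, hq, (h.sound q hq).1, rfl⟩
  · have := (h.sound r hr).1
    omega
  · omega
  · omega

end Ram

/-! ### The parts of the program for the search -/

namespace Ram

/-- The position of the item that was taken up last. -/
@[simp] def curE : NExpr := (reg 1).pred

/-- The length of the item that was taken up last. -/
@[simp] def lenE : NExpr := .get 26 curE

/-- Compute the space `X` that is orthogonal to the column space of the current item with respect to
the block of the edge in register 12. The codimension is written to register 8; it is `0` if the
column space lies in the right kernel of the block. -/
def computeX : Prog :=
  .cond (.eq (.get 28 curE) (.const 1))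
    (.block [perpVec 2 1 (reg 12) 16 curE, copyVec 26 (.const 0) 20 (.const 0),
      .cond (.and (.feq (.get 20 (.const 0)) .zero) (.feq (.get 21 (.const 0)) .zero))
        (.setN 20 (.const 8) (.const 0)) (.setN 20 (.const 8) (.const 1))])
    (.cond (.eq (.get 28 curE) (.const 0))
      (.cond (.feq (detAt (reg 12)) .zero)
        (.block [kerVec 1 2 (reg 12), copyVec 26 (.const 0) 20 (.const 0),
          .setN 20 (.const 8) (.const 1)])
        (.setN 20 (.const 8) (.const 2)))
      (.setN 20 (.const 8) (.const 0)))

/-- Write a vector outside the line of the label at the column end of the edge in register 7 to the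
cells `0` of the arrays `24`, `25`. -/
def oppositeLabel : Prog :=
  .cond (.feq (.get 13 (.add numE (reg 7))) .zero)
    (.block [.setF 24 (.const 0) .zero, .setF 25 (.const 0) .one])
    (.block [.setF 24 (.const 0) .one, .setF 25 (.const 0) .zero])

/-- Write the edge `g` of `I` with the spaces of an inner step along it to the registers. -/
def prepInner (g : NExpr) : Prog := .block
  [.setN 20 (.const 7) g, .setN 20 (.const 9) (.const 1), .setN 20 (.const 10) (.const 1),
   .setN 20 (.const 15) (.sub (.get 15 colE) (reg 7).succ),
   copyVec 12 (reg 7) 22 (.const 0),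
   .cond (.eq (reg 15) (.const 0)) oppositeLabel
     (copyVec 12 (.add numE (reg 15).pred) 24 (.const 0))]

/-- Enter an inner space-walk along the edge `g` of `I` after an outer step. -/
def enterPush (g : NExpr) : Prog := .block
  [prepInner g, .setN 20 (.const 6) (.const 2),
   .setN 20 (.const 11) (.add lenE (.const 2)), pushItem]

/-- Continue an outer space-walk along the isolated rank-2 edge in register 13. -/
def isoPush : Prog := .block
  [.setN 20 (.const 6) (.const 1), .setN 20 (.const 7) (reg 13), .setN 20 (.const 9) (reg 8),
   .setN 20 (.const 11) lenE.succ, copyVec 20 (.const 0) 22 (.const 0),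
   .cond (.eq (reg 8) (.const 1))
     (.block [perpVec 1 2 (reg 13) 20 (.const 0), copyVec 26 (.const 0) 24 (.const 0),
       .setN 20 (.const 10) (.const 1)])
     (.setN 20 (.const 10) (.const 0)),
   pushItem]

/-- Continue an inner space-walk along the edge before the number in register 14. -/
def extendPush : Prog := .block
  [prepInner (reg 14).pred, .setN 20 (.const 6) (.const 3), .setN 20 (.const 8) (.const 1),
   .setN 20 (.const 11) lenE.succ, copyVec 22 (.const 0) 20 (.const 0), pushItem]

variable {F : Type*} [Field F] {μ ν : ℕ} {A : Blocks F μ ν} {I : Finset (Fin μ × Fin ν)}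
  {enum : Fin (edges A).card ≃ {e // e ∈ edges A}} {L : Labeling F μ ν} {T : List (Item F μ ν)}

theorem ne_zero_of_mem_edges {e : Fin μ × Fin ν} (h : e ∈ edges A) : A e.1 e.2 ≠ 0 := by
  simpa [edges] using h

theorem computeX_wp {σ : State F} (hI : Indexed I enum σ) {q : Item F μ ν}
    (hq : ItemAt enum σ (σ.nat 20 1 - 1) q) {e : Fin μ × Fin ν} (he : EdgeAt enum (σ.nat 20 12) e)
    {Q : State F → Prop}
    (h : ∀ τ, TempFrame σ τ → (∀ i, i ≠ 8 → τ.nat 20 i = σ.nat 20 i) →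
      (τ.nat 20 8 = 0 ∧ q.Y ≤ kerR (A e.1 e.2) ∨ τ.nat 20 8 ≠ 0 ∧ ¬ q.Y ≤ kerR (A e.1 e.2) ∧
        IsCode (τ.nat 20 8) (τ.vec 20 0) (perpCol (A e.1 e.2) q.Y)) → Q τ) :
    computeX.wp Q σ := by
  have hA := ne_zero_of_mem_edges he.mem
  have hY := hq.Y
  have hdet := (hI.blockAt he).det
  simp only [computeX, Prog.wp, Test.Holds, NExpr.eval, FExpr.eval, curE, reg, NExpr.pred, detAt,
    hdet]
  refine ⟨fun h1 => ?_, fun h1 => ⟨fun h0 => ⟨fun hd => ?_, fun hd => ?_⟩, fun h0 => ?_⟩⟩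
  · rcases hY with ⟨hc, -⟩ | ⟨-, hy, hc⟩ | ⟨hc, -⟩
    · omega
    swap
    · omega
    simp only [Prog.block, Prog.wp]
    refine perpVec_wp (hI.blockAt_transpose he) (by omega) fun τ hτ hv => ?_
    refine copyVec_wp (by omega) ?_
    generalize hσ₂ : State.setVec _ _ _ _ = σ₂
    have f₂ : TempFrame σ σ₂ := by
      rw [← hσ₂]
      exact hτ.tempFrame.setVec (by simp) _ _
    have hn : σ₂.nat = σ.nat := by rw [← hσ₂]; exact hτ.1
    have hv₂ : σ₂.vec 20 0 = colPerp (A e.1 e.2) (σ.vec 16 (σ.nat 20 1 - 1)) := by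
      rw [← hσ₂]
      simpa [State.vec_setVec, colPerp] using hv
    have hz : (σ₂.fld 20 0 = 0 ∧ σ₂.fld 21 0 = 0) ↔ q.Y ≤ kerR (A e.1 e.2) := by
      rw [hc, Submodule.span_singleton_le_iff_mem, ← not_iff_not, ← colPerp_ne_zero_iff, ← hv₂,
        vec_ne_zero_iff]
      simp only [State.vec, Matrix.cons_val_zero, Matrix.cons_val_one]
      tauto
    simp only [Test.Holds, FExpr.eval, NExpr.eval, hz]
    refine ⟨fun hle => h _ (f₂.setN (by omega) _) (fun i hi => by simp [hi, hn])
      (Or.inl ⟨by simp, hle⟩), fun hle => h _ (f₂.setN (by omega) _)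
      (fun i hi => by simp [hi, hn]) (Or.inr ⟨by simp, hle, ?_⟩)⟩
    rw [hc, Submodule.span_singleton_le_iff_mem] at hle
    simp only [State.nat_setN, if_true, Function.update_self, State.vec_setN, hv₂]
    rw [hc, perpCol_span hle]
    exact isCode_line (colPerp_ne_zero_iff.2 hle)
  · rcases hY with ⟨-, hc⟩ | ⟨hc, -⟩ | ⟨hc, -⟩
    rotate_left
    · omega
    · omega
    have hk : ¬ (⊤ : Space F) ≤ kerR (A e.1 e.2) := by
      rw [top_le_iff, kerR_eq_span hA hd]
      exact line_ne_top (finrank_span_vec (rightKerVec_ne_zero hA))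
    simp only [Prog.block, Prog.wp]
    refine kerVec_wp (hI.blockAt he) fun τ hτ hv => ?_
    refine copyVec_wp (by omega) ?_
    refine h _ ((hτ.tempFrame.setVec (by simp) _ _).setN (by simp) _)
      (fun i hi => by simp [hi, hτ.1]) (Or.inr ⟨by simp, hc ▸ hk, ?_⟩)
    simp only [State.nat_setN, if_true, Function.update_self, State.vec_setN, State.vec_setVec,
      NExpr.eval]
    rw [hv, hc, perpCol_top, kerL_eq_span hA hd]
    exact isCode_line (leftKerVec_ne_zero hA)
  · rcases hY with ⟨-, hc⟩ | ⟨hc, -⟩ | ⟨hc, -⟩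
    rotate_left
    · omega
    · omega
    refine h _ ((TempFrame.refl σ).setN (by omega) _) (fun i hi => by simp [hi])
      (Or.inr ⟨by simp, ?_, ?_⟩)
    · rw [hc, kerR_eq_bot hd, top_le_iff]
      exact bot_ne_top
    · rw [hc, perpCol_top, kerL_eq_bot hd]
      exact Or.inr (Or.inr ⟨by simp, rfl⟩)
  · rcases hY with ⟨hc, -⟩ | ⟨hc, -⟩ | ⟨hc, hc'⟩
    · omega
    · omega
    exact h _ ((TempFrame.refl σ).setN (by omega) _) (fun i hi => by simp [hi])
      (Or.inl ⟨by simp, hc' ▸ bot_le⟩)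

theorem oppositeLabel_wp {σ : State F} (h0 : σ.nat 0 0 = (edges A).card) {Q : State F → Prop}
    (h : Q (σ.setVec 24 0 (complVec (σ.vec 12 ((edges A).card + σ.nat 20 7))))) :
    oppositeLabel.wp Q σ := by
  simp only [oppositeLabel, Prog.wp, Prog.block, Test.Holds, FExpr.eval, NExpr.eval, numE, reg, h0]
  refine ⟨fun hz => ?_, fun hz => ?_⟩
  · rw [complVec, if_pos (by simpa [State.vec] using hz)] at h
    simpa [State.setVec] using h
  · rw [complVec, if_neg (by simpa [State.vec] using hz)] at h
    simpa [State.setVec] using h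

theorem prepInner_wp (hL : L.IsValid A I) {σ : State F} (hr : Ready I enum L σ) {g : NExpr}
    {e : Fin μ × Fin ν} (he : EdgeAt enum (g.eval σ) e) (heI : e ∈ I) (hi : ¬ IsIso A I e)
    {Q : State F → Prop}
    (h : ∀ τ, TempFrame σ τ →
      (∀ i, i ≠ 7 → i ≠ 9 → i ≠ 10 → i ≠ 15 → τ.nat 20 i = σ.nat 20 i) →
      τ.vec 20 = σ.vec 20 → τ.nat 20 7 = g.eval σ → τ.nat 20 9 = 1 →
      IsCode 1 (τ.vec 22 0) (L.U e.1 (L.sign e)) →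
      IsCode (τ.nat 20 10) (τ.vec 24 0) (L.V e.2 (!L.sign e)) → Q τ) :
    (prepInner g).wp Q σ := by
  have hI := hr.indexed
  have hcol := hI.col he
  simp only [prepInner, Prog.block, Prog.wp]
  generalize hσ₁ : (State.setN (State.setN (State.setN (State.setN σ _ _ _) _ _ _) _ _ _) _ _ _) = σ₁
  have f₁ : TempFrame σ σ₁ := by
    rw [← hσ₁]
    exact ((((TempFrame.refl σ).setN (by simp) _).setN (by simp) _).setN (by simp) _).setN
      (by simp) _
  have hreg : ∀ i, i ≠ 7 → i ≠ 9 → i ≠ 10 → i ≠ 15 → σ₁.nat 20 i = σ.nat 20 i := by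
    intro i h1 h2 h3 h4
    rw [← hσ₁]
    simp [h1, h2, h3, h4]
  have hfld : σ₁.fld = σ.fld := by rw [← hσ₁]; rfl
  have hvec : σ₁.vec = σ.vec := by rw [← hσ₁]; simp
  have r7 : σ₁.nat 20 7 = g.eval σ := by rw [← hσ₁]; simp
  have r9 : σ₁.nat 20 9 = 1 := by rw [← hσ₁]; simp
  have r10 : σ₁.nat 20 10 = 1 := by rw [← hσ₁]; simp
  have r15 : σ₁.nat 20 15 = σ.nat 15 e.2 - (g.eval σ + 1) := by rw [← hσ₁]; simp [hcol]
  have n0 : σ₁.nat 0 0 = (edges A).card := by rw [f₁.nat 0 (by omega), hI.num]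
  refine copyVec_wp (by omega) ?_
  have hR : IsCode 1 (σ.vec 12 (g.eval σ)) (L.U e.1 (L.sign e)) := by
    rw [hr.labels.row he heI hi]
    exact isCode_line (hr.labels.row_ne he heI hi)
  simp only [Test.Holds, NExpr.eval, reg, State.nat_setVec, r15]
  rcases hI.colOther he heI with ⟨h15, hal⟩ | ⟨j, f, hj, hf, hfe, h2, h15⟩
  · refine ⟨fun _ => oppositeLabel_wp (A := A) (by simpa using n0) ?_, fun hne => by omega⟩
    refine h _ ((f₁.setVec (by omega) _ _).setVec (by omega) _ _) ?_ ?_ ?_ ?_ ?_ ?_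
    · simpa using hreg
    · simp [State.vec_setVec_of_ne, hvec]
    · simpa using r7
    · simpa using r9
    · simpa [State.vec_setVec_of_ne, State.vec_setVec, hvec, r7] using hR
    · simp only [State.nat_setVec, r10, State.vec_setVec, Function.update_self, r7]
      rw [State.vec_setVec_of_ne _ _ _ (by omega) (by omega) (by omega), hvec,
        hr.labels.opp he heI hi hal]
      exact isCode_line (complVec_ne_zero _)
  · refine ⟨fun hne => by omega, fun _ => copyVec_wp (by omega) ?_⟩
    have hfi : ¬ IsIso A I f := not_isIso_of_ne heI hfe.symm (Or.inr h2.symm)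
    have hsign := hL.proper e heI f hf hfe.symm (Or.inr h2.symm)
    refine h _ ((f₁.setVec (by omega) _ _).setVec (by simp) _ _) ?_ ?_ ?_ ?_ ?_ ?_
    · simpa using hreg
    · simp [State.vec_setVec_of_ne, hvec]
    · simpa using r7
    · simpa using r9
    · simpa [State.vec_setVec_of_ne, State.vec_setVec, hvec, r7] using hR
    · have hc := hr.labels.col hj hf hfi
      rw [h2, not_eq_of_ne_bool hsign.symm] at hc
      have hj' : σ.nat 15 e.2 - (g.eval σ + 1) - 1 = j := by omega
      simp only [State.nat_setVec, r10, State.vec_setVec, NExpr.eval, Function.update_self, numE,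
        NExpr.pred, r15, n0, hj']
      rw [State.vec_setVec_of_ne _ _ _ (by omega) (by omega) (by omega), hvec, hc]
      exact isCode_line (hr.labels.col_ne hj hf hfi)

end Ram

namespace Ram

/-- The item `q` by which an inner space-walk along `e` is entered from the item `p` at position `i`
after an outer step with last space `X`. -/
def enterItem {F : Type*} [Field F] {μ ν : ℕ} (L : Labeling F μ ν) (i : ℕ) (p : Item F μ ν)
    (X : Space F) (e : Fin μ × Fin ν) : Item F μ ν :=
  ⟨2, i, e.1, e.2, X, L.U e.1 (L.sign e), L.V e.2 (!L.sign e), p.len + 2⟩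

/-- The item `q` by which an outer space-walk from the item `p` at position `i` continues along the
isolated edge `e` after an outer step with last space `X`. -/
def isoItem {F : Type*} [Field F] {μ ν : ℕ} (A : Blocks F μ ν) (i : ℕ) (p : Item F μ ν)
    (X : Space F) (e : Fin μ × Fin ν) : Item F μ ν :=
  ⟨1, i, e.1, e.2, X, X, perpRow (A e.1 e.2) X, p.len + 1⟩

/-- The item `q` by which an inner space-walk from the item `p` at position `i` continues along the
edge `e`. -/
def extendItem {F : Type*} [Field F] {μ ν : ℕ} (L : Labeling F μ ν) (i : ℕ) (p : Item F μ ν)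
    (e : Fin μ × Fin ν) : Item F μ ν :=
  ⟨3, i, e.1, e.2, L.U e.1 (L.sign e), L.U e.1 (L.sign e), L.V e.2 (!L.sign e), p.len + 1⟩

variable {F : Type*} [Field F] {μ ν : ℕ} {A : Blocks F μ ν} {I : Finset (Fin μ × Fin ν)}
  {enum : Fin (edges A).card ≃ {e // e ∈ edges A}} {L : Labeling F μ ν} {T : List (Item F μ ν)}

/-- The item `p` before position `qh` is being treated. -/
structure Treating (I : Finset (Fin μ × Fin ν)) (enum : Fin (edges A).card ≃ {e // e ∈ edges A})
    (L : Labeling F μ ν) (qh : ℕ) (p : Item F μ ν) (T : List (Item F μ ν)) (σ : State F) :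
    Prop where
  ready : Ready I enum L σ
  rep : Rep I enum T σ
  forest : IsForest A I L T
  item : T[qh - 1]? = some p
  entered : EnteredExcept I L T (qh - 1)
  reg1 : σ.nat 20 1 = qh

/-- The registers that control the search are the same. -/
def SameControl (σ τ : State F) : Prop :=
  ∀ i, i = 3 ∨ i = 5 ∨ i = 8 ∨ 12 ≤ i ∧ i ≤ 14 → τ.nat 20 i = σ.nat 20 i

theorem Treating.temp {qh : ℕ} {p : Item F μ ν} {σ τ : State F}
    (h : Treating I enum L qh p T σ) (hf : TempFrame σ τ) : Treating I enum L qh p T τ :=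
  ⟨h.ready.temp hf, h.rep.temp hf, h.forest, h.item, h.entered,
    (hf.regs 1 (by omega)).trans h.reg1⟩

theorem getElem?_push {j : ℕ} {p : Item F μ ν} (h : T[j]? = some p) (q : Item F μ ν) :
    (push T q)[j]? = some p := by
  obtain ⟨N, hN⟩ := push_eq T q
  rw [hN]
  exact getElem?_append_of_some h

/-- Adding a child of the item that is being treated. -/
theorem Treating.push_wp (hS : IsSearchLabeling A I L) {qh : ℕ} {p q : Item F μ ν} {σ : State F}
    (h : Treating I enum L qh p T σ) (hs : IsStep A I L p q) (hpar : q.par = qh - 1)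
    (hq : RegItem enum q σ) {Q : State F → Prop}
    (hQ : ∀ τ, Treating I enum L qh p (push T q) τ → SameControl σ τ → τ.vec 20 = σ.vec 20 →
      Q τ) : pushItem.wp Q σ := by
  refine pushItem_wp hS.valid hS.block h.forest h.ready.indexed h.rep hs hq fun τ hτ hT => ?_
  refine hQ τ ⟨h.ready.forest hτ, hT, ?_, getElem?_push h.item q, h.entered.push hpar, ?_⟩
    (fun i hi => hτ.regs i (by omega)) (hτ.vec (by omega) (by omega))
  · exact h.forest.push hS.valid (hpar ▸ h.item) hs (hpar ▸ h.entered)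
  · rw [hτ.regs 1 (by omega), h.reg1]

theorem enterPush_wp (hS : IsSearchLabeling A I L) {qh : ℕ} {p : Item F μ ν} {σ : State F}
    (h : Treating I enum L qh p T σ) {g : NExpr} {e : Fin μ × Fin ν}
    (he : EdgeAt enum (g.eval σ) e) (heI : e ∈ I) (hi : ¬ IsIso A I e) {X : Space F}
    (ho : OuterTo A I p e.1 X) (hX : X ≠ L.U e.1 (!L.sign e))
    (h1 : (∀ f ∈ I, f.1 = e.1 → f = e) → X = L.U e.1 (L.sign e))
    (hc : IsCode (σ.nat 20 8) (σ.vec 20 0) X) {Q : State F → Prop}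
    (hQ : ∀ τ, Treating I enum L qh p (push T (enterItem L (qh - 1) p X e)) τ →
      SameControl σ τ → τ.vec 20 = σ.vec 20 → Q τ) : (enterPush g).wp Q σ := by
  have hs : IsStep A I L p (enterItem L (qh - 1) p X e) :=
    IsStep.enter rfl heI hi ho hX h1 rfl rfl rfl
  simp only [enterPush, Prog.block, Prog.wp]
  refine prepInner_wp hS.valid h.ready he heI hi fun τ f hreg hv r7 r9 hR hY => ?_
  have f' := (f.setN (i := 6) (by omega) 2).setN (i := 11) (by omega) (p.len + 2)
  have hlen : NExpr.eval (τ.setN 20 6 2) (.add lenE (.const 2)) = p.len + 2 := by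
    have := (h.rep.items _ _ h.item).len
    simp [f.nat 26, f.regs 1, h.reg1, this]
  simp only [NExpr.eval] at hlen ⊢
  rw [hlen]
  refine (h.temp f').push_wp hS hs rfl ?_ fun τ' h' hc' hv' => hQ τ' h' (fun i hi => ?_) ?_
  · constructor
    · simp [enterItem]
    · simp [f.regs 1, h.reg1, enterItem]
    · simpa [r7, enterItem] using he
    · simp [enterItem]
    · simpa [hreg 8, hv, enterItem] using hc
    · simpa [r9, enterItem] using hR
    · simpa [enterItem] using hY
  · rw [hc' i hi]
    simp only [State.nat_setN, if_true]
    rw [Function.update_of_ne (by omega), Function.update_of_ne (by omega),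
      hreg i (by omega) (by omega) (by omega) (by omega)]
  · rw [hv']
    simpa using hv

theorem isoPush_wp (hS : IsSearchLabeling A I L) {qh : ℕ} {p : Item F μ ν} {σ : State F}
    (h : Treating I enum L qh p T σ) {e : Fin μ × Fin ν} (he : EdgeAt enum (σ.nat 20 13) e)
    (heI : e ∈ I) (hi : IsIso A I e) {X : Space F} (ho : OuterTo A I p e.1 X)
    (hc : IsCode (σ.nat 20 8) (σ.vec 20 0) X) {Q : State F → Prop}
    (hQ : ∀ τ, Treating I enum L qh p (push T (isoItem A (qh - 1) p X e)) τ → SameControl σ τ →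
      Q τ) : isoPush.wp Q σ := by
  have hs : IsStep A I L p (isoItem A (qh - 1) p X e) := IsStep.iso rfl heI hi ho rfl rfl rfl
  have hlen := (h.rep.items _ _ h.item).len
  have hXtop : X ≠ ⊤ := by
    rw [ho.2.2.2]
    exact perpCol_ne_top ho.2.2.1
  simp only [isoPush, Prog.block, Prog.wp]
  generalize hσ₁ : (State.setN (State.setN (State.setN (State.setN σ _ _ _) _ _ _) _ _ _) _ _ _) = σ₁
  have f₁ : TempFrame σ σ₁ := by
    rw [← hσ₁]
    exact ((((TempFrame.refl σ).setN (by simp) _).setN (by simp) _).setN (by simp) _).setN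
      (by simp) _
  have hreg : ∀ i, i ≠ 6 → i ≠ 7 → i ≠ 9 → i ≠ 11 → σ₁.nat 20 i = σ.nat 20 i := by
    intro i h1 h2 h3 h4
    rw [← hσ₁]
    simp [h1, h2, h3, h4]
  have hvec : σ₁.vec = σ.vec := by rw [← hσ₁]; simp
  have r6 : σ₁.nat 20 6 = 1 := by rw [← hσ₁]; simp
  have r7 : σ₁.nat 20 7 = σ.nat 20 13 := by rw [← hσ₁]; simp
  have r9 : σ₁.nat 20 9 = σ.nat 20 8 := by rw [← hσ₁]; simp
  have r11 : σ₁.nat 20 11 = p.len + 1 := by rw [← hσ₁]; simp [h.reg1, hlen]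
  refine copyVec_wp (by omega) ?_
  generalize hσ₂ : State.setVec _ _ _ _ = σ₂
  have f₂ : TempFrame σ σ₂ := by
    rw [← hσ₂]
    exact f₁.setVec (by omega) _ _
  have hn₂ : σ₂.nat = σ₁.nat := by rw [← hσ₂]; rfl
  have v20 : σ₂.vec 20 = σ.vec 20 := by
    rw [← hσ₂, State.vec_setVec_of_ne _ _ _ (by omega) (by omega) (by omega), hvec]
  have v22 : σ₂.vec 22 0 = σ.vec 20 0 := by
    rw [← hσ₂]
    simp [State.vec_setVec, hvec]
  -- the item is in the registers as soon as its column space is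
  have key : ∀ τ : State F, TempFrame σ₂ τ → (∀ i, i ≠ 10 → τ.nat 20 i = σ₂.nat 20 i) →
      τ.vec 20 = σ₂.vec 20 → τ.vec 22 = σ₂.vec 22 →
      IsCode (τ.nat 20 10) (τ.vec 24 0) (perpRow (A e.1 e.2) X) → pushItem.wp Q τ := by
    intro τ f hn hv hv' hY
    refine (h.temp (f₂.trans f)).push_wp hS hs rfl ?_ fun τ' h' hc' _ => hQ τ' h' fun i hi => ?_
    · constructor
      · rw [hn 6 (by omega), hn₂, r6]
        rfl
      · rw [hn 1 (by omega), hn₂, hreg 1 (by omega) (by omega) (by omega) (by omega), h.reg1]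
        rfl
      · rw [hn 7 (by omega), hn₂, r7]
        exact he
      · rw [hn 11 (by omega), hn₂, r11]
        rfl
      · rw [hn 8 (by omega), hn₂, hreg 8 (by omega) (by omega) (by omega) (by omega), hv, v20]
        exact hc
      · rw [hn 9 (by omega), hn₂, r9, hv', v22]
        exact hc
      · exact hY
    · rw [hc' i hi, hn i (by omega), hn₂, hreg i (by omega) (by omega) (by omega) (by omega)]
  have r8 : σ₂.nat 20 8 = σ.nat 20 8 := by
    rw [hn₂, hreg 8 (by omega) (by omega) (by omega) (by omega)]
  have r13 : σ₂.nat 20 13 = σ.nat 20 13 := by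
    rw [hn₂, hreg 13 (by omega) (by omega) (by omega) (by omega)]
  simp only [Test.Holds, NExpr.eval, reg, r8]
  rcases hc with ⟨-, hc⟩ | ⟨hc1, hx, hc⟩ | ⟨hc1, hc⟩
  · exact absurd hc hXtop
  · refine ⟨fun _ => ?_, fun hn => absurd hc1 hn⟩
    refine perpVec_wp (B := A e.1 e.2) ?_ (by omega) fun τ hτ hv => copyVec_wp (by omega) ?_
    · simp only [NExpr.eval, r13]
      exact (h.ready.temp f₂).indexed.blockAt he
    refine key _ ((hτ.tempFrame.setVec (by omega) _ _).setN (by omega) _)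
      (fun i hi => by simp [hi, hτ.1]) ?_ ?_ ?_
    · simp [State.vec_setVec_of_ne, hτ.vec]
    · simp [State.vec_setVec_of_ne, hτ.vec]
    · simp only [State.nat_setN, if_true, Function.update_self, State.vec_setN, State.vec_setVec,
        NExpr.eval]
      rw [hv, v20, hc, perpRow_span (by rw [kerL_eq_bot hi.1]; simpa using hx)]
      exact isCode_line (rowPerp_ne_zero hi.1 hx)
  · refine ⟨fun hn => by omega, fun _ => ?_⟩
    refine key _ ((TempFrame.refl σ₂).setN (by omega) _) (fun i hi => by simp [hi]) (by simp)
      (by simp) (Or.inl ⟨by simp, by rw [hc, perpRow_bot]⟩)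

theorem extendPush_wp (hS : IsSearchLabeling A I L) {qh : ℕ} {p : Item F μ ν} {σ : State F}
    (h : Treating I enum L qh p T σ) {e : Fin μ × Fin ν} (he : EdgeAt enum (σ.nat 20 14 - 1) e)
    (heI : e ∈ I) (hp : 2 ≤ p.kind) (hJ : (e.1, p.β) ∈ I) (hd : (A e.1 p.β).det ≠ 0)
    (hα : e.1 ≠ p.α) (hβ : e.2 ≠ p.β) {Q : State F → Prop}
    (hQ : ∀ τ, Treating I enum L qh p (push T (extendItem L (qh - 1) p e)) τ →
      (∀ i, i = 3 ∨ i = 5 → τ.nat 20 i = σ.nat 20 i) → Q τ) : extendPush.wp Q σ := by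
  have hs : IsStep A I L p (extendItem L (qh - 1) p e) :=
    IsStep.extend rfl heI hp hJ hd hα hβ rfl rfl rfl rfl
  have hi : ¬ IsIso A I e := not_isIso_of_ne hJ (fun h' => hβ (congrArg Prod.snd h').symm)
    (Or.inl rfl)
  simp only [extendPush, Prog.block, Prog.wp]
  refine prepInner_wp hS.valid h.ready (by simpa using he) heI hi fun τ f hreg hv r7 r9 hR hY => ?_
  have hlen : NExpr.eval ((τ.setN 20 6 3).setN 20 8 1) lenE.succ = p.len + 1 := by
    have := (h.rep.items _ _ h.item).len
    simp [f.nat 26, f.regs 1, h.reg1, this]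
  simp only [NExpr.eval] at hlen ⊢
  rw [hlen]
  refine copyVec_wp (by omega) ?_
  have f' := (((f.setN (i := 6) (by omega) 3).setN (i := 8) (by omega) 1).setN (i := 11)
    (by omega) (p.len + 1)).setVec (a := 20) (by omega) 0 (τ.vec 22 0)
  refine (h.temp f').push_wp hS hs rfl ?_ fun τ' h' hc' _ => hQ τ' h' fun i hi => ?_
  · constructor
    · simp [extendItem]
    · simp [f.regs 1, h.reg1, extendItem]
    · simpa [r7, extendItem] using he
    · simp [extendItem]
    · simpa [extendItem, State.vec_setVec] using hR
    · simpa [r9, extendItem, State.vec_setVec_of_ne] using hR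
    · simpa [extendItem, State.vec_setVec_of_ne] using hY
  · rw [hc' i (by omega)]
    simp only [State.nat_setN, State.nat_setVec, if_true]
    rw [Function.update_of_ne (by omega), Function.update_of_ne (by omega),
      Function.update_of_ne (by omega), hreg i (by omega) (by omega) (by omega) (by omega)]

end Ram

/-! ### One step of the search -/

namespace Ram

/-- The space in register 8 is the line of the row label of the edge `g`. -/
@[simp] def isLine (g : NExpr) : Test :=
  .and (.eq (reg 8) (.const 1)) (.feq (crossE 20 (.const 0) 12 g) .zero)

/-- The row node of the edge in register 12. -/
@[simp] def rowK : NExpr := .get 1 (reg 12)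

/-- Enter an inner space-walk along the edge `g` of `I`, unless the space in register 8 is the line
of the other edge `x` of `I` at its row node. -/
def enterUnless (x g : NExpr) : Prog := .cond (isLine x) .skip (enterPush g)

/-- Treat the visit of the row node of the edge in register 12 with the space in register 8.
Register 5 becomes `1` if a space-walk can end there. -/
def treatRow : Prog :=
  .cond (.eq (.get 14 rowK) (.const 0)) (.setN 20 (.const 5) (.const 1))
    (.block
      [.setN 20 (.const 13) (NExpr.get 14 rowK).pred,
       .setN 20 (.const 14) (.sub (.get 13 rowK) (reg 13).succ),
       .cond (.eq (reg 14) (.const 0))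
        (.cond (.not (.feq (detAt (reg 13)) .zero)) isoPush
          (.cond (isLine (reg 13)) (enterPush (reg 13)) (.setN 20 (.const 5) (.const 1))))
        (.block [enterUnless (reg 14).pred (reg 13), enterUnless (reg 13) (reg 14).pred])])

/-- Continue the inner space-walks that end with the current item. -/
def treatInner : Prog := .block
  [.setN 20 (.const 13) (.sub (.get 15 (.get 24 curE)) (NExpr.get 25 curE).succ),
   .cond (.and (.not (.eq (reg 13) (.const 0))) (.not (.feq (detAt (reg 13).pred) .zero)))
    (.block [.setN 20 (.const 14) (.sub (.get 13 (.get 1 (reg 13).pred)) (reg 13)), extendPush])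
    .skip]

variable {F : Type*} [Field F] {μ ν : ℕ} {A : Blocks F μ ν} {I : Finset (Fin μ × Fin ν)}
  {enum : Fin (edges A).card ≃ {e // e ∈ edges A}} {L : Labeling F μ ν} {T : List (Item F μ ν)}

theorem Ready.isLine_iff {σ : State F} (h : Ready I enum L σ) {g : NExpr} {e : Fin μ × Fin ν}
    (he : EdgeAt enum (g.eval σ) e) (heI : e ∈ I) (hi : ¬ IsIso A I e) {X : Space F}
    (hc : IsCode (σ.nat 20 8) (σ.vec 20 0) X) :
    (isLine g).Holds σ ↔ X = L.U e.1 (L.sign e) := by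
  rw [h.labels.row he heI hi, hc.eq_line_iff (h.labels.row_ne he heI hi)]
  rfl

theorem Treating.setReg {qh : ℕ} {p : Item F μ ν} {σ : State F} (h : Treating I enum L qh p T σ)
    {i : ℕ} (h1 : i ≠ 1) (h2 : i ≠ 2) (v : ℕ) : Treating I enum L qh p T (σ.setN 20 i v) :=
  ⟨h.ready.setReg i v, h.rep.setReg h2 v, h.forest, h.item, h.entered, by
    simpa [h1.symm] using h.reg1⟩

theorem push_eq_append (T : List (Item F μ ν)) (q : Item F μ ν) :
    ∃ N, push T q = T ++ N ∧ ∀ r ∈ N, r = q := by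
  unfold push
  split_ifs
  exacts [⟨[], by simp⟩, ⟨[q], by simp⟩]

theorem enterUnless_wp (hS : IsSearchLabeling A I L) {qh : ℕ} {p : Item F μ ν} {σ : State F}
    (h : Treating I enum L qh p T σ) {g x : NExpr} {e f : Fin μ × Fin ν}
    (he : EdgeAt enum (g.eval σ) e) (heI : e ∈ I) (hf : EdgeAt enum (x.eval σ) f) (hfI : f ∈ I)
    (hfe : f ≠ e) (h1 : f.1 = e.1) {X : Space F} (ho : OuterTo A I p e.1 X)
    (hc : IsCode (σ.nat 20 8) (σ.vec 20 0) X) {Q : State F → Prop}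
    (hQ : ∀ τ N, Treating I enum L qh p (T ++ N) τ → SameControl σ τ → τ.vec 20 = σ.vec 20 →
      (∀ r ∈ N, r.α = e.1 ∧ r.X = X) →
      (X ≠ L.U e.1 (!L.sign e) → wRow (T ++ N) e.1 ≤ L.U e.1 (L.sign e)) → Q τ) :
    (enterUnless x g).wp Q σ := by
  have hi : ¬ IsIso A I e := not_isIso_of_ne hfI hfe (Or.inl h1)
  have hi' : ¬ IsIso A I f := not_isIso_of_ne heI hfe.symm (Or.inl h1.symm)
  have hsign : L.sign f = !L.sign e :=
    not_eq_of_ne_bool (hS.valid.proper f hfI e heI hfe (Or.inl h1))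
  rw [enterUnless, Prog.wp, h.ready.isLine_iff hf hfI hi' hc, h1, hsign]
  refine ⟨fun hX => ?_, fun hX => ?_⟩
  · exact hQ σ [] (by simpa using h) (fun _ _ => rfl) rfl (by simp) fun hn => absurd hX hn
  · refine enterPush_wp hS h he heI hi ho hX (fun hal => absurd (hal f hfI h1) hfe) hc
      fun τ h' hc' hv => ?_
    obtain ⟨N, hN, hN'⟩ := push_eq_append T (enterItem L (qh - 1) p X e)
    have hle := wRow_push_le (T := T) (q := enterItem L (qh - 1) p X e)
      (by simp [enterItem])
    rw [hN] at h' hle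
    exact hQ τ N h' hc' hv (fun r hr => by rw [hN' r hr]; exact ⟨rfl, rfl⟩) fun _ => hle

theorem treatRow_wp (hS : IsSearchLabeling A I L) {qh : ℕ} {p : Item F μ ν} {σ : State F}
    (h : Treating I enum L qh p T σ) (hE : Entered I L T) {α : Fin μ}
    (hk : EdgeAt enum (σ.nat 20 12) (α, p.β)) {X : Space F} (ho : OuterTo A I p α X)
    (hc : IsCode (σ.nat 20 8) (σ.vec 20 0) X) {Q : State F → Prop}
    (hQ : ∀ τ N, Treating I enum L qh p (T ++ N) τ → Entered I L (T ++ N) →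
      Handled A I L (T ++ N) α X → (∀ i, i = 3 ∨ i = 5 → τ.nat 20 i = σ.nat 20 i) → Q τ)
    (hQ' : ∀ τ, Treating I enum L qh p T τ → τ.nat 20 5 = 1 → τ.nat 20 3 = σ.nat 20 3 →
      τ.nat 20 12 = σ.nat 20 12 → IsCode (τ.nat 20 8) (τ.vec 20 0) X → X ≠ kerRow A I α →
      kerRow A I α ≠ ⊥ → Q τ) : treatRow.wp Q σ := by
  have hL := hS.valid
  have hI := h.ready.indexed
  have hrow := hI.row hk
  dsimp only at hrow
  have hXtop : X ≠ ⊤ := by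
    rw [ho.2.2.2]
    exact perpCol_ne_top ho.2.2.1
  have hfound : ∀ τ : State F, Treating I enum L qh p T τ → τ.nat 20 = σ.nat 20 ∨
      τ.nat 20 = Function.update (Function.update (σ.nat 20) 13 (τ.nat 20 13)) 14 (τ.nat 20 14) →
      τ.vec 20 = σ.vec 20 → X ≠ kerRow A I α → kerRow A I α ≠ ⊥ → Q (τ.setN 20 5 1) := by
    intro τ hτ h20 hv hX hker
    have hreg : ∀ i, i ≠ 13 → i ≠ 14 → τ.nat 20 i = σ.nat 20 i := by
      intro i h1 h2
      rcases h20 with h20 | h20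
      · rw [h20]
      · rw [h20, Function.update_of_ne h2, Function.update_of_ne h1]
    refine hQ' _ (hτ.setReg (by omega) (by omega) 1) (by simp) ?_ ?_ ?_ hX hker
    · simp [hreg 3]
    · simp [hreg 12]
    · simpa [hreg 8, hv] using hc
  simp only [treatRow, Prog.block, Prog.wp, Test.Holds, NExpr.eval, FExpr.eval, rowK, reg, hrow,
    NExpr.pred, NExpr.succ]
  rcases hI.rowLast α with ⟨h14, hno⟩ | ⟨k, e, he, heI, rfl, h14⟩
  · refine ⟨fun _ => ?_, fun hn => absurd h14 hn⟩
    have hker : kerRow A I α = ⊤ := kerRow_of_forall_ne hno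
    exact hfound σ h (Or.inl rfl) rfl (hker ▸ hXtop) (hker ▸ top_ne_bot)
  refine ⟨fun hn => by omega, fun _ => ?_⟩
  simp only [h14, Nat.add_sub_cancel]
  generalize hσ₁ : State.setN (σ.setN 20 13 k) _ _ _ = σ₁
  have h₁ : Treating I enum L qh p T σ₁ := by
    rw [← hσ₁]
    exact (h.setReg (by omega) (by omega) _).setReg (by omega) (by omega) _
  have hreg : ∀ i, i ≠ 13 → i ≠ 14 → σ₁.nat 20 i = σ.nat 20 i := by
    intro i h1 h2
    rw [← hσ₁]
    simp [h1, h2]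
  have hv₁ : σ₁.vec = σ.vec := by rw [← hσ₁]; rfl
  have hc₁ : IsCode (σ₁.nat 20 8) (σ₁.vec 20 0) X := by
    rwa [hv₁, hreg 8 (by omega) (by omega)]
  have r13 : σ₁.nat 20 13 = k := by rw [← hσ₁]; simp
  have r14 : σ₁.nat 20 14 = σ.nat 13 e.1 - (k + 1) := by rw [← hσ₁]; simp [hrow]
  have h20 : σ₁.nat 20 =
      Function.update (Function.update (σ.nat 20) 13 (σ₁.nat 20 13)) 14 (σ₁.nat 20 14) := by
    funext i
    by_cases h14 : i = 14
    · subst h14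
      simp
    by_cases h13 : i = 13
    · subst h13
      simp
    rw [Function.update_of_ne h14, Function.update_of_ne h13, hreg i h13 h14]
  have he₁ : EdgeAt enum ((reg 13).eval σ₁) e := by simpa [r13] using he
  have hdet := (h₁.ready.indexed.blockAt he).det
  simp only [detAt, FExpr.eval, NExpr.eval, r13, r14, hdet]
  rcases hI.rowOther he heI with ⟨h13, hal⟩ | ⟨j, f, hj, hf, hfe, h2, h13⟩
  · refine ⟨fun _ => ⟨fun hd => ?_, fun hd => ?_⟩, fun hn => by omega⟩
    · have hi : IsIso A I e := ⟨hd, hal, hS.unique_col e heI hd hal⟩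
      refine isoPush_wp hS h₁ (by simpa using he₁) heI hi ho hc₁ fun τ h' hc' => ?_
      obtain ⟨N, hN, hN'⟩ := push_eq_append T (isoItem A (qh - 1) p X e)
      have hle := wRow_push_le (T := T) (q := isoItem A (qh - 1) p X e)
        (by simp [isoItem])
      rw [hN] at h' hle
      refine hQ τ N h' (hE.of_append fun r hr hk => ?_) (handled_of_iso heI hi hle) fun i hi => ?_
      · rw [hN' r hr] at hk
        simp [isoItem] at hk
      · rw [hc' i (by omega), hreg i (by omega) (by omega)]
    · rw [not_not] at hd
      have hi : ¬ IsIso A I e := fun hi => hi.1 hd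
      have hker : kerRow A I e.1 = L.U e.1 (L.sign e) := by
        rw [kerRow_of_alone heI hal]
        exact (hL.kernel e heI (block_rank_eq_one_iff.2 ⟨hS.block e heI, hd⟩)).1
      have hiff := h₁.ready.isLine_iff he₁ heI hi hc₁
      simp only [isLine, Test.Holds] at hiff
      refine ⟨fun hX => ?_, fun hX => ?_⟩
      · have hX := hiff.1 hX
        refine enterPush_wp hS h₁ he₁ heI hi ho (hX ▸ hL.ne_not _ _) (fun _ => hX) hc₁
          fun τ h' hc' hv => ?_
        obtain ⟨N, hN, hN'⟩ := push_eq_append T (enterItem L (qh - 1) p X e)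
        have hle := wRow_push_le (T := T) (q := enterItem L (qh - 1) p X e)
          (by simp [enterItem])
        rw [hN] at h' hle
        refine hQ τ N h' (hE.of_append fun r hr hk => ?_) ?_ fun i hi => ?_
        · rw [hN' r hr]
          intro f hf hfe hne
          obtain rfl := hal f hf hfe
          exact hle
        · rw [hX]
          exact handled_of_alone heI hal hi hle
        · rw [hc' i (by omega), hreg i (by omega) (by omega)]
      · have hX : X ≠ L.U e.1 (L.sign e) := fun h' => hX (hiff.2 h')
        exact hfound σ₁ h₁ (Or.inr h20) (by rw [hv₁]) (hker ▸ hX)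
          (hker ▸ line_ne_bot (hL.dimU _ _))
  · refine ⟨fun hn => by omega, fun _ => ?_⟩
    have hf₁ : EdgeAt enum ((reg 14).pred.eval σ₁) f := by
      simpa [r14, h13] using hj
    refine enterUnless_wp hS h₁ he₁ heI hf₁ hf hfe h2 ho hc₁ fun τ N h' hc' hv hN hle => ?_
    have he' : EdgeAt enum ((reg 13).eval τ) e := by
      simpa [hc' 13 (by omega)] using he₁
    have hf' : EdgeAt enum ((reg 14).pred.eval τ) f := by
      simpa [hc' 14 (by omega)] using hf₁
    refine enterUnless_wp hS h' hf' hf he' heI hfe.symm h2.symm (h2 ▸ ho)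
      (by rw [hc' 8 (by omega), hv]; exact hc₁) fun τ' N' h'' hc'' hv' hN' hle' => ?_
    rw [h2] at hle'
    rw [List.append_assoc] at h'' hle'
    have hle₂ : X ≠ L.U e.1 (!L.sign e) → wRow (T ++ (N ++ N')) e.1 ≤ L.U e.1 (L.sign e) := by
      intro hX
      rw [← List.append_assoc]
      exact (wRow_append_le _ _ _).trans (hle hX)
    refine hQ τ' (N ++ N') h'' (hE.of_append fun r hr _ => ?_)
      (handled_of_pair hL heI hf hfe h2 hle₂ hle') fun i hi => ?_
    · obtain ⟨h1, h1'⟩ : r.α = e.1 ∧ r.X = X := by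
        rcases List.mem_append.1 hr with hr | hr
        · exact hN r hr
        · exact h2 ▸ hN' r hr
      intro g hg hge hne
      rw [h1] at hge hne ⊢
      rw [h1'] at hne
      rcases IsProperSign.eq_or_eq hL.proper heI hf hg hfe h2 hge with rfl | rfl
      · exact hle₂ hne
      · exact hle' hne
    · rw [hc'' i (by omega), hc' i (by omega), hreg i (by omega) (by omega)]

theorem treatInner_wp (hS : IsSearchLabeling A I L) {qh : ℕ} {p : Item F μ ν} {σ : State F}
    (h : Treating I enum L qh p T σ) (hE : Entered I L T) (hp : 2 ≤ p.kind) {Q : State F → Prop}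
    (hQ : ∀ τ N, Treating I enum L qh p (T ++ N) τ → Entered I L (T ++ N) →
      (∀ f ∈ I, f.2 = p.β → f.1 ≠ p.α → (A f.1 f.2).det ≠ 0 → ∀ g ∈ I, g.1 = f.1 → g ≠ f →
        wRow (T ++ N) g.1 ≤ L.U g.1 (L.sign g)) →
      (∀ i, i = 3 ∨ i = 5 → τ.nat 20 i = σ.nat 20 i) → Q τ) : treatInner.wp Q σ := by
  have hL := hS.valid
  have hI := h.ready.indexed
  have hitem := h.rep.items _ _ h.item
  have hmem : (p.α, p.β) ∈ I := by
    obtain ⟨p', -, -, hs⟩ := h.forest.exists_step (List.mem_of_getElem? h.item)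
      (show p.kind ≠ 0 by omega)
    exact hs.mem
  have hk := hitem.edge
  simp only [treatInner, Prog.block, Prog.wp, Test.Holds, NExpr.eval, FExpr.eval, reg,
    NExpr.pred, NExpr.succ, curE, h.reg1, hitem.col, detAt]
  generalize hσ₁ : State.setN σ _ _ _ = σ₁
  have h₁ : Treating I enum L qh p T σ₁ := by
    rw [← hσ₁]
    exact h.setReg (by omega) (by omega) _
  have hreg : ∀ i, i ≠ 13 → σ₁.nat 20 i = σ.nat 20 i := by
    intro i h1
    rw [← hσ₁]
    simp [h1]
  have r13 : σ₁.nat 20 13 = σ.nat 15 p.β - (σ.nat 25 (qh - 1) + 1) := by rw [← hσ₁]; simp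
  have hskip : (∀ f ∈ I, f.2 = p.β → f.1 ≠ p.α → (A f.1 f.2).det = 0) → Q σ₁ := by
    intro hno
    refine hQ σ₁ [] (by simpa using h₁) (by simpa using hE) (fun f hf h2 h1 hd => ?_)
      fun i hi => hreg i (by omega)
    exact absurd (hno f hf h2 h1) hd
  rcases hI.colOther hk hmem with ⟨h15, hal⟩ | ⟨j, f, hj, hf, hfe, h2, h15⟩ <;>
    dsimp only at h15
  · refine ⟨fun hn => absurd (by omega) hn.1, fun _ => hskip fun f hf h2 h1 => ?_⟩
    exact absurd (congrArg Prod.fst (hal f hf h2)) h1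
  dsimp only at h2
  have r13' : σ₁.nat 20 13 = j + 1 := by omega
  have huniq : ∀ f' ∈ I, f'.2 = p.β → f'.1 ≠ p.α → f' = f := by
    intro f' hf' h2' h1'
    exact (IsProperSign.eq_or_eq' hL.proper hmem hf hf' hfe h2 h2').resolve_left
      fun h' => h1' (congrArg Prod.fst h')
  have hdet := (h₁.ready.indexed.blockAt hj).det
  simp only [r13', Nat.add_sub_cancel, hdet]
  refine ⟨fun hd => ?_, fun hd => hskip fun f' hf' h2' h1' => ?_⟩
  swap
  · rw [huniq f' hf' h2' h1']
    by_contra hd'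
    exact hd ⟨by omega, hd'⟩
  have hd := hd.2
  have hrow := h₁.ready.indexed.row hj
  have hα : f.1 ≠ p.α := fun h' => hfe (Prod.ext h' h2)
  simp only [hrow]
  rcases h₁.ready.indexed.rowOther hj hf with ⟨-, hal⟩ | ⟨l, g, hl, hg, hgf, hg1, h13⟩
  · exact absurd (hS.unique_col f hf hd hal _ hmem h2.symm) hfe.symm
  have hJ : (g.1, p.β) ∈ I := by
    rw [hg1, ← h2]
    exact hf
  have hdJ : (A g.1 p.β).det ≠ 0 := by
    rw [hg1, ← h2]
    exact hd
  have hgα : g.1 ≠ p.α := by rwa [hg1]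
  have hgβ : g.2 ≠ p.β := fun h' => hgf (Prod.ext hg1 (h'.trans h2.symm))
  refine extendPush_wp hS (h₁.setReg (i := 14) (by omega) (by omega) _) (e := g) ?_ hg hp hJ hdJ hgα
    hgβ fun τ h' hc' => ?_
  · simpa [h13] using hl
  · obtain ⟨N, hN, hN'⟩ := push_eq_append T (extendItem L (qh - 1) p g)
    have hle := wRow_push_le (T := T) (q := extendItem L (qh - 1) p g)
      (by simp [extendItem])
    rw [hN] at h' hle
    have hs : IsStep A I L p (extendItem L (qh - 1) p g) :=
      IsStep.extend rfl hg hp hJ hdJ hgα hgβ rfl rfl rfl rfl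
    refine hQ τ N h' (hE.of_append fun r hr _ => ?_) (fun f' hf' h2' h1' _ g' hg' hg1' hne => ?_)
      fun i hi => ?_
    · rw [hN' r hr]
      exact hs.isEntered_extend hL rfl hle
    · obtain rfl := huniq f' hf' h2' h1'
      obtain rfl := (IsProperSign.eq_or_eq hL.proper hf hg hg' hgf hg1 hg1').resolve_left hne
      exact hle
    · rw [hc' i hi]
      simp only [State.nat_setN, if_true]
      rw [Function.update_of_ne (by omega), hreg i (by omega)]

end Ram

/-! ### The search -/

namespace Ram

open Classical in
/-- The number of `k < m` with the property `P`. -/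
noncomputable def cntBelow (P : ℕ → Prop) (m : ℕ) : ℕ := ((Finset.range m).filter P).card

theorem cntBelow_succ {P : ℕ → Prop} {m : ℕ} (h : P m) : cntBelow P (m + 1) = cntBelow P m + 1 := by
  rw [cntBelow, cntBelow, Finset.range_add_one, Finset.filter_insert, if_pos h,
    Finset.card_insert_of_notMem (by simp)]

theorem cntBelow_lastBelow (P : ℕ → Prop) (m : ℕ) :
    cntBelow P (lastBelow P m) = cntBelow P m := by
  induction m with
  | zero => rfl
  | succ m ih =>
    rw [lastBelow]
    split_ifs with h
    · rfl
    · rw [ih, cntBelow, cntBelow, Finset.range_add_one, Finset.filter_insert, if_neg h]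

/-- Take up the next item. -/
def takeUp : Prog := .block
  [.setN 20 (.const 1) (reg 1).succ, .setN 20 (.const 3) (.get 11 (.get 24 curE)),
   .cond (.lt (.const 1) (.get 21 curE)) treatInner .skip]

/-- Treat the next edge outside `I` at the column node of the current item. -/
def treatEdge : Prog := .block
  [.setN 20 (.const 12) (reg 3).pred, .setN 20 (.const 3) (.get 12 (reg 12)), computeX,
   .cond (.eq (reg 8) (.const 0)) .skip treatRow]

/-- One step of the search. Register 1 is the number of items that have been taken up, register 2
the number of items, and register 3 is zero or the successor of the position of the next edge
outside `I` at the column node of the current item. -/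
def searchBody : Prog := .cond (.eq (reg 3) (.const 0)) takeUp treatEdge

/-- No space-walk has been found, and the search is not completed. -/
@[simp] def searchTest : Test :=
  .and (.eq (reg 5) (.const 0))
    (.not (.and (.eq (reg 3) (.const 0)) (.not (.lt (reg 1) (reg 2)))))

/-- The search. -/
def search : Prog := .loop searchTest searchBody

variable {F : Type*} [Field F] {μ ν : ℕ} {A : Blocks F μ ν} {I : Finset (Fin μ × Fin ν)}
  {enum : Fin (edges A).card ≃ {e // e ∈ edges A}} {L : Labeling F μ ν} {T : List (Item F μ ν)}

/-- The number of steps for taking up the items of the list and treating the edges outside `I` at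
their column nodes. -/
noncomputable def work (I : Finset (Fin μ × Fin ν))
    (enum : Fin (edges A).card ≃ {e // e ∈ edges A}) (T : List (Item F μ ν)) : ℕ :=
  (T.map fun q => 1 + cntBelow (OffEdge enum I q.β) (edges A).card).sum

theorem work_append (T N : List (Item F μ ν)) :
    work I enum (T ++ N) = work I enum T + work I enum N := by
  simp [work]

theorem sum_cntBelow_le (B : Finset (Fin ν)) :
    ∑ β ∈ B, cntBelow (OffEdge enum I β) (edges A).card ≤ (edges A).card := by
  classical
  unfold cntBelow
  rw [← Finset.card_biUnion]
  · refine (Finset.card_le_card (Finset.biUnion_subset.2 fun β _ =>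
      Finset.filter_subset _ _)).trans ?_
    rw [Finset.card_range]
  · intro β _ β' _ hne
    rw [Function.onFun, Finset.disjoint_left]
    intro k hk hk'
    obtain ⟨e, he, -, rfl⟩ := (Finset.mem_filter.1 hk).2
    obtain ⟨f, hf, -, rfl⟩ := (Finset.mem_filter.1 hk').2
    exact hne (by rw [he.eq hf])

/-- Every column node occurs at most twice in the search forest, so that the work is linear. -/
theorem _root_.IsForest.work_le (hS : IsSearchLabeling A I L) (h : IsForest A I L T)
    (hT : ∀ q ∈ T, (q.α, q.β) ∈ edges A) : work I enum T ≤ 4 * (edges A).card := by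
  classical
  have hsub : (T.map (·.β)).toFinset ⊆ (edges A).image Prod.snd := by
    intro β hβ
    rw [List.mem_toFinset, List.mem_map] at hβ
    obtain ⟨q, hq, rfl⟩ := hβ
    exact Finset.mem_image.2 ⟨_, hT q hq, rfl⟩
  have hcount : ∀ β, (T.map (·.β)).count β ≤ 2 := by
    intro β
    refine le_trans (le_of_eq ?_) (h.length_col_le hS.valid hS.block β)
    rw [List.count_eq_length_filter, List.filter_map, List.length_map]
    congr 1
  have h1 : work I enum T =
      ((T.map (·.β)).map fun β => 1 + cntBelow (OffEdge enum I β) (edges A).card).sum := by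
    rw [List.map_map]
    rfl
  rw [h1, Finset.sum_list_map_count]
  calc _ ≤ ∑ β ∈ (edges A).image Prod.snd,
        2 * (1 + cntBelow (OffEdge enum I β) (edges A).card) := by
        refine (Finset.sum_le_sum fun β _ => ?_).trans
          (Finset.sum_le_sum_of_subset_of_nonneg hsub fun _ _ _ => Nat.zero_le _)
        rw [smul_eq_mul]
        exact Nat.mul_le_mul_right _ (hcount β)
    _ ≤ 4 * (edges A).card := by
        rw [← Finset.mul_sum, Finset.sum_add_distrib, Finset.sum_const, smul_eq_mul, mul_one]
        have h2 := Finset.card_image_le (s := edges A) (f := Prod.snd)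
        have h3 := sum_cntBelow_le (I := I) (enum := enum) ((edges A).image Prod.snd)
        omega

/-- A space-walk to the last item that was taken up can be completed by an outer step along the edge
in register 12 to an augmenting space-walk. The last space of that step is in register 8. -/
def IsFound (I : Finset (Fin μ × Fin ν)) (enum : Fin (edges A).card ≃ {e // e ∈ edges A})
    (T : List (Item F μ ν)) (qh : ℕ) (σ : State F) : Prop :=
  ∃ p α X, T[qh - 1]? = some p ∧ EdgeAt enum (σ.nat 20 12) (α, p.β) ∧ OuterTo A I p α X ∧
    IsCode (σ.nat 20 8) (σ.vec 20 0) X ∧ X ≠ kerRow A I α ∧ kerRow A I α ≠ ⊥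

/-- The invariant of the search after `i` steps. -/
structure Searching (I : Finset (Fin μ × Fin ν)) (enum : Fin (edges A).card ≃ {e // e ∈ edges A})
    (L : Labeling F μ ν) (T : List (Item F μ ν)) (qh p i : ℕ) (σ : State F) : Prop where
  ready : Ready I enum L σ
  rep : Rep I enum T σ
  forest : IsForest A I L T
  le : qh ≤ T.length
  reg1 : σ.nat 20 1 = qh
  reg3 : σ.nat 20 3 = p
  count : i ≤ work I enum (T.take qh)
  count_pos : ∀ q, T[qh - 1]? = some q → p ≠ 0 →
    i + cntBelow (OffEdge enum I q.β) p ≤ work I enum (T.take qh)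
  state : σ.nat 20 5 = 0 ∧ SearchState I enum L T qh p ∨ σ.nat 20 5 = 1 ∧ IsFound I enum T qh σ

theorem take_append_of_le {α : Type*} {T N : List α} {m : ℕ} (h : m ≤ T.length) :
    (T ++ N).take m = T.take m := by
  rw [List.take_append_of_le_length h]

theorem Searching.takeUp_wp (hS : IsSearchLabeling A I L) {qh i : ℕ} {σ : State F}
    (h : Searching I enum L T qh 0 i σ) (h5 : σ.nat 20 5 = 0) (hlt : qh < T.length) :
    takeUp.wp (fun τ => ∃ T' qh' p', Searching I enum L T' qh' p' (i + 1) τ) σ := by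
  have hstate : SearchState I enum L T qh 0 := by
    rcases h.state with ⟨-, h'⟩ | ⟨h', -⟩
    · exact h'
    · omega
  obtain ⟨q, hq⟩ : ∃ q, T[qh]? = some q := ⟨_, List.getElem?_eq_getElem hlt⟩
  have hitem := h.rep.items _ _ hq
  have hwork : work I enum (T.take (qh + 1)) =
      work I enum (T.take qh) + (1 + cntBelow (OffEdge enum I q.β) (edges A).card) := by
    rw [List.take_add_one, hq, work_append]
    simp [work]
  have hc := h.count
  simp only [takeUp, Prog.block, Prog.wp, Test.Holds, NExpr.eval, NExpr.succ, NExpr.pred, reg,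
    curE, h.reg1]
  generalize hσ₁ : State.setN (σ.setN 20 1 (qh + 1)) _ _ _ = σ₁
  have hreg : ∀ i, i ≠ 1 → i ≠ 3 → σ₁.nat 20 i = σ.nat 20 i := by
    intro i h1 h2
    rw [← hσ₁]
    simp [h1, h2]
  have h₁ : Treating I enum L (qh + 1) q T σ₁ := by
    rw [← hσ₁]
    exact ⟨(h.ready.setReg _ _).setReg _ _,
      (h.rep.setReg (by omega) _).setReg (by omega) _, h.forest, hq, hstate.entered.except _,
      by simp⟩
  have r3 : σ₁.nat 20 3 = lastBelow (OffEdge enum I q.β) (edges A).card := by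
    rw [← hσ₁, ← h.ready.indexed.head]
    simp [hitem.col]
  have r21 : σ₁.nat 21 (σ₁.nat 20 1 - 1) = q.kind := by
    rw [h₁.reg1]
    exact (h₁.rep.items _ _ hq).kind
  have key : ∀ (τ : State F) (N : List (Item F μ ν)), Treating I enum L (qh + 1) q (T ++ N) τ →
      Entered I L (T ++ N) → (2 ≤ q.kind → ∀ f ∈ I, f.2 = q.β → f.1 ≠ q.α →
        (A f.1 f.2).det ≠ 0 → ∀ g ∈ I, g.1 = f.1 → g ≠ f →
          wRow (T ++ N) g.1 ≤ L.U g.1 (L.sign g)) →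
      (∀ i, i = 3 ∨ i = 5 → τ.nat 20 i = σ₁.nat 20 i) →
      ∃ T' qh' p', Searching I enum L T' qh' p' (i + 1) τ := by
    intro τ N hτ hE hin hr
    have htake : (T ++ N).take (qh + 1) = T.take (qh + 1) := take_append_of_le hlt
    refine ⟨T ++ N, qh + 1, lastBelow (OffEdge enum I q.β) (edges A).card, hτ.ready, hτ.rep,
      hτ.forest, by rw [List.length_append]; omega, hτ.reg1, by rw [hr 3 (by omega), r3], ?_,
      fun r hr' _ => ?_, Or.inl ⟨?_, hstate.pop hq hτ.forest hE hin⟩⟩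
    · rw [htake, hwork]
      omega
    · have : q = r := by
        have := hτ.item
        rw [hr'] at this
        exact (Option.some.inj this).symm
      subst this
      rw [htake, hwork, cntBelow_lastBelow]
      omega
    · rw [hr 5 (by omega), hreg 5 (by omega) (by omega), h5]
  rw [r21]
  refine ⟨fun hk => treatInner_wp hS h₁ hstate.entered hk fun τ N hτ hE hin hr =>
    key τ N hτ hE (fun _ => hin) hr, fun hk => key σ₁ [] (by simpa using h₁)
      (by simpa using hstate.entered) (fun hk' => absurd hk' hk) fun _ _ => rfl⟩

theorem Searching.treatEdge_wp (hS : IsSearchLabeling A I L) {qh k i : ℕ} {σ : State F}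
    (h : Searching I enum L T qh (k + 1) i σ) (h5 : σ.nat 20 5 = 0) :
    treatEdge.wp (fun τ => ∃ T' qh' p', Searching I enum L T' qh' p' (i + 1) τ) σ := by
  have hstate : SearchState I enum L T qh (k + 1) := by
    rcases h.state with ⟨-, h'⟩ | ⟨h', -⟩
    · exact h'
    · omega
  obtain ⟨q, hqh, hq, hoff⟩ := hstate.pos k rfl
  obtain ⟨⟨α, β⟩, he, heI, hβ⟩ := id hoff
  dsimp only at hβ
  subst hβ
  have hwork := h.count_pos q hq (by omega)
  rw [cntBelow_succ hoff] at hwork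
  simp only [treatEdge, Prog.block, Prog.wp, Test.Holds, NExpr.eval, NExpr.pred, reg, h.reg3,
    Nat.add_sub_cancel]
  generalize hσ₁ : State.setN (σ.setN 20 12 k) _ _ _ = σ₁
  have hreg : ∀ i, i ≠ 12 → i ≠ 3 → σ₁.nat 20 i = σ.nat 20 i := by
    intro i h1 h2
    rw [← hσ₁]
    simp [h1, h2]
  have h₁ : Treating I enum L qh q T σ₁ := by
    rw [← hσ₁]
    exact ⟨(h.ready.setReg _ _).setReg _ _,
      (h.rep.setReg (by omega) _).setReg (by omega) _, h.forest, hq, hstate.entered.except _,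
      by simpa using h.reg1⟩
  have r3 : σ₁.nat 20 3 = lastBelow (OffEdge enum I q.β) k := by
    rw [← hσ₁]
    simpa using h.ready.indexed.next he heI
  have r12 : σ₁.nat 20 12 = k := by
    rw [← hσ₁]
    simp
  have hadv : ∀ (τ : State F) (N : List (Item F μ ν)), Treating I enum L qh q (T ++ N) τ →
      τ.nat 20 3 = σ₁.nat 20 3 →
      (τ.nat 20 5 = 0 ∧ Entered I L (T ++ N) ∧
        (∀ X, OuterTo A I q α X → Handled A I L (T ++ N) α X) ∨
        τ.nat 20 5 = 1 ∧ IsFound I enum (T ++ N) qh τ) →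
      ∃ T' qh' p', Searching I enum L T' qh' p' (i + 1) τ := by
    intro τ N hτ hr3 hend
    have htake : (T ++ N).take qh = T.take qh := take_append_of_le h.le
    refine ⟨T ++ N, qh, lastBelow (OffEdge enum I q.β) k, hτ.ready, hτ.rep, hτ.forest,
      by rw [List.length_append]; exact h.le.trans (Nat.le_add_right _ _), hτ.reg1,
      by rw [hr3, r3], ?_, fun r hr' _ => ?_,
      hend.imp (fun h' => ⟨h'.1, hstate.advance hqh hq he hτ.forest h'.2.1 h'.2.2⟩) id⟩
    · rw [htake]
      omega
    · have : q = r := by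
        have := hτ.item
        rw [hr'] at this
        exact (Option.some.inj this).symm
      subst this
      rw [htake, cntBelow_lastBelow]
      omega
  have hitem := h₁.rep.items _ _ h₁.item
  rw [← h₁.reg1] at hitem
  refine computeX_wp h₁.ready.indexed hitem (e := (α, q.β)) (by rwa [r12])
    fun τ f hr hX => ?_
  have hτ := h₁.temp f
  rcases hX with ⟨h8, hle⟩ | ⟨h8, hle, hc⟩
  · refine ⟨fun _ => hadv τ [] (by simpa using hτ) (hr 3 (by omega)) (Or.inl ⟨?_, ?_, ?_⟩),
      fun hn => absurd h8 hn⟩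
    · rw [hr 5 (by omega), hreg 5 (by omega) (by omega), h5]
    · simpa using hstate.entered
    · exact fun X ho => absurd hle ho.2.2.1
  · refine ⟨fun hn => absurd hn h8, fun _ => ?_⟩
    have ho : OuterTo A I q α (perpCol (A α q.β) q.Y) := ⟨he.mem, heI, hle, rfl⟩
    refine treatRow_wp hS hτ hstate.entered (by rwa [hr 12 (by omega), r12]) ho hc ?_ ?_
    · intro τ' N hτ' hE hH hr'
      refine hadv τ' N hτ' ?_ (Or.inl ⟨?_, hE, fun X ho' => ?_⟩)
      · rw [hr' 3 (by omega), hr 3 (by omega)]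
      · rw [hr' 5 (by omega), hr 5 (by omega), hreg 5 (by omega) (by omega), h5]
      · rw [ho'.2.2.2]
        exact hH
    · intro τ' hτ' r5 r3' r12' hc' hX hker
      refine hadv τ' [] (by simpa using hτ') ?_ (Or.inr ⟨r5, q, α, _, by simpa using hq, ?_, ho, hc',
        hX, hker⟩)
      · rw [r3', hr 3 (by omega)]
      · rwa [r12', hr 12 (by omega), r12]

theorem Searching.le_edges (hS : IsSearchLabeling A I L) {qh p i : ℕ} {σ : State F}
    (h : Searching I enum L T qh p i σ) : i ≤ 4 * (edges A).card := by
  refine h.count.trans (le_trans ?_ (h.forest.work_le (enum := enum) hS fun q hq => ?_))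
  · conv_rhs => rw [← List.take_append_drop qh T, work_append]
    exact Nat.le_add_right _ _
  · obtain ⟨j, hj⟩ := List.mem_iff_getElem?.1 hq
    exact (h.rep.items j q hj).edge.mem

/-- The search ends with a found space-walk, or it is completed. -/
theorem triple_search (hS : IsSearchLabeling A I L) {σ₀ : State F}
    (h : Searching I enum L T 0 0 0 σ₀) :
    Triple (fun σ => σ = σ₀) search
      ((searchTest.cost + searchBody.bound) * (4 * (edges A).card) + searchTest.cost)
      (fun τ => ∃ T qh, Ready I enum L τ ∧ Rep I enum T τ ∧ IsForest A I L T ∧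
        (τ.nat 20 5 = 0 ∧ IsCompleted A I L T ∨
          τ.nat 20 5 = 1 ∧ τ.nat 20 1 = qh ∧ IsFound I enum T qh τ)) := by
  have hl := Triple.loop (b := searchTest) (p := searchBody) (N := 4 * (edges A).card)
    (J := fun i (σ : State F) => ∃ T qh p, Searching I enum L T qh p i σ)
    (fun i σ ⟨T, qh, p, h⟩ => h.le_edges hS) (fun i σ ⟨T, qh, p, h⟩ hb => by
      simp only [searchTest, Test.Holds, NExpr.eval, reg, h.reg3, h.reg1, h.rep.count] at hb
      obtain ⟨h5, hb⟩ := hb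
      constructor
      · intro h3
        simp only [Test.Holds, NExpr.eval, reg, h.reg3] at h3
        subst h3
        exact h.takeUp_wp hS h5 (by simpa using hb)
      · intro h3
        simp only [Test.Holds, NExpr.eval, reg, h.reg3] at h3
        obtain ⟨k, rfl⟩ := Nat.exists_eq_succ_of_ne_zero h3
        exact h.treatEdge_wp hS h5)
  rintro σ rfl
  obtain ⟨t, τ, hex, ht, ⟨i, T, qh, p, hT⟩, hb⟩ := hl σ ⟨0, T, 0, 0, h⟩
  refine ⟨t, τ, hex, ht, T, qh, hT.ready, hT.rep, hT.forest, ?_⟩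
  rcases hT.state with ⟨h5, hst⟩ | ⟨h5, hf⟩
  · refine Or.inl ⟨h5, ?_⟩
    simp only [searchTest, Test.Holds, NExpr.eval, reg, hT.reg3, hT.reg1, hT.rep.count, h5,
      true_and, not_not] at hb
    obtain ⟨rfl, hb⟩ := hb
    obtain rfl : qh = T.length := le_antisymm hT.le (not_lt.1 hb)
    exact hst.isCompleted
  · exact Or.inr ⟨h5, hT.reg1, hf⟩

end Ram

/-! ### The output -/

namespace Ram

/-- Write a step to the position `pos` of the output. Its row space has codimension `xc` and the
vector in the cells `xi` of the arrays `xa`, `xa + 1`; its column space has codimension `yc` and the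
vector in the cells `yi` of the arrays `16`, `17`. -/
def writeStep (pos row col xc : NExpr) (xa : ℕ) (xi yc yi : NExpr) : Prog := .block
  [.setN 7 pos row, .setN 8 pos col, .setN 9 pos xc, .setN 10 pos yc, copyVec xa xi 8 pos,
   copyVec 16 yi 10 pos]

/-- The item in register 4 is not a root. -/
@[simp] def backTest : Test := .not (.eq (.get 21 (reg 4)) (.const 0))

/-- Write the steps by which the item in register 4 was reached, and go to its parent. The outer
step comes last if the item belongs to an outer space-walk, and last but one if it is the first one
of an inner space-walk. -/
def backBody : Prog := .block
  [.cond (.lt (.get 21 (reg 4)) (.const 3))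
    (writeStep (.sub (.get 26 (reg 4)) (.get 21 (reg 4))) (.get 23 (reg 4))
      (.get 24 (.get 22 (reg 4))) (.get 27 (reg 4)) 14 (reg 4) (.get 28 (.get 22 (reg 4)))
      (.get 22 (reg 4))) .skip,
   .cond (.lt (.const 1) (.get 21 (reg 4)))
    (writeStep (NExpr.get 26 (reg 4)).pred (.get 23 (reg 4)) (.get 24 (reg 4)) (.get 29 (reg 4)) 18
      (reg 4) (.get 28 (reg 4)) (reg 4)) .skip,
   .setN 20 (.const 4) (.get 22 (reg 4))]

/-- Write the number of steps and the last step. -/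
def lastStep : Prog := .block
  [.setN 4 (.const 0) (.const 1), .setN 4 (.const 1) lenE.succ, .setN 20 (.const 4) curE,
   writeStep lenE rowK (.get 24 curE) (reg 8) 20 (.const 0) (.get 28 curE) curE]

/-- Output the space-walk if one has been found. -/
def output : Prog :=
  .cond (.eq (reg 5) (.const 1)) (.seq lastStep (.loop backTest backBody)) .skip

variable {F : Type*} [Field F] {μ ν : ℕ} {A : Blocks F μ ν} {I : Finset (Fin μ × Fin ν)}
  {enum : Fin (edges A).card ≃ {e // e ∈ edges A}} {L : Labeling F μ ν} {T : List (Item F μ ν)}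

/-- The step `s` is at position `k` of the output. -/
structure StepAt (σ : State F) (k : ℕ) (s : WalkStep F μ ν) : Prop where
  row : σ.nat 7 k = s.α
  col : σ.nat 8 k = s.β
  X : IsCode (σ.nat 9 k) (σ.vec 8 k) s.X
  Y : IsCode (σ.nat 10 k) (σ.vec 10 k) s.Y

/-- The state `τ` arises from `σ` by a change of the steps of the output. -/
structure OutFrame {F : Type*} (σ τ : State F) : Prop where
  nat : ∀ a, (a < 7 ∨ 10 < a) → τ.nat a = σ.nat a
  fld : ∀ a, (a < 8 ∨ 11 < a) → τ.fld a = σ.fld a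

theorem OutFrame.vec {F : Type*} {σ τ : State F} (h : OutFrame σ τ) {a : ℕ} (ha : 11 < a) :
    τ.vec a = σ.vec a := by
  funext j
  rw [State.vec, State.vec, h.fld a (by omega), h.fld (a + 1) (by omega)]

theorem OutFrame.itemAt {σ τ : State F} (h : OutFrame σ τ) {j : ℕ} {q : Item F μ ν}
    (hq : ItemAt enum σ j q) : ItemAt enum τ j q := by
  obtain ⟨h1, h2, h3, h4, h5, h6, h7, h8, h9⟩ := hq
  constructor <;> rw [h.nat _ (by omega)] <;>
    first | assumption | (rw [h.vec (by omega)]; assumption)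

theorem writeStep_wp {σ : State F} {pos row col xc xi yc yi : NExpr} {xa k i j c d : ℕ}
    {s : WalkStep F μ ν} (hpos : ∀ τ, OutFrame σ τ → pos.eval τ = k)
    (hrow : ∀ τ, OutFrame σ τ → row.eval τ = s.α) (hcol : ∀ τ, OutFrame σ τ → col.eval τ = s.β)
    (hxc : ∀ τ, OutFrame σ τ → xc.eval τ = c) (hyc : ∀ τ, OutFrame σ τ → yc.eval τ = d)
    (hxi : ∀ τ, OutFrame σ τ → xi.eval τ = i) (hyi : ∀ τ, OutFrame σ τ → yi.eval τ = j)
    (hxa : 11 < xa) (hX : IsCode c (σ.vec xa i) s.X) (hY : IsCode d (σ.vec 16 j) s.Y)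
    {Q : State F → Prop} (hQ : ∀ τ, OutFrame σ τ → StepAt τ k s →
      (∀ (l : ℕ) (t : WalkStep F μ ν), l ≠ k → StepAt σ l t → StepAt τ l t) → Q τ) :
    (writeStep pos row col xc xa xi yc yi).wp Q σ := by
  have f0 : OutFrame σ σ := ⟨fun _ _ => rfl, fun _ _ => rfl⟩
  have fN : ∀ τ a i v, OutFrame σ τ → 7 ≤ a → a ≤ 10 → OutFrame σ (τ.setN a i v) :=
    fun τ a i v h h1 h2 => ⟨fun b hb => by simp [show b ≠ a by omega, h.nat b hb], h.fld⟩
  have fV : ∀ τ a i v, OutFrame σ τ → 8 ≤ a → a ≤ 10 → OutFrame σ (τ.setVec a i v) :=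
    fun τ a i v h h1 h2 => ⟨h.nat, fun b hb => by
      rw [State.fld_setVec _ _ _ (by omega) (by omega), h.fld b hb]⟩
  simp only [writeStep, Prog.block, Prog.wp]
  rw [hpos σ f0, hrow σ f0]
  have f1 := fN _ 7 k s.α f0 (by omega) (by omega)
  rw [hpos _ f1, hcol _ f1]
  have f2 := fN _ 8 k s.β f1 (by omega) (by omega)
  rw [hpos _ f2, hxc _ f2]
  have f3 := fN _ 9 k c f2 (by omega) (by omega)
  rw [hpos _ f3, hyc _ f3]
  have f4 := fN _ 10 k d f3 (by omega) (by omega)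
  refine copyVec_wp (by omega) ?_
  rw [hpos _ f4, hxi _ f4]
  have f5 := fV _ 8 k (σ.vec xa i) f4 (by omega) (by omega)
  refine copyVec_wp (by omega) ?_
  simp only [State.vec_setN]
  rw [hpos _ f5, hyi _ f5, State.vec_setVec_of_ne _ _ _ (by omega) (by omega) (by omega)]
  have f6 := fV _ 10 k (σ.vec 16 j) f5 (by omega) (by omega)
  refine hQ _ f6 ⟨?_, ?_, ?_, ?_⟩ fun l t hl ⟨h1, h2, h3, h4⟩ => ⟨?_, ?_, ?_, ?_⟩
  · simp
  · simp
  · simpa [State.vec_setVec, State.vec_setVec_of_ne] using hX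
  · simpa [State.vec_setVec, State.vec_setVec_of_ne] using hY
  · simpa [hl] using h1
  · simpa [hl] using h2
  · simpa [State.vec_setVec, State.vec_setVec_of_ne, hl] using h3
  · simpa [State.vec_setVec, State.vec_setVec_of_ne, hl] using h4

/-- The steps of the list from the position `m` on have been written. -/
def Written (l : List (WalkStep F μ ν)) (m : ℕ) (σ : State F) : Prop :=
  ∀ k s, m ≤ k → l[k]? = some s → StepAt σ k s

theorem Written.write {l : List (WalkStep F μ ν)} {m : ℕ} {σ τ : State F} {s : WalkStep F μ ν}
    (h : Written l (m + 1) σ) (hs : l[m]? = some s) (hm : StepAt τ m s)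
    (ho : ∀ k (t : WalkStep F μ ν), k ≠ m → StepAt σ k t → StepAt τ k t) : Written l m τ := by
  intro k t hk ht
  by_cases hkm : k = m
  · subst hkm
    rw [hs] at ht
    rwa [← Option.some.inj ht]
  · exact ho k t hkm (h k t (by omega) ht)

theorem _root_.IsForest.length_pathSteps (h : IsForest A I L T) {i : ℕ}
    {S : List (WalkStep F μ ν)} (hS : PathSteps T i S) {q : Item F μ ν} (hq : T[i]? = some q) :
    S.length = q.len := by
  have key : ∀ {i : ℕ} {q p : Item F μ ν}, T[i]? = some q → q.kind ≠ 0 → T[q.par]? = some p →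
      IsStep A I L p q := by
    intro i q p hq hk hp
    rcases h.item hq with ⟨h0, -⟩ | ⟨p', hp', -, hs⟩
    · exact absurd h0 hk
    · rw [hp] at hp'
      rwa [Option.some.inj hp']
  induction hS generalizing q with
  | @root i r hr hk =>
    obtain rfl : r = q := by rw [hr] at hq; exact Option.some.inj hq
    rcases h.item hq with ⟨-, -, -, h0⟩ | ⟨p, -, -, hs⟩
    · rw [h0]
      rfl
    · exact absurd hk hs.kind_ne
  | @iso i r p S hr hp hk hS ih =>
    obtain rfl : r = q := by rw [hr] at hq; exact Option.some.inj hq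
    have hs := key hr (by omega) hp
    rw [List.length_append, ih hp]
    cases hs with
    | iso _ _ _ _ _ _ hl => exact hl.symm
    | enter hk' => omega
    | extend hk' => omega
  | @enter i r p S hr hp hk hS ih =>
    obtain rfl : r = q := by rw [hr] at hq; exact Option.some.inj hq
    have hs := key hr (by omega) hp
    rw [List.length_append, ih hp]
    cases hs with
    | iso hk' => omega
    | enter _ _ _ _ _ _ _ _ hl => exact hl.symm
    | extend hk' => omega
  | @extend i r p S hr hp hk hS ih =>
    obtain rfl : r = q := by rw [hr] at hq; exact Option.some.inj hq
    have hs := key hr (by omega) hp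
    rw [List.length_append, ih hp]
    cases hs with
    | iso hk' => omega
    | enter hk' => omega
    | extend _ _ _ _ _ _ _ _ _ _ hl => exact hl.symm

/-- The invariant of the output after `i` items: the steps after those that lead to the item in
register 4 have been written. -/
structure Backtrack (enum : Fin (edges A).card ≃ {e // e ∈ edges A}) (T : List (Item F μ ν))
    (l : List (WalkStep F μ ν)) (i : ℕ) (σ : State F) : Prop where
  items : ∀ j q, T[j]? = some q → ItemAt enum σ j q
  out0 : σ.nat 4 0 = 1
  out1 : σ.nat 4 1 = l.length
  le : i + σ.nat 20 4 ≤ T.length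
  path : ∃ S R, PathSteps T (σ.nat 20 4) S ∧ l = S ++ R ∧ Written l S.length σ

theorem _root_.PathSteps.getElem {i : ℕ} {S : List (WalkStep F μ ν)} (h : PathSteps T i S) :
    ∃ q, T[i]? = some q := by
  cases h <;> exact ⟨_, ‹_›⟩

theorem Backtrack.step (hF : IsForest A I L T) {l : List (WalkStep F μ ν)} {i : ℕ} {σ : State F}
    (h : Backtrack enum T l i σ) (hb : backTest.Holds σ) :
    backBody.wp (Backtrack enum T l (i + 1)) σ := by
  obtain ⟨S, R, hS, hl, hW⟩ := h.path
  have hle := h.le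
  have ho0 := h.out0
  have ho1 := h.out1
  obtain ⟨q, hq⟩ := hS.getElem
  have hitem := h.items _ _ hq
  simp only [backTest, Test.Holds, NExpr.eval, reg, hitem.kind] at hb
  generalize hc : σ.nat 20 4 = c at *
  rcases hF.item hq with ⟨h0, -⟩ | ⟨p, hp, hlt, hs⟩
  · exact absurd h0 hb
  have hpitem := h.items _ _ hp
  have hlen : S.length = q.len := hF.length_pathSteps hS hq
  have hcell : ∀ τ, OutFrame σ τ → τ.nat 20 4 = c ∧ τ.nat 21 c = q.kind ∧ τ.nat 22 c = q.par ∧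
      τ.nat 23 c = q.α ∧ τ.nat 24 c = q.β ∧ τ.nat 26 c = q.len ∧ τ.nat 27 = σ.nat 27 ∧
      τ.nat 28 = σ.nat 28 ∧ τ.nat 29 = σ.nat 29 ∧ τ.nat 24 q.par = p.β := by
    intro τ f
    have h1 := f.itemAt hitem
    have h2 := f.itemAt hpitem
    exact ⟨by rw [f.nat 20 (by omega), hc], h1.kind, h1.par, h1.row, h1.col, h1.len,
      f.nat _ (by omega), f.nat _ (by omega), f.nat _ (by omega), h2.col⟩
  -- the outer step and the inner step of the item
  have houter : q.kind ≤ 2 → ∀ m, q.len - q.kind = m → ∀ Q : State F → Prop,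
      (∀ τ, OutFrame σ τ → StepAt τ m (⟨q.α, p.β, q.X, p.Y⟩ : WalkStep F μ ν) →
        (∀ (k : ℕ) (t : WalkStep F μ ν), k ≠ m → StepAt σ k t → StepAt τ k t) → Q τ) →
      (writeStep (.sub (.get 26 (reg 4)) (.get 21 (reg 4))) (.get 23 (reg 4))
        (.get 24 (.get 22 (reg 4))) (.get 27 (reg 4)) 14 (reg 4) (.get 28 (.get 22 (reg 4)))
        (.get 22 (reg 4))).wp Q σ := by
    intro _ m hm Q hQ
    refine writeStep_wp (i := c) (j := q.par) ?_ ?_ ?_ ?_ ?_ ?_ ?_ (by omega) hitem.X hpitem.Y hQ <;>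
      intro τ f <;> obtain ⟨h1, h2, h3, h4, h5, h6, h7, h8, h9, h10⟩ := hcell τ f <;>
      simp only [NExpr.eval, reg, *]
  have hinner : ∀ ρ, OutFrame σ ρ → ∀ m, q.len - 1 = m → ∀ Q : State F → Prop,
      (∀ τ, OutFrame σ τ → StepAt τ m (⟨q.α, q.β, q.R, q.Y⟩ : WalkStep F μ ν) →
        (∀ (k : ℕ) (t : WalkStep F μ ν), k ≠ m → StepAt ρ k t → StepAt τ k t) → Q τ) →
      (writeStep (NExpr.get 26 (reg 4)).pred (.get 23 (reg 4)) (.get 24 (reg 4)) (.get 29 (reg 4)) 18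
        (reg 4) (.get 28 (reg 4)) (reg 4)).wp Q ρ := by
    intro ρ fρ m hm Q hQ
    have htr : ∀ τ, OutFrame ρ τ → OutFrame σ τ := fun τ f =>
      ⟨fun a ha => (f.nat a ha).trans (fρ.nat a ha), fun a ha => (f.fld a ha).trans (fρ.fld a ha)⟩
    refine writeStep_wp (i := c) (j := c) (c := σ.nat 29 c) (d := σ.nat 28 c) ?_ ?_ ?_ ?_ ?_ ?_ ?_
      (by omega) ?_ ?_ fun τ f => hQ τ (htr τ f)
    iterate 7
      intro τ f
      obtain ⟨h1, h2, h3, h4, h5, h6, h7, h8, h9, h10⟩ := hcell τ (htr τ f)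
      simp only [NExpr.eval, NExpr.pred, reg, *]
    · rw [fρ.vec (by omega)]
      exact hitem.R
    · rw [fρ.vec (by omega)]
      exact hitem.Y
  have hfin : ∀ τ S' R', OutFrame σ τ → PathSteps T q.par S' → l = S' ++ R' →
      Written l S'.length τ →
      Backtrack enum T l (i + 1) (τ.setN 20 4 (τ.nat 22 (τ.nat 20 4))) := by
    intro τ S' R' f hS' hl' hW'
    obtain ⟨h1, h2, h3, -⟩ := hcell τ f
    rw [h1, h3]
    refine ⟨fun j r hr => ?_, ?_, ?_, ?_, S', R', by simpa using hS', hl', fun k s hk hs' => ?_⟩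
    · obtain ⟨h1, h2, h3, h4, h5, h6, h7, h8, h9⟩ := f.itemAt (h.items j r hr)
      constructor <;> simpa
    · simpa [f.nat 4] using ho0
    · simpa [f.nat 4] using ho1
    · simp only [State.nat_setN, if_true, Function.update_self]
      omega
    · obtain ⟨h1, h2, h3, h4⟩ := hW' k s hk hs'
      constructor <;> simpa
  have hget : ∀ (S' R' : List (WalkStep F μ ν)) s, l = S' ++ s :: R' →
      l[S'.length]? = some s := by
    rintro S' R' s rfl
    simp
  have f0 : OutFrame σ σ := ⟨fun _ _ => rfl, fun _ _ => rfl⟩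
  have hreg : ∀ τ : State F, (reg 4).eval τ = τ.nat 20 4 := fun _ => rfl
  simp only [backBody, Prog.block, Prog.wp, Test.Holds, NExpr.eval, hreg, hc, hitem.kind]
  cases hS with
  | @root _ r hr hk =>
    obtain rfl : r = q := by rw [hr] at hq; exact Option.some.inj hq
    exact absurd hk hb
  | @iso _ r p' S' hr hp' hk hS' =>
    obtain rfl : r = q := by rw [hr] at hq; exact Option.some.inj hq
    obtain rfl : p' = p := by rw [hp'] at hp; exact Option.some.inj hp
    rw [List.length_append, List.length_singleton] at hlen hW
    refine ⟨fun _ => houter (by omega) S'.length (by omega) _ fun τ f hτ hold => ?_,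
      fun hn => absurd (by omega) hn⟩
    obtain ⟨h1, h2, -⟩ := hcell τ f
    rw [h1, h2]
    refine ⟨fun hn => by omega, fun _ => ?_⟩
    have hnext := hfin τ S' _ f hS' (by rw [hl, List.append_assoc])
      (hW.write (hget S' R _ (by rw [hl, List.append_assoc]; rfl)) hτ hold)
    rwa [h1] at hnext
  | @enter _ r p' S' hr hp' hk hS' =>
    obtain rfl : r = q := by rw [hr] at hq; exact Option.some.inj hq
    obtain rfl : p' = p := by rw [hp'] at hp; exact Option.some.inj hp
    rw [List.length_append] at hlen hW
    simp only [List.length_cons, List.length_nil, Nat.zero_add] at hlen hW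
    refine ⟨fun _ => houter (by omega) S'.length (by omega) _ fun τ f hτ hold => ?_,
      fun hn => absurd (by omega) hn⟩
    obtain ⟨h1, h2, -⟩ := hcell τ f
    rw [h1, h2]
    refine ⟨fun _ => hinner τ f (S'.length + 1) (by omega) _ fun τ' f' hτ' hold' => ?_,
      fun hn => absurd (by omega) hn⟩
    refine hfin τ' S' _ f' hS' (by rw [hl, List.append_assoc]) ?_
    intro k s hk hs'
    rcases (show k = S'.length ∨ k = S'.length + 1 ∨ S'.length + 2 ≤ k by omega) with
      rfl | rfl | hk
    · rw [hget S' _ _ (by rw [hl, List.append_assoc]; rfl)] at hs'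
      rw [← Option.some.inj hs']
      exact hold' _ _ (by omega) hτ
    · have := hget (S' ++ [⟨r.α, p'.β, r.X, p'.Y⟩]) R ⟨r.α, r.β, r.R, r.Y⟩ (by
        rw [hl, List.append_assoc, List.append_assoc]; rfl)
      rw [List.length_append, List.length_singleton, hs'] at this
      rw [Option.some.inj this]
      exact hτ'
    · exact hold' _ _ (by omega) (hold _ _ (by omega) (hW k s hk hs'))
  | @extend _ r p' S' hr hp' hk hS' =>
    obtain rfl : r = q := by rw [hr] at hq; exact Option.some.inj hq
    rw [List.length_append, List.length_singleton] at hlen hW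
    refine ⟨fun hn => by omega, fun _ => ⟨fun _ => hinner σ f0 S'.length (by omega) _
      fun τ f hτ hold => ?_, fun hn => ?_⟩⟩
    · refine hfin τ S' _ f hS' (by rw [hl, List.append_assoc]) ?_
      exact hW.write (hget S' R _ (by rw [hl, List.append_assoc]; rfl)) hτ hold
    · omega

end Ram

namespace Ram

variable {F : Type*} [Field F] {μ ν : ℕ} {A : Blocks F μ ν} {I : Finset (Fin μ × Fin ν)}
  {enum : Fin (edges A).card ≃ {e // e ∈ edges A}} {L : Labeling F μ ν} {T : List (Item F μ ν)}

theorem Rep.length_le (hS : IsSearchLabeling A I L) (hF : IsForest A I L T) {σ : State F}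
    (h : Rep I enum T σ) : T.length ≤ 4 * (edges A).card := by
  refine le_trans ?_ (hF.work_le (enum := enum) hS fun q hq => ?_)
  · calc T.length = (T.map fun _ => 1).sum := by simp
      _ ≤ work I enum T := List.sum_le_sum fun q _ => Nat.le_add_right _ _
  · obtain ⟨j, hj⟩ := List.mem_iff_getElem?.1 hq
    exact (h.items j q hj).edge.mem

theorem lastStep_wp (hF : IsForest A I L T) {σ : State F} (hR : Ready I enum L σ)
    (hT : Rep I enum T σ) {p : Item F μ ν} (hp : T[σ.nat 20 1 - 1]? = some p) {α : Fin μ}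
    {X : Space F} (he : EdgeAt enum (σ.nat 20 12) (α, p.β))
    (hc : IsCode (σ.nat 20 8) (σ.vec 20 0) X) {S : List (WalkStep F μ ν)}
    (hS : PathSteps T (σ.nat 20 1 - 1) S) :
    lastStep.wp (Backtrack enum T (S ++ [⟨α, p.β, X, p.Y⟩]) 0) σ := by
  have hlen := hF.length_pathSteps hS hp
  have hitem := hT.items _ _ hp
  have hrow := hR.indexed.row he
  have hlt : σ.nat 20 1 - 1 < T.length := (List.getElem?_eq_some_iff.1 hp).1
  simp only [lastStep, Prog.block, Prog.wp]
  generalize hσ' : State.setN _ 20 _ _ = σ'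
  have h4 : ∀ a, a ≠ 4 → a ≠ 20 → σ'.nat a = σ.nat a := by
    intro a h1 h2
    rw [← hσ']
    simp [h1, h2]
  have h20 : ∀ j, j ≠ 4 → σ'.nat 20 j = σ.nat 20 j := by
    intro j hj
    rw [← hσ']
    simp [NExpr.eval, hj]
  have hv : ∀ a, σ'.vec a = σ.vec a := by
    intro a
    rw [← hσ']
    simp
  have h204 : σ'.nat 20 4 = σ.nat 20 1 - 1 := by
    rw [← hσ']
    simp [NExpr.eval]
  have h40 : σ'.nat 4 0 = 1 := by
    rw [← hσ']
    simp [NExpr.eval]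
  have h41 : σ'.nat 4 1 = p.len + 1 := by
    rw [← hσ']
    simp [NExpr.eval, hitem.len]
  have hit : ∀ j q, T[j]? = some q → ItemAt enum σ' j q := by
    intro j q hq
    obtain ⟨g1, g2, g3, g4, g5, g6, g7, g8, g9⟩ := hT.items j q hq
    constructor <;> (try rw [h4 _ (by omega) (by omega)]) <;> (try rw [hv]) <;> assumption
  have hitem' := hit _ _ hp
  have hcell : ∀ τ, OutFrame σ' τ → τ.nat 20 1 = σ.nat 20 1 ∧ τ.nat 20 12 = σ.nat 20 12 ∧
      τ.nat 20 8 = σ.nat 20 8 ∧ τ.nat 1 (σ.nat 20 12) = α ∧ τ.nat 24 (σ.nat 20 1 - 1) = p.β ∧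
      τ.nat 26 (σ.nat 20 1 - 1) = S.length ∧ τ.nat 28 = σ.nat 28 := by
    intro τ f
    have g := f.itemAt hitem'
    refine ⟨?_, ?_, ?_, ?_, g.col, g.len.trans hlen.symm, ?_⟩
    · rw [f.nat _ (by omega), h20 _ (by omega)]
    · rw [f.nat _ (by omega), h20 _ (by omega)]
    · rw [f.nat _ (by omega), h20 _ (by omega)]
    · rw [f.nat _ (by omega), h4 _ (by omega) (by omega), hrow]
    · rw [f.nat _ (by omega), h4 _ (by omega) (by omega)]
  refine writeStep_wp (i := 0) (j := σ.nat 20 1 - 1) (k := S.length) (c := σ.nat 20 8)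
    (d := σ.nat 28 (σ.nat 20 1 - 1)) (s := ⟨α, p.β, X, p.Y⟩) ?_ ?_ ?_ ?_ ?_ ?_ ?_ (by omega) ?_ ?_
    fun τ f hτ _ => ?_
  iterate 7
    intro τ f
    obtain ⟨h1, h2, h3, h4, h5, h6, h7⟩ := hcell τ f
    simp only [NExpr.eval, NExpr.pred, reg, curE, lenE, rowK, *]
  · rw [hv]
    exact hc
  · rw [hv]
    exact hitem.Y
  · have e : τ.nat 20 4 = σ.nat 20 1 - 1 := by rw [f.nat _ (by omega), h204]
    refine ⟨fun j q hq => f.itemAt (hit j q hq), by rw [f.nat _ (by omega), h40], ?_, by omega,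
      S, [⟨α, p.β, X, p.Y⟩], by rwa [e], rfl, fun k s hk hs => ?_⟩
    · rw [f.nat _ (by omega), h41, List.length_append, hlen]
      rfl
    · obtain rfl : k = S.length := by
        have := (List.getElem?_eq_some_iff.1 hs).1
        rw [List.length_append, List.length_singleton] at this
        omega
      rw [List.getElem?_concat_length] at hs
      rwa [← Option.some.inj hs]

theorem Backtrack.outputsWalk (hF : IsForest A I L T) {W : SpaceWalk F μ ν} {i : ℕ} {σ : State F}
    (h : Backtrack enum T W.steps i σ) (hb : ¬ backTest.Holds σ) : OutputsWalk σ W := by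
  obtain ⟨S, R, hS, hl, hW⟩ := h.path
  obtain ⟨q, hq⟩ := hS.getElem
  have hk : q.kind = 0 := by
    simpa [backTest, Test.Holds, NExpr.eval, (h.items _ _ hq).kind] using hb
  have h0 : S.length = 0 := by
    rw [hF.length_pathSteps hS hq]
    rcases hF.item hq with ⟨-, -, -, h0⟩ | ⟨p, -, -, hs⟩
    · exact h0
    · exact absurd hk hs.kind_ne
  refine ⟨h.out0, h.out1, fun k hk => ?_⟩
  have := hW k _ (by omega) (List.getElem?_eq_getElem hk)
  exact ⟨this.row, this.col, this.X.decodeSpace, this.Y.decodeSpace⟩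

/-- After the search, the program outputs an optimality witness or an augmenting space-walk. -/
theorem triple_output (hS : IsSearchLabeling A I L) :
    Triple (fun σ : State F => ∃ T qh, Ready I enum L σ ∧ Rep I enum T σ ∧ IsForest A I L T ∧
        (σ.nat 20 5 = 0 ∧ IsCompleted A I L T ∨
          σ.nat 20 5 = 1 ∧ σ.nat 20 1 = qh ∧ IsFound I enum T qh σ)) output
      (4 + (lastStep.bound + ((backTest.cost + backBody.bound) * (4 * (edges A).card) +
        backTest.cost) + 1))
      (fun τ => (∃ X Y, OutputsWitness τ X Y ∧ IsOptimalityWitness A I X Y) ∨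
        ∃ W : SpaceWalk F μ ν, OutputsWalk τ W ∧ W.IsAugmenting A I) := by
  refine Triple.cond ?_ ?_
  · rintro σ ⟨⟨T, qh, hR, hT, hF, ⟨h5, -⟩ | ⟨-, rfl, p, α, X, hp, he, ho, hc, hX, hk⟩⟩, hb⟩
    · simp [Test.Holds, NExpr.eval, h5] at hb
    · obtain ⟨W, S, hP, -, hW, hA⟩ := hF.exists_augmenting hS hp ho hX hk
      have h1 : Triple (fun τ => τ = σ) lastStep lastStep.bound
          (fun τ => ∃ i, Backtrack enum T W.steps i τ) :=
        Triple.of_wp fun τ hτ => by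
          subst hτ
          rw [hW]
          exact Prog.wp_mono (lastStep_wp hF hR hT hp he hc hP) fun τ h => ⟨0, h⟩
      have h2 := Triple.loop (b := backTest) (p := backBody) (N := 4 * (edges A).card)
        (J := Backtrack enum T W.steps)
        (fun i τ h => (Nat.le_of_add_right_le h.le).trans (hT.length_le hS hF))
        fun i τ h hb => h.step hF hb
      obtain ⟨t, τ, hex, ht, ⟨i, hB⟩, hb'⟩ := h1.seq h2 σ rfl
      exact ⟨t, τ, hex, ht, Or.inr ⟨W, hB.outputsWalk hF hb', hA⟩⟩
  · rintro σ ⟨⟨T, qh, hR, hT, hF, ⟨-, hC⟩ | ⟨h5, -⟩⟩, hb⟩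
    · exact ⟨1, σ, Exec.skip σ, le_rfl, Or.inl ⟨_, _, ⟨hR.output, fun α => (hT.row α).decodeSpace,
        fun β => (hT.col β).decodeSpace⟩, hF.isOptimalityWitness hS hC⟩⟩
    · exact absurd (by simpa [Test.Holds, NExpr.eval] using h5) hb

end Ram

/-! ### Correctness and running time of the whole program -/

namespace Ram

variable {F : Type*} [Field F] {μ ν : ℕ} {A : Blocks F μ ν} {I : Finset (Fin μ × Fin ν)}
  {enum : Fin (edges A).card ≃ {e // e ∈ edges A}} {L : Labeling F μ ν}

/-- After the list of edges has been read and the nodes are labelled, the search forest is empty. -/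
theorem Rooted.of_scanned (hI : I ⊆ edges A) {σ τ : State F}
    (hs : Scanned (inputState A I enum) (edges A).card σ) (hi : Indexed I enum σ)
    (hf : LabelFrame σ τ) (hl : HasLabels I enum L τ) : Rooted I enum L [] 0 τ := by
  have hnat : ∀ a j, a ≠ 6 → a ≠ 17 → a ≠ 20 → 3 < a → a < 11 → τ.nat a j = 0 := by
    intro a j h1 h2 h3 h4 h5
    rw [hf.nat a h2 h3, hs.nat a h1 h3 (Or.inl h5)]
    simp only [inputState]
    split <;> omega
  have hreg : ∀ j, 0 < j → j < 12 → τ.nat 20 j = 0 := by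
    intro j h1 h2
    rw [hf.regs j (by omega) (by omega) (by omega), hs.regs j (by omega)]
    rfl
  have h6 : τ.nat 6 = σ.nat 6 := hf.nat 6 (by omega) (by omega)
  refine ⟨⟨hi.congr hf.sameData, hl, hnat 4 0 (by omega) (by omega) (by omega) (by omega)
    (by omega)⟩,
    ⟨hreg 2 (by omega) (by omega), by simp, fun α => Or.inl ⟨?_, by simp [wRow]⟩, fun β => ?_⟩,
    IsForest.nil, hreg 1 (by omega) (by omega), hreg 3 (by omega) (by omega),
    hreg 4 (by omega) (by omega), hreg 5 (by omega) (by omega), Nat.zero_le _, by simp, by simp⟩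
  · exact hnat 5 α (by omega) (by omega) (by omega) (by omega) (by omega)
  · have hex : (∃ k < (edges A).card, (inputState A I enum).nat 3 k = 1 ∧
        (inputState A I enum).nat 2 k = β) ↔ ∃ f ∈ I, f.2 = β := by
      constructor
      · rintro ⟨k, hk, h3, h2⟩
        refine ⟨(enum ⟨k, hk⟩).1, ?_, ?_⟩
        · by_contra hn
          simp [inputState, hk, hn] at h3
        · apply Fin.ext
          simpa [inputState, hk] using h2
      · rintro ⟨f, hf, rfl⟩
        obtain ⟨k, hk, rfl⟩ := exists_pos enum (hI hf)
        exact ⟨k, hk, by simp [inputState, hk, hf], by simp [inputState, hk]⟩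
    rw [h6, hs.col, witnessCol]
    by_cases h : ∃ f ∈ I, f.2 = β
    · rw [if_pos (hex.2 h), if_neg (by push Not; exact h)]
      exact Or.inr (Or.inr ⟨rfl, by simp [wCol]⟩)
    · rw [if_neg (mt hex.1 h), if_pos (by push Not at h; exact h)]
      exact Or.inl ⟨rfl, rfl⟩

/-- The algorithm: read the edges of `I` and the edges outside `I`, compute the labels and the roots,
search, and output the result. -/
def algorithm : Prog := .seq scan (.seq labels (.seq roots (.seq search output)))

/-- The factor in the bound for the running time. -/
def factor : ℕ :=
  (5 + scanBody.bound) + 5 + ((labelTest.cost + labelBody.bound) * 6 + labelTest.cost) +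
    (rootTest.cost + rootBody.bound + rootTest.cost) +
    ((searchTest.cost + searchBody.bound) * 4 + searchTest.cost) +
    (4 + lastStep.bound + ((backTest.cost + backBody.bound) * 4 + backTest.cost) + 1)

/-- The algorithm finds an optimality witness or an augmenting space-walk in linear time. -/
theorem triple_algorithm (h : IsMatching A I) :
    Triple (fun σ => σ = inputState A I enum) algorithm (factor * ((edges A).card + 1))
      (fun τ => (∃ X Y, OutputsWitness τ X Y ∧ IsOptimalityWitness A I X Y) ∨
        ∃ W : SpaceWalk F μ ν, OutputsWalk τ W ∧ W.IsAugmenting A I) := by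
  obtain ⟨sgn, hs⟩ := h.exists_sign
  have hw := h.isWellLabelled hs
  have hI : I ⊆ edges A := h.1
  rintro _ rfl
  obtain ⟨t₁, σ₁, e₁, ht₁, h₁⟩ := triple_scan (inputState A I enum) rfl (fun _ => rfl)
    (fun a i h1 h2 => by simp only [inputState]; split <;> omega) _ rfl
  have hi := h₁.indexed hs hI
  obtain ⟨L, hL, hT⟩ := triple_labels hw hI hi
    (fun i => by rw [h₁.nat 17 (by omega) (by omega) (by omega)]; rfl)
    (by rw [h₁.regs 12 (by omega)]; rfl) (by rw [h₁.regs 13 (by omega)]; rfl)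
  obtain ⟨t₂, σ₂, e₂, ht₂, hf, hl⟩ := hT _ rfl
  obtain ⟨t₃, σ₃, e₃, ht₃, T, h₃⟩ := triple_roots hL (Rooted.of_scanned hI h₁ hi hf hl) _ rfl
  obtain ⟨t₄, σ₄, e₄, ht₄, h₄⟩ := triple_search hL
    (⟨h₃.ready, h₃.rep, h₃.forest, Nat.zero_le _, h₃.reg1, h₃.reg3, Nat.zero_le _,
      fun _ _ h0 => absurd rfl h0, Or.inl ⟨h₃.reg5, h₃.searchState hI⟩⟩ :
      Searching I enum L T 0 0 0 σ₃) _ rfl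
  obtain ⟨t₅, σ₅, e₅, ht₅, h₅⟩ := triple_output hL _ h₄
  refine ⟨_, σ₅, e₁.seq (e₂.seq (e₃.seq (e₄.seq e₅))), ?_, h₅⟩
  have hn : (inputState A I enum).nat 0 0 = (edges A).card := rfl
  rw [hn] at ht₁
  unfold factor
  generalize scanBody.bound = b₁ at *
  generalize labelTest.cost = c₂ at *
  generalize labelBody.bound = b₂ at *
  generalize rootTest.cost = c₃ at *
  generalize rootBody.bound = b₃ at *
  generalize searchTest.cost = c₄ at *
  generalize searchBody.bound = b₄ at *
  generalize backTest.cost = c₅ at *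
  generalize backBody.bound = b₅ at *
  generalize lastStep.bound = b₆ at *
  refine (Nat.add_le_add ht₁ (Nat.add_le_add ht₂ (Nat.add_le_add ht₃
    (Nat.add_le_add ht₄ ht₅)))).trans ?_
  generalize (edges A).card = n
  refine Nat.le.intro (k := 5 + b₁ + 6 * (c₂ + b₂) + (c₃ + b₃) + 4 * (c₄ + b₄) + 4 * (c₅ + b₅) +
    (5 + c₂ + c₃ + c₄ + 5 + b₆ + c₅) * n) ?_
  ring

end Ram

theorem mainTheorem4 :
    ∃ (prog : Ram.Prog) (C : ℕ),
      ∀ (F : Type*) [Field F] (μ ν : ℕ) (A : Blocks F μ ν) (I : Finset (Fin μ × Fin ν))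
        (enum : Fin (edges A).card ≃ {e // e ∈ edges A}),
        IsMatching A I →
        ∃ (t : ℕ) (σ : Ram.State F),
          Ram.Exec prog (inputState A I enum) t σ ∧
          t ≤ C * ((edges A).card + 1) ∧
          ((∃ (X : Fin μ → Space F) (Y : Fin ν → Space F),
              OutputsWitness σ X Y ∧ IsOptimalityWitness A I X Y) ∨
            (∃ T : SpaceWalk F μ ν, OutputsWalk σ T ∧ T.IsAugmenting A I)) :=
  ⟨Ram.algorithm, Ram.factor, fun _ _ _ _ _ _ _ h => Ram.triple_algorithm h _ rfl⟩
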